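/- **Setting.** Let $(\boldsymbol X,Y)\in\mathbb R^p\times\{-1,1\}$ have law $P$, let $\tilde{\boldsymbol X}=(1,\boldsymbol X^\top)^\top$, and let $\boldsymbol\beta^*\in\mathbb R^{p+1}$ (coordinates $0,\dots,p$) minimize $E\max\{1-Y\tilde{\boldsymbol X}^\top\boldsymbol\beta,0\}$; put $s=\|\boldsymbol\beta^*\|_0$. For a kernel $K$ and $h>0$ let $K_h(u)=h^{-1}K(u/h)$ and $l_h(u)=\int_{\mathbb R}\max\{1-t,0\}K_h(t-u)\,dt$. Batches $D_t=\{(\boldsymbol X_{ti},Y_{ti})\}_{i\le n_t}$, $n_t\ge1$, $t=1,2,\dots,b$, consist of independent observations with law $P$; $N_t=n_1+\dots+n_t$, $N_0=0$, and $\widehat L(\boldsymbol\beta,D_t,h)=n_t^{-1}\sum_{i=1}^{n_t}l_h(Y_{ti}\tilde{\boldsymbol X}_{ti}^\top\boldsymbol\beta)$, with Hessian $\nabla^2\widehat L(\boldsymbol\beta,D_t,h)=n_t^{-1}\sum_{i=1}^{n_t}K_h(1-Y_{ti}\tilde{\boldsymbol X}_{ti}^\top\boldsymbol\beta)\tilde{\boldsymbol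 X}_{ti}\tilde{\boldsymbol X}_{ti}^\top$. Starting from $\widehat{\boldsymbol\beta}_0^{\rm on}=\boldsymbol 0$, the online Lasso estimate $\widehat{\boldsymbol\beta}^{\rm on}_t$ is a minimizer over $\boldsymbol\beta\in\mathbb R^{p+1}$ of $$\frac1{N_t}\Big\{\frac{N_{t-1}}2(\boldsymbol\beta-\widehat{\boldsymbol\beta}^{\rm on}_{t-1})^\top\widehat{\boldsymbol H}_{t-1}(\boldsymbol\beta-\widehat{\boldsymbol\beta}^{\rm on}_{t-1})+n_t\widehat L(\boldsymbol\beta,D_t,h_t)\Big\}+\lambda_t\sum_{j=1}^p|\beta_j|,\qquad \widehat{\boldsymbol H}_{t}=\frac1{N_{t}}\sum_{r=1}^{t}n_r\nabla^2\widehat L(\widehat{\boldsymbol\beta}^{\rm on}_r,D_r,h_r).$$ **Assumptions.** Fix $K$ and constants $C_f,\nu_0,c_1,c_2,M,c,C,a_1,a_2$, with $C_f,\nu_0,c_1,c,C,a_1>0$. 1. $K\ge0$ is symmetric, twice differentiable, $\int K=1$, $\int tK(t)\,dt=0$; $K,K',K''$ are bounded; $\kappa_l=\min_{|t|\le1}K(t)>0$;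 $\kappa_a=\int|t|^aK(t)\,dt<\infty$ for $a=1,2$. 2. Both classes $Y=\pm1$ have positive probability, and given either class $\boldsymbol X$ has a continuous bounded density with finite second moments. For almost every value of $(X_2,\dots,X_p)$, the corresponding conditional density $\varphi$ of $X_1$ given $(X_2,\dots,X_p)$ is differentiable, $|\varphi(x)|,|\varphi'(x)|,|x^2\varphi(x)|,|x\varphi'(x)|,|x^2\varphi'(x)|\le C_f$ for all $x$, and $\int|x|\varphi(x)\,dx<\infty$. 3. $\boldsymbol\Sigma=E[\tilde{\boldsymbol X}\tilde{\boldsymbol X}^\top]$ has smallest and largest eigenvalues $c_1\le\gamma_{p+1}\le\gamma_1\le c_2$, all absolute row sums of $\boldsymbol\Sigma^{-1}$ are at most $M$, and $\Pr(|\boldsymbol u^\top\boldsymbol\Sigma^{-1/2}\tilde{\boldsymbol X}|\ge\nu_0\|\boldsymbol u\|_2t)\le2e^{-t^2/2}$ for all $\boldsymbol u\ne\boldsymbol 0$, $t>0$. 4. $|\beta^*_1|\ge c$ and $\|\boldsymbol\beta^*\|_2\le C$. 5. The matrix $D=E[\delta(1-Y\tilde{\boldsymbol X}^\top\boldsymbol\beta^*)\tilde{\boldsymbol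 X}\tilde{\boldsymbol X}^\top]$, that is, $\lim_{r\downarrow0}(2r)^{-1}E[\mathbf 1\{|1-Y\tilde{\boldsymbol X}^\top\boldsymbol\beta^*|\le r\}\tilde{\boldsymbol X}\tilde{\boldsymbol X}^\top]$, exists and has all eigenvalues in $[a_1,a_2]$. **Constants.** With $G=\gamma_1\gamma_{p+1}^{-1}a_2/(\kappa_la_1^2)$ let $C_{1,2}=(3+2C_f\kappa_2/c)G$, $C_{1,1}=(4+2C_f\kappa_2/c)C_{1,2}$ and, for $b\ge2$, $$C_{b,2}=(3+2C_f\kappa_2/c+2a_2C_{b-1,2})G,\qquad C_{b,1}=(4+2C_f\kappa_2/c+2a_2C_{b-1,2})C_{b,2}.$$ **Theorem.** There are $A_0,\rho>0$, depending only on $K$ and the fixed constants, such that for all $A_1\in\mathbb R$, $B_0>0$, $B_1\in\mathbb R$ there is $\varepsilon>0$, depending in addition only on $A_1,B_0,B_1$, with the following property. Let $p,b\ge1$, and suppose that the assumptions hold, that the tuning parameters satisfy $\lambda_t\asymp\sqrt{\log(p)/N_t}$ and $h_t\asymp\{s\log(p)/N_t\}^{1/4}$ in the sense that for $1\le t\le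 b$ $$A_0\sqrt{\tfrac{\log p}{N_t}}\le\lambda_t\le A_1\sqrt{\tfrac{\log p}{N_t}},\qquad B_0\Big(\tfrac{s\log p}{N_t}\Big)^{1/4}\le h_t\le B_1\Big(\tfrac{s\log p}{N_t}\Big)^{1/4},\qquad h_t^2\le\rho\sqrt s\,\lambda_t,$$ and $N_t\lambda_t\le N_{t+1}\lambda_{t+1}$ for $1\le t<b$, that $s\log p\le\varepsilon n_1$, and that the scaling condition $$C_{t,1}^2s^2(\log p)^3\{1+\log(N_t/n_1)\}\le\varepsilon N_th_t^3$$ holds for $1\le t<b$. Then with probability greater than $1-4/p$, online Lasso estimates $\widehat{\boldsymbol\beta}^{\rm on}_1,\dots,\widehat{\boldsymbol\beta}^{\rm on}_b$ exist, and every choice of them satisfies $$\|\widehat{\boldsymbol\beta}^{\rm on}_b-\boldsymbol\beta^*\|_2\le C_{b,2}s^{1/2}\lambda_b,\qquad\|\widehat{\boldsymbol\beta}^{\rm on}_b-\boldsymbol\beta^*\|_1\le C_{b,1}s\lambda_b.$$ -/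

import Mathlib

open MeasureTheory ProbabilityTheory Filter Topology
open scoped Matrix

noncomputable section

namespace SmoothedSVM

/-! ### Vectors and matrices -/

/-- The `l₁` norm of a coordinate vector. -/
def l1Norm {k : ℕ} (v : Fin k → ℝ) : ℝ := ∑ j, |v j|

/-- The Euclidean norm of a coordinate vector. -/
def l2Norm {k : ℕ} (v : Fin k → ℝ) : ℝ := √(∑ j, v j ^ 2)

/-- The number of nonzero coordinates. -/
def l0Norm {k : ℕ} (v : Fin k → ℝ) : ℕ := (Function.support v).ncard

/-- The matrix norm `max_i ∑_j |A i j|`. -/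
def rowSumNorm {k : ℕ} (A : Matrix (Fin k) (Fin k) ℝ) : ℝ := ⨆ i, ∑ j, |A i j|

/-- The largest (real) eigenvalue. -/
def maxEig {k : ℕ} (A : Matrix (Fin k) (Fin k) ℝ) : ℝ := sSup (spectrum ℝ A)

/-- The smallest (real) eigenvalue. -/
def minEig {k : ℕ} (A : Matrix (Fin k) (Fin k) ℝ) : ℝ := sInf (spectrum ℝ A)

/-! ### Kernels and the smoothed hinge loss -/

/-- `κ_a = ∫ |t|^a K(t) dt` for a natural exponent `a`. -/
def kappa (K : ℝ → ℝ) (a : ℕ) : ℝ := ∫ t, |t| ^ a * K t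

/-- `κ_l`, the minimum of `K` on `[-1, 1]`. -/
def kappaLow (K : ℝ → ℝ) : ℝ := sInf (K '' Set.Icc (-1) 1)

/-- The conditions on the smoothing kernel. -/
structure KernelAssumption (K : ℝ → ℝ) : Prop where
  nonneg : ∀ t, 0 ≤ K t
  symm : ∀ t, K (-t) = K t
  integrable : Integrable K
  integral_eq_one : ∫ t, K t = 1
  integral_id_mul : ∫ t, t * K t = 0
  differentiable : Differentiable ℝ K
  differentiable_deriv : Differentiable ℝ (deriv K)
  bdd_deriv : ∃ κ : ℝ, ∀ t, |deriv K t| ≤ κ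
  bdd_deriv_deriv : ∃ κ : ℝ, ∀ t, |deriv (deriv K) t| ≤ κ
  bdd : ∃ κ : ℝ, ∀ t, K t ≤ κ
  low_pos : 0 < kappaLow K
  moment_one : Integrable fun t => |t| ^ 1 * K t
  moment_two : Integrable fun t => |t| ^ 2 * K t

/-- The scaled kernel `K_h(u) = h⁻¹ K(u / h)`. -/
def scaledKernel (K : ℝ → ℝ) (h u : ℝ) : ℝ := h⁻¹ * K (u / h)

/-- The hinge loss. -/
def hinge (u : ℝ) : ℝ := max (1 - u) 0

/-- The smoothed hinge loss `l_h(u) = ∫ l(t) K_h(t - u) dt`. -/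
def smoothHinge (K : ℝ → ℝ) (h u : ℝ) : ℝ := ∫ t, hinge t * scaledKernel K h (t - u)

/-! ### The population -/

/-- An observation: the features `X ∈ ℝ^p` and the response `Y ∈ {-1, 1} ⊆ ℝ`. -/
abbrev Obs (p : ℕ) := (Fin p → ℝ) × ℝ

/-- The augmented feature vector `(1, X)`; coordinate `0` is the intercept. -/
def aug {p : ℕ} (x : Fin p → ℝ) : Fin (p + 1) → ℝ := Fin.cons 1 x

/-- The margin `Y (1, X)ᵀ β`. -/
def margin {p : ℕ} (β : Fin (p + 1) → ℝ) (o : Obs p) : ℝ := o.2 * (aug o.1 ⬝ᵥ β)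

/-- The population hinge risk `E l(Y (1, X)ᵀ β)`. -/
def hingeRisk {p : ℕ} (P : Measure (Obs p)) (β : Fin (p + 1) → ℝ) : ℝ :=
  ∫ o, hinge (margin β o) ∂P

/-- `Σ = E[(1, X) (1, X)ᵀ]`. -/
def secondMoment {p : ℕ} (P : Measure (Obs p)) : Matrix (Fin (p + 1)) (Fin (p + 1)) ℝ :=
  fun j k => ∫ o, aug o.1 j * aug o.1 k ∂P

/-- Density of the features other than the first one, for a feature density `f`
(the value does not depend on the first coordinate of `x`). -/
def restDensity {p : ℕ} [NeZero p] (f : (Fin p → ℝ) → ℝ) (x : Fin p → ℝ) : ℝ :=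
  ∫ t, f (Function.update x 0 t)

/-- Conditional density, at `t`, of the first feature given that the other features agree
with those of `x`. -/
def condDensity {p : ℕ} [NeZero p] (f : (Fin p → ℝ) → ℝ) (x : Fin p → ℝ) (t : ℝ) : ℝ :=
  f (Function.update x 0 t) / restDensity f x

/-- The class `Y = y` has positive probability and, given `Y = y`, the features have a density
with the required regularity. -/
def DensityAssumption {p : ℕ} [NeZero p] (P : Measure (Obs p)) (y Cf : ℝ) : Prop :=
  0 < P {o | o.2 = y} ∧
  ∃ f : (Fin p → ℝ) → ℝ,
    (∀ x, 0 ≤ f x) ∧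
    (P.restrict {o | o.2 = y}).map Prod.fst =
      P {o | o.2 = y} • (volume : Measure (Fin p → ℝ)).withDensity
        (fun x => ENNReal.ofReal (f x)) ∧
    Continuous f ∧ (∃ κ : ℝ, ∀ x, f x ≤ κ) ∧ (∀ j, Integrable fun x => x j ^ 2 * f x) ∧
    ∀ᵐ x, 0 < restDensity f x →
      Differentiable ℝ (condDensity f x) ∧
      (∀ t, |condDensity f x t| ≤ Cf ∧ |deriv (condDensity f x) t| ≤ Cf ∧
        |t ^ 2 * condDensity f x t| ≤ Cf ∧ |t * deriv (condDensity f x) t| ≤ Cf ∧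
        |t ^ 2 * deriv (condDensity f x) t| ≤ Cf) ∧
      Integrable fun t => |t| * condDensity f x t

/-- The conditions on the design: sub-Gaussian tails of `ω = Σ^{-1/2} (1, X)`, eigenvalues of `Σ`
in `[c₁, c₂]`, and a bound on the row sums of `Σ⁻¹`. Here `R` is the positive semidefinite square
root of `Σ⁻¹`; the direction `u = 0`, for which the tail bound is meaningless, is left out. -/
structure DesignAssumption {p : ℕ} (P : Measure (Obs p)) (ν₀ c₁ c₂ M : ℝ) : Prop where
  subgaussian : ∃ R : Matrix (Fin (p + 1)) (Fin (p + 1)) ℝ,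
    R.PosSemidef ∧ R * R = (secondMoment P)⁻¹ ∧
    ∀ u : Fin (p + 1) → ℝ, u ≠ 0 → ∀ t : ℝ, 0 < t →
      P {o | ν₀ * l2Norm u * t ≤ |u ⬝ᵥ (R *ᵥ aug o.1)|} ≤
        ENNReal.ofReal (2 * Real.exp (-t ^ 2 / 2))
  eig_low : c₁ ≤ minEig (secondMoment P)
  eig_high : maxEig (secondMoment P) ≤ c₂
  inv_rowSum : rowSumNorm (secondMoment P)⁻¹ ≤ M

/-- `D = E[δ(1 - Y (1, X)ᵀ β) (1, X) (1, X)ᵀ]`, the Dirac delta being the limit of the uniform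
densities on `[-r, r]` as `r` decreases to `0`. -/
def IsDiracHessian {p : ℕ} (P : Measure (Obs p)) (β : Fin (p + 1) → ℝ)
    (D : Matrix (Fin (p + 1)) (Fin (p + 1)) ℝ) : Prop :=
  ∀ j k, Tendsto
    (fun r : ℝ => (2 * r)⁻¹ * ∫ o in {o | |1 - margin β o| ≤ r}, aug o.1 j * aug o.1 k ∂P)
    (𝓝[>] 0) (𝓝 (D j k))

/-- The population `P` and its hinge-risk minimizer `β` satisfy the assumptions of the model. -/
structure ModelAssumption {p : ℕ} [NeZero p] (P : Measure (Obs p)) (β : Fin (p + 1) → ℝ)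
    (Cf ν₀ c₁ c₂ M c C a₁ a₂ : ℝ) : Prop where
  response : ∀ᵐ o ∂P, o.2 = 1 ∨ o.2 = -1
  isMin : ∀ β', hingeRisk P β ≤ hingeRisk P β'
  density_pos : DensityAssumption P 1 Cf
  density_neg : DensityAssumption P (-1) Cf
  design : DesignAssumption P ν₀ c₁ c₂ M
  first_coef : c ≤ |β (Fin.succ 0)|
  bounded_coef : l2Norm β ≤ C
  hessian : ∃ D, IsDiracHessian P β D ∧ a₁ ≤ minEig D ∧ maxEig D ≤ a₂

/-! ### The online estimator -/

/-- The cumulative sample size `N_b = n_1 + ⋯ + n_b`. -/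
def cumSize (n : ℕ → ℕ) (b : ℕ) : ℕ := ∑ t ∈ Finset.Icc 1 b, n t

/-- The empirical smoothed hinge loss of one batch. -/
def batchLoss {p m : ℕ} (K : ℝ → ℝ) (h : ℝ) (d : Fin m → Obs p) (β : Fin (p + 1) → ℝ) : ℝ :=
  (m : ℝ)⁻¹ * ∑ i, smoothHinge K h (margin β (d i))

/-- The Hessian `m⁻¹ ∑ K_h(1 - Y (1, X)ᵀ β) (1, X) (1, X)ᵀ` of the loss of one batch. -/
def batchHessian {p m : ℕ} (K : ℝ → ℝ) (h : ℝ) (d : Fin m → Obs p) (β : Fin (p + 1) → ℝ) :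
    Matrix (Fin (p + 1)) (Fin (p + 1)) ℝ :=
  (m : ℝ)⁻¹ • ∑ i, scaledKernel K h (1 - margin β (d i)) •
    Matrix.vecMulVec (aug (d i).1) (aug (d i).1)

/-- The aggregated Hessian `Ĥ_b`, each batch `t ≤ b` being evaluated at its own estimate `β t`. -/
def aggHessian {p : ℕ} (K : ℝ → ℝ) (h : ℕ → ℝ) {n : ℕ → ℕ} (d : (t : ℕ) → Fin (n t) → Obs p)
    (β : ℕ → Fin (p + 1) → ℝ) (b : ℕ) : Matrix (Fin (p + 1)) (Fin (p + 1)) ℝ :=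
  (cumSize n b : ℝ)⁻¹ • ∑ t ∈ Finset.Icc 1 b, (n t : ℝ) • batchHessian K (h t) (d t) (β t)

/-- The penalized objective minimized at batch `b ≥ 1`, as a function of `v`; it depends on the
earlier estimates through `β (b - 1)` and the aggregated Hessian. The intercept is not penalized. -/
def onlineObjective {p : ℕ} (K : ℝ → ℝ) (lam h : ℕ → ℝ) {n : ℕ → ℕ}
    (d : (t : ℕ) → Fin (n t) → Obs p) (β : ℕ → Fin (p + 1) → ℝ) (b : ℕ)
    (v : Fin (p + 1) → ℝ) : ℝ :=
  (cumSize n b : ℝ)⁻¹ *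
      ((cumSize n (b - 1) : ℝ) / 2 *
          ((v - β (b - 1)) ⬝ᵥ (aggHessian K h d β (b - 1) *ᵥ (v - β (b - 1)))) +
        (n b : ℝ) * batchLoss K (h b) (d b) v) +
    lam b * ∑ j : Fin p, |v j.succ|

/-- `β 1, …, β b` are online Lasso estimates computed successively from the batches
`d 1, …, d b`, started at `β 0 = 0`. -/
def IsOnlineLasso {p : ℕ} (K : ℝ → ℝ) (lam h : ℕ → ℝ) {n : ℕ → ℕ}
    (d : (t : ℕ) → Fin (n t) → Obs p) (b : ℕ) (β : ℕ → Fin (p + 1) → ℝ) : Prop :=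
  β 0 = 0 ∧ ∀ t ∈ Finset.Icc 1 b, ∀ v,
    onlineObjective K lam h d β t (β t) ≤ onlineObjective K lam h d β t v

/-! ### The constants of the error bounds -/

/-- `C_{b,2}`, where `r = 2 C_f κ_2 / c` and `G = γ_1 γ_{p+1}⁻¹ a₂ / (κ_l a₁²)`. The value `0` at
`b = 0` makes the recursion start with `C_{1,2} = (3 + r) G`. -/
def constTwo (r G a₂ : ℝ) : ℕ → ℝ
  | 0 => 0
  | b + 1 => (3 + r + 2 * a₂ * constTwo r G a₂ b) * G

/-- `C_{b,1}`, with the same conventions; `C_{1,1} = (4 + r) C_{1,2}`. -/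
def constOne (r G a₂ : ℝ) : ℕ → ℝ
  | 0 => 0
  | b + 1 => (4 + r + 2 * a₂ * constTwo r G a₂ b) * constTwo r G a₂ (b + 1)

/-- `2 C_f κ_2 / c`. -/
def biasRatio (K : ℝ → ℝ) (Cf c : ℝ) : ℝ := 2 * Cf * kappa K 2 / c

/-- `γ_1 γ_{p+1}⁻¹ a₂ / (κ_l a₁²)`, with `γ_1`, `γ_{p+1}` the extreme eigenvalues of `Σ`. -/
def gainFactor {p : ℕ} (K : ℝ → ℝ) (P : Measure (Obs p)) (a₁ a₂ : ℝ) : ℝ :=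
  maxEig (secondMoment P) * (minEig (secondMoment P))⁻¹ * a₂ / (kappaLow K * a₁ ^ 2)

/-- `C_{b,1}` for the population `P`. -/
def C1 {p : ℕ} (K : ℝ → ℝ) (P : Measure (Obs p)) (Cf c a₁ a₂ : ℝ) (b : ℕ) : ℝ :=
  constOne (biasRatio K Cf c) (gainFactor K P a₁ a₂) a₂ b

/-- `C_{b,2}` for the population `P`. -/
def C2 {p : ℕ} (K : ℝ → ℝ) (P : Measure (Obs p)) (Cf c a₁ a₂ : ℝ) (b : ℕ) : ℝ :=
  constTwo (biasRatio K Cf c) (gainFactor K P a₁ a₂) a₂ b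

/-! ### Tuning and scaling -/

/-- The tuning parameters of batches `1, …, b`: `lam t` lies between `A₀` and `A₁` times
`√(log p / N_t)`, `h t` lies between `B₀` and `B₁` times `(s log p / N_t)^{1/4}`, the squared
bandwidth is at most `ρ √s` times the penalty level, and `N_t lam t` does not decrease in `t`. -/
structure Tuning (p s : ℕ) (n : ℕ → ℕ) (b : ℕ) (lam h : ℕ → ℝ) (A₀ A₁ B₀ B₁ ρ : ℝ) : Prop where
  lam_low : ∀ t ∈ Finset.Icc 1 b, A₀ * √(Real.log p / cumSize n t) ≤ lam t
  lam_high : ∀ t ∈ Finset.Icc 1 b, lam t ≤ A₁ * √(Real.log p / cumSize n t)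
  h_low : ∀ t ∈ Finset.Icc 1 b, B₀ * (s * Real.log p / cumSize n t) ^ (1 / 4 : ℝ) ≤ h t
  h_high : ∀ t ∈ Finset.Icc 1 b, h t ≤ B₁ * (s * Real.log p / cumSize n t) ^ (1 / 4 : ℝ)
  h_sq : ∀ t ∈ Finset.Icc 1 b, h t ^ 2 ≤ ρ * √s * lam t
  lam_mono : ∀ t ∈ Finset.Ico 1 b, cumSize n t * lam t ≤ cumSize n (t + 1) * lam (t + 1)

/-- The scaling condition at batch `t`, with the `o(·)` read as a factor `ε`. -/
def ScalingAt (p s : ℕ) (n : ℕ → ℕ) (h : ℕ → ℝ) (C : ℝ) (ε : ℝ) (t : ℕ) : Prop :=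
  C ^ 2 * (s : ℝ) ^ 2 * Real.log p ^ 3 * (1 + Real.log (cumSize n t / n 1)) ≤
    ε * (cumSize n t * h t ^ 3)

end SmoothedSVM

end

/-!
The theorem splits into a deterministic statement on a sample that avoids a few exceptional events
(`GoodSample.bounds`) and a bound of the probability of these events (`measure_not_goodSample_le`).

*The deterministic part* is an induction over the batches (`online_induction`). In one step
(`online_step`) the smooth part of the objective is a convex function `f`, and near the target `β*`
its increments are bounded below by a linear term and a curvature term (`onlineLoss_sub_ge`):

* The linear term has two sources. The gradient of the current batch at `β*` is its mean plus noise.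
  The mean is of order `h²` (`abs_integral_slope_le`), because the gradient of the hinge risk
  vanishes at `β*` and the smoothing error of the unit step is odd; the noise is at most a fraction
  of `λ` in each coordinate. The quadratic prior contributes `Ĥ (β̂ - β*)`, with `β̂` the preceding
  estimate, which is estimated by the Cauchy-Schwarz inequality for `Ĥ`
  (`PriorControl.abs_linear_le`); this is the reason why `C_{t-1,2}` enters `C_{t,2}`.
* The curvature is at least a multiple of `κ_l a₁` on the intersection of the cone
  `‖v‖₁ ≲ √s ‖v‖₂` with the sphere of the asserted radius.

Both bounds, a positive penalty level and convexity confine all minimizers of the penalized problem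
to the ball and the cone, and show that there is one (`penalized_minimizer`).

*The curvature of the current batch* is the delicate point, because `D_t` may be small compared with
the dimension. Around its kink the smoothed hinge loss is strongly convex, which gives a lower bound
for its increments by a truncated square (`smoothHinge_curvature`) whose expectation is at least of
the order of `vᵀ D v` (`le_integral_curvTerm`). Uniformity in `v` comes from Maurey's argument: a truncated
square has upper tangent parabolas, hence the truncated empirical curvature at `v` differs little
from that at an average of few vertices of the `l₁` ball (`exists_vertexAverage_le`), and a union bound over these averages suffices
(`measure_curvature_lt_le`).

*The aggregated Hessian* is compared with its summands at `β*`. As `K ≥ 0` has a bounded second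
derivative, `|K(a + b) - K(a)| ≤ η K(a) + C b²` (`KernelAssumption.abs_sub_le`); hence moving the
coefficients costs a small multiple of the Hessian itself and a weighted Gram matrix with small
weights (`abs_aggHessian_sub_le`). The Gram matrices concentrate entrywise
(`measure_gram_deviation_le`), which is enough because of the cone. No independence between the
estimates and the data is needed: the estimates enter only through their deterministic error bounds.

*The population* is treated by conditioning on all features but the first: since `|β*₁| ≥ c`, the
margin has a conditional density with a bounded derivative (`abs_integral_kernel_le`). Thus the
expected smoothed Hessian differs from the Dirac Hessian `D` by a term of order `h`
(`abs_integral_kernel_sub_hessian_le`).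

Each exceptional event of batch `t` has a probability of order `(p t)⁻²`, summable in `t`, so the
total is of order `p⁻²`, with no condition linking the number of batches to `p`. This is possible
because the constants `C_{t,2}` grow geometrically: they leave room for the larger deviations that
have to be admitted in late batches (`noise_le`). The tuning and scaling conditions enter only
through the numerical inequalities of `Regime`, which follow from them by `Tuning.regime`. For
`p < 4` the asserted probability bound is trivial.
-/

noncomputable section

namespace SmoothedSVM

/-! ### Norms of coordinate vectors -/

section Norms

variable {k : ℕ}

lemma l2Norm_nonneg (v : Fin k → ℝ) : 0 ≤ l2Norm v := Real.sqrt_nonneg _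

lemma l1Norm_nonneg (v : Fin k → ℝ) : 0 ≤ l1Norm v := Finset.sum_nonneg fun _ _ => abs_nonneg _

lemma l2Norm_sq (v : Fin k → ℝ) : l2Norm v ^ 2 = ∑ j, v j ^ 2 :=
  Real.sq_sqrt (Finset.sum_nonneg fun _ _ => sq_nonneg _)

lemma l2Norm_eq_norm (v : Fin k → ℝ) : l2Norm v = ‖WithLp.toLp 2 v‖ := by
  simp [l2Norm, EuclideanSpace.norm_eq]

lemma l2Norm_add_le (v w : Fin k → ℝ) : l2Norm (v + w) ≤ l2Norm v + l2Norm w := by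
  simp only [l2Norm_eq_norm, WithLp.toLp_add]
  exact norm_add_le _ _

lemma l2Norm_smul (a : ℝ) (v : Fin k → ℝ) : l2Norm (a • v) = |a| * l2Norm v := by
  simp only [l2Norm_eq_norm, WithLp.toLp_smul, norm_smul, Real.norm_eq_abs]

lemma l2Norm_eq_zero {v : Fin k → ℝ} : l2Norm v = 0 ↔ v = 0 := by
  rw [l2Norm_eq_norm, norm_eq_zero]; simp

lemma l2Norm_pos {v : Fin k → ℝ} (hv : v ≠ 0) : 0 < l2Norm v :=
  (l2Norm_nonneg v).lt_of_ne fun h => hv (l2Norm_eq_zero.1 h.symm)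

@[simp] lemma l2Norm_zero : l2Norm (0 : Fin k → ℝ) = 0 := l2Norm_eq_zero.2 rfl

lemma l2Norm_neg (v : Fin k → ℝ) : l2Norm (-v) = l2Norm v := by simp [l2Norm]

lemma l1Norm_neg (v : Fin k → ℝ) : l1Norm (-v) = l1Norm v := by simp [l1Norm]

lemma l1Norm_smul (a : ℝ) (v : Fin k → ℝ) : l1Norm (a • v) = |a| * l1Norm v := by
  simp [l1Norm, abs_mul, Finset.mul_sum]

lemma abs_apply_le_l2Norm (v : Fin k → ℝ) (j : Fin k) : |v j| ≤ l2Norm v := by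
  apply Real.abs_le_sqrt
  exact Finset.single_le_sum (f := fun j => v j ^ 2) (fun _ _ => sq_nonneg _) (Finset.mem_univ j)

lemma sum_abs_le_sqrt_card_mul (S : Finset (Fin k)) (v : Fin k → ℝ) :
    ∑ j ∈ S, |v j| ≤ √S.card * √(∑ j ∈ S, v j ^ 2) := by
  rw [← Real.sqrt_mul (by positivity)]
  apply Real.le_sqrt_of_sq_le
  simpa [sq_abs] using sq_sum_le_card_mul_sum_sq (s := S) (f := fun j => |v j|)

lemma l1Norm_le_sqrt_mul_l2Norm (v : Fin k → ℝ) : l1Norm v ≤ √k * l2Norm v := by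
  simpa [l1Norm, l2Norm] using sum_abs_le_sqrt_card_mul Finset.univ v

lemma abs_dotProduct_le (x v : Fin k → ℝ) : |x ⬝ᵥ v| ≤ ‖x‖ * l1Norm v := by
  rw [l1Norm, Finset.mul_sum]
  refine (Finset.abs_sum_le_sum_abs _ _).trans (Finset.sum_le_sum fun j _ => ?_)
  rw [abs_mul]
  exact mul_le_mul_of_nonneg_right (norm_le_pi_norm x j) (abs_nonneg _)

lemma continuous_l2Norm : Continuous (l2Norm : (Fin k → ℝ) → ℝ) := by
  unfold l2Norm; fun_prop

lemma isCompact_l2Ball (β : Fin k → ℝ) (r : ℝ) : IsCompact {v | l2Norm (v - β) ≤ r} := by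
  refine Metric.isCompact_of_isClosed_isBounded ?_ ?_
  · exact isClosed_le (continuous_l2Norm.comp (by fun_prop)) continuous_const
  · refine (Metric.isBounded_closedBall (x := β) (r := max r 0)).subset fun v hv => ?_
    rw [Metric.mem_closedBall, dist_eq_norm, pi_norm_le_iff_of_nonneg (le_max_right _ _)]
    exact fun j => (abs_apply_le_l2Norm (v - β) j).trans ((show _ ≤ r from hv).trans (le_max_left _ _))

end Norms

/-! ### Extreme eigenvalues as Rayleigh bounds -/

section Spectral

variable {k : ℕ} {A : Matrix (Fin k) (Fin k) ℝ}

lemma dotProduct_self_eq_l2Norm_sq (v : Fin k → ℝ) : v ⬝ᵥ v = l2Norm v ^ 2 := by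
  rw [l2Norm_sq]; simp [dotProduct, sq]

lemma dotProduct_mulVec_le_maxEig (hA : A.IsHermitian) (v : Fin k → ℝ) :
    v ⬝ᵥ (A *ᵥ v) ≤ maxEig A * l2Norm v ^ 2 := by
  have hB : (maxEig A • (1 : Matrix (Fin k) (Fin k) ℝ) - A).PosSemidef := by
    rw [Matrix.posSemidef_iff_isHermitian_and_spectrum_nonneg]
    refine ⟨(Matrix.isHermitian_one.smul (by simp [IsSelfAdjoint])).sub hA, ?_⟩
    rw [← Algebra.algebraMap_eq_smul_one, ← spectrum.singleton_sub_eq]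
    rintro x ⟨a, rfl, y, hy, rfl⟩
    have : y ≤ maxEig A := le_csSup (hA.spectrum_real_eq_range_eigenvalues ▸
      (Set.finite_range _).bddAbove) hy
    simpa using this
  have := hB.dotProduct_mulVec_nonneg v
  simp only [star_trivial, Matrix.sub_mulVec, dotProduct_sub, Matrix.smul_mulVec,
    Matrix.one_mulVec, dotProduct_smul, dotProduct_self_eq_l2Norm_sq, smul_eq_mul] at this
  linarith

lemma minEig_mul_le_dotProduct_mulVec (hA : A.IsHermitian) (v : Fin k → ℝ) :
    minEig A * l2Norm v ^ 2 ≤ v ⬝ᵥ (A *ᵥ v) := by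
  have hB : (A - minEig A • (1 : Matrix (Fin k) (Fin k) ℝ)).PosSemidef := by
    rw [Matrix.posSemidef_iff_isHermitian_and_spectrum_nonneg]
    refine ⟨hA.sub (Matrix.isHermitian_one.smul (by simp [IsSelfAdjoint])), ?_⟩
    rw [← Algebra.algebraMap_eq_smul_one, ← spectrum.sub_singleton_eq]
    rintro x ⟨y, hy, a, rfl, rfl⟩
    have : minEig A ≤ y := csInf_le (hA.spectrum_real_eq_range_eigenvalues ▸
      (Set.finite_range _).bddBelow) hy
    simpa using this
  have := hB.dotProduct_mulVec_nonneg v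
  simp only [star_trivial, Matrix.sub_mulVec, dotProduct_sub, Matrix.smul_mulVec,
    Matrix.one_mulVec, dotProduct_smul, dotProduct_self_eq_l2Norm_sq, smul_eq_mul] at this
  linarith

lemma minEig_le_maxEig [NeZero k] (hA : A.IsHermitian) : minEig A ≤ maxEig A := by
  have h1 := minEig_mul_le_dotProduct_mulVec hA (Pi.single 0 1)
  have h2 := dotProduct_mulVec_le_maxEig hA (Pi.single 0 1)
  have h3 : l2Norm (Pi.single (0 : Fin k) (1 : ℝ)) ^ 2 = 1 := by
    rw [← dotProduct_self_eq_l2Norm_sq]; simp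
  rw [h3] at h1 h2
  linarith

end Spectral

lemma secondMoment_isHermitian {p : ℕ} (P : Measure (Obs p)) : (secondMoment P).IsHermitian := by
  ext j k
  simp [secondMoment, mul_comm]

/-! ### Sub-Gaussian features and their moments -/

/-- The squares of the unit linear forms in the augmented features have exponential moments of
order `1 / τ`, bounded by `3`. -/
def ExpSquareBound {p : ℕ} (P : Measure (Obs p)) (τ : ℝ) : Prop :=
  ∀ v : Fin (p + 1) → ℝ, l2Norm v ≤ 1 →
    Integrable (fun o : Obs p => Real.exp ((aug o.1 ⬝ᵥ v) ^ 2 / τ)) P ∧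
      ∫ o, Real.exp ((aug o.1 ⬝ᵥ v) ^ 2 / τ) ∂P ≤ 3

lemma continuous_aug {p : ℕ} : Continuous (aug : (Fin p → ℝ) → Fin (p + 1) → ℝ) := by
  refine continuous_pi fun j => ?_
  refine Fin.cases ?_ (fun i => ?_) j
  · simpa [aug] using continuous_const
  · simpa [aug] using continuous_apply i

@[fun_prop]
lemma measurable_aug {p : ℕ} : Measurable (aug : (Fin p → ℝ) → Fin (p + 1) → ℝ) :=
  continuous_aug.measurable

@[fun_prop]
lemma measurable_aug_dot {p : ℕ} (v : Fin (p + 1) → ℝ) :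
    Measurable fun o : Obs p => aug o.1 ⬝ᵥ v := by
  have : Continuous fun o : Obs p => aug o.1 ⬝ᵥ v := by
    have := continuous_aug (p := p)
    unfold dotProduct
    fun_prop
  exact this.measurable

@[fun_prop]
lemma measurable_margin {p : ℕ} (β : Fin (p + 1) → ℝ) : Measurable (margin (p := p) β) := by
  unfold margin
  fun_prop

/-- Tails `2 exp (- t² / 2)` of `|f|` give `E exp (f² / 4) ≤ 3`, by the layer-cake formula. -/
lemma integral_exp_sq_div_four_le {Ω : Type*} [MeasurableSpace Ω] {μ : Measure Ω}
    [IsProbabilityMeasure μ] {f : Ω → ℝ} (hf : Measurable f)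
    (htail : ∀ t, 0 < t → μ {ω | t ≤ |f ω|} ≤ ENNReal.ofReal (2 * Real.exp (-t ^ 2 / 2))) :
    Integrable (fun ω => Real.exp (f ω ^ 2 / 4)) μ ∧ ∫ ω, Real.exp (f ω ^ 2 / 4) ∂μ ≤ 3 := by
  have hderiv : ∀ t : ℝ, HasDerivAt (fun t => Real.exp (t ^ 2 / 4))
      (t / 2 * Real.exp (t ^ 2 / 4)) t := fun t => by
    have := ((hasDerivAt_pow 2 t).div_const 4).exp
    convert this using 1
    push_cast; ring
  have hcont : Continuous fun t : ℝ => t / 2 * Real.exp (t ^ 2 / 4) := by fun_prop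
  have hFTC : ∀ x : ℝ, ∫ t in (0 : ℝ)..x, t / 2 * Real.exp (t ^ 2 / 4)
      = Real.exp (x ^ 2 / 4) - 1 := fun x => by
    rw [intervalIntegral.integral_eq_sub_of_hasDerivAt (fun t _ => hderiv t)
      (hcont.intervalIntegrable _ _)]
    simp
  have hlc := lintegral_comp_eq_lintegral_meas_le_mul μ (f := fun ω => |f ω|)
    (g := fun t => t / 2 * Real.exp (t ^ 2 / 4)) (ae_of_all _ fun _ => abs_nonneg _)
    (hf.abs.aemeasurable) (fun t _ => hcont.intervalIntegrable _ _)
    ((ae_restrict_iff' measurableSet_Ioi).2 (ae_of_all _ fun t ht => by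
      have : (0 : ℝ) < t := ht
      positivity))
  simp only [hFTC, sq_abs] at hlc
  -- the primitive of `t exp (- t² / 4)` is `- 2 exp (- t² / 4)`
  have hderiv2 : ∀ t : ℝ, HasDerivAt (fun t => -2 * Real.exp (-t ^ 2 / 4))
      (t * Real.exp (-t ^ 2 / 4)) t := fun t => by
    have := ((((hasDerivAt_pow 2 t).fun_neg).div_const 4).exp).const_mul (-2)
    refine this.congr_deriv ?_
    push_cast; ring
  have hlim : Tendsto (fun t : ℝ => -2 * Real.exp (-t ^ 2 / 4)) atTop (𝓝 0) := by
    have h : Tendsto (fun t : ℝ => -t ^ 2 / 4) atTop atBot := by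
      have h1 : Tendsto (fun t : ℝ => t ^ 2 / 4) atTop atTop :=
        (tendsto_pow_atTop (by norm_num)).atTop_div_const (by norm_num)
      have h2 := tendsto_neg_atTop_atBot.comp h1
      refine h2.congr fun t => by simp [neg_div]
    simpa using (Real.tendsto_exp_atBot.comp h).const_mul (-2)
  have hpos : ∀ t ∈ Set.Ioi (0 : ℝ), 0 ≤ t * Real.exp (-t ^ 2 / 4) := fun t ht => by
    have : (0 : ℝ) < t := ht
    positivity
  have hint : IntegrableOn (fun t : ℝ => t * Real.exp (-t ^ 2 / 4)) (Set.Ioi 0) :=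
    integrableOn_Ioi_deriv_of_nonneg' (fun t _ => hderiv2 t) hpos hlim
  have hval : ∫ t in Set.Ioi (0 : ℝ), t * Real.exp (-t ^ 2 / 4) = 2 := by
    rw [integral_Ioi_of_hasDerivAt_of_nonneg' (fun t _ => hderiv2 t) hpos hlim]
    simp
  have hle : ∫⁻ ω, ENNReal.ofReal (Real.exp (f ω ^ 2 / 4) - 1) ∂μ ≤ 2 := by
    rw [hlc]
    calc _ ≤ ∫⁻ t in Set.Ioi (0 : ℝ), ENNReal.ofReal (t * Real.exp (-t ^ 2 / 4)) := by
          refine setLIntegral_mono' measurableSet_Ioi fun t ht => ?_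
          have ht' : (0 : ℝ) < t := ht
          calc _ ≤ ENNReal.ofReal (2 * Real.exp (-t ^ 2 / 2)) *
                ENNReal.ofReal (t / 2 * Real.exp (t ^ 2 / 4)) := by gcongr; exact htail t ht'
            _ = _ := by
              rw [← ENNReal.ofReal_mul (by positivity)]
              congr 1
              rw [show -t ^ 2 / 4 = -t ^ 2 / 2 + t ^ 2 / 4 by ring, Real.exp_add]
              ring
      _ = 2 := by
          rw [← ofReal_integral_eq_lintegral_ofReal hint
            ((ae_restrict_iff' measurableSet_Ioi).2 (ae_of_all _ hpos)), hval]
          simp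
  have hnn : ∀ ω, 0 ≤ Real.exp (f ω ^ 2 / 4) - 1 := fun ω => by
    have := Real.add_one_le_exp (f ω ^ 2 / 4)
    nlinarith [sq_nonneg (f ω)]
  have hi : Integrable (fun ω => Real.exp (f ω ^ 2 / 4) - 1) μ := by
    refine ⟨by fun_prop, ?_⟩
    rw [hasFiniteIntegral_iff_ofReal (ae_of_all _ hnn)]
    exact hle.trans_lt (by simp)
  have hi2 : Integrable (fun ω => Real.exp (f ω ^ 2 / 4)) μ := by
    exact (hi.add (integrable_const (1 : ℝ))).congr (ae_of_all _ fun ω => by simp)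
  refine ⟨hi2, ?_⟩
  have h2 : ∫ ω, (Real.exp (f ω ^ 2 / 4) - 1) ∂μ ≤ 2 := by
    rw [integral_eq_lintegral_of_nonneg_ae (ae_of_all _ hnn) (by fun_prop)]
    exact ENNReal.toReal_le_of_le_ofReal (by norm_num) (by simpa using hle)
  rw [integral_sub hi2 (integrable_const _)] at h2
  simp at h2
  linarith

/-- The whitened tail bound turns into tails of `(1, X)ᵀ v` because
`(1, X)ᵀ v = (Σ^{1/2} v)ᵀ Σ^{-1/2} (1, X)` and `‖Σ^{1/2} v‖² = vᵀ Σ v ≤ c₂ ‖v‖²`. -/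
lemma DesignAssumption.expSquareBound {p : ℕ} {P : Measure (Obs p)} [IsProbabilityMeasure P]
    {ν₀ c₁ c₂ M : ℝ} (h : DesignAssumption P ν₀ c₁ c₂ M) (hν₀ : 0 < ν₀) (hc₁ : 0 < c₁) :
    0 < c₂ ∧ ExpSquareBound P (4 * (ν₀ ^ 2 * c₂)) := by
  have hH := secondMoment_isHermitian P
  have hc₂ : 0 < c₂ := by
    have := minEig_le_maxEig hH
    linarith [h.eig_low, h.eig_high]
  refine ⟨hc₂, fun v hv => ?_⟩
  rcases eq_or_ne v 0 with rfl | hv0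
  · simp
  obtain ⟨R, hR, hRR, htail⟩ := h.subgaussian
  set S := secondMoment P with hS
  have hSpos : ∀ w, w ≠ 0 → 0 < w ⬝ᵥ (S *ᵥ w) := fun w hw =>
    lt_of_lt_of_le (mul_pos (hc₁.trans_le h.eig_low) (pow_pos (l2Norm_pos hw) 2))
      (minEig_mul_le_dotProduct_mulVec hH w)
  have hSunit : IsUnit S.det := by
    rw [isUnit_iff_ne_zero]
    intro h0
    obtain ⟨w, hw, hw0⟩ := Matrix.exists_mulVec_eq_zero_iff.2 h0
    have := hSpos w hw
    simp [hw0] at this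
  -- `u = R S v` is the preimage of `v` under the transpose of `R`
  set u := R *ᵥ (S *ᵥ v) with hu
  have hRu : R *ᵥ u = v := by
    rw [hu, Matrix.mulVec_mulVec, Matrix.mulVec_mulVec, hRR, Matrix.nonsing_inv_mul _ hSunit,
      Matrix.one_mulVec]
  have hu0 : u ≠ 0 := fun h0 => hv0 (by rw [← hRu, h0, Matrix.mulVec_zero])
  have hsymm : ∀ a b : Fin (p + 1) → ℝ, a ⬝ᵥ (R *ᵥ b) = (R *ᵥ a) ⬝ᵥ b := fun a b => by
    rw [Matrix.dotProduct_mulVec, ← Matrix.mulVec_transpose]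
    congr 2
    have := hR.1
    rwa [Matrix.IsHermitian, Matrix.conjTranspose_eq_transpose_of_trivial] at this
  have hux : ∀ x, u ⬝ᵥ (R *ᵥ x) = x ⬝ᵥ v := fun x => by rw [hsymm, hRu, dotProduct_comm]
  have hun : l2Norm u ^ 2 ≤ c₂ := by
    rw [← dotProduct_self_eq_l2Norm_sq]
    calc u ⬝ᵥ u = v ⬝ᵥ (S *ᵥ v) := by
          conv_lhs => rw [hu, hsymm, ← hu, hRu]
      _ ≤ maxEig S * l2Norm v ^ 2 := dotProduct_mulVec_le_maxEig hH v
      _ ≤ c₂ * 1 := by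
          have h1 : l2Norm v ^ 2 ≤ 1 := by nlinarith [l2Norm_nonneg v]
          have h2 := minEig_le_maxEig hH
          exact mul_le_mul h.eig_high h1 (by positivity) hc₂.le
      _ = c₂ := mul_one _
  have hu' : l2Norm u ≤ √c₂ := Real.le_sqrt_of_sq_le hun
  have hσ : 0 < ν₀ * √c₂ := by positivity
  have key := integral_exp_sq_div_four_le (μ := P) (f := fun o => (aug o.1 ⬝ᵥ v) / (ν₀ * √c₂))
    (by fun_prop) (fun t ht => by
      refine (measure_mono fun o ho => ?_).trans (htail u hu0 t ht)
      simp only [Set.mem_ofPred_eq] at ho ⊢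
      rw [hux]
      rw [abs_div, abs_of_pos hσ, le_div_iff₀ hσ] at ho
      calc _ ≤ ν₀ * √c₂ * t := by gcongr
        _ ≤ _ := by linarith)
  have heq : ∀ o : Obs p, (aug o.1 ⬝ᵥ v / (ν₀ * √c₂)) ^ 2 / 4
      = (aug o.1 ⬝ᵥ v) ^ 2 / (4 * (ν₀ ^ 2 * c₂)) := fun o => by
    rw [div_pow, mul_pow, Real.sq_sqrt hc₂.le, div_div]
    ring
  simpa only [heq] using key

section Moments

variable {p : ℕ} {P : Measure (Obs p)} {τ : ℝ}

lemma exists_unit_smul {k : ℕ} (v : Fin k → ℝ) : ∃ u, l2Norm u ≤ 1 ∧ v = l2Norm v • u := by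
  rcases eq_or_ne v 0 with rfl | hv
  · exact ⟨0, by simp, by simp⟩
  · have h := l2Norm_pos hv
    refine ⟨(l2Norm v)⁻¹ • v, ?_, ?_⟩
    · rw [l2Norm_smul, abs_of_pos (inv_pos.2 h), inv_mul_cancel₀ h.ne']
    · rw [smul_smul, mul_inv_cancel₀ h.ne', one_smul]

lemma ExpSquareBound.integral_sq (h : ExpSquareBound P τ) (hτ : 0 < τ) (v : Fin (p + 1) → ℝ) :
    Integrable (fun o : Obs p => (aug o.1 ⬝ᵥ v) ^ 2) P ∧
      ∫ o, (aug o.1 ⬝ᵥ v) ^ 2 ∂P ≤ 3 * τ * l2Norm v ^ 2 := by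
  obtain ⟨u, hu, huv⟩ := exists_unit_smul v
  obtain ⟨hi, hb⟩ := h u hu
  have hle : ∀ o : Obs p, (aug o.1 ⬝ᵥ u) ^ 2 ≤ τ * Real.exp ((aug o.1 ⬝ᵥ u) ^ 2 / τ) := fun o => by
    have := Real.add_one_le_exp ((aug o.1 ⬝ᵥ u) ^ 2 / τ)
    rw [← div_le_iff₀' hτ]
    linarith
  have hiu : Integrable (fun o : Obs p => (aug o.1 ⬝ᵥ u) ^ 2) P :=
    (hi.const_mul τ).mono' ((measurable_aug_dot u).pow_const 2).aestronglyMeasurable (ae_of_all _ fun o => by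
      rw [Real.norm_of_nonneg (sq_nonneg _)]; exact hle o)
  have heq : ∀ o : Obs p, (aug o.1 ⬝ᵥ v) ^ 2 = l2Norm v ^ 2 * (aug o.1 ⬝ᵥ u) ^ 2 := fun o => by
    conv_lhs => rw [huv]
    rw [dotProduct_smul, smul_eq_mul, mul_pow]
  simp only [heq]
  refine ⟨hiu.const_mul _, ?_⟩
  rw [integral_const_mul, mul_comm (3 * τ)]
  refine mul_le_mul_of_nonneg_left ?_ (sq_nonneg _)
  calc _ ≤ ∫ o : Obs p, τ * Real.exp ((aug o.1 ⬝ᵥ u) ^ 2 / τ) ∂P :=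
        integral_mono hiu (hi.const_mul τ) hle
    _ ≤ 3 * τ := by rw [integral_const_mul]; nlinarith

lemma ExpSquareBound.integral_fourth (h : ExpSquareBound P τ) (hτ : 0 < τ)
    (v : Fin (p + 1) → ℝ) :
    Integrable (fun o : Obs p => (aug o.1 ⬝ᵥ v) ^ 4) P ∧
      ∫ o, (aug o.1 ⬝ᵥ v) ^ 4 ∂P ≤ 6 * τ ^ 2 * l2Norm v ^ 4 := by
  obtain ⟨u, hu, huv⟩ := exists_unit_smul v
  obtain ⟨hi, hb⟩ := h u hu
  have hle : ∀ o : Obs p, (aug o.1 ⬝ᵥ u) ^ 4 ≤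
      2 * τ ^ 2 * Real.exp ((aug o.1 ⬝ᵥ u) ^ 2 / τ) := fun o => by
    have h0 : 0 ≤ (aug o.1 ⬝ᵥ u) ^ 2 / τ := by positivity
    have := Real.quadratic_le_exp_of_nonneg h0
    have h2 : (aug o.1 ⬝ᵥ u) ^ 4 = τ ^ 2 * ((aug o.1 ⬝ᵥ u) ^ 2 / τ) ^ 2 := by
      field_simp
    rw [h2]
    have hτ2 : 0 < τ ^ 2 := by positivity
    nlinarith
  have hiu : Integrable (fun o : Obs p => (aug o.1 ⬝ᵥ u) ^ 4) P :=
    (hi.const_mul (2 * τ ^ 2)).mono' ((measurable_aug_dot u).pow_const 4).aestronglyMeasurable (ae_of_all _ fun o => by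
      rw [Real.norm_of_nonneg (by positivity)]; exact hle o)
  have heq : ∀ o : Obs p, (aug o.1 ⬝ᵥ v) ^ 4 = l2Norm v ^ 4 * (aug o.1 ⬝ᵥ u) ^ 4 := fun o => by
    conv_lhs => rw [huv]
    rw [dotProduct_smul, smul_eq_mul, mul_pow]
  simp only [heq]
  refine ⟨hiu.const_mul _, ?_⟩
  rw [integral_const_mul, mul_comm (6 * τ ^ 2)]
  refine mul_le_mul_of_nonneg_left ?_ (by have := l2Norm_nonneg v; positivity)
  calc _ ≤ ∫ o : Obs p, 2 * τ ^ 2 * Real.exp ((aug o.1 ⬝ᵥ u) ^ 2 / τ) ∂P :=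
        integral_mono hiu (hi.const_mul _) hle
    _ ≤ 6 * τ ^ 2 := by rw [integral_const_mul]; nlinarith [sq_nonneg τ]

lemma l2Norm_single {k : ℕ} (j : Fin k) : l2Norm (Pi.single j (1 : ℝ)) = 1 := by
  have : l2Norm (Pi.single j (1 : ℝ)) ^ 2 = 1 := by rw [← dotProduct_self_eq_l2Norm_sq]; simp
  have h := l2Norm_nonneg (Pi.single j (1 : ℝ))
  nlinarith

lemma ExpSquareBound.coord (h : ExpSquareBound P τ) (j : Fin (p + 1)) :
    Integrable (fun o : Obs p => Real.exp (aug o.1 j ^ 2 / τ)) P ∧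
      ∫ o, Real.exp (aug o.1 j ^ 2 / τ) ∂P ≤ 3 := by
  simpa using h (Pi.single j 1) (l2Norm_single j).le

@[fun_prop]
lemma measurable_aug_apply {p : ℕ} (j : Fin (p + 1)) :
    Measurable fun o : Obs p => aug o.1 j :=
  (measurable_pi_apply j).comp (measurable_aug.comp measurable_fst)

/-- Products of two coordinates have exponential moments of order `1 / τ`. -/
lemma ExpSquareBound.coord_mul (h : ExpSquareBound P τ) (hτ : 0 < τ) (j k : Fin (p + 1)) :
    Integrable (fun o : Obs p => Real.exp (|aug o.1 j * aug o.1 k| / τ)) P ∧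
      ∫ o, Real.exp (|aug o.1 j * aug o.1 k| / τ) ∂P ≤ 3 := by
  obtain ⟨hj, hj3⟩ := h.coord j
  obtain ⟨hk, hk3⟩ := h.coord k
  have hle : ∀ o : Obs p, Real.exp (|aug o.1 j * aug o.1 k| / τ) ≤
      (1 / 2) * Real.exp (aug o.1 j ^ 2 / τ) + (1 / 2) * Real.exp (aug o.1 k ^ 2 / τ) := fun o => by
    have h1 : |aug o.1 j * aug o.1 k| / τ ≤
        (1 / 2) * (aug o.1 j ^ 2 / τ) + (1 / 2) * (aug o.1 k ^ 2 / τ) := by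
      rw [div_le_iff₀ hτ, abs_mul]
      have : ((1 / 2) * (aug o.1 j ^ 2 / τ) + (1 / 2) * (aug o.1 k ^ 2 / τ)) * τ =
          (1 / 2) * (aug o.1 j ^ 2 + aug o.1 k ^ 2) := by field_simp
      rw [this, ← sq_abs (aug o.1 j), ← sq_abs (aug o.1 k)]
      nlinarith [sq_nonneg (|aug o.1 j| - |aug o.1 k|)]
    refine (Real.exp_le_exp.2 h1).trans ?_
    have := convexOn_exp.2 (Set.mem_univ (aug o.1 j ^ 2 / τ)) (Set.mem_univ (aug o.1 k ^ 2 / τ))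
      (show (0 : ℝ) ≤ 1 / 2 by norm_num) (show (0 : ℝ) ≤ 1 / 2 by norm_num) (by norm_num)
    simpa using this
  have hi : Integrable (fun o : Obs p => Real.exp (|aug o.1 j * aug o.1 k| / τ)) P :=
    ((hj.const_mul _).add (hk.const_mul _)).mono' (by fun_prop) (ae_of_all _ fun o => by
      rw [Real.norm_of_nonneg (Real.exp_nonneg _)]; exact hle o)
  refine ⟨hi, (integral_mono hi ((hj.const_mul _).add (hk.const_mul _)) hle).trans ?_⟩
  simp only [Pi.add_apply]
  rw [integral_add (hj.const_mul _) (hk.const_mul _), integral_const_mul, integral_const_mul]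
  linarith

lemma measurable_norm_aug : Measurable fun o : Obs p => ‖aug o.1‖ :=
  (continuous_aug.norm.measurable).comp measurable_fst

/-- A maximum of `p + 1` sub-Gaussian squares costs only a factor `log p`: beyond the level
`2 τ log p` the excess of each coordinate has expectation of order `1 / p`. -/
lemma ExpSquareBound.integral_norm_sq_mul_sq (h : ExpSquareBound P τ) (hτ : 0 < τ)
    (hp : 1 ≤ Real.log p) (v : Fin (p + 1) → ℝ) :
    Integrable (fun o : Obs p => ‖aug o.1‖ ^ 2 * (aug o.1 ⬝ᵥ v) ^ 2) P ∧
      ∫ o, ‖aug o.1‖ ^ 2 * (aug o.1 ⬝ᵥ v) ^ 2 ∂P ≤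
        (6 * τ ^ 2 + 2 * τ * (3 + 6 * τ ^ 2)) * Real.log p * l2Norm v ^ 2 := by
  have hp1 : (1 : ℝ) ≤ p := by
    rcases Nat.eq_zero_or_pos p with rfl | hp'
    · simp at hp; linarith
    · exact_mod_cast hp'
  obtain ⟨u, hu, huv⟩ := exists_unit_smul v
  set L := Real.log p with hL
  have hpe : (p : ℝ)⁻¹ = Real.exp (-L) := by rw [Real.exp_neg, hL, Real.exp_log (by linarith)]
  -- the pointwise bound on the maximum
  have hmax : ∀ o : Obs p, ‖aug o.1‖ ^ 2 ≤
      2 * τ * L + ∑ j, 2 * τ * (p : ℝ)⁻¹ * Real.exp (aug o.1 j ^ 2 / (2 * τ)) := fun o => by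
    have hcoord : ∀ j, aug o.1 j ^ 2 ≤
        2 * τ * L + 2 * τ * (p : ℝ)⁻¹ * Real.exp (aug o.1 j ^ 2 / (2 * τ)) := fun j => by
      have h1 := Real.add_one_le_exp (-L + aug o.1 j ^ 2 / (2 * τ))
      rw [Real.exp_add, ← hpe] at h1
      have h2 : aug o.1 j ^ 2 = 2 * τ * (aug o.1 j ^ 2 / (2 * τ)) := by field_simp
      calc aug o.1 j ^ 2 = 2 * τ * (aug o.1 j ^ 2 / (2 * τ)) := h2
        _ ≤ 2 * τ * (L + (p : ℝ)⁻¹ * Real.exp (aug o.1 j ^ 2 / (2 * τ))) := by gcongr; linarith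
        _ = _ := by ring
    obtain ⟨j, hj⟩ : ∃ j, ‖aug o.1‖ = |aug o.1 j| := by
      obtain ⟨j, -, hj⟩ := Finset.exists_max_image Finset.univ (fun j => |aug o.1 j|)
        Finset.univ_nonempty
      refine ⟨j, le_antisymm ?_ (norm_le_pi_norm (aug o.1) j)⟩
      exact (pi_norm_le_iff_of_nonneg (abs_nonneg _)).2 fun i => hj i (Finset.mem_univ i)
    rw [hj, sq_abs]
    refine (hcoord j).trans ?_
    have := Finset.single_le_sum
      (f := fun j => 2 * τ * (p : ℝ)⁻¹ * Real.exp (aug o.1 j ^ 2 / (2 * τ)))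
      (fun _ _ => by positivity) (Finset.mem_univ j)
    linarith
  -- `exp (x_j² / (2 τ)) (xᵀu)² ≤ (exp (x_j² / τ) + (xᵀu)⁴) / 2`
  have hpt : ∀ o : Obs p, ‖aug o.1‖ ^ 2 * (aug o.1 ⬝ᵥ u) ^ 2 ≤ 2 * τ * L * (aug o.1 ⬝ᵥ u) ^ 2 +
      ∑ j, (τ * (p : ℝ)⁻¹ * Real.exp (aug o.1 j ^ 2 / τ) + τ * (p : ℝ)⁻¹ * (aug o.1 ⬝ᵥ u) ^ 4) :=
    fun o => by
    refine (mul_le_mul_of_nonneg_right (hmax o) (sq_nonneg _)).trans ?_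
    rw [add_mul, Finset.sum_mul]
    gcongr with j _
    have h1 : Real.exp (aug o.1 j ^ 2 / τ) = Real.exp (aug o.1 j ^ 2 / (2 * τ)) ^ 2 := by
      rw [← Real.exp_nat_mul]; congr 1; field_simp; push_cast; ring
    rw [h1]
    have : 0 ≤ τ * (p : ℝ)⁻¹ := by positivity
    nlinarith [sq_nonneg (Real.exp (aug o.1 j ^ 2 / (2 * τ)) - (aug o.1 ⬝ᵥ u) ^ 2)]
  obtain ⟨h2i, h2b⟩ := h.integral_sq hτ u
  obtain ⟨h4i, h4b⟩ := h.integral_fourth hτ u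
  have hu2 : l2Norm u ^ 2 ≤ 1 := pow_le_one₀ (l2Norm_nonneg u) hu
  have hu4 : l2Norm u ^ 4 ≤ 1 := pow_le_one₀ (l2Norm_nonneg u) hu
  have hsumi : ∀ j : Fin (p + 1), Integrable (fun o : Obs p =>
      τ * (p : ℝ)⁻¹ * Real.exp (aug o.1 j ^ 2 / τ) + τ * (p : ℝ)⁻¹ * (aug o.1 ⬝ᵥ u) ^ 4) P :=
    fun j => ((h.coord j).1.const_mul _).add (h4i.const_mul _)
  have hbi := (h2i.const_mul (2 * τ * L)).add
    (integrable_finsetSum Finset.univ fun j _ => hsumi j)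
  have hiu : Integrable (fun o : Obs p => ‖aug o.1‖ ^ 2 * (aug o.1 ⬝ᵥ u) ^ 2) P := by
    refine hbi.mono' ?_ (ae_of_all _ fun o => ?_)
    · exact ((measurable_norm_aug.pow_const 2).mul
        ((measurable_aug_dot u).pow_const 2)).aestronglyMeasurable
    · rw [Real.norm_of_nonneg (by positivity)]
      simpa using hpt o
  have hbu : ∫ o, ‖aug o.1‖ ^ 2 * (aug o.1 ⬝ᵥ u) ^ 2 ∂P ≤
      (6 * τ ^ 2 + 2 * τ * (3 + 6 * τ ^ 2)) * L := by
    refine (integral_mono hiu hbi fun o => by simpa using hpt o).trans ?_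
    simp only [Pi.add_apply]
    rw [integral_add (h2i.const_mul _) (integrable_finsetSum _ fun j _ => hsumi j),
      integral_const_mul, integral_finsetSum _ fun j _ => hsumi j]
    have hj : ∀ j ∈ (Finset.univ : Finset (Fin (p + 1))), ∫ o : Obs p, (τ * (p : ℝ)⁻¹ *
        Real.exp (aug o.1 j ^ 2 / τ) + τ * (p : ℝ)⁻¹ * (aug o.1 ⬝ᵥ u) ^ 4) ∂P ≤
        τ * (p : ℝ)⁻¹ * (3 + 6 * τ ^ 2) := fun j _ => by
      rw [integral_add ((h.coord j).1.const_mul _) (h4i.const_mul _), integral_const_mul,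
        integral_const_mul, ← mul_add]
      refine mul_le_mul_of_nonneg_left (add_le_add (h.coord j).2 (h4b.trans ?_)) (by positivity)
      nlinarith [sq_nonneg τ]
    have h3 := Finset.sum_le_sum hj
    rw [Finset.sum_const, Finset.card_univ, Fintype.card_fin, nsmul_eq_mul] at h3
    have h4 : ((p + 1 : ℕ) : ℝ) * (τ * (p : ℝ)⁻¹ * (3 + 6 * τ ^ 2)) ≤ 2 * τ * (3 + 6 * τ ^ 2) := by
      have : ((p + 1 : ℕ) : ℝ) * (p : ℝ)⁻¹ ≤ 2 := by
        rw [← div_eq_mul_inv, div_le_iff₀ (by linarith)]; push_cast; linarith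
      calc _ = ((p + 1 : ℕ) : ℝ) * (p : ℝ)⁻¹ * (τ * (3 + 6 * τ ^ 2)) := by ring
        _ ≤ 2 * (τ * (3 + 6 * τ ^ 2)) := by gcongr
        _ = _ := by ring
    have h5 : 2 * τ * L * ∫ o, (aug o.1 ⬝ᵥ u) ^ 2 ∂P ≤ 2 * τ * L * (3 * τ) := by
      gcongr
      nlinarith
    have h6 : 2 * τ * (3 + 6 * τ ^ 2) ≤ 2 * τ * (3 + 6 * τ ^ 2) * L :=
      le_mul_of_one_le_right (by positivity) hp
    nlinarith
  have heq : ∀ o : Obs p, ‖aug o.1‖ ^ 2 * (aug o.1 ⬝ᵥ v) ^ 2 =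
      l2Norm v ^ 2 * (‖aug o.1‖ ^ 2 * (aug o.1 ⬝ᵥ u) ^ 2) := fun o => by
    conv_lhs => rw [huv]
    rw [dotProduct_smul, smul_eq_mul, mul_pow]
    ring
  simp only [heq]
  refine ⟨hiu.const_mul _, ?_⟩
  rw [integral_const_mul, mul_comm _ (l2Norm v ^ 2)]
  exact mul_le_mul_of_nonneg_left hbu (sq_nonneg _)

end Moments

/-! ### Exponential inequalities for independent observations -/

section Concentration

lemma exp_le_one_add_add_sq_mul_exp_abs (x : ℝ) :
    Real.exp x ≤ 1 + x + x ^ 2 * Real.exp |x| := by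
  rcases le_or_gt |x| 1 with h | h
  · have h1 := (abs_le.1 (Real.abs_exp_sub_one_sub_id_le h)).2
    have h2 := Real.one_le_exp (abs_nonneg x)
    nlinarith [sq_nonneg x]
  · rcases lt_abs.1 h with h' | h'
    · rw [abs_of_pos (by linarith)]
      nlinarith [Real.exp_pos x, mul_pos (sub_pos.2 h') (Real.exp_pos x)]
    · have h1 : Real.exp x ≤ 1 := Real.exp_le_one_iff.2 (by linarith)
      have h2 := Real.one_le_exp (abs_nonneg x)
      nlinarith [sq_nonneg x]

variable {Ω E ι : Type*} [MeasurableSpace Ω] [MeasurableSpace E] {μ : Measure Ω}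
  {P : Measure E} {O : ι → Ω → E} {g : ι → E → ℝ}

/-- Chernoff's bound for a sum of functions of independent observations with law `P`. -/
lemma measure_le_sum_le_exp [IsProbabilityMeasure μ]
    (hlaw : ∀ i, HasLaw (O i) P μ) (hind : iIndepFun O μ) (hg : ∀ i, Measurable (g i))
    (S : Finset ι) {θ : ℝ} (hθ : 0 ≤ θ) {c : ι → ℝ}
    (hi : ∀ i ∈ S, Integrable (fun x => Real.exp (θ * g i x)) P)
    (hc : ∀ i ∈ S, ∫ x, Real.exp (θ * g i x) ∂P ≤ Real.exp (c i)) (a : ℝ) :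
    μ {ω | a ≤ ∑ i ∈ S, g i (O i ω)} ≤ ENNReal.ofReal (Real.exp (-θ * a + ∑ i ∈ S, c i)) := by
  -- pass to measurable versions of the observations
  set O' : ι → Ω → E := fun i => (hlaw i).aemeasurable.mk (O i) with hO'
  have hae : ∀ i, O i =ᵐ[μ] O' i := fun i => (hlaw i).aemeasurable.ae_eq_mk
  have hO'm : ∀ i, Measurable (O' i) := fun i => (hlaw i).aemeasurable.measurable_mk
  have hlaw' : ∀ i, HasLaw (O' i) P μ := fun i => (hlaw i).congr (hae i).symm
  have hind' : iIndepFun O' μ := hind.congr hae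
  have hset : μ {ω | a ≤ ∑ i ∈ S, g i (O i ω)} = μ {ω | a ≤ (∑ i ∈ S, g i ∘ O' i) ω} := by
    apply measure_congr
    have : ∀ᵐ ω ∂μ, ∀ i ∈ S, O i ω = O' i ω := (Finset.eventually_all S).2 fun i _ => hae i
    filter_upwards [this] with ω hω
    apply propext
    simp only [Finset.sum_apply, Function.comp_apply]
    change a ≤ ∑ i ∈ S, g i (O i ω) ↔ a ≤ _
    rw [Finset.sum_congr rfl fun i hi => by rw [hω i hi]]
  have hindg : iIndepFun (fun i => g i ∘ O' i) μ := hind'.comp _ hg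
  have hint : ∀ i ∈ S, Integrable (fun ω => Real.exp (θ * (g i ∘ O' i) ω)) μ := fun i his => by
    have h1 := hi i his
    rw [← (hlaw' i).map_eq] at h1
    exact h1.comp_measurable (hO'm i)
  have hmgf : ∀ i ∈ S, mgf (g i ∘ O' i) μ θ ≤ Real.exp (c i) := fun i his => by
    refine le_trans (le_of_eq ?_) (hc i his)
    exact (hlaw' i).integral_comp (f := fun x => Real.exp (θ * g i x))
      (((hg i).const_mul θ).exp.aestronglyMeasurable)
  have hch := measure_ge_le_exp_mul_mgf (μ := μ) (X := ∑ i ∈ S, g i ∘ O' i) a hθ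
    (hindg.integrable_exp_mul_sum (fun i => (hg i).comp (hO'm i)) hint)
  rw [hindg.mgf_sum (fun i => (hg i).comp (hO'm i))] at hch
  rw [hset, ← ofReal_measureReal]
  refine ENNReal.ofReal_le_ofReal (hch.trans ?_)
  rw [Real.exp_add, Real.exp_sum]
  gcongr with i his
  · intro i _; exact mgf_nonneg
  · exact hmgf i his

/-- Two-sided deviations of a sum whose summands have centred moment generating functions at most
`exp (V θ²)` near `0`. -/
lemma measure_le_abs_sum_sub_le [IsProbabilityMeasure μ]
    (hlaw : ∀ i, HasLaw (O i) P μ) (hind : iIndepFun O μ) (hg : ∀ i, Measurable (g i))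
    (S : Finset ι) {m V θ₀ a : ℝ} (hm : 0 < m) (hcard : (S.card : ℝ) ≤ m) (hV : 0 < V)
    (ha : 0 ≤ a) (haθ : a / (2 * m * V) ≤ θ₀)
    (hmgf : ∀ i ∈ S, ∀ θ, |θ| ≤ θ₀ → Integrable (fun x => Real.exp (θ * g i x)) P ∧
      ∫ x, Real.exp (θ * g i x) ∂P ≤ Real.exp (θ * ∫ x, g i x ∂P + V * θ ^ 2)) :
    μ {ω | a ≤ |∑ i ∈ S, (g i (O i ω) - ∫ x, g i x ∂P)|} ≤
      ENNReal.ofReal (2 * Real.exp (-a ^ 2 / (4 * m * V))) := by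
  set θ := a / (2 * m * V) with hθ
  have hθ0 : 0 ≤ θ := by positivity
  set e : ι → ℝ := fun i => ∫ x, g i x ∂P with he
  have hfin : -θ * a + S.card * (V * θ ^ 2) ≤ -a ^ 2 / (4 * m * V) := by
    calc _ ≤ -θ * a + m * (V * θ ^ 2) := by gcongr
      _ = _ := by rw [hθ]; field_simp; ring
  have hup := measure_le_sum_le_exp hlaw hind hg S hθ0 (c := fun i => θ * e i + V * θ ^ 2)
    (fun i hi => (hmgf i hi θ (by rwa [abs_of_nonneg hθ0])).1)
    (fun i hi => (hmgf i hi θ (by rwa [abs_of_nonneg hθ0])).2) (a + ∑ i ∈ S, e i)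
  have hdn := measure_le_sum_le_exp hlaw hind (g := fun i x => -g i x) (fun i => (hg i).neg) S hθ0
    (c := fun i => -θ * e i + V * θ ^ 2)
    (fun i hi => by
      simpa using (hmgf i hi (-θ) (by rwa [abs_neg, abs_of_nonneg hθ0])).1)
    (fun i hi => by
      simpa using (hmgf i hi (-θ) (by rwa [abs_neg, abs_of_nonneg hθ0])).2) (a - ∑ i ∈ S, e i)
  have hsub : {ω | a ≤ |∑ i ∈ S, (g i (O i ω) - e i)|} ⊆
      {ω | a + ∑ i ∈ S, e i ≤ ∑ i ∈ S, g i (O i ω)} ∪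
        {ω | a - ∑ i ∈ S, e i ≤ ∑ i ∈ S, -g i (O i ω)} := fun ω hω => by
    simp only [Set.mem_ofPred_eq, Finset.sum_sub_distrib, Set.mem_union,
      Finset.sum_neg_distrib] at hω ⊢
    rcases le_abs.1 hω with h | h
    · left; linarith
    · right; linarith
  refine (measure_mono hsub).trans ((measure_union_le _ _).trans ?_)
  rw [two_mul, ENNReal.ofReal_add (Real.exp_nonneg _) (Real.exp_nonneg _)]
  refine add_le_add (hup.trans ?_) (hdn.trans ?_) <;>
  · refine ENNReal.ofReal_le_ofReal (Real.exp_le_exp.2 (le_trans (le_of_eq ?_) hfin))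
    simp only [Finset.sum_add_distrib, Finset.sum_const, nsmul_eq_mul, ← Finset.mul_sum]
    ring

lemma integral_exp_mul_le_of_exp_abs [IsProbabilityMeasure P] {f : E → ℝ} (hf : Measurable f)
    {b : ℝ} (hb : 0 < b) (hi : Integrable (fun x => Real.exp (|f x| / b)) P)
    (h3 : ∫ x, Real.exp (|f x| / b) ∂P ≤ 3) {θ : ℝ} (hθ : |θ| ≤ 1 / (2 * b)) :
    Integrable (fun x => Real.exp (θ * f x)) P ∧
      ∫ x, Real.exp (θ * f x) ∂P ≤ Real.exp (θ * ∫ x, f x ∂P + 24 * b ^ 2 * θ ^ 2) := by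
  have habs : ∀ x, |θ * f x| ≤ |f x| / (2 * b) := fun x => by
    rw [abs_mul, div_eq_inv_mul]
    exact mul_le_mul_of_nonneg_right (by simpa using hθ) (abs_nonneg _)
  have hhalf : ∀ x, Real.exp (|f x| / (2 * b)) ^ 2 = Real.exp (|f x| / b) := fun x => by
    rw [← Real.exp_nat_mul]; congr 1; field_simp; push_cast; ring
  have hle1 : ∀ x, Real.exp (θ * f x) ≤ Real.exp (|f x| / b) := fun x => by
    refine Real.exp_le_exp.2 ((le_abs_self _).trans ((habs x).trans ?_))
    gcongr; linarith
  have hint : Integrable (fun x => Real.exp (θ * f x)) P :=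
    hi.mono' (by fun_prop) (ae_of_all _ fun x => by
      rw [Real.norm_of_nonneg (Real.exp_nonneg _)]; exact hle1 x)
  have hfi : Integrable f P := by
    refine (hi.const_mul b).mono' (by fun_prop) (ae_of_all _ fun x => ?_)
    have := Real.add_one_le_exp (|f x| / b)
    rw [Real.norm_eq_abs, ← div_le_iff₀' hb]
    linarith
  have hsq : ∀ x, f x ^ 2 ≤ 8 * b ^ 2 * Real.exp (|f x| / (2 * b)) := fun x => by
    have h0 : 0 ≤ |f x| / (2 * b) := by positivity
    have := Real.quadratic_le_exp_of_nonneg h0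
    have h2 : f x ^ 2 = 4 * b ^ 2 * (|f x| / (2 * b)) ^ 2 := by
      rw [div_pow, sq_abs]; field_simp; norm_num
    rw [h2]
    have hb2 : 0 < b ^ 2 := by positivity
    nlinarith
  have hpt : ∀ x, Real.exp (θ * f x) ≤ 1 + θ * f x + 8 * b ^ 2 * θ ^ 2 * Real.exp (|f x| / b) :=
    fun x => by
    refine (exp_le_one_add_add_sq_mul_exp_abs _).trans ?_
    gcongr 1 + θ * f x + ?_
    calc (θ * f x) ^ 2 * Real.exp |θ * f x|
        ≤ θ ^ 2 * (8 * b ^ 2 * Real.exp (|f x| / (2 * b))) * Real.exp (|f x| / (2 * b)) := by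
          rw [mul_pow]
          gcongr
          · exact hsq x
          · exact habs x
      _ = 8 * b ^ 2 * θ ^ 2 * Real.exp (|f x| / (2 * b)) ^ 2 := by ring
      _ = _ := by rw [hhalf]
  refine ⟨hint, ?_⟩
  have hi1 : Integrable (fun x => 1 + θ * f x) P := (integrable_const _).add (hfi.const_mul θ)
  calc _ ≤ ∫ x, (1 + θ * f x + 8 * b ^ 2 * θ ^ 2 * Real.exp (|f x| / b)) ∂P :=
        integral_mono hint (hi1.add (hi.const_mul _)) hpt
    _ = 1 + θ * ∫ x, f x ∂P + 8 * b ^ 2 * θ ^ 2 * ∫ x, Real.exp (|f x| / b) ∂P := by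
        rw [integral_add hi1 (hi.const_mul _),
          integral_add (integrable_const _) (hfi.const_mul θ), integral_const_mul,
          integral_const_mul]
        simp
    _ ≤ (θ * ∫ x, f x ∂P + 24 * b ^ 2 * θ ^ 2) + 1 := by
        have : 0 ≤ 8 * b ^ 2 * θ ^ 2 := by positivity
        nlinarith
    _ ≤ _ := Real.add_one_le_exp _

lemma integral_exp_mul_le_of_exp_sq [IsProbabilityMeasure P] {f : E → ℝ} (hf : Measurable f)
    {b : ℝ} (hb : 0 < b) (hi : Integrable (fun x => Real.exp (f x ^ 2 / b)) P)
    (h3 : ∫ x, Real.exp (f x ^ 2 / b) ∂P ≤ 3) (θ : ℝ) :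
    Integrable (fun x => Real.exp (θ * f x)) P ∧
      ∫ x, Real.exp (θ * f x) ∂P ≤ Real.exp (θ * ∫ x, f x ∂P + 10 * b * θ ^ 2) := by
  have hle : ∀ x, |θ * f x| ≤ θ ^ 2 * b / 2 + f x ^ 2 / (2 * b) := fun x => by
    have h1 : 0 ≤ (|θ| * b - |f x|) ^ 2 / (2 * b) := by positivity
    have h2 : (|θ| * b - |f x|) ^ 2 / (2 * b) =
        θ ^ 2 * b / 2 + f x ^ 2 / (2 * b) - |θ| * |f x| := by
      rw [sub_sq, mul_pow, sq_abs, sq_abs]; field_simp; ring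
    rw [abs_mul]; linarith
  have hle4 : ∀ x, θ * f x ≤ θ ^ 2 * b / 4 + f x ^ 2 / b := fun x => by
    have h1 : 0 ≤ (θ * b / 2 - f x) ^ 2 / b := by positivity
    have h2 : (θ * b / 2 - f x) ^ 2 / b = θ ^ 2 * b / 4 + f x ^ 2 / b - θ * f x := by
      field_simp; ring
    linarith
  have hle1 : ∀ x, Real.exp (θ * f x) ≤ Real.exp (θ ^ 2 * b / 4) * Real.exp (f x ^ 2 / b) :=
    fun x => by rw [← Real.exp_add]; exact Real.exp_le_exp.2 (hle4 x)
  have hint : Integrable (fun x => Real.exp (θ * f x)) P :=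
    (hi.const_mul _).mono' (by fun_prop) (ae_of_all _ fun x => by
      rw [Real.norm_of_nonneg (Real.exp_nonneg _)]; exact hle1 x)
  have habs : ∀ x, |f x| ≤ √b * Real.exp (f x ^ 2 / b) := fun x => by
    have hsb : 0 < √b := Real.sqrt_pos.2 hb
    have h1 := Real.add_one_le_exp (f x ^ 2 / b)
    have h2 : f x ^ 2 / b = (|f x| / √b) ^ 2 := by rw [div_pow, sq_abs, Real.sq_sqrt hb.le]
    rw [← div_le_iff₀' hsb]
    nlinarith [sq_nonneg (|f x| / √b - 1)]
  have hfi : Integrable f P := (hi.const_mul (√b)).mono' (by fun_prop) (ae_of_all _ habs)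
  have hmean : |∫ x, f x ∂P| ≤ 3 * √b := by
    calc _ ≤ ∫ x, |f x| ∂P := abs_integral_le_integral_abs
      _ ≤ ∫ x, √b * Real.exp (f x ^ 2 / b) ∂P := integral_mono hfi.abs (hi.const_mul _) habs
      _ ≤ 3 * √b := by
        rw [integral_const_mul]
        nlinarith [Real.sqrt_nonneg b]
  refine ⟨hint, ?_⟩
  rcases le_or_gt (b * θ ^ 2) 1 with hs | hs
  · have hsq : ∀ x, f x ^ 2 ≤ 2 * b * Real.exp (f x ^ 2 / (2 * b)) := fun x => by
      have := Real.add_one_le_exp (f x ^ 2 / (2 * b))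
      rw [← div_le_iff₀' (by positivity)]
      linarith
    have hhalf : ∀ x, Real.exp (f x ^ 2 / (2 * b)) ^ 2 = Real.exp (f x ^ 2 / b) := fun x => by
      rw [← Real.exp_nat_mul]; congr 1; field_simp; push_cast; ring
    have hexp : Real.exp (θ ^ 2 * b / 2) ≤ 5 / 3 := by
      calc Real.exp (θ ^ 2 * b / 2) ≤ Real.exp (1 / 2) := Real.exp_le_exp.2 (by linarith)
        _ ≤ 5 / 3 := by
          have h1 : Real.exp (1 / 2) ^ 2 = Real.exp 1 := by
            rw [← Real.exp_nat_mul]; norm_num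
          have h2 := Real.exp_one_lt_d9
          nlinarith [Real.exp_pos (1 / 2)]
    have hpt : ∀ x, Real.exp (θ * f x) ≤
        1 + θ * f x + 10 / 3 * b * θ ^ 2 * Real.exp (f x ^ 2 / b) := fun x => by
      refine (exp_le_one_add_add_sq_mul_exp_abs _).trans ?_
      gcongr 1 + θ * f x + ?_
      calc (θ * f x) ^ 2 * Real.exp |θ * f x|
          ≤ θ ^ 2 * (2 * b * Real.exp (f x ^ 2 / (2 * b))) *
            (Real.exp (θ ^ 2 * b / 2) * Real.exp (f x ^ 2 / (2 * b))) := by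
            rw [mul_pow, ← Real.exp_add]
            gcongr
            · exact hsq x
            · exact hle x
        _ = 2 * b * θ ^ 2 * Real.exp (f x ^ 2 / (2 * b)) ^ 2 * Real.exp (θ ^ 2 * b / 2) := by ring
        _ ≤ 2 * b * θ ^ 2 * Real.exp (f x ^ 2 / (2 * b)) ^ 2 * (5 / 3) := by gcongr
        _ = _ := by rw [hhalf]; ring
    have hi1 : Integrable (fun x => 1 + θ * f x) P := (integrable_const _).add (hfi.const_mul θ)
    calc _ ≤ ∫ x, (1 + θ * f x + 10 / 3 * b * θ ^ 2 * Real.exp (f x ^ 2 / b)) ∂P :=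
          integral_mono hint (hi1.add (hi.const_mul _)) hpt
      _ = 1 + θ * ∫ x, f x ∂P + 10 / 3 * b * θ ^ 2 * ∫ x, Real.exp (f x ^ 2 / b) ∂P := by
          rw [integral_add hi1 (hi.const_mul _),
            integral_add (integrable_const _) (hfi.const_mul θ), integral_const_mul,
            integral_const_mul]
          simp
      _ ≤ (θ * ∫ x, f x ∂P + 10 * b * θ ^ 2) + 1 := by
          have : 0 ≤ 10 / 3 * b * θ ^ 2 := by positivity
          nlinarith
      _ ≤ _ := Real.add_one_le_exp _
  · -- for large `θ` the linear term is dominated by the quadratic one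
    have h1 : -(3 * (b * θ ^ 2)) ≤ θ * ∫ x, f x ∂P := by
      have h2 : |θ * ∫ x, f x ∂P| ≤ |θ| * (3 * √b) := by rw [abs_mul]; gcongr
      have h3 : |θ| * √b ≤ b * θ ^ 2 := by
        have h4 : (|θ| * √b) ^ 2 = b * θ ^ 2 := by
          rw [mul_pow, sq_abs, Real.sq_sqrt hb.le]; ring
        have h5 : 1 ≤ |θ| * √b := by
          by_contra h6
          have : (|θ| * √b) ^ 2 < 1 := by
            rw [sq_lt_one_iff_abs_lt_one, abs_of_nonneg (by positivity)]; linarith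
          linarith
        rw [← h4]; nlinarith
      have := neg_abs_le (θ * ∫ x, f x ∂P)
      linarith
    calc _ ≤ ∫ x, Real.exp (θ ^ 2 * b / 4) * Real.exp (f x ^ 2 / b) ∂P :=
          integral_mono hint (hi.const_mul _) hle1
      _ ≤ Real.exp (θ ^ 2 * b / 4) * 3 := by rw [integral_const_mul]; gcongr
      _ ≤ Real.exp (θ ^ 2 * b / 4) * Real.exp (2 * (b * θ ^ 2)) := by
          gcongr
          have := Real.add_one_le_exp (2 * (b * θ ^ 2))
          linarith
      _ ≤ _ := by
          rw [← Real.exp_add]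
          exact Real.exp_le_exp.2 (by linarith)

/-- Lower tails of a sum of nonnegative summands are sub-Gaussian with the raw second moment as
variance proxy, because `exp (-y) ≤ 1 - y + y² / 2` for `y ≥ 0`. -/
lemma measure_sum_le_sub_le [IsProbabilityMeasure P] [IsProbabilityMeasure μ]
    (hlaw : ∀ i, HasLaw (O i) P μ) (hind : iIndepFun O μ) (hg : ∀ i, Measurable (g i))
    (S : Finset ι) {m V a : ℝ} (hm : 0 < m) (hcard : (S.card : ℝ) ≤ m) (hV : 0 < V)
    (ha : 0 ≤ a) (hnn : ∀ i ∈ S, ∀ x, 0 ≤ g i x) (hi : ∀ i ∈ S, Integrable (g i) P)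
    (hi2 : ∀ i ∈ S, Integrable (fun x => g i x ^ 2) P)
    (h2 : ∀ i ∈ S, ∫ x, g i x ^ 2 ∂P ≤ V) :
    μ {ω | ∑ i ∈ S, g i (O i ω) ≤ ∑ i ∈ S, ∫ x, g i x ∂P - a} ≤
      ENNReal.ofReal (Real.exp (-a ^ 2 / (2 * m * V))) := by
  set θ := a / (m * V) with hθ
  have hθ0 : 0 ≤ θ := by positivity
  have hexp : ∀ y : ℝ, 0 ≤ y → Real.exp (-y) ≤ 1 - y + y ^ 2 / 2 := fun y hy => by
    have h1 := Real.quadratic_le_exp_of_nonneg hy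
    rw [Real.exp_neg, inv_le_iff_one_le_mul₀ (Real.exp_pos y)]
    have h2 : 0 ≤ 1 - y + y ^ 2 / 2 := by nlinarith [sq_nonneg (y - 1)]
    calc (1 : ℝ) ≤ (1 - y + y ^ 2 / 2) * (1 + y + y ^ 2 / 2) := by nlinarith [sq_nonneg (y ^ 2)]
      _ ≤ _ := by gcongr
  have hint : ∀ i ∈ S, Integrable (fun x => Real.exp (θ * -g i x)) P := fun i his => by
    refine (integrable_const (1 : ℝ)).mono' (by have := hg i; fun_prop) (ae_of_all _ fun x => ?_)
    rw [Real.norm_of_nonneg (Real.exp_nonneg _), Real.exp_le_one_iff]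
    have := mul_nonneg hθ0 (hnn i his x)
    linarith
  have hmgf : ∀ i ∈ S, ∫ x, Real.exp (θ * -g i x) ∂P ≤
      Real.exp (-θ * ∫ x, g i x ∂P + θ ^ 2 * V / 2) := fun i his => by
    have hi1 : Integrable (fun x => 1 - θ * g i x) P :=
      (integrable_const _).sub ((hi i his).const_mul θ)
    calc _ ≤ ∫ x, (1 - θ * g i x + θ ^ 2 / 2 * g i x ^ 2) ∂P := by
          refine integral_mono (hint i his) (hi1.add ((hi2 i his).const_mul _)) fun x => ?_
          have := hexp (θ * g i x) (mul_nonneg hθ0 (hnn i his x))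
          simp only [mul_neg]
          refine this.trans (le_of_eq ?_)
          simp only [mul_pow]; ring
      _ = 1 - θ * ∫ x, g i x ∂P + θ ^ 2 / 2 * ∫ x, g i x ^ 2 ∂P := by
          rw [integral_add hi1 ((hi2 i his).const_mul _),
            integral_sub (integrable_const _) ((hi i his).const_mul θ), integral_const_mul,
            integral_const_mul]
          simp
      _ ≤ (-θ * ∫ x, g i x ∂P + θ ^ 2 * V / 2) + 1 := by
          have := h2 i his
          nlinarith [sq_nonneg θ]
      _ ≤ _ := Real.add_one_le_exp _
  have := measure_le_sum_le_exp hlaw hind (g := fun i x => -g i x) (fun i => (hg i).neg) S hθ0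
    hint hmgf (a - ∑ i ∈ S, ∫ x, g i x ∂P)
  refine le_trans (measure_mono fun ω hω => ?_) (this.trans (ENNReal.ofReal_le_ofReal
    (Real.exp_le_exp.2 ?_)))
  · simp only [Set.mem_ofPred_eq, Finset.sum_neg_distrib] at hω ⊢
    linarith
  · rw [Finset.sum_add_distrib, ← Finset.mul_sum, Finset.sum_const, nsmul_eq_mul]
    calc _ ≤ -θ * a + m * (θ ^ 2 * V / 2) := by
          have : (S.card : ℝ) * (θ ^ 2 * V / 2) ≤ m * (θ ^ 2 * V / 2) := by gcongr
          linarith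
      _ = _ := by rw [hθ]; field_simp; ring

end Concentration

/-! ### The kernel -/

section Kernel

variable {K : ℝ → ℝ}

/-- A nonnegative function with `|K''| ≤ κ` satisfies `K'² ≤ 4 κ K`, so that the first-order term
of a Taylor expansion of `K` is absorbed into `η K` plus a quadratic remainder. -/
lemma KernelAssumption.abs_sub_le (hK : KernelAssumption K) {η : ℝ} (hη : 0 < η) :
    ∃ C > 0, ∀ a b, |K (a + b) - K a| ≤ η * K a + C * b ^ 2 := by
  obtain ⟨κ', hκ'⟩ := hK.bdd_deriv_deriv
  set κ := max κ' 1 with hκdef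
  have hκ1 : 1 ≤ κ := le_max_right _ _
  have hκ : ∀ t, ‖deriv (deriv K) t‖ ≤ κ := fun t => (hκ' t).trans (le_max_left _ _)
  have hlip : ∀ x y, |deriv K y - deriv K x| ≤ κ * |y - x| := fun x y =>
    Convex.norm_image_sub_le_of_norm_deriv_le (s := Set.univ)
      (fun t _ => hK.differentiable_deriv t) (fun t _ => hκ t) convex_univ (Set.mem_univ x)
      (Set.mem_univ y)
  have htaylor : ∀ a b, |K (a + b) - K a - deriv K a * b| ≤ κ * b ^ 2 := fun a b => by
    have h1 := Convex.norm_image_sub_le_of_norm_hasDerivWithin_le (s := Set.uIcc a (a + b))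
      (f := fun y => K y - deriv K a * y) (f' := fun y => deriv K y - deriv K a)
      (C := κ * |b|) (x := a) (y := a + b)
      (fun y _ => by
        have h2 := (hK.differentiable y).hasDerivAt.fun_sub
          ((hasDerivAt_id' y).const_mul (deriv K a))
        simpa using h2.hasDerivWithinAt)
      (fun y hy => by
        refine (hlip a y).trans ?_
        have := Set.abs_sub_left_of_mem_uIcc hy
        rw [add_sub_cancel_left] at this
        exact mul_le_mul_of_nonneg_left this (by linarith))
      (convex_uIcc _ _) Set.left_mem_uIcc Set.right_mem_uIcc
    simp only [Real.norm_eq_abs, add_sub_cancel_left] at h1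
    calc _ = |K (a + b) - deriv K a * (a + b) - (K a - deriv K a * a)| := by congr 1; ring
      _ ≤ κ * |b| * |b| := h1
      _ = κ * b ^ 2 := by rw [mul_assoc, ← sq, sq_abs]
  -- the parabola `K a + K' a x + κ x²` lies above `K (a + x) ≥ 0`
  have hdisc : ∀ a, deriv K a ^ 2 ≤ 4 * κ * K a := fun a => by
    have h1 := discrim_le_zero (a := κ) (b := deriv K a) (c := K a) fun x => by
      have h2 := (abs_le.1 (htaylor a x)).2
      have h3 := hK.nonneg (a + x)
      nlinarith
    unfold discrim at h1
    linarith
  refine ⟨κ / η + κ, by positivity, fun a b => ?_⟩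
  have h1 : |deriv K a * b| ≤ η * K a + κ / η * b ^ 2 := by
    have hKa := hK.nonneg a
    apply abs_le_of_sq_le_sq _ (by positivity)
    have h2 : η * (κ / η) = κ := by field_simp
    calc (deriv K a * b) ^ 2 ≤ 4 * κ * K a * b ^ 2 := by
          rw [mul_pow]; gcongr; exact hdisc a
      _ = 4 * (η * K a) * (κ / η * b ^ 2) := by
          rw [show 4 * (η * K a) * (κ / η * b ^ 2) = 4 * (η * (κ / η)) * K a * b ^ 2 by ring, h2]
      _ ≤ _ := by nlinarith [sq_nonneg (η * K a - κ / η * b ^ 2)]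
  have h2 := htaylor a b
  calc |K (a + b) - K a| = |(K (a + b) - K a - deriv K a * b) + deriv K a * b| := by
        congr 1; ring
    _ ≤ _ := (abs_add_le _ _).trans (by linarith)

lemma KernelAssumption.continuous (hK : KernelAssumption K) : Continuous K :=
  hK.differentiable.continuous

lemma KernelAssumption.exists_bound (hK : KernelAssumption K) : ∃ κ ≥ 1, ∀ t, K t ≤ κ := by
  obtain ⟨κ, h⟩ := hK.bdd
  exact ⟨max κ 1, le_max_right _ _, fun t => (h t).trans (le_max_left _ _)⟩

lemma KernelAssumption.kappaLow_le (hK : KernelAssumption K) {s : ℝ} (hs : |s| ≤ 1) :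
    kappaLow K ≤ K s :=
  csInf_le ⟨0, by rintro _ ⟨t, -, rfl⟩; exact hK.nonneg t⟩ ⟨s, abs_le.1 hs, rfl⟩

lemma KernelAssumption.kappaLow_le_half (hK : KernelAssumption K) : kappaLow K ≤ 1 / 2 := by
  have h1 : ∫ _ in Set.Icc (-1 : ℝ) 1, kappaLow K ≤ ∫ s in Set.Icc (-1 : ℝ) 1, K s :=
    setIntegral_mono_on (integrableOn_const (by simp)) hK.integrable.integrableOn
      measurableSet_Icc fun s hs => hK.kappaLow_le (abs_le.2 hs)
  have h2 : ∫ s in Set.Icc (-1 : ℝ) 1, K s ≤ 1 := by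
    rw [← hK.integral_eq_one]
    exact setIntegral_le_integral hK.integrable (ae_of_all _ hK.nonneg)
  simp at h1
  linarith

lemma KernelAssumption.kappa_nonneg (hK : KernelAssumption K) (a : ℕ) : 0 ≤ kappa K a :=
  integral_nonneg fun t => mul_nonneg (by positivity) (hK.nonneg t)

lemma measurable_scaledKernel (hK : KernelAssumption K) (h : ℝ) :
    Measurable (scaledKernel K h) := by
  have := hK.continuous
  unfold scaledKernel
  exact Continuous.measurable (by fun_prop)

lemma scaledKernel_nonneg (hK : KernelAssumption K) {h : ℝ} (hh : 0 < h) (u : ℝ) :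
    0 ≤ scaledKernel K h u := mul_nonneg (by positivity) (hK.nonneg _)

lemma integrable_scaledKernel (hK : KernelAssumption K) {h : ℝ} (hh : 0 < h) :
    Integrable (scaledKernel K h) := (hK.integrable.comp_div hh.ne').const_mul _

lemma integral_scaledKernel (hK : KernelAssumption K) {h : ℝ} (hh : 0 < h) :
    ∫ u, scaledKernel K h u = 1 := by
  unfold scaledKernel
  rw [integral_const_mul, Measure.integral_comp_div, hK.integral_eq_one, abs_of_pos hh]
  simp [hh.ne']

lemma abs_mul_scaledKernel {h : ℝ} (hh : 0 < h) (u : ℝ) :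
    |u| * scaledKernel K h u = |u / h| ^ 1 * K (u / h) := by
  unfold scaledKernel
  rw [pow_one, abs_div, abs_of_pos hh]
  field_simp

lemma integrable_abs_mul_scaledKernel (hK : KernelAssumption K) {h : ℝ} (hh : 0 < h) :
    Integrable fun u => |u| * scaledKernel K h u := by
  simp only [abs_mul_scaledKernel hh]
  exact hK.moment_one.comp_div hh.ne'

lemma integral_abs_mul_scaledKernel {h : ℝ} (hh : 0 < h) :
    ∫ u, |u| * scaledKernel K h u = h * kappa K 1 := by
  simp only [abs_mul_scaledKernel hh]
  rw [Measure.integral_comp_div (fun u => |u| ^ 1 * K u), abs_of_pos hh]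
  rfl

end Kernel

/-! ### The smoothed hinge loss -/

section SmoothHinge

variable {K : ℝ → ℝ} {h : ℝ}

lemma smoothHinge_eq (hh : 0 < h) (u : ℝ) :
    smoothHinge K h u = ∫ s, hinge (u + h * s) * K s := by
  have h1 := Measure.integral_comp_mul_left (fun y => hinge (u + y) * K (y / h)) h
  have h2 := integral_add_left_eq_self (μ := (volume : Measure ℝ))
    (fun t => hinge t * K ((t - u) / h)) u
  simp only [add_sub_cancel_left] at h2
  rw [h2] at h1
  simp only [smul_eq_mul, abs_of_pos (inv_pos.2 hh)] at h1
  unfold smoothHinge scaledKernel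
  calc _ = ∫ t, h⁻¹ * (hinge t * K ((t - u) / h)) := by congr 1; ext t; ring
    _ = _ := by
      rw [integral_const_mul, ← h1]
      congr 1; ext s
      rw [mul_div_cancel_left₀ _ hh.ne']

lemma integrable_hinge_mul (hK : KernelAssumption K) (u : ℝ) :
    Integrable fun s => hinge (u + h * s) * K s := by
  have hKc := hK.continuous
  have hm1 := hK.moment_one
  simp only [pow_one] at hm1
  refine ((hK.integrable.const_mul (1 + |u|)).add (hm1.const_mul |h|)).mono' ?_
    (ae_of_all _ fun s => ?_)
  · unfold hinge
    exact Continuous.aestronglyMeasurable (by fun_prop)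
  · have h1 : |hinge (u + h * s)| ≤ 1 + |u| + |h| * |s| := by
      unfold hinge
      rw [abs_of_nonneg (le_max_right _ _), max_le_iff, ← abs_mul]
      constructor
      · linarith [neg_abs_le u, neg_abs_le (h * s)]
      · positivity
    rw [norm_mul, Real.norm_eq_abs, Real.norm_of_nonneg (hK.nonneg s), Pi.add_apply]
    nlinarith [hK.nonneg s]

/-- The derivative `- ∫ 1{u + h s < 1} K(s) ds` of the smoothed hinge loss. -/
def smoothSlope (K : ℝ → ℝ) (h u : ℝ) : ℝ := -∫ s, Set.indicator {s | u + h * s < 1} K s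

lemma measurableSet_slope (h u : ℝ) : MeasurableSet {s : ℝ | u + h * s < 1} :=
  measurableSet_lt (by fun_prop) measurable_const

lemma integrable_slope (hK : KernelAssumption K) (h u : ℝ) :
    Integrable (Set.indicator {s | u + h * s < 1} K) :=
  hK.integrable.indicator (measurableSet_slope h u)

lemma abs_smoothSlope_le (hK : KernelAssumption K) (u : ℝ) : |smoothSlope K h u| ≤ 1 := by
  have h0 : 0 ≤ ∫ s, Set.indicator {s | u + h * s < 1} K s :=
    integral_nonneg fun s => Set.indicator_nonneg (fun s _ => hK.nonneg s) s
  unfold smoothSlope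
  rw [abs_neg, abs_of_nonneg h0]
  refine le_of_le_of_eq ?_ hK.integral_eq_one
  exact integral_mono (integrable_slope hK h u) hK.integrable
    (Set.indicator_le_self' fun s _ => hK.nonneg s)

lemma measurable_smoothSlope (hK : KernelAssumption K) : Measurable (smoothSlope K h) := by
  refine Monotone.measurable fun u v huv => neg_le_neg ?_
  refine integral_mono (integrable_slope hK h v) (integrable_slope hK h u) fun s => ?_
  refine Set.indicator_le_indicator_of_subset (fun s hs => ?_) hK.nonneg s
  simp only [Set.mem_ofPred_eq] at hs ⊢
  linarith

/-- The Bregman divergence of the hinge loss. -/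
def hingeBregman (a δ : ℝ) : ℝ := hinge (a + δ) - hinge a + Set.indicator (Set.Iio 1) (fun _ => δ) a

lemma hingeBregman_nonneg (a δ : ℝ) : 0 ≤ hingeBregman a δ := by
  unfold hingeBregman hinge
  by_cases ha : a < 1
  · rw [Set.indicator_of_mem (by simpa using ha), max_eq_left (by linarith : (0 : ℝ) ≤ 1 - a)]
    linarith [le_max_left (1 - (a + δ)) 0]
  · rw [Set.indicator_of_notMem (by simpa using ha), max_eq_right (by linarith : 1 - a ≤ 0)]
    linarith [le_max_right (1 - (a + δ)) 0]

lemma smoothHinge_bregman (hK : KernelAssumption K) (hh : 0 < h) (u δ : ℝ) :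
    (Integrable fun s => hingeBregman (u + h * s) δ * K s) ∧
    smoothHinge K h (u + δ) - smoothHinge K h u - smoothSlope K h u * δ =
      ∫ s, hingeBregman (u + h * s) δ * K s := by
  have h1 := integrable_hinge_mul hK (h := h) (u + δ)
  have h2 := integrable_hinge_mul hK (h := h) u
  have h3 := (integrable_slope hK h u).mul_const δ
  have heq : ∀ s, hingeBregman (u + h * s) δ * K s = hinge (u + δ + h * s) * K s -
      hinge (u + h * s) * K s + Set.indicator {s | u + h * s < 1} K s * δ := fun s => by
    unfold hingeBregman
    rw [show u + δ + h * s = u + h * s + δ by ring]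
    by_cases hs : u + h * s < 1
    · rw [Set.indicator_of_mem (by simpa using hs), Set.indicator_of_mem (by simpa using hs)]
      ring
    · rw [Set.indicator_of_notMem (by simpa using hs),
        Set.indicator_of_notMem (by simpa using hs)]
      ring
  simp only [heq]
  refine ⟨(h1.sub h2).add h3, ?_⟩
  rw [integral_add (f := fun s => hinge (u + δ + h * s) * K s - hinge (u + h * s) * K s)
    (h1.sub h2) h3, integral_sub h1 h2, integral_mul_const, smoothHinge_eq hh,
    smoothHinge_eq hh]
  unfold smoothSlope
  ring

lemma smoothHinge_tangent_le (hK : KernelAssumption K) (hh : 0 < h) (u δ : ℝ) :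
    smoothHinge K h u + smoothSlope K h u * δ ≤ smoothHinge K h (u + δ) := by
  have h1 := (smoothHinge_bregman hK hh u δ).2
  have h2 : 0 ≤ ∫ s, hingeBregman (u + h * s) δ * K s :=
    integral_nonneg fun s => mul_nonneg (hingeBregman_nonneg _ _) (hK.nonneg s)
  linarith

lemma convexOn_smoothHinge (hK : KernelAssumption K) (hh : 0 < h) :
    ConvexOn ℝ Set.univ (smoothHinge K h) := by
  refine ⟨convex_univ, fun x _ y _ a b ha hb hab => ?_⟩
  simp only [smul_eq_mul]
  have h1 := smoothHinge_tangent_le hK hh (a * x + b * y) (x - (a * x + b * y))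
  have h2 := smoothHinge_tangent_le hK hh (a * x + b * y) (y - (a * x + b * y))
  rw [add_sub_cancel] at h1 h2
  have h3 := mul_le_mul_of_nonneg_left h1 ha
  have h4 := mul_le_mul_of_nonneg_left h2 hb
  have h5 : a = 1 - b := by linarith
  have h6 : a * (smoothSlope K h (a * x + b * y) * (x - (a * x + b * y))) +
      b * (smoothSlope K h (a * x + b * y) * (y - (a * x + b * y))) = 0 := by
    rw [h5]; ring
  have h7 : a * smoothHinge K h (a * x + b * y) + b * smoothHinge K h (a * x + b * y) =
      smoothHinge K h (a * x + b * y) := by rw [← add_mul, hab, one_mul]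
  nlinarith

lemma continuous_smoothHinge (hK : KernelAssumption K) (hh : 0 < h) :
    Continuous (smoothHinge K h) :=
  continuousOn_univ.1 ((convexOn_smoothHinge hK hh).continuousOn isOpen_univ)

/-- The smoothed hinge loss is strongly convex near its kink: where `|1 - u| ≤ 7h/8`, a step of
size at most `h/8` stays in the range of arguments at which `K ≥ κ_l`. -/
lemma smoothHinge_strong (hK : KernelAssumption K) (hh : 0 < h) {u δ : ℝ}
    (hu : |1 - u| ≤ 7 / 8 * h) (hδ : |δ| ≤ h / 8) :
    smoothHinge K h u + smoothSlope K h u * δ + kappaLow K / (2 * h) * δ ^ 2 ≤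
      smoothHinge K h (u + δ) := by
  obtain ⟨hint, heq⟩ := smoothHinge_bregman hK hh u δ
  set s₀ := (1 - u) / h with hs₀
  set s₁ := (1 - u - δ) / h with hs₁
  have hκ : 0 < kappaLow K := hK.low_pos
  have hs0 : h * s₀ = 1 - u := by rw [hs₀]; field_simp
  have hs1 : h * s₁ = 1 - u - δ := by rw [hs₁]; field_simp
  -- between `s₁` and `s₀` the divergence is the distance to the new kink
  have hval : ∀ s ∈ Set.Ioo (min s₁ s₀) (max s₁ s₀),
      h * |s - s₁| ≤ hingeBregman (u + h * s) δ ∧ |s| ≤ 1 := by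
    rintro s ⟨hlo, hhi⟩
    constructor
    · unfold hingeBregman hinge
      have habs : h * |s - s₁| = |u + h * s - (1 - δ)| := by
        rw [← abs_of_pos hh, ← abs_mul, abs_of_pos hh]; congr 1; linarith
      rw [habs]
      rcases le_total s₁ s₀ with h5 | h5
      · rw [min_eq_left h5] at hlo
        rw [max_eq_right h5] at hhi
        have h6 := mul_lt_mul_of_pos_left hlo hh
        have h7 := mul_lt_mul_of_pos_left hhi hh
        have ha : u + h * s < 1 := by linarith
        rw [Set.indicator_of_mem (by simpa using ha), abs_of_pos (by linarith),
          max_eq_left (by linarith : (0 : ℝ) ≤ 1 - (u + h * s))]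
        linarith [le_max_right (1 - (u + h * s + δ)) 0]
      · rw [min_eq_right h5] at hlo
        rw [max_eq_left h5] at hhi
        have h6 := mul_lt_mul_of_pos_left hlo hh
        have h7 := mul_lt_mul_of_pos_left hhi hh
        have ha : ¬ u + h * s < 1 := by linarith
        rw [Set.indicator_of_notMem (by simpa using ha), abs_of_neg (by linarith),
          max_eq_right (by linarith : 1 - (u + h * s) ≤ 0)]
        linarith [le_max_left (1 - (u + h * s + δ)) 0]
    · have hb0 : |s₀| ≤ 1 := by
        rw [hs₀, abs_div, abs_of_pos hh, div_le_one hh]; linarith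
      have hb1 : |s₁| ≤ 1 := by
        rw [hs₁, abs_div, abs_of_pos hh, div_le_one hh]
        linarith [abs_sub (1 - u) δ]
      rw [abs_le] at hb0 hb1 ⊢
      exact ⟨(le_min hb1.1 hb0.1).trans hlo.le, hhi.le.trans (max_le hb1.2 hb0.2)⟩
  have hmono : ∫ s in Set.Ioo (min s₁ s₀) (max s₁ s₀), h * |s - s₁| * kappaLow K ≤
      ∫ s, hingeBregman (u + h * s) δ * K s := by
    have hc : Continuous fun s => h * |s - s₁| * kappaLow K := by fun_prop
    refine (setIntegral_mono_on (hc.integrableOn_Icc.mono_set Set.Ioo_subset_Icc_self)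
      hint.integrableOn measurableSet_Ioo fun s hs => ?_).trans
      (setIntegral_le_integral hint (ae_of_all _ fun s =>
        mul_nonneg (hingeBregman_nonneg _ _) (hK.nonneg s)))
    obtain ⟨h1, h2⟩ := hval s hs
    exact mul_le_mul h1 (hK.kappaLow_le h2) hκ.le (hingeBregman_nonneg _ _)
  have hcalc : ∫ s in Set.Ioo (min s₁ s₀) (max s₁ s₀), h * |s - s₁| * kappaLow K =
      kappaLow K / (2 * h) * δ ^ 2 := by
    have hd : δ = h * (s₀ - s₁) := by linarith
    rw [← integral_Ioc_eq_integral_Ioo,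
      ← intervalIntegral.integral_of_le (min_le_max : min s₁ s₀ ≤ max s₁ s₀)]
    rcases le_total s₁ s₀ with h5 | h5
    · rw [min_eq_left h5, max_eq_right h5]
      have : ∫ s in s₁..s₀, h * |s - s₁| * kappaLow K =
          ∫ s in s₁..s₀, (h * kappaLow K) * (s - s₁) := by
        refine intervalIntegral.integral_congr fun s hs => ?_
        rw [Set.uIcc_of_le h5] at hs
        simp only [abs_of_nonneg (sub_nonneg.2 hs.1)]
        ring
      rw [this, intervalIntegral.integral_const_mul,
        intervalIntegral.integral_comp_sub_right (fun x => x) s₁, integral_id, hd]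
      field_simp; ring
    · rw [min_eq_right h5, max_eq_left h5]
      have : ∫ s in s₀..s₁, h * |s - s₁| * kappaLow K =
          ∫ s in s₀..s₁, (-(h * kappaLow K)) * (s - s₁) := by
        refine intervalIntegral.integral_congr fun s hs => ?_
        rw [Set.uIcc_of_le h5] at hs
        simp only [abs_of_nonpos (sub_nonpos.2 hs.2)]
        ring
      rw [this, intervalIntegral.integral_const_mul,
        intervalIntegral.integral_comp_sub_right (fun x => x) s₁, integral_id, hd]
      field_simp; ring
  linarith

end SmoothHinge

/-! ### Smoothing of the margin density -/

section Affine

variable {k G : ℝ → ℝ}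

/-- A kernel of integral zero tested against a Lipschitz function only sees its first absolute
moment. -/
lemma abs_integral_comp_affine_mul_le (hk : Integrable k) (hk0 : ∫ u, k u = 0)
    (hk1 : Integrable fun u => |u| * |k u|) {c₀ c₁ B : ℝ} (hc₁ : c₁ ≠ 0)
    (hG : ∀ s t, |G s - G t| ≤ B * |s - t|) :
    |∫ t, k (c₀ + c₁ * t) * G t| ≤ B / c₁ ^ 2 * ∫ u, |u| * |k u| := by
  have hB : 0 ≤ B := by simpa using (abs_nonneg _).trans (hG 1 0)
  have hGc : Continuous G := by
    refine (LipschitzWith.of_dist_le_mul (K := ⟨B, hB⟩) fun s t => ?_).continuous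
    rw [Real.dist_eq, Real.dist_eq]
    exact hG s t
  -- affine substitution
  have hsub : ∀ F : ℝ → ℝ, ∫ t, F (c₀ + c₁ * t) = |c₁⁻¹| * ∫ u, F u := fun F => by
    have h1 := Measure.integral_comp_mul_left (fun y => F (c₀ + y)) c₁
    rw [h1, smul_eq_mul, integral_add_left_eq_self (μ := (volume : Measure ℝ)) F c₀]
  have hsubi : ∀ F : ℝ → ℝ, Integrable F → Integrable fun t => F (c₀ + c₁ * t) := fun F hF =>
    Integrable.comp_mul_left' (hF.comp_add_left c₀) hc₁
  set t₀ := -c₀ / c₁ with ht₀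
  have hdist : ∀ t, |t - t₀| = |c₀ + c₁ * t| / |c₁| := fun t => by
    rw [← abs_div, ht₀]; congr 1; field_simp; ring
  have hki := hsubi k hk
  have hk1i := hsubi _ hk1
  have hbound : ∀ t, ‖k (c₀ + c₁ * t) * (G t - G t₀)‖ ≤
      B / |c₁| * (|c₀ + c₁ * t| * |k (c₀ + c₁ * t)|) := fun t => by
    rw [norm_mul, Real.norm_eq_abs, Real.norm_eq_abs]
    calc _ ≤ |k (c₀ + c₁ * t)| * (B * |t - t₀|) := by gcongr; exact hG t t₀
      _ = _ := by rw [hdist]; ring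
  have hdi : Integrable fun t => k (c₀ + c₁ * t) * (G t - G t₀) :=
    (hk1i.const_mul (B / |c₁|)).mono'
      (hki.aestronglyMeasurable.mul (by fun_prop)) (ae_of_all _ hbound)
  have heq : ∫ t, k (c₀ + c₁ * t) * G t = ∫ t, k (c₀ + c₁ * t) * (G t - G t₀) := by
    have h1 : ∫ t, k (c₀ + c₁ * t) * G t₀ = 0 := by
      rw [integral_mul_const, hsub k, hk0]; simp
    rw [← add_zero (∫ t, k (c₀ + c₁ * t) * (G t - G t₀)), ← h1,
      ← integral_add hdi (hki.mul_const _)]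
    congr 1; ext t; ring
  rw [heq]
  refine (norm_integral_le_integral_norm _).trans ((integral_mono_of_nonneg
    (ae_of_all _ fun _ => norm_nonneg _) (hk1i.const_mul (B / |c₁|))
    (ae_of_all _ hbound)).trans (le_of_eq ?_))
  rw [integral_const_mul, hsub fun u => |u| * |k u|, abs_inv, ← sq_abs c₁]
  field_simp

lemma abs_sub_le_of_weighted_bounds {φ : ℝ → ℝ} {Cf v₁ w : ℝ} (hφ : Differentiable ℝ φ)
    (hb : ∀ t, |φ t| ≤ Cf ∧ |deriv φ t| ≤ Cf ∧ |t ^ 2 * φ t| ≤ Cf ∧ |t * deriv φ t| ≤ Cf ∧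
      |t ^ 2 * deriv φ t| ≤ Cf) (s t : ℝ) :
    |(w + v₁ * s) ^ 2 * φ s - (w + v₁ * t) ^ 2 * φ t| ≤
      5 * Cf * (v₁ ^ 2 + w ^ 2) * |s - t| := by
  have hder : ∀ x, HasDerivAt (fun x => (w + v₁ * x) ^ 2 * φ x)
      (2 * (w + v₁ * x) * v₁ * φ x + (w + v₁ * x) ^ 2 * deriv φ x) x := fun x => by
    have h1 : HasDerivAt (fun x => w + v₁ * x) v₁ x := by
      simpa using ((hasDerivAt_id' x).const_mul v₁).const_add w
    refine ((h1.fun_pow 2).mul (hφ x).hasDerivAt).congr_deriv ?_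
    push_cast; ring
  refine Convex.norm_image_sub_le_of_norm_hasDerivWithin_le (s := Set.univ)
    (fun x _ => (hder x).hasDerivWithinAt) (fun x _ => ?_) convex_univ (Set.mem_univ t)
    (Set.mem_univ s)
  obtain ⟨h0, h1, h2, h3, h4⟩ := hb x
  have hxφ : |x * φ x| ≤ Cf := by
    have h5 : |x| ≤ (1 + x ^ 2) / 2 := by
      rw [← sq_abs x]; nlinarith [sq_nonneg (|x| - 1)]
    rw [abs_mul] at h2 ⊢
    rw [abs_of_nonneg (sq_nonneg x)] at h2
    nlinarith [abs_nonneg (φ x)]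
  rw [Real.norm_eq_abs]
  have e : 2 * (w + v₁ * x) * v₁ * φ x + (w + v₁ * x) ^ 2 * deriv φ x =
      2 * w * v₁ * φ x + 2 * v₁ ^ 2 * (x * φ x) + w ^ 2 * deriv φ x +
        2 * w * v₁ * (x * deriv φ x) + v₁ ^ 2 * (x ^ 2 * deriv φ x) := by ring
  have hwv : |2 * w * v₁| ≤ v₁ ^ 2 + w ^ 2 := by
    rw [abs_le]; constructor <;> nlinarith [sq_nonneg (w - v₁), sq_nonneg (w + v₁)]
  have hCf : 0 ≤ Cf := (abs_nonneg _).trans h0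
  have m1 : |2 * w * v₁ * φ x| ≤ (v₁ ^ 2 + w ^ 2) * Cf := by rw [abs_mul]; gcongr
  have m2 : |2 * v₁ ^ 2 * (x * φ x)| ≤ 2 * v₁ ^ 2 * Cf := by
    rw [abs_mul, abs_of_nonneg (by positivity : (0 : ℝ) ≤ 2 * v₁ ^ 2)]; gcongr
  have m3 : |w ^ 2 * deriv φ x| ≤ w ^ 2 * Cf := by
    rw [abs_mul, abs_of_nonneg (sq_nonneg w)]; gcongr
  have m4 : |2 * w * v₁ * (x * deriv φ x)| ≤ (v₁ ^ 2 + w ^ 2) * Cf := by rw [abs_mul]; gcongr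
  have m5 : |v₁ ^ 2 * (x ^ 2 * deriv φ x)| ≤ v₁ ^ 2 * Cf := by
    rw [abs_mul, abs_of_nonneg (sq_nonneg v₁)]; gcongr
  rw [e]
  refine (abs_add_le _ _).trans ?_
  refine (add_le_add_left ((abs_add_le _ _).trans (add_le_add_left ((abs_add_le _ _).trans
    (add_le_add_left (abs_add_le _ _) _)) _)) _).trans ?_
  nlinarith [mul_nonneg hCf (sq_nonneg v₁), mul_nonneg hCf (sq_nonneg w)]

end Affine

section Density

variable {q : ℕ}

/-- Splitting off the first feature. -/
def consEquiv (q : ℕ) : ((Fin q → ℝ) × ℝ) ≃ᵐ (Fin (q + 1) → ℝ) :=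
  MeasurableEquiv.prodComm.trans (MeasurableEquiv.piFinSuccAbove (fun _ => ℝ) 0).symm

lemma consEquiv_apply (z : (Fin q → ℝ) × ℝ) : consEquiv q z = Fin.cons z.2 z.1 := by
  simp only [consEquiv, MeasurableEquiv.trans_apply, MeasurableEquiv.piFinSuccAbove_symm_apply,
    Fin.insertNthEquiv, Equiv.coe_fn_mk, Fin.insertNth_zero']
  rfl

lemma measurePreserving_consEquiv : MeasurePreserving (consEquiv q) :=
  ((volume_preserving_piFinSuccAbove (fun _ : Fin (q + 1) => ℝ) 0).symm _).comp
    Measure.measurePreserving_swap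

lemma aug_cons_dot (t : ℝ) (y : Fin q → ℝ) (v : Fin (q + 1 + 1) → ℝ) :
    aug (Fin.cons t y : Fin (q + 1) → ℝ) ⬝ᵥ v =
      (v 0 + ∑ j : Fin q, y j * v j.succ.succ) + v (Fin.succ 0) * t := by
  simp only [dotProduct, aug, Fin.sum_univ_succ, Fin.cons_zero, Fin.cons_succ]
  ring

/-- Conditioning on all features but the first, a kernel of integral zero in the margin is
integrated against the density of the first feature times a quadratic polynomial, which is
Lipschitz by the decay of the density and of its derivative. -/
lemma abs_integral_density_mul_le {f : (Fin (q + 1) → ℝ) → ℝ} {Cf : ℝ} (hf0 : ∀ x, 0 ≤ f x)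
    (hfi : Integrable f)
    (hae : ∀ᵐ x, 0 < restDensity f x →
      Differentiable ℝ (condDensity f x) ∧
      (∀ t, |condDensity f x t| ≤ Cf ∧ |deriv (condDensity f x) t| ≤ Cf ∧
        |t ^ 2 * condDensity f x t| ≤ Cf ∧ |t * deriv (condDensity f x) t| ≤ Cf ∧
        |t ^ 2 * deriv (condDensity f x) t| ≤ Cf) ∧
      Integrable fun t => |t| * condDensity f x t)
    {k : ℝ → ℝ} (hk : Integrable k) (hk0 : ∫ u, k u = 0)
    (hk1 : Integrable fun u => |u| * |k u|) {y : ℝ} (hy : y ^ 2 = 1)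
    {β v : Fin (q + 1 + 1) → ℝ} {c : ℝ} (hc : 0 < c) (hβ : c ≤ |β (Fin.succ 0)|)
    (hΨ : Integrable fun x => f x * (k (1 - y * (aug x ⬝ᵥ β)) * (aug x ⬝ᵥ v) ^ 2))
    (hB : Integrable fun x => f x *
      (v (Fin.succ 0) ^ 2 + (aug x ⬝ᵥ v - v (Fin.succ 0) * x 0) ^ 2)) :
    |∫ x, f x * (k (1 - y * (aug x ⬝ᵥ β)) * (aug x ⬝ᵥ v) ^ 2)| ≤
      (5 * Cf / c ^ 2 * ∫ u, |u| * |k u|) *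
        ∫ x, f x * (v (Fin.succ 0) ^ 2 + (aug x ⬝ᵥ v - v (Fin.succ 0) * x 0) ^ 2) := by
  set m := ∫ u, |u| * |k u| with hm
  have hm0 : 0 ≤ m := integral_nonneg fun u => by positivity
  set A := 5 * Cf / c ^ 2 * m with hA
  have hmp := measurePreserving_consEquiv (q := q)
  have hem := (consEquiv q).measurableEmbedding
  rw [← integral_const_mul, ← hmp.integral_comp hem, ← hmp.integral_comp hem]
  have hfi' := (hmp.integrable_comp_emb hem).2 hfi
  have hΨ' := (hmp.integrable_comp_emb hem).2 hΨ
  have hB' := (hmp.integrable_comp_emb hem).2 (hB.const_mul A)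
  have hae' := hmp.quasiMeasurePreserving.ae hae
  simp only [Function.comp_def, consEquiv_apply] at hfi' hΨ' hB' hae' ⊢
  rw [Measure.volume_eq_prod] at hfi' hΨ' hB' hae' ⊢
  rw [integral_prod _ hΨ', integral_prod _ hB']
  refine (norm_integral_le_integral_norm _).trans (integral_mono_ae hΨ'.integral_prod_left.norm
    hB'.integral_prod_left ?_)
  filter_upwards [Measure.ae_ae_of_ae_prod hae', hfi'.prod_right_ae] with z hz hfz
  obtain ⟨t₁, ht₁⟩ := hz.exists
  simp only [aug_cons_dot, Fin.cons_zero]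
  set F : ℝ → ℝ := fun t => f (Fin.cons t z) with hF
  have hF0 : ∀ t, 0 ≤ F t := fun t => hf0 _
  set a := β 0 + ∑ j : Fin q, z j * β j.succ.succ with ha
  set b := β (Fin.succ 0) with hb
  set w := v 0 + ∑ j : Fin q, z j * v j.succ.succ with hw
  set v₁ := v (Fin.succ 0) with hv₁
  simp only [add_sub_cancel_right]
  change ‖∫ t, F t * _‖ ≤ ∫ t, A * (F t * _)
  have hrest : restDensity f (Fin.cons t₁ z) = ∫ t, F t := by
    simp only [restDensity, Fin.update_cons_zero, hF]
  have hR0 : 0 ≤ ∫ t, F t := integral_nonneg hF0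
  -- where the rest density vanishes, the conditional density is not available, but both sides vanish
  rcases hR0.eq_or_lt with hR | hR
  · have hF0ae : F =ᵐ[volume] 0 := (integral_eq_zero_iff_of_nonneg hF0 hfz).1 hR.symm
    have h1 : ∫ t, F t * (k (1 - y * (a + b * t)) * (w + v₁ * t) ^ 2) = 0 := by
      rw [integral_eq_zero_of_ae]
      filter_upwards [hF0ae] with t ht
      simp [ht]
    have h2 : ∫ t, A * (F t * (v₁ ^ 2 + w ^ 2)) = 0 := by
      rw [integral_eq_zero_of_ae]
      filter_upwards [hF0ae] with t ht
      simp [ht]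
    rw [h1, h2, norm_zero]
  · obtain ⟨hd, hbd, -⟩ := ht₁ (by rwa [hrest])
    set R := ∫ t, F t with hRdef
    have hcd : condDensity f (Fin.cons t₁ z) = fun t => F t / R := by
      funext t
      simp only [condDensity, hrest, Fin.update_cons_zero, hF]
    rw [hcd] at hd hbd
    have hb0 : 0 < b ^ 2 := by
      rw [← sq_abs]
      exact pow_pos (hc.trans_le hβ) 2
    have hcb : c ^ 2 ≤ b ^ 2 := by rw [← sq_abs b]; gcongr
    have hCf : 0 ≤ Cf := (abs_nonneg _).trans (hbd 0).1
    have key := abs_integral_comp_affine_mul_le (G := fun t => (w + v₁ * t) ^ 2 * (F t / R))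
      hk hk0 hk1 (c₀ := 1 - y * a) (c₁ := -(y * b)) (B := 5 * Cf * (v₁ ^ 2 + w ^ 2))
      (by
        intro h0
        have : (y * b) ^ 2 = 0 := by rw [neg_eq_zero.1 h0]; simp
        rw [mul_pow, hy] at this
        linarith)
      (abs_sub_le_of_weighted_bounds hd hbd)
    have e1 : ∫ t, F t * (k (1 - y * (a + b * t)) * (w + v₁ * t) ^ 2) =
        R * ∫ t, k (1 - y * a + -(y * b) * t) * ((w + v₁ * t) ^ 2 * (F t / R)) := by
      rw [← integral_const_mul]
      congr 1; ext t
      rw [show 1 - y * a + -(y * b) * t = 1 - y * (a + b * t) by ring]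
      field_simp
    have e2 : ∫ t, A * (F t * (v₁ ^ 2 + w ^ 2)) = R * (A * (v₁ ^ 2 + w ^ 2)) := by
      rw [integral_const_mul, integral_mul_const]; ring
    rw [e1, e2, norm_mul, Real.norm_of_nonneg hR.le, Real.norm_eq_abs]
    refine mul_le_mul_of_nonneg_left (key.trans ?_) hR.le
    rw [neg_sq, mul_pow, hy, one_mul, ← hm, hA]
    calc 5 * Cf * (v₁ ^ 2 + w ^ 2) / b ^ 2 * m
        ≤ 5 * Cf * (v₁ ^ 2 + w ^ 2) / c ^ 2 * m := by gcongr
      _ = _ := by ring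

end Density

section Margin

variable {p : ℕ} {P : Measure (Obs p)} [IsProbabilityMeasure P]

/-- Integrals over one class in terms of its feature density. -/
lemma setIntegral_eq_of_density {y : ℝ} {f : (Fin p → ℝ) → ℝ} (hpos : 0 < P {o | o.2 = y})
    (hf0 : ∀ x, 0 ≤ f x) (hfc : Continuous f)
    (hf : (P.restrict {o | o.2 = y}).map Prod.fst =
      P {o | o.2 = y} • (volume : Measure (Fin p → ℝ)).withDensity
        (fun x => ENNReal.ofReal (f x)))
    {F : (Fin p → ℝ) → ℝ} (hF : Measurable F)
    (hi : Integrable (fun o : Obs p => F o.1) (P.restrict {o | o.2 = y})) :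
    Integrable (fun x => f x * F x) ∧
      ∫ o in {o : Obs p | o.2 = y}, F o.1 ∂P =
        (P {o | o.2 = y}).toReal * ∫ x, f x * F x := by
  have hfm : Measurable fun x => ENNReal.ofReal (f x) := hfc.measurable.ennreal_ofReal
  have h1 : Integrable F ((P.restrict {o : Obs p | o.2 = y}).map Prod.fst) :=
    (integrable_map_measure hF.aestronglyMeasurable measurable_fst.aemeasurable).2 hi
  rw [hf, integrable_smul_measure hpos.ne' (measure_ne_top _ _),
    integrable_withDensity_iff_integrable_smul' hfm (ae_of_all _ fun _ => ENNReal.ofReal_lt_top)]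
    at h1
  simp only [ENNReal.toReal_ofReal (hf0 _), smul_eq_mul] at h1
  refine ⟨h1, ?_⟩
  rw [← integral_map (φ := Prod.fst) (f := F) measurable_fst.aemeasurable hF.aestronglyMeasurable,
    hf, integral_smul_measure, smul_eq_mul, integral_withDensity_eq_integral_toReal_smul hfm
    (ae_of_all _ fun _ => ENNReal.ofReal_lt_top)]
  simp only [ENNReal.toReal_ofReal (hf0 _), smul_eq_mul]

lemma abs_setIntegral_kernel_le [NeZero p] {y Cf c : ℝ} (hD : DensityAssumption P y Cf) (hy : y ^ 2 = 1)
    {k : ℝ → ℝ} (hkm : Measurable k) {κ : ℝ} (hkb : ∀ u, |k u| ≤ κ) (hk : Integrable k)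
    (hk0 : ∫ u, k u = 0) (hk1 : Integrable fun u => |u| * |k u|)
    {β v : Fin (p + 1) → ℝ} (hc : 0 < c) (hβ : c ≤ |β (Fin.succ 0)|)
    (hv : Integrable (fun o : Obs p => (aug o.1 ⬝ᵥ v) ^ 2) P)
    (hw : Integrable (fun o : Obs p => (aug o.1 ⬝ᵥ v - v (Fin.succ 0) * o.1 0) ^ 2) P) :
    |∫ o in {o : Obs p | o.2 = y}, k (1 - margin β o) * (aug o.1 ⬝ᵥ v) ^ 2 ∂P| ≤
      (5 * Cf / c ^ 2 * ∫ u, |u| * |k u|) * ∫ o in {o : Obs p | o.2 = y},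
        (v (Fin.succ 0) ^ 2 + (aug o.1 ⬝ᵥ v - v (Fin.succ 0) * o.1 0) ^ 2) ∂P := by
  obtain ⟨hpos, f, hf0, hf, hfc, -, -, hae⟩ := hD
  have hms : MeasurableSet {o : Obs p | o.2 = y} := measurable_snd (measurableSet_singleton y)
  have haug : ∀ v : Fin (p + 1) → ℝ, Measurable fun x : Fin p → ℝ => aug x ⬝ᵥ v := fun v => by
    have : Continuous fun x : Fin p → ℝ => aug x ⬝ᵥ v := by
      have := continuous_aug (p := p)
      unfold dotProduct
      fun_prop
    exact this.measurable
  have hm1 : Measurable fun x : Fin p → ℝ => k (1 - y * (aug x ⬝ᵥ β)) * (aug x ⬝ᵥ v) ^ 2 :=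
    (hkm.comp (((haug β).const_mul y).const_sub 1)).mul ((haug v).pow_const 2)
  have hm2 : Measurable fun x : Fin p → ℝ =>
      v (Fin.succ 0) ^ 2 + (aug x ⬝ᵥ v - v (Fin.succ 0) * x 0) ^ 2 :=
    ((((haug v).sub ((measurable_pi_apply 0).const_mul _))).pow_const 2).const_add _
  have hi1 : Integrable (fun o : Obs p => k (1 - y * (aug o.1 ⬝ᵥ β)) * (aug o.1 ⬝ᵥ v) ^ 2) P := by
    refine (hv.const_mul κ).mono' (hm1.comp measurable_fst).aestronglyMeasurable
      (ae_of_all _ fun o => ?_)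
    rw [norm_mul, Real.norm_eq_abs, Real.norm_of_nonneg (sq_nonneg _)]
    gcongr
    exact hkb _
  have hi2 : Integrable (fun o : Obs p =>
      v (Fin.succ 0) ^ 2 + (aug o.1 ⬝ᵥ v - v (Fin.succ 0) * o.1 0) ^ 2) P :=
    (integrable_const _).add hw
  have hone : Integrable (fun _ : Obs p => (1 : ℝ)) (P.restrict {o | o.2 = y}) :=
    integrable_const _
  obtain ⟨a1, -⟩ := setIntegral_eq_of_density hpos hf0 hfc hf (F := fun _ => 1)
    measurable_const hone
  obtain ⟨a2, b2⟩ := setIntegral_eq_of_density hpos hf0 hfc hf hm1 hi1.integrableOn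
  obtain ⟨a3, b3⟩ := setIntegral_eq_of_density hpos hf0 hfc hf hm2 hi2.integrableOn
  have hcongr : ∫ o in {o : Obs p | o.2 = y}, k (1 - margin β o) * (aug o.1 ⬝ᵥ v) ^ 2 ∂P =
      ∫ o in {o : Obs p | o.2 = y}, k (1 - y * (aug o.1 ⬝ᵥ β)) * (aug o.1 ⬝ᵥ v) ^ 2 ∂P := by
    refine setIntegral_congr_fun hms fun o ho => ?_
    have ho' : o.2 = y := ho
    simp only [margin, ho']
  rw [hcongr, b2, b3, abs_mul, abs_of_nonneg ENNReal.toReal_nonneg, mul_left_comm]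
  refine mul_le_mul_of_nonneg_left ?_ ENNReal.toReal_nonneg
  simp only [mul_one] at a1
  obtain ⟨q, rfl⟩ : ∃ q, p = q + 1 := ⟨p - 1, (Nat.succ_pred (NeZero.ne p)).symm⟩
  exact abs_integral_density_mul_le hf0 a1 hae hk hk0 hk1 hy hc hβ a2 a3

end Margin

/-! ### The error of the smoothed step -/

section Step

variable {K : ℝ → ℝ} {h : ℝ}

/-- The difference between the distribution function of the scaled kernel and the unit step. -/
def stepError (K : ℝ → ℝ) (h u : ℝ) : ℝ :=
  (∫ s, Set.indicator {s | h * s < u} K s) - Set.indicator (Set.Ioi 0) (fun _ => 1) u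

lemma smoothSlope_eq (u : ℝ) :
    smoothSlope K h u = -(stepError K h (1 - u) + Set.indicator (Set.Iio 1) (fun _ => 1) u) := by
  unfold smoothSlope stepError
  have h1 : {s : ℝ | u + h * s < 1} = {s | h * s < 1 - u} := by
    ext s; simp only [Set.mem_ofPred_eq]; constructor <;> intro <;> linarith
  have h2 : Set.indicator (Set.Ioi (0 : ℝ)) (fun _ => (1 : ℝ)) (1 - u) =
      Set.indicator (Set.Iio 1) (fun _ => 1) u := by
    by_cases hu : u < 1
    · rw [Set.indicator_of_mem (by simpa using hu), Set.indicator_of_mem (by simpa using hu)]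
    · rw [Set.indicator_of_notMem (by simpa using hu), Set.indicator_of_notMem (by simpa using hu)]
  rw [h1, h2]
  ring

lemma measurable_stepError (hK : KernelAssumption K) : Measurable (stepError K h) := by
  refine Measurable.sub (Monotone.measurable fun u v huv => ?_)
    (measurable_const.indicator measurableSet_Ioi)
  refine integral_mono
    (hK.integrable.indicator (measurableSet_lt (by fun_prop) measurable_const))
    (hK.integrable.indicator (measurableSet_lt (by fun_prop) measurable_const)) fun s => ?_
  refine Set.indicator_le_indicator_of_subset (fun s hs => ?_) hK.nonneg s
  exact lt_of_lt_of_le hs huv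

lemma integrable_indicator_step (hK : KernelAssumption K) (h u : ℝ) :
    Integrable (Set.indicator {s | h * s < u} K) :=
  hK.integrable.indicator (measurableSet_lt (by fun_prop) measurable_const)

lemma abs_stepError_le_tail (hK : KernelAssumption K) (hh : 0 < h) (u : ℝ) :
    |stepError K h u| ≤ ∫ s, Set.indicator {s | |u| ≤ h * |s|} K s := by
  have hm : MeasurableSet {s : ℝ | |u| ≤ h * |s|} :=
    measurableSet_le measurable_const (by fun_prop)
  have hti : Integrable (Set.indicator {s | |u| ≤ h * |s|} K) := hK.integrable.indicator hm
  have hi := integrable_indicator_step hK h u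
  unfold stepError
  by_cases hu : 0 < u
  · rw [Set.indicator_of_mem (by simpa using hu), abs_sub_comm]
    have h1 : 1 - ∫ s, Set.indicator {s | h * s < u} K s =
        ∫ s, (K s - Set.indicator {s | h * s < u} K s) := by
      rw [integral_sub hK.integrable hi, hK.integral_eq_one]
    have hnn : ∀ s, 0 ≤ K s - Set.indicator {s | h * s < u} K s := fun s =>
      sub_nonneg.2 (Set.indicator_le_self' (fun s _ => hK.nonneg s) s)
    rw [h1, abs_of_nonneg (integral_nonneg hnn)]
    refine integral_mono (hK.integrable.sub hi) hti fun s => ?_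
    by_cases hs : h * s < u
    · simp only [Set.indicator_of_mem (show s ∈ {s | h * s < u} from hs), sub_self]
      exact Set.indicator_nonneg (fun s _ => hK.nonneg s) s
    · have h2 : s ∈ {s | |u| ≤ h * |s|} := by
        simp only [Set.mem_ofPred_eq, abs_of_pos hu]
        nlinarith [le_abs_self s]
      simp only [Set.indicator_of_notMem (show s ∉ {s | h * s < u} from hs),
        Set.indicator_of_mem h2, sub_zero, le_refl]
  · rw [Set.indicator_of_notMem (by simpa using hu), sub_zero,
      abs_of_nonneg (integral_nonneg fun s => Set.indicator_nonneg (fun s _ => hK.nonneg s) s)]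
    refine integral_mono hi hti fun s => ?_
    refine Set.indicator_le_indicator_of_subset (fun s hs => ?_) hK.nonneg s
    simp only [Set.mem_ofPred_eq] at hs ⊢
    rw [abs_of_nonpos (not_lt.1 hu)]
    nlinarith [neg_abs_le s]

lemma abs_stepError_le (hK : KernelAssumption K) (hh : 0 < h) (u : ℝ) :
    |stepError K h u| ≤ 1 := by
  refine (abs_stepError_le_tail hK hh u).trans (le_of_le_of_eq ?_ hK.integral_eq_one)
  exact integral_mono
    (hK.integrable.indicator (measurableSet_le measurable_const (by fun_prop))) hK.integrable
    (Set.indicator_le_self' fun s _ => hK.nonneg s)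

/-- Exchanging the order of integration in a moment of the tail of the kernel. -/
lemma lintegral_mul_tail_le (hK : KernelAssumption K) (hh : 0 < h) {a : ℕ}
    (ha : Integrable fun s => |s| ^ (a + 1) * K s) :
    ∫⁻ u, ENNReal.ofReal (|u| ^ a * ∫ s, Set.indicator {s | |u| ≤ h * |s|} K s) ≤
      ENNReal.ofReal (2 * h ^ (a + 1) * kappa K (a + 1)) := by
  have hmeas : MeasurableSet {z : ℝ × ℝ | |z.1| ≤ h * |z.2|} :=
    measurableSet_le (by fun_prop) (by fun_prop)
  have hKm := hK.continuous.measurable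
  have h1 : ∀ u : ℝ, ENNReal.ofReal (|u| ^ a * ∫ s, Set.indicator {s | |u| ≤ h * |s|} K s) =
      ∫⁻ s, Set.indicator {z : ℝ × ℝ | |z.1| ≤ h * |z.2|}
        (fun z => ENNReal.ofReal (|z.1| ^ a * K z.2)) (u, s) := fun u => by
    rw [ENNReal.ofReal_mul (by positivity), ofReal_integral_eq_lintegral_ofReal
      (hK.integrable.indicator (measurableSet_le measurable_const (by fun_prop)))
      (ae_of_all _ fun s => Set.indicator_nonneg (fun s _ => hK.nonneg s) s),
      ← lintegral_const_mul _ (by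
        refine Measurable.ennreal_ofReal (hKm.indicator ?_)
        exact measurableSet_le measurable_const (by fun_prop))]
    congr 1; ext s
    by_cases hs : |u| ≤ h * |s|
    · rw [Set.indicator_of_mem (by simpa using hs), Set.indicator_of_mem (by simpa using hs),
        ENNReal.ofReal_mul (by positivity)]
    · rw [Set.indicator_of_notMem (by simpa using hs), Set.indicator_of_notMem (by simpa using hs)]
      simp
  simp only [h1]
  rw [lintegral_lintegral_swap]
  · have h2 : ∀ s : ℝ, ∫⁻ u, Set.indicator {z : ℝ × ℝ | |z.1| ≤ h * |z.2|}
        (fun z => ENNReal.ofReal (|z.1| ^ a * K z.2)) (u, s) ≤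
        ENNReal.ofReal (2 * h ^ (a + 1) * (|s| ^ (a + 1) * K s)) := fun s => by
      have h3 : ∀ u : ℝ, Set.indicator {z : ℝ × ℝ | |z.1| ≤ h * |z.2|}
          (fun z => ENNReal.ofReal (|z.1| ^ a * K z.2)) (u, s) ≤
          Set.indicator (Set.Icc (-(h * |s|)) (h * |s|))
            (fun _ => ENNReal.ofReal ((h * |s|) ^ a * K s)) u := fun u => by
        by_cases hu : |u| ≤ h * |s|
        · rw [Set.indicator_of_mem (by simpa using hu), Set.indicator_of_mem (by
            rw [Set.mem_Icc]; exact abs_le.1 hu)]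
          have := hK.nonneg s
          refine ENNReal.ofReal_le_ofReal ?_
          gcongr
        · rw [Set.indicator_of_notMem (by simpa using hu)]
          exact zero_le
      refine (lintegral_mono h3).trans ?_
      rw [lintegral_indicator measurableSet_Icc, setLIntegral_const, Real.volume_Icc,
        ← ENNReal.ofReal_mul (by have := hK.nonneg s; positivity)]
      refine ENNReal.ofReal_le_ofReal (le_of_eq ?_)
      rw [mul_pow]; ring
    refine (lintegral_mono h2).trans ?_
    rw [← ofReal_integral_eq_lintegral_ofReal (ha.const_mul _)
      (ae_of_all _ fun s => by have := hK.nonneg s; simp only [Pi.zero_apply]; positivity),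
      integral_const_mul]
    rfl
  · exact (Measurable.indicator (by fun_prop) hmeas).aemeasurable

lemma integrable_pow_mul_stepError (hK : KernelAssumption K) (hh : 0 < h) {a : ℕ}
    (ha : Integrable fun s => |s| ^ (a + 1) * K s) :
    Integrable (fun u => |u| ^ a * |stepError K h u|) ∧
      ∫ u, |u| ^ a * |stepError K h u| ≤ 2 * h ^ (a + 1) * kappa K (a + 1) := by
  have hle := (lintegral_mono fun u => ENNReal.ofReal_le_ofReal (mul_le_mul_of_nonneg_left
    (abs_stepError_le_tail hK hh u) (show 0 ≤ |u| ^ a by positivity))).trans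
    (lintegral_mul_tail_le hK hh ha)
  have hnn : ∀ u, 0 ≤ |u| ^ a * |stepError K h u| := fun u => by positivity
  have hm : Measurable fun u => |u| ^ a * |stepError K h u| := by
    have := measurable_stepError hK (h := h)
    fun_prop
  refine ⟨⟨hm.aestronglyMeasurable, ?_⟩, ?_⟩
  · rw [hasFiniteIntegral_iff_ofReal (ae_of_all _ hnn)]
    exact hle.trans_lt ENNReal.ofReal_lt_top
  · rw [integral_eq_lintegral_of_nonneg_ae (ae_of_all _ hnn) hm.aestronglyMeasurable]
    refine ENNReal.toReal_le_of_le_ofReal ?_ hle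
    have := hK.kappa_nonneg (a + 1)
    positivity

lemma integrable_stepError (hK : KernelAssumption K) (hh : 0 < h) :
    Integrable (stepError K h) := by
  have := (integrable_pow_mul_stepError hK hh (a := 0) (by simpa using hK.moment_one)).1
  simp only [pow_zero, one_mul] at this
  exact (integrable_norm_iff (measurable_stepError hK).aestronglyMeasurable).1 this

/-- The step error is odd, because the kernel is symmetric. -/
lemma integral_stepError (hK : KernelAssumption K) (hh : 0 < h) :
    ∫ u, stepError K h u = 0 := by
  have hodd : ∀ u : ℝ, u ≠ 0 → stepError K h (-u) = -stepError K h u := fun u hu => by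
    have h1 : ∫ s, Set.indicator {s | h * s < -u} K s =
        ∫ s, Set.indicator {s | u < h * s} K s := by
      rw [← integral_neg_eq_self]
      congr 1; ext s
      by_cases hs : u < h * s
      · rw [Set.indicator_of_mem (by simpa using hs), Set.indicator_of_mem (by simpa using hs),
          hK.symm]
      · rw [Set.indicator_of_notMem (by simpa using hs),
          Set.indicator_of_notMem (by simpa using hs)]
    have h2 : ∫ s, Set.indicator {s | u < h * s} K s =
        1 - ∫ s, Set.indicator {s | h * s < u} K s := by
      rw [← hK.integral_eq_one, ← integral_sub hK.integrable (integrable_indicator_step hK h u)]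
      apply integral_congr_ae
      have hne : ∀ᵐ s : ℝ, s ≠ u / h := by simp [ae_iff]
      filter_upwards [hne] with s hs
      rcases lt_trichotomy (h * s) u with h3 | h3 | h3
      · rw [Set.indicator_of_notMem (by simpa using h3.le), Set.indicator_of_mem (by simpa using h3),
          sub_self]
      · exact absurd (by rw [← h3]; field_simp) hs
      · rw [Set.indicator_of_mem (by simpa using h3), Set.indicator_of_notMem (by simpa using h3.le),
          sub_zero]
    have h3 : Set.indicator (Set.Ioi (0 : ℝ)) (fun _ => (1 : ℝ)) (-u) =
        1 - Set.indicator (Set.Ioi 0) (fun _ => 1) u := by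
      rcases lt_or_gt_of_ne hu with h4 | h4
      · rw [Set.indicator_of_mem (by simpa using h4), Set.indicator_of_notMem (by simpa using h4.le),
          sub_zero]
      · rw [Set.indicator_of_notMem (by simpa using h4.le), Set.indicator_of_mem (by simpa using h4),
          sub_self]
    unfold stepError
    rw [h1, h2, h3]; ring
  have hae : (fun u => stepError K h (-u)) =ᵐ[volume] fun u => -stepError K h u := by
    have hne : ∀ᵐ s : ℝ, s ≠ 0 := by simp [ae_iff]
    filter_upwards [hne] with u hu using hodd u hu
  have h1 : ∫ u, stepError K h u = -∫ u, stepError K h u := by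
    conv_lhs => rw [← integral_neg_eq_self, integral_congr_ae hae, integral_neg]
  linarith

end Step

/-! ### Population bounds -/

section Population

variable {p : ℕ} [NeZero p] {P : Measure (Obs p)} [IsProbabilityMeasure P]
  {β : Fin (p + 1) → ℝ} {Cf ν₀ c₁ c₂ M c C a₁ a₂ τ : ℝ}

/-- The factor of the first absolute moment of the kernel in the smoothing bounds. -/
def smoothConst (Cf c τ : ℝ) : ℝ := 5 * Cf / c ^ 2 * (1 + 3 * τ)

omit [IsProbabilityMeasure P] in
lemma integral_eq_add_of_response (hM : ModelAssumption P β Cf ν₀ c₁ c₂ M c C a₁ a₂)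
    {F : Obs p → ℝ} (hF : Integrable F P) :
    ∫ o, F o ∂P = ∫ o in {o : Obs p | o.2 = 1}, F o ∂P +
      ∫ o in {o : Obs p | o.2 = -1}, F o ∂P := by
  have h := setIntegral_union (μ := P) (f := F) (s := {o : Obs p | o.2 = 1})
    (t := {o : Obs p | o.2 = -1}) (Set.disjoint_left.2 fun o h1 h2 => by
      simp only [Set.mem_ofPred_eq] at h1 h2; linarith)
    (measurable_snd (measurableSet_singleton (-1 : ℝ))) hF.integrableOn hF.integrableOn
  rw [← h, Measure.restrict_eq_self_of_ae_mem]
  filter_upwards [hM.response] with o ho using ho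

/-- A kernel of integral zero in the margin at `β`, tested against a quadratic form of the
features, is of the order of its first absolute moment. -/
lemma abs_integral_kernel_le (hM : ModelAssumption P β Cf ν₀ c₁ c₂ M c C a₁ a₂) (hc : 0 < c)
    (hCf : 0 < Cf) (hτ : 0 < τ) (hE : ExpSquareBound P τ) {k : ℝ → ℝ} (hkm : Measurable k)
    {κ : ℝ} (hkb : ∀ u, |k u| ≤ κ) (hk : Integrable k) (hk0 : ∫ u, k u = 0)
    (hk1 : Integrable fun u => |u| * |k u|) {σ : ℝ → ℝ} (hσm : Measurable σ)
    (hσ : ∀ y, |σ y| ≤ |y|) (v : Fin (p + 1) → ℝ) :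
    |∫ o, σ o.2 * (k (1 - margin β o) * (aug o.1 ⬝ᵥ v) ^ 2) ∂P| ≤
      smoothConst Cf c τ * (∫ u, |u| * |k u|) * l2Norm v ^ 2 := by
  obtain ⟨hvi, hvb⟩ := hE.integral_sq hτ v
  -- the linear form without the first feature
  set v' : Fin (p + 1) → ℝ := Function.update v (Fin.succ 0) 0 with hv'
  have hw : ∀ o : Obs p, aug o.1 ⬝ᵥ v - v (Fin.succ 0) * o.1 0 = aug o.1 ⬝ᵥ v' := fun o => by
    have h1 : v = v' + v (Fin.succ 0) • Pi.single (Fin.succ 0) 1 := by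
      ext j
      rcases eq_or_ne j (Fin.succ 0) with rfl | hj
      · simp [hv']
      · rw [Pi.add_apply, Pi.smul_apply, hv', Function.update_of_ne hj, Pi.single_eq_of_ne hj,
          smul_zero, add_zero]
    conv_lhs => enter [1]; rw [h1, dotProduct_add, dotProduct_smul, dotProduct_single_one]
    have h2 : aug o.1 (Fin.succ 0) = o.1 0 := by simp only [aug, Fin.cons_succ]
    rw [h2, smul_eq_mul, add_sub_cancel_right]
  have hv'n : l2Norm v' ^ 2 ≤ l2Norm v ^ 2 := by
    rw [l2Norm_sq, l2Norm_sq]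
    refine Finset.sum_le_sum fun j _ => ?_
    rcases eq_or_ne j (Fin.succ 0) with rfl | hj
    · simp only [hv', Function.update_self]; nlinarith [sq_nonneg (v (Fin.succ 0))]
    · rw [hv', Function.update_of_ne hj]
  obtain ⟨hwi, hwb⟩ := hE.integral_sq hτ v'
  have hwi' : Integrable (fun o : Obs p => (aug o.1 ⬝ᵥ v - v (Fin.succ 0) * o.1 0) ^ 2) P := by
    simpa only [hw] using hwi
  have hm := hkm.comp ((measurable_margin β).const_sub 1)
  have hFi : Integrable (fun o : Obs p => k (1 - margin β o) * (aug o.1 ⬝ᵥ v) ^ 2) P := by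
    refine (hvi.const_mul κ).mono' (hm.mul ((measurable_aug_dot v).pow_const 2)).aestronglyMeasurable
      (ae_of_all _ fun o => ?_)
    rw [norm_mul, Real.norm_eq_abs, Real.norm_of_nonneg (sq_nonneg _)]
    gcongr
    exact hkb _
  have hσFi : Integrable
      (fun o : Obs p => σ o.2 * (k (1 - margin β o) * (aug o.1 ⬝ᵥ v) ^ 2)) P := by
    refine hFi.norm.mono' ((hσm.comp measurable_snd).mul
      (hm.mul ((measurable_aug_dot v).pow_const 2))).aestronglyMeasurable ?_
    filter_upwards [hM.response] with o ho
    rw [norm_mul]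
    refine mul_le_of_le_one_left (norm_nonneg _) ((hσ _).trans ?_)
    rcases ho with h | h <;> simp [h]
  have hmeas : ∀ y : ℝ, MeasurableSet {o : Obs p | o.2 = y} := fun y =>
    measurable_snd (measurableSet_singleton y)
  set A := 5 * Cf / c ^ 2 * ∫ u, |u| * |k u| with hA
  have hA0 : 0 ≤ A := mul_nonneg (by positivity) (integral_nonneg fun u => by positivity)
  set Q : Obs p → ℝ := fun o =>
    v (Fin.succ 0) ^ 2 + (aug o.1 ⬝ᵥ v - v (Fin.succ 0) * o.1 0) ^ 2 with hQ
  have hQi : Integrable Q P := (integrable_const _).add hwi'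
  have hclass : ∀ y : ℝ, y = 1 ∨ y = -1 → DensityAssumption P y Cf →
      |∫ o in {o : Obs p | o.2 = y}, σ o.2 * (k (1 - margin β o) * (aug o.1 ⬝ᵥ v) ^ 2) ∂P| ≤
        A * ∫ o in {o : Obs p | o.2 = y}, Q o ∂P := fun y hy hD => by
    have hy1 : |y| = 1 := by rcases hy with rfl | rfl <;> simp
    have h1 : ∫ o in {o : Obs p | o.2 = y}, σ o.2 * (k (1 - margin β o) * (aug o.1 ⬝ᵥ v) ^ 2) ∂P =
        σ y * ∫ o in {o : Obs p | o.2 = y}, k (1 - margin β o) * (aug o.1 ⬝ᵥ v) ^ 2 ∂P := by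
      rw [← integral_const_mul]
      refine setIntegral_congr_fun (hmeas y) fun o ho => ?_
      have ho' : o.2 = y := ho
      simp only [ho']
    rw [h1, abs_mul]
    refine (mul_le_of_le_one_left (abs_nonneg _) ((hσ y).trans hy1.le)).trans ?_
    exact abs_setIntegral_kernel_le hD (by rw [← sq_abs, hy1, one_pow]) hkm hkb hk hk0 hk1 hc
      hM.first_coef hvi hwi'
  rw [integral_eq_add_of_response hM hσFi]
  calc _ ≤ A * ∫ o in {o : Obs p | o.2 = 1}, Q o ∂P +
        A * ∫ o in {o : Obs p | o.2 = -1}, Q o ∂P :=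
      (abs_add_le _ _).trans (add_le_add (hclass 1 (Or.inl rfl) hM.density_pos)
        (hclass (-1) (Or.inr rfl) hM.density_neg))
    _ = A * ∫ o, Q o ∂P := by rw [← mul_add, ← integral_eq_add_of_response hM hQi]
    _ ≤ A * ((1 + 3 * τ) * l2Norm v ^ 2) := by
      gcongr
      have h2 : v (Fin.succ 0) ^ 2 ≤ l2Norm v ^ 2 := by
        rw [← sq_abs]; gcongr; exact abs_apply_le_l2Norm v _
      have h3 : ∫ o, Q o ∂P = v (Fin.succ 0) ^ 2 + ∫ o, (aug o.1 ⬝ᵥ v') ^ 2 ∂P := by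
        simp only [hQ, hw]
        rw [integral_add (integrable_const _) hwi]
        simp
      rw [h3]
      nlinarith
    _ = _ := by rw [hA, smoothConst]; ring

/-- The uniform density on `[-r, r]`. -/
def unifKernel (r u : ℝ) : ℝ := Set.indicator {u | |u| ≤ r} (fun _ => (2 * r)⁻¹) u

lemma measurableSet_abs_le (r : ℝ) : MeasurableSet {u : ℝ | |u| ≤ r} :=
  measurableSet_le (by fun_prop) measurable_const

lemma measurable_unifKernel (r : ℝ) : Measurable (unifKernel r) :=
  measurable_const.indicator (measurableSet_abs_le r)

lemma abs_unifKernel_le {r : ℝ} (hr : 0 < r) (u : ℝ) : |unifKernel r u| ≤ (2 * r)⁻¹ := by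
  unfold unifKernel
  rw [abs_of_nonneg (Set.indicator_nonneg (fun _ _ => by positivity) _)]
  exact Set.indicator_le_self' (fun _ _ => by positivity) u

lemma abs_le_set_eq (r : ℝ) : {u : ℝ | |u| ≤ r} = Set.Icc (-r) r := by
  ext u; simp [abs_le]

lemma integrable_unifKernel (r : ℝ) : Integrable (unifKernel r) := by
  unfold unifKernel
  rw [integrable_indicator_iff (measurableSet_abs_le r), abs_le_set_eq]
  exact integrableOn_const (by simp)

lemma integral_unifKernel {r : ℝ} (hr : 0 < r) : ∫ u, unifKernel r u = 1 := by
  unfold unifKernel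
  rw [integral_indicator (measurableSet_abs_le r), abs_le_set_eq]
  simp only [integral_const, MeasurableSet.univ, measureReal_restrict_apply, Set.univ_inter,
    Real.volume_real_Icc, smul_eq_mul]
  rw [max_eq_left (by linarith)]
  field_simp; ring

lemma abs_mul_unifKernel_le {r : ℝ} (hr : 0 < r) (u : ℝ) :
    |u| * |unifKernel r u| ≤ r * unifKernel r u := by
  unfold unifKernel
  by_cases hu : |u| ≤ r
  · rw [Set.indicator_of_mem (by simpa using hu), abs_of_pos (show (0 : ℝ) < (2 * r)⁻¹ by positivity)]
    gcongr
  · rw [Set.indicator_of_notMem (by simpa using hu)]; simp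

lemma integrable_abs_mul_unifKernel {r : ℝ} (hr : 0 < r) :
    Integrable fun u => |u| * |unifKernel r u| := by
  have := measurable_unifKernel r
  refine ((integrable_unifKernel r).const_mul r).mono' (by fun_prop) (ae_of_all _ fun u => ?_)
  rw [Real.norm_of_nonneg (by positivity)]
  exact abs_mul_unifKernel_le hr u

lemma integral_abs_mul_unifKernel_le {r : ℝ} (hr : 0 < r) :
    ∫ u, |u| * |unifKernel r u| ≤ r := by
  refine (integral_mono (integrable_abs_mul_unifKernel hr)
    ((integrable_unifKernel r).const_mul r) (abs_mul_unifKernel_le hr)).trans ?_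
  rw [integral_const_mul, integral_unifKernel hr, mul_one]

omit [NeZero p] [IsProbabilityMeasure P] in
lemma IsDiracHessian.isHermitian {D : Matrix (Fin (p + 1)) (Fin (p + 1)) ℝ}
    (hD : IsDiracHessian P β D) : D.IsHermitian := by
  ext j k
  simp only [Matrix.conjTranspose_apply, star_trivial]
  refine tendsto_nhds_unique (hD k j) ?_
  simpa only [mul_comm (aug _ k)] using hD j k

omit [NeZero p] [IsProbabilityMeasure P] in
/-- Quadratic forms of the Dirac Hessian as limits of uniformly smoothed Hessians. -/
lemma IsDiracHessian.tendsto_quad (hτ : 0 < τ) (hE : ExpSquareBound P τ)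
    {D : Matrix (Fin (p + 1)) (Fin (p + 1)) ℝ} (hD : IsDiracHessian P β D)
    (v : Fin (p + 1) → ℝ) :
    Tendsto (fun r : ℝ => ∫ o, unifKernel r (1 - margin β o) * (aug o.1 ⬝ᵥ v) ^ 2 ∂P) (𝓝[>] 0)
      (𝓝 (v ⬝ᵥ (D *ᵥ v))) := by
  have hlim : Tendsto (fun r : ℝ => ∑ j, v j * ∑ k, ((2 * r)⁻¹ *
      ∫ o in {o | |1 - margin β o| ≤ r}, aug o.1 j * aug o.1 k ∂P) * v k) (𝓝[>] 0)
      (𝓝 (v ⬝ᵥ (D *ᵥ v))) := by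
    unfold dotProduct Matrix.mulVec dotProduct
    exact tendsto_finsetSum _ fun j _ => (tendsto_finsetSum _ fun k _ =>
      (hD j k).mul_const _).const_mul _
  refine hlim.congr fun r => ?_
  have hms : MeasurableSet {o : Obs p | |1 - margin β o| ≤ r} :=
    measurableSet_le (by fun_prop) measurable_const
  have hjk : ∀ j k, Integrable (fun o : Obs p => aug o.1 j * aug o.1 k)
      (P.restrict {o | |1 - margin β o| ≤ r}) := fun j k => by
    have h1 := ((hE.coord_mul hτ j k).1.const_mul τ)
    refine Integrable.restrict (h1.mono' (by fun_prop) (ae_of_all _ fun o => ?_))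
    have := Real.add_one_le_exp (|aug o.1 j * aug o.1 k| / τ)
    rw [Real.norm_eq_abs, ← div_le_iff₀' hτ]
    linarith
  have h1 : ∀ o : Obs p, unifKernel r (1 - margin β o) * (aug o.1 ⬝ᵥ v) ^ 2 =
      Set.indicator {o : Obs p | |1 - margin β o| ≤ r}
        (fun o => (2 * r)⁻¹ * (aug o.1 ⬝ᵥ v) ^ 2) o := fun o => by
    unfold unifKernel
    by_cases ho : |1 - margin β o| ≤ r
    · rw [Set.indicator_of_mem (by simpa using ho), Set.indicator_of_mem (by simpa using ho)]
    · rw [Set.indicator_of_notMem (by simpa using ho),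
        Set.indicator_of_notMem (by simpa using ho), zero_mul]
  simp only [h1]
  rw [integral_indicator hms, integral_const_mul]
  have h2 : ∀ o : Obs p, (aug o.1 ⬝ᵥ v) ^ 2 =
      ∑ j, ∑ k, v j * v k * (aug o.1 j * aug o.1 k) := fun o => by
    rw [sq, dotProduct, Finset.sum_mul_sum]
    exact Finset.sum_congr rfl fun j _ => Finset.sum_congr rfl fun k _ => by ring
  simp only [h2]
  rw [integral_finsetSum _ fun j _ => integrable_finsetSum _ fun k _ => (hjk j k).const_mul _]
  simp only [Finset.mul_sum]
  refine Finset.sum_congr rfl fun j _ => ?_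
  rw [integral_finsetSum _ fun k _ => (hjk j k).const_mul _, Finset.mul_sum]
  refine Finset.sum_congr rfl fun k _ => ?_
  rw [integral_const_mul]
  ring

/-- Smoothing the Dirac delta by a kernel changes quadratic forms of the Hessian by the order of
the first absolute moment of the kernel. -/
lemma abs_integral_kernel_sub_hessian_le (hM : ModelAssumption P β Cf ν₀ c₁ c₂ M c C a₁ a₂)
    (hc : 0 < c) (hCf : 0 < Cf) (hτ : 0 < τ) (hE : ExpSquareBound P τ)
    {D : Matrix (Fin (p + 1)) (Fin (p + 1)) ℝ} (hD : IsDiracHessian P β D) {k : ℝ → ℝ}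
    (hkm : Measurable k) {κ : ℝ} (hkb : ∀ u, |k u| ≤ κ) (hk : Integrable k)
    (hk0 : ∫ u, k u = 1) (hk1 : Integrable fun u => |u| * |k u|) (v : Fin (p + 1) → ℝ) :
    |∫ o, k (1 - margin β o) * (aug o.1 ⬝ᵥ v) ^ 2 ∂P - v ⬝ᵥ (D *ᵥ v)| ≤
      smoothConst Cf c τ * (∫ u, |u| * |k u|) * l2Norm v ^ 2 := by
  have hvi := (hE.integral_sq hτ v).1
  have hint : ∀ {k : ℝ → ℝ} {κ : ℝ}, Measurable k → (∀ u, |k u| ≤ κ) →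
      Integrable (fun o : Obs p => k (1 - margin β o) * (aug o.1 ⬝ᵥ v) ^ 2) P := by
    intro k κ hkm hkb
    refine (hvi.const_mul κ).mono' ((hkm.comp ((measurable_margin β).const_sub 1)).mul
      ((measurable_aug_dot v).pow_const 2)).aestronglyMeasurable (ae_of_all _ fun o => ?_)
    rw [norm_mul, Real.norm_eq_abs, Real.norm_of_nonneg (sq_nonneg _)]
    gcongr
    exact hkb _
  have hCD : 0 ≤ smoothConst Cf c τ := by unfold smoothConst; positivity
  have hlim := (hD.tendsto_quad hτ hE v).const_sub
    (∫ o, k (1 - margin β o) * (aug o.1 ⬝ᵥ v) ^ 2 ∂P)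
  have hlim2 : Tendsto (fun r : ℝ => smoothConst Cf c τ * ((∫ u, |u| * |k u|) + r) *
      l2Norm v ^ 2) (𝓝[>] 0)
      (𝓝 (smoothConst Cf c τ * ((∫ u, |u| * |k u|) + 0) * l2Norm v ^ 2)) := by
    refine tendsto_nhdsWithin_of_tendsto_nhds (Continuous.tendsto (by fun_prop) 0)
  rw [add_zero] at hlim2
  refine le_of_tendsto_of_tendsto hlim.abs hlim2 ?_
  filter_upwards [self_mem_nhdsWithin] with r hr
  have hr : 0 < r := hr
  have hum := measurable_unifKernel r
  have hle : ∀ u, |u| * |k u - unifKernel r u| ≤ |u| * |k u| + |u| * |unifKernel r u| := fun u => by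
    rw [← mul_add]
    gcongr
    exact abs_sub _ _
  have hsumi := hk1.add (integrable_abs_mul_unifKernel hr)
  have hdi : Integrable fun u => |u| * |k u - unifKernel r u| :=
    hsumi.mono' (by fun_prop) (ae_of_all _ fun u => by
      rw [Real.norm_of_nonneg (by positivity)]; exact hle u)
  have key := abs_integral_kernel_le hM hc hCf hτ hE (k := fun u => k u - unifKernel r u)
    (hkm.sub hum) (fun u => (abs_sub _ _).trans (add_le_add (hkb u) (abs_unifKernel_le hr u)))
    (hk.sub (integrable_unifKernel r))
    (by rw [integral_sub hk (integrable_unifKernel r), hk0, integral_unifKernel hr, sub_self])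
    hdi (σ := fun y => |y|) (by fun_prop) (fun y => by simp) v
  have hcongr : ∫ o : Obs p, |o.2| * ((k (1 - margin β o) - unifKernel r (1 - margin β o)) *
      (aug o.1 ⬝ᵥ v) ^ 2) ∂P = ∫ o, k (1 - margin β o) * (aug o.1 ⬝ᵥ v) ^ 2 ∂P -
        ∫ o, unifKernel r (1 - margin β o) * (aug o.1 ⬝ᵥ v) ^ 2 ∂P := by
    rw [← integral_sub (hint hkm hkb) (hint hum (abs_unifKernel_le hr))]
    apply integral_congr_ae
    filter_upwards [hM.response] with o ho
    have : |o.2| = 1 := by rcases ho with h | h <;> simp [h]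
    rw [this]; ring
  rw [hcongr] at key
  refine key.trans ?_
  gcongr
  refine (integral_mono hdi hsumi hle).trans ?_
  simp only [Pi.add_apply]
  rw [integral_add hk1 (integrable_abs_mul_unifKernel hr)]
  gcongr
  exact integral_abs_mul_unifKernel_le hr

omit [NeZero p] in
lemma IsDiracHessian.ae_margin_ne_one {D : Matrix (Fin (p + 1)) (Fin (p + 1)) ℝ}
    (hD : IsDiracHessian P β D) : ∀ᵐ o ∂P, margin β o ≠ 1 := by
  have h00 := hD 0 0
  have hms : ∀ r, MeasurableSet {o : Obs p | |1 - margin β o| ≤ r} := fun r =>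
    measurableSet_le (by fun_prop) measurable_const
  simp only [aug, Fin.cons_zero, mul_one, integral_const, smul_eq_mul,
    measureReal_restrict_apply MeasurableSet.univ, Set.univ_inter] at h00
  have h2r : Tendsto (fun r : ℝ => 2 * r) (𝓝[>] 0) (𝓝 0) := by
    have : Tendsto (fun r : ℝ => 2 * r) (𝓝 0) (𝓝 (2 * 0)) := Continuous.tendsto (by fun_prop) 0
    rw [mul_zero] at this
    exact tendsto_nhdsWithin_of_tendsto_nhds this
  have h0 := h2r.mul h00
  rw [zero_mul] at h0
  have hle : P.real {o | margin β o = 1} ≤ 0 := by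
    refine ge_of_tendsto h0 ?_
    filter_upwards [self_mem_nhdsWithin] with r hr
    have hr : 0 < r := hr
    rw [← mul_assoc, mul_inv_cancel₀ (by positivity), one_mul]
    refine measureReal_mono fun o ho => ?_
    have ho' : margin β o = 1 := ho
    simp [ho', hr.le]
  rw [ae_iff]
  simp only [not_not]
  exact (measureReal_eq_zero_iff (measure_ne_top _ _)).1 (le_antisymm hle measureReal_nonneg)

omit [NeZero p] in
/-- The population hinge risk has a vanishing gradient at its minimizer. -/
lemma integral_hinge_gradient_eq_zero (hresp : ∀ᵐ o ∂P, o.2 = 1 ∨ o.2 = -1)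
    (hmin : ∀ β', hingeRisk P β ≤ hingeRisk P β') (hτ : 0 < τ) (hE : ExpSquareBound P τ)
    (hne : ∀ᵐ o ∂P, margin β o ≠ 1) (v : Fin (p + 1) → ℝ) :
    ∫ o, Set.indicator (Set.Iio 1) (fun _ => (1 : ℝ)) (margin β o) *
      (o.2 * (aug o.1 ⬝ᵥ v)) ∂P = 0 := by
  have hlin : ∀ v : Fin (p + 1) → ℝ, Integrable (fun o : Obs p => o.2 * (aug o.1 ⬝ᵥ v)) P := by
    intro v
    refine ((integrable_const (1 : ℝ)).add (hE.integral_sq hτ v).1).mono'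
      (measurable_snd.mul (measurable_aug_dot v)).aestronglyMeasurable ?_
    filter_upwards [hresp] with o ho
    have h1 : |o.2| = 1 := by rcases ho with h | h <;> simp [h]
    rw [norm_mul, Real.norm_eq_abs, h1, one_mul, Real.norm_eq_abs, Pi.add_apply,
      ← sq_abs (aug o.1 ⬝ᵥ v)]
    nlinarith [sq_nonneg (|aug o.1 ⬝ᵥ v| - 1), abs_nonneg (aug o.1 ⬝ᵥ v)]
  have hhinge : ∀ a b : ℝ, |hinge a - hinge b| ≤ |a - b| := fun a b => by
    unfold hinge
    refine (abs_max_sub_max_le_abs _ _ _).trans (le_of_eq ?_)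
    rw [abs_sub_comm a b]; congr 1; ring
  have hhc : Continuous hinge := by unfold hinge; fun_prop
  have hmar : ∀ (θ : ℝ) (o : Obs p), margin (β + θ • v) o =
      margin β o + θ * (o.2 * (aug o.1 ⬝ᵥ v)) := fun θ o => by
    simp only [margin, dotProduct_add, dotProduct_smul, smul_eq_mul]; ring
  have hder := (hasDerivAt_integral_of_dominated_loc_of_lip (μ := P)
    (F := fun θ o => hinge (margin (β + θ • v) o))
    (F' := fun o => -(Set.indicator (Set.Iio 1) (fun _ => (1 : ℝ)) (margin β o) *
      (o.2 * (aug o.1 ⬝ᵥ v)))) (x₀ := (0 : ℝ)) (s := Set.univ)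
    (bound := fun o => |o.2 * (aug o.1 ⬝ᵥ v)|) Filter.univ_mem
    (Eventually.of_forall fun θ => (hhc.measurable.comp
      (measurable_margin _)).aestronglyMeasurable) ?_ ?_ ?_ (hlin v).abs ?_).2
  · have hmin' : IsLocalMin (fun θ : ℝ => ∫ o, hinge (margin (β + θ • v) o) ∂P) 0 := by
      refine Eventually.of_forall fun θ => ?_
      have := hmin (β + θ • v)
      simpa [hingeRisk] using this
    have := hmin'.hasDerivAt_eq_zero hder
    rw [integral_neg] at this
    linarith
  · simp only [zero_smul, add_zero]
    refine ((integrable_const (1 : ℝ)).add (hlin β).abs).mono'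
      (hhc.measurable.comp (measurable_margin _)).aestronglyMeasurable (ae_of_all _ fun o => ?_)
    have := hhinge (margin β o) 1
    have h1 : hinge 1 = 0 := by simp [hinge]
    rw [h1, sub_zero] at this
    refine this.trans ((abs_sub _ _).trans ?_)
    simp [margin, add_comm]
  · refine Measurable.aestronglyMeasurable ?_
    exact (((measurable_const.indicator measurableSet_Iio).comp (measurable_margin β)).mul
      (measurable_snd.mul (measurable_aug_dot v))).neg
  · refine ae_of_all _ fun o => ?_
    refine LipschitzOnWith.of_dist_le_mul fun a _ b _ => ?_
    rw [Real.dist_eq, Real.dist_eq]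
    refine (hhinge _ _).trans (le_of_eq ?_)
    rw [hmar, hmar, show margin β o + a * (o.2 * (aug o.1 ⬝ᵥ v)) -
      (margin β o + b * (o.2 * (aug o.1 ⬝ᵥ v))) = (o.2 * (aug o.1 ⬝ᵥ v)) * (a - b) by ring,
      abs_mul]
    simp
  · filter_upwards [hne] with o ho
    simp only [hmar]
    have hinner : HasDerivAt (fun θ : ℝ => margin β o + θ * (o.2 * (aug o.1 ⬝ᵥ v)))
        (o.2 * (aug o.1 ⬝ᵥ v)) 0 := by
      simpa using ((hasDerivAt_id' (0 : ℝ)).mul_const (o.2 * (aug o.1 ⬝ᵥ v))).const_add (margin β o)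
    have hcont := hinner.continuousAt
    have h0 : margin β o + 0 * (o.2 * (aug o.1 ⬝ᵥ v)) = margin β o := by ring
    rcases lt_or_gt_of_ne ho with h1 | h1
    · rw [Set.indicator_of_mem (by simpa using h1), one_mul]
      refine (hinner.const_sub 1).congr_of_eventuallyEq ?_
      filter_upwards [hcont.eventually_lt (continuousAt_const (y := (1 : ℝ))) (by rwa [h0])] with θ hθ
      unfold hinge
      exact max_eq_left (by linarith)
    · rw [Set.indicator_of_notMem (by simpa using h1.le), zero_mul, neg_zero]
      refine (hasDerivAt_const (0 : ℝ) (0 : ℝ)).congr_of_eventuallyEq ?_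
      filter_upwards [(continuousAt_const (y := (1 : ℝ))).eventually_lt hcont (by rwa [h0])] with θ hθ
      unfold hinge
      exact max_eq_right (by linarith)

/-- The smoothing bias of the gradient is of order `h²`: the linear form is the polarization
`4 xᵀv = (xᵀ(v + e₀))² - (xᵀ(v - e₀))²` of quadratic forms, as the intercept feature is `1`. -/
lemma abs_integral_slope_le {K : ℝ → ℝ} (hK : KernelAssumption K)
    (hM : ModelAssumption P β Cf ν₀ c₁ c₂ M c C a₁ a₂) (hc : 0 < c)
    (hCf : 0 < Cf) (hτ : 0 < τ) (hE : ExpSquareBound P τ) {h : ℝ} (hh : 0 < h)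
    (v : Fin (p + 1) → ℝ) :
    |∫ o, smoothSlope K h (margin β o) * (o.2 * (aug o.1 ⬝ᵥ v)) ∂P| ≤
      4 * smoothConst Cf c τ * kappa K 2 * h ^ 2 * l2Norm v := by
  obtain ⟨D, hD, -, -⟩ := hM.hessian
  have hne := hD.ae_margin_ne_one
  obtain ⟨hm1, hm2⟩ := integrable_pow_mul_stepError hK hh (a := 1) hK.moment_two
  simp only [pow_one] at hm1 hm2
  have hCD : 0 ≤ smoothConst Cf c τ := by unfold smoothConst; positivity
  have hsm := measurable_stepError hK (h := h)
  have hquadi : ∀ v : Fin (p + 1) → ℝ, Integrable (fun o : Obs p =>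
      o.2 * (stepError K h (1 - margin β o) * (aug o.1 ⬝ᵥ v) ^ 2)) P := fun v => by
    refine (hE.integral_sq hτ v).1.mono' (measurable_snd.mul ((hsm.comp
      ((measurable_margin β).const_sub 1)).mul
      ((measurable_aug_dot v).pow_const 2))).aestronglyMeasurable ?_
    filter_upwards [hM.response] with o ho
    have h1 : |o.2| = 1 := by rcases ho with h | h <;> simp [h]
    rw [norm_mul, Real.norm_eq_abs, h1, one_mul, norm_mul, Real.norm_of_nonneg (sq_nonneg _)]
    exact mul_le_of_le_one_left (sq_nonneg _) (abs_stepError_le hK hh _)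
  have hunit : ∀ u : Fin (p + 1) → ℝ, l2Norm u ≤ 1 →
      |∫ o, o.2 * stepError K h (1 - margin β o) * (aug o.1 ⬝ᵥ u) ∂P| ≤
        4 * smoothConst Cf c τ * kappa K 2 * h ^ 2 := fun u hu => by
    set e : Fin (p + 1) → ℝ := Pi.single 0 1 with he
    have hae : ∀ o : Obs p, aug o.1 ⬝ᵥ e = 1 := fun o => by simp [he, aug]
    have hpol : ∀ o : Obs p, o.2 * stepError K h (1 - margin β o) * (aug o.1 ⬝ᵥ u) =
        1 / 4 * (o.2 * (stepError K h (1 - margin β o) * (aug o.1 ⬝ᵥ (u + e)) ^ 2) -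
          o.2 * (stepError K h (1 - margin β o) * (aug o.1 ⬝ᵥ (u - e)) ^ 2)) := fun o => by
      rw [dotProduct_add, dotProduct_sub, hae]; ring
    have hb : ∀ w : Fin (p + 1) → ℝ, l2Norm w ≤ 2 →
        |∫ o, o.2 * (stepError K h (1 - margin β o) * (aug o.1 ⬝ᵥ w) ^ 2) ∂P| ≤
          smoothConst Cf c τ * (2 * h ^ 2 * kappa K 2) * 4 := fun w hw => by
      refine (abs_integral_kernel_le hM hc hCf hτ hE hsm (abs_stepError_le hK hh)
        (integrable_stepError hK hh) (integral_stepError hK hh) hm1 (σ := fun y => y)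
        measurable_id (fun y => le_rfl) w).trans ?_
      have hk2 := hK.kappa_nonneg 2
      have : l2Norm w ^ 2 ≤ 4 := by nlinarith [l2Norm_nonneg w]
      gcongr
    have he1 : l2Norm e = 1 := l2Norm_single 0
    have hp := hb (u + e) ((l2Norm_add_le _ _).trans (by linarith))
    have hmn := hb (u - e) (by
      rw [sub_eq_add_neg]
      refine (l2Norm_add_le _ _).trans ?_
      rw [l2Norm_neg]; linarith)
    simp only [hpol]
    rw [integral_const_mul, integral_sub (hquadi _) (hquadi _), abs_mul,
      abs_of_pos (by norm_num : (0 : ℝ) < 1 / 4)]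
    have := abs_sub (∫ o, o.2 * (stepError K h (1 - margin β o) * (aug o.1 ⬝ᵥ (u + e)) ^ 2) ∂P)
      (∫ o, o.2 * (stepError K h (1 - margin β o) * (aug o.1 ⬝ᵥ (u - e)) ^ 2) ∂P)
    linarith
  obtain ⟨u, hu, huv⟩ := exists_unit_smul v
  have hlin : Integrable (fun o : Obs p => (aug o.1 ⬝ᵥ v)) P := by
    refine ((integrable_const (1 : ℝ)).add (hE.integral_sq hτ v).1).mono'
      (measurable_aug_dot v).aestronglyMeasurable (ae_of_all _ fun o => ?_)
    rw [Real.norm_eq_abs, Pi.add_apply, ← sq_abs (aug o.1 ⬝ᵥ v)]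
    nlinarith [sq_nonneg (|aug o.1 ⬝ᵥ v| - 1), abs_nonneg (aug o.1 ⬝ᵥ v)]
  have hi1 : Integrable (fun o : Obs p => o.2 * stepError K h (1 - margin β o) *
      (aug o.1 ⬝ᵥ v)) P := by
    refine hlin.abs.mono' ((measurable_snd.mul (hsm.comp
      ((measurable_margin β).const_sub 1))).mul (measurable_aug_dot v)).aestronglyMeasurable ?_
    filter_upwards [hM.response] with o ho
    have h1 : |o.2| = 1 := by rcases ho with h | h <;> simp [h]
    rw [norm_mul, norm_mul, Real.norm_eq_abs, h1, one_mul]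
    exact mul_le_of_le_one_left (norm_nonneg _) (abs_stepError_le hK hh _)
  have hi2 : Integrable (fun o : Obs p => Set.indicator (Set.Iio 1) (fun _ => (1 : ℝ))
      (margin β o) * (o.2 * (aug o.1 ⬝ᵥ v))) P := by
    refine hlin.abs.mono' (((measurable_const.indicator measurableSet_Iio).comp
      (measurable_margin β)).mul (measurable_snd.mul
      (measurable_aug_dot v))).aestronglyMeasurable ?_
    filter_upwards [hM.response] with o ho
    have h1 : |o.2| = 1 := by rcases ho with h | h <;> simp [h]
    rw [norm_mul, norm_mul, Real.norm_eq_abs o.2, h1, one_mul]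
    refine mul_le_of_le_one_left (norm_nonneg _) ?_
    rw [Real.norm_of_nonneg (Set.indicator_nonneg (fun _ _ => zero_le_one) _)]
    exact Set.indicator_le_self' (fun _ _ => zero_le_one) _
  -- the second summand is the hinge gradient, with vanishing expectation at the minimizer
  have hsplit : ∀ o : Obs p, smoothSlope K h (margin β o) * (o.2 * (aug o.1 ⬝ᵥ v)) =
      -(o.2 * stepError K h (1 - margin β o) * (aug o.1 ⬝ᵥ v) +
        Set.indicator (Set.Iio 1) (fun _ => (1 : ℝ)) (margin β o) *
          (o.2 * (aug o.1 ⬝ᵥ v))) := fun o => by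
    rw [smoothSlope_eq]; ring
  simp only [hsplit]
  rw [integral_neg, integral_add hi1 hi2,
    integral_hinge_gradient_eq_zero hM.response hM.isMin hτ hE hne v, add_zero, abs_neg]
  have hscale : ∀ o : Obs p, o.2 * stepError K h (1 - margin β o) * (aug o.1 ⬝ᵥ v) =
      l2Norm v * (o.2 * stepError K h (1 - margin β o) * (aug o.1 ⬝ᵥ u)) := fun o => by
    conv_lhs => rw [huv]
    rw [dotProduct_smul, smul_eq_mul]; ring
  simp only [hscale]
  rw [integral_const_mul, abs_mul, abs_of_nonneg (l2Norm_nonneg v), mul_comm]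
  exact mul_le_mul_of_nonneg_right (hunit u hu) (l2Norm_nonneg v)

end Population

/-! ### The truncated square -/

/-- The squared distance of `u` to `{0} ∪ {c : 2 T ≤ |c|}`. It agrees with `u²` for `|u| ≤ T`,
vanishes for `|u| ≥ 2 T`, and, as a squared distance, its increments are bounded above by those of
a parabola. -/
def truncSq (T u : ℝ) : ℝ := max 0 (min |u| (2 * T - |u|)) ^ 2

lemma truncSq_nonneg (T u : ℝ) : 0 ≤ truncSq T u := sq_nonneg _

lemma measurable_truncSq (T : ℝ) : Measurable (truncSq T) := by
  unfold truncSq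
  have : Continuous fun u : ℝ => max 0 (min |u| (2 * T - |u|)) ^ 2 := by fun_prop
  exact this.measurable

lemma truncSq_le_sq_sub {T c : ℝ} (hc : c = 0 ∨ 2 * T ≤ |c|) (u : ℝ) :
    truncSq T u ≤ (u - c) ^ 2 := by
  rw [← sq_abs (u - c)]
  refine pow_le_pow_left₀ (le_max_left _ _) (max_le (abs_nonneg _) ?_) 2
  rcases hc with rfl | hc
  · rw [sub_zero]; exact min_le_left _ _
  · refine (min_le_right _ _).trans ?_
    have := abs_sub_abs_le_abs_sub c u
    rw [abs_sub_comm] at this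
    linarith

lemma truncSq_le_sq (T u : ℝ) : truncSq T u ≤ u ^ 2 := by
  simpa using truncSq_le_sq_sub (T := T) (Or.inl rfl) u

lemma truncSq_eq_zero {T u : ℝ} (h : 2 * T ≤ |u|) : truncSq T u = 0 := by
  rw [truncSq, max_eq_left ((min_le_right _ _).trans (by linarith)), zero_pow two_ne_zero]

lemma sq_sub_le_truncSq {T : ℝ} (hT : 0 < T) (u : ℝ) :
    u ^ 2 - u ^ 4 / T ^ 2 ≤ truncSq T u := by
  rcases le_total |u| T with h | h
  · rw [truncSq, min_eq_left (by linarith), max_eq_right (abs_nonneg _), sq_abs]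
    have : 0 ≤ u ^ 4 / T ^ 2 := by positivity
    linarith
  · refine le_trans ?_ (truncSq_nonneg T u)
    have h2 : T ^ 2 ≤ u ^ 2 := by rw [← sq_abs u]; exact pow_le_pow_left₀ hT.le h 2
    rw [sub_nonpos, le_div_iff₀ (by positivity)]
    nlinarith [sq_nonneg u]

/-- A nearest point of `{0} ∪ {c : 2 T ≤ |c|}` gives a tangent parabola of leading coefficient
one above the truncated square. -/
lemma exists_truncSq_add_le (T u : ℝ) :
    ∃ g, ∀ d, truncSq T (u + d) ≤ truncSq T u + g * d + d ^ 2 := by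
  suffices h : ∃ c, (c = 0 ∨ 2 * T ≤ |c|) ∧ truncSq T u = (u - c) ^ 2 by
    obtain ⟨c, hc, hu⟩ := h
    refine ⟨2 * (u - c), fun d => (truncSq_le_sq_sub hc (u + d)).trans_eq ?_⟩
    rw [hu]; ring
  rcases le_total |u| T with h | h
  · refine ⟨0, Or.inl rfl, ?_⟩
    rw [truncSq, min_eq_left (by linarith), max_eq_right (abs_nonneg _), sq_abs, sub_zero]
  rcases le_total (2 * T) |u| with h2 | h2
  · exact ⟨u, Or.inr h2, by rw [truncSq_eq_zero h2, sub_self, zero_pow two_ne_zero]⟩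
  rw [truncSq, min_eq_right (by linarith), max_eq_right (by linarith)]
  rcases le_total 0 u with hu | hu
  · refine ⟨2 * T, Or.inr (le_abs_self _), ?_⟩
    rw [abs_of_nonneg hu]; ring
  · refine ⟨-(2 * T), Or.inr (by rw [abs_neg]; exact le_abs_self _), ?_⟩
    rw [abs_of_nonpos hu]; ring

/-! ### Curvature of the smoothed hinge loss -/

/-- The curvature weight of an observation whose margin is `u`: the minimum of `K` divided by `h`,
cut off at the distance `7 h / 8` of the margin from the kink at `1`. -/
def curvWeight (K : ℝ → ℝ) (h u : ℝ) : ℝ :=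
  kappaLow K / h * Set.indicator {x | |x| ≤ 7 / 8 * h} (fun _ => 1) (1 - u)

lemma measurable_curvWeight (K : ℝ → ℝ) (h : ℝ) : Measurable (curvWeight K h) :=
  ((measurable_const.indicator (measurableSet_abs_le _)).comp
    (measurable_id.const_sub 1)).const_mul _

section Curvature

variable {K : ℝ → ℝ} {h : ℝ}

lemma curvWeight_nonneg (hK : KernelAssumption K) (hh : 0 < h) (u : ℝ) :
    0 ≤ curvWeight K h u :=
  mul_nonneg (div_nonneg hK.low_pos.le hh.le) (Set.indicator_nonneg (fun _ _ => zero_le_one) _)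

lemma curvWeight_le (hK : KernelAssumption K) (hh : 0 < h) (u : ℝ) :
    curvWeight K h u ≤ kappaLow K / h :=
  mul_le_of_le_one_right (div_nonneg hK.low_pos.le hh.le)
    (Set.indicator_le_self' (fun _ _ => zero_le_one) _)

lemma curvWeight_eq (hh : 0 < h) (u : ℝ) :
    curvWeight K h u = 7 / 4 * kappaLow K * unifKernel (7 / 8 * h) (1 - u) := by
  unfold curvWeight unifKernel
  by_cases hu : |1 - u| ≤ 7 / 8 * h
  · rw [Set.indicator_of_mem (by simpa using hu), Set.indicator_of_mem (by simpa using hu)]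
    field_simp; ring
  · rw [Set.indicator_of_notMem (by simpa using hu), Set.indicator_of_notMem (by simpa using hu)]
    ring

/-- Second-order lower bound for the smoothed hinge loss, valid for increments of any size
because the truncated square vanishes for the large ones. -/
lemma smoothHinge_curvature (hK : KernelAssumption K) (hh : 0 < h) (u δ : ℝ) :
    smoothHinge K h u + smoothSlope K h u * δ +
      1 / 2 * (curvWeight K h u * truncSq (h / 16) δ) ≤ smoothHinge K h (u + δ) := by
  by_cases hu : |1 - u| ≤ 7 / 8 * h
  · rcases le_total |δ| (h / 8) with hδ | hδ
    · refine le_trans ?_ (smoothHinge_strong hK hh hu hδ)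
      have h1 := mul_le_mul_of_nonneg_left (truncSq_le_sq (h / 16) δ)
        (div_nonneg hK.low_pos.le hh.le)
      have h2 : kappaLow K / (2 * h) * δ ^ 2 = 1 / 2 * (kappaLow K / h * δ ^ 2) := by
        field_simp
      have h3 := mul_le_mul_of_nonneg_right (curvWeight_le hK hh u) (truncSq_nonneg (h / 16) δ)
      linarith
    · rw [truncSq_eq_zero (by linarith), mul_zero, mul_zero, add_zero]
      exact smoothHinge_tangent_le hK hh u δ
  · rw [curvWeight, Set.indicator_of_notMem (by simpa using hu), mul_zero, zero_mul, mul_zero,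
      add_zero]
    exact smoothHinge_tangent_le hK hh u δ

end Curvature

/-! ### Sparse averages -/

section Sparse

variable {q : ℕ}

/-- The vertices `± R e_j` of the `l₁` ball of radius `R`. -/
def l1Vertex (R : ℝ) (a : Fin q × Bool) : Fin q → ℝ :=
  (if a.2 then R else -R) • Pi.single a.1 1

lemma l1Norm_single (j : Fin q) : l1Norm (Pi.single j (1 : ℝ)) = 1 := by
  unfold l1Norm
  rw [Finset.sum_eq_single j]
  · simp
  · intro i _ hi; rw [Pi.single_eq_of_ne hi, abs_zero]
  · simp

lemma l1Norm_l1Vertex {R : ℝ} (hR : 0 ≤ R) (a : Fin q × Bool) : l1Norm (l1Vertex R a) = R := by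
  rw [l1Vertex, l1Norm_smul, l1Norm_single, mul_one]
  split_ifs
  · exact abs_of_nonneg hR
  · rw [abs_neg, abs_of_nonneg hR]

lemma l1Norm_add_le (v w : Fin q → ℝ) : l1Norm (v + w) ≤ l1Norm v + l1Norm w := by
  unfold l1Norm
  rw [← Finset.sum_add_distrib]
  exact Finset.sum_le_sum fun j _ => abs_add_le _ _

lemma l1Norm_sub_le (v w : Fin q → ℝ) : l1Norm (v - w) ≤ l1Norm v + l1Norm w := by
  rw [sub_eq_add_neg, ← l1Norm_neg w]
  exact l1Norm_add_le _ _

lemma l2Norm_le_l1Norm (v : Fin q → ℝ) : l2Norm v ≤ l1Norm v := by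
  refine Real.sqrt_le_iff.2 ⟨l1Norm_nonneg v, ?_⟩
  have h : ∀ j, |v j| ≤ l1Norm v := fun j =>
    Finset.single_le_sum (f := fun i => |v i|) (fun i _ => abs_nonneg _) (Finset.mem_univ j)
  calc ∑ j, v j ^ 2 = ∑ j, |v j| * |v j| := by simp only [← sq, sq_abs]
    _ ≤ ∑ j, l1Norm v * |v j| :=
      Finset.sum_le_sum fun j _ => mul_le_mul_of_nonneg_right (h j) (abs_nonneg _)
    _ = l1Norm v ^ 2 := by rw [← Finset.mul_sum, sq]; rfl

lemma exists_l1Vertex_dotProduct_le [NeZero q] {v : Fin q → ℝ} {R : ℝ} (hv : l1Norm v ≤ R)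
    (g : Fin q → ℝ) : ∃ a, g ⬝ᵥ (l1Vertex R a - v) ≤ 0 := by
  have hR : 0 ≤ R := (l1Norm_nonneg v).trans hv
  obtain ⟨j, hj⟩ : ∃ j, ‖g‖ = |g j| := by
    obtain ⟨j, -, hj⟩ := Finset.exists_mem_eq_sup' (Finset.univ_nonempty (α := Fin q))
      fun j => |g j|
    refine ⟨j, le_antisymm ((pi_norm_le_iff_of_nonneg (abs_nonneg _)).2 fun i => ?_)
      (norm_le_pi_norm g j)⟩
    rw [← hj, Real.norm_eq_abs]
    exact Finset.le_sup' (fun j => |g j|) (Finset.mem_univ i)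
  have h1 := (abs_le.1 (abs_dotProduct_le g v)).1
  have h2 := mul_le_mul_of_nonneg_left hv (norm_nonneg g)
  rcases le_total 0 (g j) with h | h
  · refine ⟨(j, false), ?_⟩
    rw [abs_of_nonneg h] at hj
    simp only [l1Vertex, dotProduct_sub, dotProduct_smul, dotProduct_single_one, smul_eq_mul,
      Bool.false_eq_true, if_false]
    rw [hj] at h1 h2
    linarith
  · refine ⟨(j, true), ?_⟩
    rw [abs_of_nonpos h] at hj
    simp only [l1Vertex, dotProduct_sub, dotProduct_smul, dotProduct_single_one, smul_eq_mul,
      if_true]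
    rw [hj] at h1 h2
    linarith

/-- The average of the vertices of the `l₁` ball listed by `f`. -/
def vertexAverage (R : ℝ) {m : ℕ} (f : Fin m → Fin q × Bool) : Fin q → ℝ :=
  (m : ℝ)⁻¹ • ∑ i, l1Vertex R (f i)

/-- A greedy form of Maurey's argument: if `Φ` lies below a parabola of curvature `c` in each
direction from a point of the `l₁` ball to a vertex, then the average of some `m` vertices
exceeds the value at `v` by at most `c / m`. -/
lemma exists_vertexAverage_le [NeZero q] {v : Fin q → ℝ} {R c : ℝ} (hv : l1Norm v ≤ R)
    {Φ : (Fin q → ℝ) → ℝ}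
    (hΦ : ∀ z, ∃ g : Fin q → ℝ, ∀ a, ∀ ε : ℝ,
      Φ (z + ε • (l1Vertex R a - v)) ≤ Φ z + ε * (g ⬝ᵥ (l1Vertex R a - v)) + c * ε ^ 2)
    {m : ℕ} (hm : 0 < m) :
    ∃ f : Fin m → Fin q × Bool, Φ (vertexAverage R f) ≤ Φ v + c / m := by
  have hm' : (0 : ℝ) < m := by exact_mod_cast hm
  have key : ∀ i : ℕ, ∃ f : Fin i → Fin q × Bool,
      Φ (v + ∑ j, (m : ℝ)⁻¹ • (l1Vertex R (f j) - v)) ≤ Φ v + i * (c * (m : ℝ)⁻¹ ^ 2) := by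
    intro i
    induction i with
    | zero => exact ⟨Fin.elim0, by simp⟩
    | succ i ih =>
      obtain ⟨f, hf⟩ := ih
      obtain ⟨g, hg⟩ := hΦ (v + ∑ j, (m : ℝ)⁻¹ • (l1Vertex R (f j) - v))
      obtain ⟨a, ha⟩ := exists_l1Vertex_dotProduct_le hv g
      refine ⟨Fin.snoc f a, ?_⟩
      simp only [Fin.sum_univ_castSucc, Fin.snoc_castSucc, Fin.snoc_last]
      rw [← add_assoc]
      refine (hg a (m : ℝ)⁻¹).trans ?_
      have := mul_nonpos_of_nonneg_of_nonpos (inv_nonneg.2 hm'.le) ha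
      push_cast
      linarith
  obtain ⟨f, hf⟩ := key m
  refine ⟨f, ?_⟩
  have h1 : v + ∑ j, (m : ℝ)⁻¹ • (l1Vertex R (f j) - v) = vertexAverage R f := by
    rw [vertexAverage, ← Finset.smul_sum, Finset.sum_sub_distrib, smul_sub, Finset.sum_const,
      Finset.card_univ, Fintype.card_fin, ← Nat.cast_smul_eq_nsmul ℝ, smul_smul,
      inv_mul_cancel₀ hm'.ne', one_smul]
    abel
  rw [h1] at hf
  refine hf.trans_eq ?_
  field_simp

end Sparse

/-! ### The penalized convex problem -/

section Core

variable {p : ℕ}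

lemma l1Norm_eq_add (v : Fin (p + 1) → ℝ) : l1Norm v = |v 0| + ∑ j : Fin p, |v j.succ| :=
  Fin.sum_univ_succ _

/-- The penalty cannot decrease by more than the `l₁` mass on the support, and it grows by the mass
outside; the intercept, which is not penalized, counts as part of the support. -/
lemma penalty_sub_ge {β : Fin (p + 1) → ℝ} {s : ℕ} (hs : l0Norm β = s) (hs1 : 1 ≤ s)
    (v : Fin (p + 1) → ℝ) :
    l1Norm v - √5 * √s * l2Norm v ≤
      ∑ j : Fin p, |(β + v) j.succ| - ∑ j : Fin p, |β j.succ| := by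
  classical
  set S : Finset (Fin p) := Finset.univ.filter fun j => β j.succ ≠ 0 with hS
  have hcard : (S.card : ℝ) ≤ s := by
    have h1 : (S.map (Fin.succEmb p)).card ≤ l0Norm β := by
      rw [l0Norm, ← Set.ncard_coe_finset]
      refine Set.ncard_le_ncard (fun j hj => ?_) (Set.toFinite _)
      obtain ⟨i, hi, rfl⟩ := Finset.mem_map.1 (Finset.mem_coe.1 hj)
      exact (Finset.mem_filter.1 hi).2
    rw [Finset.card_map, hs] at h1
    exact_mod_cast h1
  have h1 : ∑ j : Fin p, |v j.succ| - 2 * ∑ j ∈ S, |v j.succ| ≤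
      ∑ j : Fin p, |(β + v) j.succ| - ∑ j : Fin p, |β j.succ| := by
    rw [hS, Finset.sum_filter, Finset.mul_sum, ← Finset.sum_sub_distrib, ← Finset.sum_sub_distrib]
    refine Finset.sum_le_sum fun j _ => ?_
    rw [Pi.add_apply]
    split_ifs with h
    · have := abs_sub_abs_le_abs_sub (β j.succ) (-v j.succ)
      rw [sub_neg_eq_add, abs_neg] at this
      linarith
    · rw [not_not.1 h]; simp
  have h2 : 2 * ∑ j ∈ S, |v j.succ| + |v 0| ≤ √5 * √s * l2Norm v := by
    have h3 := sum_abs_le_sqrt_card_mul (S.map (Fin.succEmb p)) v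
    rw [Finset.sum_map, Finset.sum_map, Finset.card_map] at h3
    simp only [Fin.coe_succEmb] at h3
    set A := ∑ j ∈ S, |v j.succ| with hA
    set B := ∑ j ∈ S, v j.succ ^ 2 with hB
    have hB0 : 0 ≤ B := Finset.sum_nonneg fun _ _ => sq_nonneg _
    have hA0 : 0 ≤ A := Finset.sum_nonneg fun _ _ => abs_nonneg _
    have h4 : B + v 0 ^ 2 ≤ l2Norm v ^ 2 := by
      rw [l2Norm_sq, Fin.sum_univ_succ, add_comm]
      gcongr
      exact Finset.sum_le_sum_of_subset_of_nonneg (Finset.subset_univ _)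
        fun _ _ _ => sq_nonneg _
    have h5 : A ^ 2 ≤ s * B := by
      calc A ^ 2 ≤ (√S.card * √B) ^ 2 := pow_le_pow_left₀ hA0 h3 2
        _ = S.card * B := by
          rw [mul_pow, Real.sq_sqrt (Nat.cast_nonneg _), Real.sq_sqrt hB0]
        _ ≤ s * B := by gcongr
    have hs1' : (1 : ℝ) ≤ s := by exact_mod_cast hs1
    refine abs_le_of_sq_le_sq' ?_ (by positivity [l2Norm_nonneg v]) |>.2
    rw [mul_pow, mul_pow, Real.sq_sqrt (by norm_num), Real.sq_sqrt (Nat.cast_nonneg _)]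
    have h6 : v 0 ^ 2 ≤ s * v 0 ^ 2 := le_mul_of_one_le_left (sq_nonneg _) hs1'
    have h7 : (s : ℝ) * (B + v 0 ^ 2) ≤ s * l2Norm v ^ 2 := by gcongr
    rw [← sq_abs (v 0)] at h6 h7
    nlinarith [sq_nonneg (A - 2 * |v 0|)]
  rw [l1Norm_eq_add]
  linarith

/-- The deterministic core: a convex loss with a first-order lower bound everywhere and a
second-order lower bound on the sphere of radius `r`, inside the cone, has penalized minimizers,
all of them within `r` of `β` and in the cone. -/
lemma penalized_minimizer {f : (Fin (p + 1) → ℝ) → ℝ} (hf : ConvexOn ℝ Set.univ f)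
    (hfc : Continuous f) {β : Fin (p + 1) → ℝ} {s : ℕ} (hs : l0Norm β = s) (hs1 : 1 ≤ s)
    {lam D κ C : ℝ} (hlam : 0 < lam) (hD : 0 ≤ D) (hκ : 0 < κ) (hC : 3 + 2 * D ≤ κ * C)
    (hlin : ∀ v, -(1 / 4 * lam * l1Norm v + (1 / 8 + 11 / 8 * D) * √s * lam * l2Norm v) ≤
      f (β + v) - f β)
    (hcurv : ∀ v, l2Norm v = C * √s * lam → l1Norm v ≤ (4 + 2 * D) * √s * l2Norm v →
      13 / 16 * κ * l2Norm v ^ 2 -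
        (1 / 4 * lam * l1Norm v + (1 / 8 + 11 / 8 * D) * √s * lam * l2Norm v) ≤
      f (β + v) - f β) :
    (∃ u, ∀ v, f u + lam * ∑ j : Fin p, |u j.succ| ≤ f v + lam * ∑ j : Fin p, |v j.succ|) ∧
    ∀ u, (∀ v, f u + lam * ∑ j : Fin p, |u j.succ| ≤ f v + lam * ∑ j : Fin p, |v j.succ|) →
      l2Norm (u - β) ≤ C * √s * lam ∧ l1Norm (u - β) ≤ (4 + 2 * D) * √s * l2Norm (u - β) := by
  have hs1' : (1 : ℝ) ≤ s := by exact_mod_cast hs1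
  have hsq : 0 < √(s : ℝ) := Real.sqrt_pos.2 (by linarith)
  have h5 : √5 ≤ (2237 / 1000 : ℝ) := Real.sqrt_le_iff.2 ⟨by norm_num, by norm_num⟩
  have hC0 : 0 < C := by
    by_contra h
    have := mul_nonpos_of_nonneg_of_nonpos hκ.le (not_lt.1 h)
    linarith
  set F : (Fin (p + 1) → ℝ) → ℝ := fun v => f v + lam * ∑ j : Fin p, |v j.succ| with hF
  have hFconv : ConvexOn ℝ Set.univ F := by
    refine hf.add ⟨convex_univ, fun x _ y _ a b ha hb _ => ?_⟩
    simp only [Pi.add_apply, Pi.smul_apply, smul_eq_mul]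
    have : ∑ j : Fin p, |a * x j.succ + b * y j.succ| ≤
        a * ∑ j : Fin p, |x j.succ| + b * ∑ j : Fin p, |y j.succ| := by
      rw [Finset.mul_sum, Finset.mul_sum, ← Finset.sum_add_distrib]
      refine Finset.sum_le_sum fun j _ => (abs_add_le _ _).trans_eq ?_
      rw [abs_mul, abs_mul, abs_of_nonneg ha, abs_of_nonneg hb]
    nlinarith
  have hFc : Continuous F := by fun_prop
  have hpen : ∀ v : Fin (p + 1) → ℝ, lam * (l1Norm v - √5 * √s * l2Norm v) ≤
      lam * ∑ j : Fin p, |(β + v) j.succ| - lam * ∑ j : Fin p, |β j.succ| := fun v => by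
    rw [← mul_sub]; exact mul_le_mul_of_nonneg_left (penalty_sub_ge hs hs1 v) hlam.le
  have hcone : ∀ v, F (β + v) ≤ F β → l1Norm v ≤ (4 + 2 * D) * √s * l2Norm v := fun v hv => by
    have h1 := hpen v
    have h2 := hlin v
    simp only [hF] at hv
    have h3 : lam * (3 / 4 * l1Norm v) ≤
        lam * ((√5 + (1 / 8 + 11 / 8 * D)) * √s * l2Norm v) := by nlinarith
    have h4 := le_of_mul_le_mul_left h3 hlam
    have hnn : 0 ≤ √(s : ℝ) * l2Norm v := mul_nonneg hsq.le (l2Norm_nonneg v)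
    nlinarith [mul_nonneg hD hnn]
  set r := C * √s * lam with hr
  have hr0 : 0 < r := by positivity
  have hsphere : ∀ v, l2Norm v = r → F β < F (β + v) := fun v hv => by
    by_contra hle
    rw [not_lt] at hle
    have h1 := hpen v
    have h2 := hcurv v hv (hcone v hle)
    simp only [hF] at hle
    have h3 : 13 / 16 * κ * r ^ 2 ≤ lam * (√5 + (1 / 8 + 11 / 8 * D)) * √s * r := by
      have := mul_nonneg hlam.le (l1Norm_nonneg v)
      rw [hv] at h1 h2
      nlinarith
    have h4 : 13 / 16 * κ * r ^ 2 = 13 / 16 * (κ * C) * (lam * √s * r) := by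
      rw [hr]; ring
    have h5' : lam * √s * r > 0 := by positivity
    rw [h4] at h3
    have h6 : (√5 + (1 / 8 + 11 / 8 * D)) < 13 / 16 * (κ * C) := by nlinarith
    nlinarith
  -- by convexity, the strict increase on the sphere extends to its exterior
  have hout : ∀ v, r < l2Norm v → F β < F (β + v) := fun v hv => by
    have hv0 : 0 < l2Norm v := hr0.trans hv
    have hθ : r / l2Norm v < 1 := (div_lt_one hv0).2 hv
    have h1 := hsphere ((r / l2Norm v) • v) (by
      rw [l2Norm_smul, abs_of_pos (by positivity), div_mul_cancel₀ _ hv0.ne'])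
    have h2 := hFconv.2 (Set.mem_univ β) (Set.mem_univ (β + v))
      (sub_nonneg.2 hθ.le) (by positivity : 0 ≤ r / l2Norm v) (by ring)
    have h3 : (1 - r / l2Norm v) • β + (r / l2Norm v) • (β + v) = β + (r / l2Norm v) • v := by
      rw [smul_add, ← add_assoc, ← add_smul, sub_add_cancel, one_smul]
    rw [h3, smul_eq_mul, smul_eq_mul] at h2
    have h4 : (r / l2Norm v) * F β < (r / l2Norm v) * F (β + v) := by linarith
    exact lt_of_mul_lt_mul_left h4 (by positivity)
  refine ⟨?_, fun u hu => ?_⟩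
  · obtain ⟨u, hu, humin⟩ := (isCompact_l2Ball β r).exists_isMinOn
      ⟨β, by simp only [Set.mem_ofPred_eq, sub_self, l2Norm_zero]; exact hr0.le⟩
      hFc.continuousOn
    refine ⟨u, fun v => ?_⟩
    change F u ≤ F v
    rcases le_or_gt (l2Norm (v - β)) r with hv | hv
    · exact humin hv
    · refine (humin (show l2Norm (β - β) ≤ r by
        rw [sub_self, l2Norm_zero]; exact hr0.le)).trans ?_
      have := (hout _ hv).le
      rwa [add_sub_cancel] at this
  · have h1 : F (β + (u - β)) ≤ F β := by rw [add_sub_cancel]; exact hu β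
    refine ⟨?_, hcone _ h1⟩
    by_contra h
    exact absurd (hout _ (not_le.1 h)) (not_lt.2 h1)

end Core

/-! ### Lower bound for the empirical curvature -/

section LowerDeterministic

variable {ι : Type*} {q : ℕ}

/-- A bound on the diagonal of a Gram matrix controls its quadratic form in the `l₁` norm. -/
lemma sum_dotProduct_sq_le {S : Finset ι} {X : ι → Fin q → ℝ} {B : ℝ}
    (hB : ∀ j, ∑ i ∈ S, X i j ^ 2 ≤ B) (u : Fin q → ℝ) :
    ∑ i ∈ S, (X i ⬝ᵥ u) ^ 2 ≤ B * l1Norm u ^ 2 := by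
  have h1 : ∀ i, (X i ⬝ᵥ u) ^ 2 ≤ l1Norm u * ∑ j, |u j| * X i j ^ 2 := fun i =>
    Finset.sum_sq_le_sum_mul_sum_of_sq_le_mul _ (fun j _ => abs_nonneg (u j))
      (fun j _ => mul_nonneg (abs_nonneg (u j)) (sq_nonneg _)) fun j _ => by
        rw [mul_pow, ← sq_abs (u j)]; exact le_of_eq (by ring)
  calc ∑ i ∈ S, (X i ⬝ᵥ u) ^ 2 ≤ ∑ i ∈ S, l1Norm u * ∑ j, |u j| * X i j ^ 2 :=
        Finset.sum_le_sum fun i _ => h1 i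
    _ = l1Norm u * ∑ j, |u j| * ∑ i ∈ S, X i j ^ 2 := by
        rw [← Finset.mul_sum, Finset.sum_comm]
        simp only [Finset.mul_sum]
    _ ≤ l1Norm u * ∑ j, |u j| * B := by
        gcongr with j
        · exact l1Norm_nonneg u
        · exact hB j
    _ = B * l1Norm u ^ 2 := by rw [← Finset.sum_mul, sq]; unfold l1Norm; ring

/-- Passing from averages of `k` vertices of the `l₁` ball to its whole intersection with a
Euclidean sphere. The penalty `‖z - v‖²` in the greedy step keeps the approximating average `z`
at a distance from `v` that costs little curvature. -/
lemma lower_of_vertexAverage [NeZero q] {S : Finset ι} {X : ι → Fin q → ℝ} {w : ι → ℝ}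
    {ω₀ α N B T r R : ℝ} {k : ℕ} (hω : 0 ≤ ω₀) (hw : ∀ i, 0 ≤ w i ∧ w i ≤ ω₀)
    (hα : 0 < α) (hr : 0 < r)
    (hcard : (S.card : ℝ) ≤ N) (hk : 0 < k)
    (hkR : 4 * R ^ 2 * (ω₀ * B + 112 * α) / k ≤ α * r ^ 2 / 32)
    (hdiag : ∀ j, ∑ i ∈ S, X i j ^ 2 ≤ B * N)
    (hgrid : ∀ f : Fin k → Fin q × Bool, l2Norm (vertexAverage R f) ≤ 2 * r →
      S.card * (7 / 4 * α * l2Norm (vertexAverage R f) ^ 2 - α * r ^ 2 / 32) -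
        N * (α * r ^ 2 / 32) ≤ ∑ i ∈ S, w i * truncSq T (X i ⬝ᵥ vertexAverage R f))
    {v : Fin q → ℝ} (hv2 : l2Norm v = r) (hv1 : l1Norm v ≤ R) :
    (27 / 16 * S.card - N / 16) * (α * r ^ 2) ≤ ∑ i ∈ S, w i * truncSq T (X i ⬝ᵥ v) := by
  have hn0 : (0 : ℝ) ≤ S.card := Nat.cast_nonneg _
  have hN0 : 0 ≤ N := hn0.trans hcard
  have hR : 0 ≤ R := (l1Norm_nonneg v).trans hv1
  -- the penalty `112 α N ‖z - v‖²` pays for `‖z‖ < ‖v‖` in the bound at the average `z`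
  set Φ : (Fin q → ℝ) → ℝ := fun z =>
    ∑ i ∈ S, w i * truncSq T (X i ⬝ᵥ z) + N * (112 * α) * l2Norm (z - v) ^ 2 with hΦ
  obtain ⟨f, hf⟩ := exists_vertexAverage_le (c := N * (4 * R ^ 2 * (ω₀ * B + 112 * α)))
    (Φ := Φ) hv1 (fun z => by
      choose g hg using fun i => exists_truncSq_add_le T (X i ⬝ᵥ z)
      refine ⟨∑ i ∈ S, (w i * g i) • X i + (N * (112 * α) * 2) • (z - v), fun a ε => ?_⟩
      set d := l1Vertex R a - v with hd
      have hd1 : l1Norm d ^ 2 ≤ 4 * R ^ 2 := by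
        have h1 : l1Norm d ≤ 2 * R := by
          have := l1Norm_sub_le (l1Vertex R a) v
          rw [l1Norm_l1Vertex hR] at this
          linarith
        nlinarith [l1Norm_nonneg d]
      have hd2 : l2Norm d ^ 2 ≤ 4 * R ^ 2 :=
        (pow_le_pow_left₀ (l2Norm_nonneg d) (l2Norm_le_l1Norm d) 2).trans hd1
      have h1 : ∑ i ∈ S, w i * truncSq T (X i ⬝ᵥ (z + ε • d)) ≤
          ∑ i ∈ S, (w i * truncSq T (X i ⬝ᵥ z) + ε * ((w i * g i) * (X i ⬝ᵥ d)) +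
            ε ^ 2 * (ω₀ * (X i ⬝ᵥ d) ^ 2)) := Finset.sum_le_sum fun i _ => by
        rw [dotProduct_add, dotProduct_smul, smul_eq_mul]
        have h2 := mul_le_mul_of_nonneg_left (hg i (ε * (X i ⬝ᵥ d))) (hw i).1
        have h3 := mul_le_mul_of_nonneg_right (hw i).2 (sq_nonneg (ε * (X i ⬝ᵥ d)))
        linarith
      rw [Finset.sum_add_distrib, Finset.sum_add_distrib, ← Finset.mul_sum, ← Finset.mul_sum,
        ← Finset.mul_sum] at h1
      have h2 : l2Norm (z + ε • d - v) ^ 2 =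
          l2Norm (z - v) ^ 2 + 2 * ε * ((z - v) ⬝ᵥ d) + ε ^ 2 * l2Norm d ^ 2 := by
        rw [show z + ε • d - v = (z - v) + ε • d by abel]
        simp only [← dotProduct_self_eq_l2Norm_sq, dotProduct_add, add_dotProduct,
          dotProduct_smul, smul_dotProduct, smul_eq_mul]
        rw [dotProduct_comm d (z - v)]
        ring
      have h3 : (∑ i ∈ S, (w i * g i) • X i + (N * (112 * α) * 2) • (z - v)) ⬝ᵥ d =
          ∑ i ∈ S, (w i * g i) * (X i ⬝ᵥ d) + N * (112 * α) * 2 * ((z - v) ⬝ᵥ d) := by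
        rw [add_dotProduct, sum_dotProduct, smul_dotProduct, smul_eq_mul]
        simp only [smul_dotProduct, smul_eq_mul]
      have hBN : 0 ≤ B * N :=
        (Finset.sum_nonneg fun _ _ => sq_nonneg _).trans (hdiag ⟨0, Nat.pos_of_neZero q⟩)
      have h4 := sum_dotProduct_sq_le hdiag d
      have h5 := mul_le_mul_of_nonneg_left (h4.trans (mul_le_mul_of_nonneg_left hd1 hBN))
        (show 0 ≤ ε ^ 2 * ω₀ by positivity)
      have h6 := mul_le_mul_of_nonneg_left hd2
        (show 0 ≤ N * (112 * α) * ε ^ 2 by positivity)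
      simp only [hΦ]
      rw [h2, h3]
      linarith) hk
  set z := vertexAverage R f with hz
  have hΦv : Φ v = ∑ i ∈ S, w i * truncSq T (X i ⬝ᵥ v) := by
    simp only [hΦ]
    rw [sub_self, l2Norm_zero]; ring
  rw [hΦv] at hf
  have hf' : Φ z ≤ ∑ i ∈ S, w i * truncSq T (X i ⬝ᵥ v) + N * (α * r ^ 2 / 32) := by
    refine hf.trans ?_
    rw [mul_div_assoc]
    gcongr
  simp only [hΦ] at hf'
  set δ := l2Norm (z - v) with hδ
  have hδ0 : 0 ≤ δ := l2Norm_nonneg _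
  have hr2 : 0 < α * r ^ 2 := by positivity
  -- a distance over `r` makes the penalty alone exceed the asserted bound
  rcases lt_or_ge r δ with h | h
  · have h1 : 0 ≤ ∑ i ∈ S, w i * truncSq T (X i ⬝ᵥ z) :=
      Finset.sum_nonneg fun i _ => mul_nonneg (hw i).1 (truncSq_nonneg _ _)
    have h2 : r ^ 2 ≤ δ ^ 2 := pow_le_pow_left₀ hr.le h.le 2
    have h3 := mul_le_mul_of_nonneg_left h2 (show 0 ≤ N * (112 * α) by positivity)
    nlinarith [mul_nonneg (sub_nonneg.2 hcard) hr2.le, mul_nonneg hN0 hr2.le]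
  · have h1 : l2Norm z ≤ 2 * r := by
      have := l2Norm_add_le (z - v) v
      rw [sub_add_cancel] at this
      linarith
    have h2 : r - δ ≤ l2Norm z := by
      have := l2Norm_add_le (v - z) z
      rw [sub_add_cancel, ← l2Norm_neg (v - z), neg_sub] at this
      linarith
    have h3 := hgrid f h1
    have h4 : (r - δ) ^ 2 ≤ l2Norm z ^ 2 := pow_le_pow_left₀ (sub_nonneg.2 h) h2 2
    have h5 : 63 / 64 * r ^ 2 ≤ l2Norm z ^ 2 + 64 * δ ^ 2 := by
      nlinarith [sq_nonneg (r - 64 * δ)]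
    have h6 := mul_le_mul_of_nonneg_left h5 (mul_nonneg hn0 hα.le)
    have h7 := mul_le_mul_of_nonneg_right hcard (show 0 ≤ 112 * α * δ ^ 2 by positivity)
    nlinarith [mul_nonneg hn0 hr2.le, mul_nonneg hN0 hr2.le]

end LowerDeterministic

section LowerProbability

variable {p : ℕ} [NeZero p] {P : Measure (Obs p)} [IsProbabilityMeasure P]
  {β : Fin (p + 1) → ℝ} {K : ℝ → ℝ} {Cf ν₀ c₁ c₂ M c C a₁ a₂ τ h r : ℝ}

/-- The curvature contributed by one observation in the direction `z`. -/
def curvTerm (K : ℝ → ℝ) (h : ℝ) (β z : Fin (p + 1) → ℝ) (o : Obs p) : ℝ :=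
  curvWeight K h (margin β o) * truncSq (h / 16) (aug o.1 ⬝ᵥ z)

omit [NeZero p] in
lemma measurable_curvTerm (z : Fin (p + 1) → ℝ) : Measurable (curvTerm K h β z) :=
  ((measurable_curvWeight K h).comp (measurable_margin β)).mul
    ((measurable_truncSq _).comp (measurable_aug_dot z))

omit [NeZero p] in
lemma curvTerm_nonneg (hK : KernelAssumption K) (hh : 0 < h) (z : Fin (p + 1) → ℝ) (o : Obs p) :
    0 ≤ curvTerm K h β z o :=
  mul_nonneg (curvWeight_nonneg hK hh _) (truncSq_nonneg _ _)

omit [NeZero p] in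
lemma curvTerm_le (hK : KernelAssumption K) (hh : 0 < h) (z : Fin (p + 1) → ℝ) (o : Obs p) :
    curvTerm K h β z o ≤ kappaLow K / h * (aug o.1 ⬝ᵥ z) ^ 2 :=
  mul_le_mul (curvWeight_le hK hh _) (truncSq_le_sq _ _) (truncSq_nonneg _ _)
    (div_nonneg hK.low_pos.le hh.le)

omit [NeZero p] [IsProbabilityMeasure P] in
lemma integrable_curvTerm (hK : KernelAssumption K) (hh : 0 < h) (hτ : 0 < τ)
    (hE : ExpSquareBound P τ) (z : Fin (p + 1) → ℝ) : Integrable (curvTerm K h β z) P := by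
  refine ((hE.integral_sq hτ z).1.const_mul (kappaLow K / h)).mono'
    (measurable_curvTerm z).aestronglyMeasurable (ae_of_all _ fun o => ?_)
  rw [Real.norm_of_nonneg (curvTerm_nonneg hK hh z o)]
  exact curvTerm_le hK hh z o

omit [NeZero p] [IsProbabilityMeasure P] in
lemma integral_curvTerm_sq_le (hK : KernelAssumption K) (hh : 0 < h) (hτ : 0 < τ)
    (hE : ExpSquareBound P τ) (z : Fin (p + 1) → ℝ) :
    Integrable (fun o => curvTerm K h β z o ^ 2) P ∧ ∫ o, curvTerm K h β z o ^ 2 ∂P ≤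
      (kappaLow K / h) ^ 2 * (6 * τ ^ 2 * l2Norm z ^ 4) := by
  obtain ⟨hi, hb⟩ := hE.integral_fourth hτ z
  have hle : ∀ o : Obs p, curvTerm K h β z o ^ 2 ≤
      (kappaLow K / h) ^ 2 * (aug o.1 ⬝ᵥ z) ^ 4 := fun o => by
    refine (pow_le_pow_left₀ (curvTerm_nonneg hK hh z o) (curvTerm_le hK hh z o) 2).trans_eq ?_
    ring
  have hi' := hi.const_mul ((kappaLow K / h) ^ 2)
  have hi2 : Integrable (fun o => curvTerm K h β z o ^ 2) P := by
    refine hi'.mono' ((measurable_curvTerm z).pow_const 2).aestronglyMeasurable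
      (ae_of_all _ fun o => ?_)
    rw [Real.norm_of_nonneg (sq_nonneg _)]
    exact hle o
  refine ⟨hi2, (integral_mono hi2 hi' hle).trans ?_⟩
  rw [integral_const_mul]
  gcongr

/-- Expected curvature: the window of the weight makes it a uniformly smoothed Hessian, and the
truncation only costs a fourth moment. -/
lemma le_integral_curvTerm (hK : KernelAssumption K)
    (hM : ModelAssumption P β Cf ν₀ c₁ c₂ M c C a₁ a₂) (hc : 0 < c) (hCf : 0 < Cf) (hτ : 0 < τ)
    (hE : ExpSquareBound P τ) (hh : 0 < h) (hsmall : 392 * smoothConst Cf c τ * h ≤ a₁)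
    (hr : 1572864 * τ ^ 2 * r ^ 2 ≤ a₁ * h ^ 3) {z : Fin (p + 1) → ℝ} (hz : l2Norm z ≤ 2 * r) :
    7 / 4 * (kappaLow K * a₁) * l2Norm z ^ 2 - kappaLow K * a₁ * r ^ 2 / 32 ≤
      ∫ o, curvTerm K h β z o ∂P := by
  obtain ⟨D, hD, hD1, -⟩ := hM.hessian
  have hκ := hK.low_pos
  have hh8 : 0 < 7 / 8 * h := by positivity
  obtain ⟨hi2, -⟩ := hE.integral_sq hτ z
  obtain ⟨hi4, hb4⟩ := hE.integral_fourth hτ z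
  have hquad := abs_integral_kernel_sub_hessian_le hM hc hCf hτ hE hD
    (measurable_unifKernel (7 / 8 * h)) (abs_unifKernel_le hh8) (integrable_unifKernel _)
    (integral_unifKernel hh8) (integrable_abs_mul_unifKernel hh8) z
  have hSC : 0 ≤ smoothConst Cf c τ := by unfold smoothConst; positivity
  have hz0 := l2Norm_nonneg z
  have hz2 : l2Norm z ^ 2 ≤ 4 * r ^ 2 := by nlinarith
  have hz4 : l2Norm z ^ 4 ≤ 16 * r ^ 4 := by
    have := pow_le_pow_left₀ (sq_nonneg (l2Norm z)) hz2 2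
    nlinarith
  have hlow := minEig_mul_le_dotProduct_mulVec hD.isHermitian z
  have hI1 := integral_abs_mul_unifKernel_le hh8
  have hq1 : a₁ * l2Norm z ^ 2 - smoothConst Cf c τ * (7 / 8 * h) * (4 * r ^ 2) ≤
      ∫ o, unifKernel (7 / 8 * h) (1 - margin β o) * (aug o.1 ⬝ᵥ z) ^ 2 ∂P := by
    have h1 := (abs_le.1 hquad).1
    have h2 : smoothConst Cf c τ * (∫ u, |u| * |unifKernel (7 / 8 * h) u|) * l2Norm z ^ 2 ≤
        smoothConst Cf c τ * (7 / 8 * h) * (4 * r ^ 2) := by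
      gcongr
    have h3 := mul_le_mul_of_nonneg_right hD1 (sq_nonneg (l2Norm z))
    linarith
  have hint : Integrable (fun o : Obs p =>
      unifKernel (7 / 8 * h) (1 - margin β o) * (aug o.1 ⬝ᵥ z) ^ 2) P := by
    refine (hi2.const_mul ((2 * (7 / 8 * h))⁻¹)).mono'
      (((measurable_unifKernel _).comp ((measurable_margin β).const_sub 1)).mul
        ((measurable_aug_dot z).pow_const 2)).aestronglyMeasurable (ae_of_all _ fun o => ?_)
    rw [norm_mul, Real.norm_eq_abs, Real.norm_of_nonneg (sq_nonneg _)]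
    gcongr
    exact abs_unifKernel_le hh8 _
  -- truncation at the level `h / 16` costs at most a multiple of the fourth power
  have hpt : ∀ o : Obs p, 7 / 4 * kappaLow K *
      (unifKernel (7 / 8 * h) (1 - margin β o) * (aug o.1 ⬝ᵥ z) ^ 2) -
        kappaLow K / h * (256 / h ^ 2) * (aug o.1 ⬝ᵥ z) ^ 4 ≤ curvTerm K h β z o := fun o => by
    have h1 := mul_le_mul_of_nonneg_left
      (sq_sub_le_truncSq (show 0 < h / 16 by positivity) (aug o.1 ⬝ᵥ z))
      (curvWeight_nonneg hK hh (margin β o))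
    have h2 := mul_le_mul_of_nonneg_right (curvWeight_le hK hh (margin β o))
      (show 0 ≤ (aug o.1 ⬝ᵥ z) ^ 4 / (h / 16) ^ 2 by positivity)
    have h3 : kappaLow K / h * ((aug o.1 ⬝ᵥ z) ^ 4 / (h / 16) ^ 2) =
        kappaLow K / h * (256 / h ^ 2) * (aug o.1 ⬝ᵥ z) ^ 4 := by field_simp; ring
    rw [mul_sub, curvWeight_eq hh] at h1
    rw [curvWeight_eq hh, h3] at h2
    rw [curvTerm, curvWeight_eq hh]
    linarith
  have hmain := integral_mono ((hint.const_mul (7 / 4 * kappaLow K)).sub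
    (hi4.const_mul (kappaLow K / h * (256 / h ^ 2)))) (integrable_curvTerm hK hh hτ hE z) hpt
  simp only [Pi.sub_apply] at hmain
  rw [integral_sub (hint.const_mul _) (hi4.const_mul _), integral_const_mul,
    integral_const_mul] at hmain
  have h4 : kappaLow K / h * (256 / h ^ 2) * ∫ o, (aug o.1 ⬝ᵥ z) ^ 4 ∂P ≤
      kappaLow K * a₁ * r ^ 2 / 64 := by
    calc kappaLow K / h * (256 / h ^ 2) * ∫ o, (aug o.1 ⬝ᵥ z) ^ 4 ∂P
        ≤ kappaLow K / h * (256 / h ^ 2) * (6 * τ ^ 2 * (16 * r ^ 4)) := by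
          gcongr
          exact hb4.trans (by gcongr)
      _ = kappaLow K * r ^ 2 / (64 * h ^ 3) * (1572864 * τ ^ 2 * r ^ 2) := by field_simp; ring
      _ ≤ kappaLow K * r ^ 2 / (64 * h ^ 3) * (a₁ * h ^ 3) := by gcongr
      _ = kappaLow K * a₁ * r ^ 2 / 64 := by field_simp
  have h5 := mul_le_mul_of_nonneg_left hq1 (show 0 ≤ 7 / 4 * kappaLow K by positivity)
  have h6 := mul_le_mul_of_nonneg_right hsmall (show 0 ≤ kappaLow K * r ^ 2 by positivity)
  linarith

variable {Ω ι : Type*} [MeasurableSpace Ω] {μ : Measure Ω} [IsProbabilityMeasure μ]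
  {O : ι → Ω → Obs p}

omit [NeZero p] [IsProbabilityMeasure P] in
/-- Squares of the features have bounded averages. -/
lemma measure_sum_sq_gt_le (hτ : 0 < τ) (hE : ExpSquareBound P τ)
    (hlaw : ∀ i, HasLaw (O i) P μ) (hind : iIndepFun O μ) (S : Finset ι) {N : ℝ}
    (hcard : (S.card : ℝ) ≤ N) :
    μ {ω | ∃ j, 3 * τ * N < ∑ i ∈ S, aug (O i ω).1 j ^ 2} ≤
      ENNReal.ofReal ((p + 1 : ℕ) * Real.exp (-N)) := by
  have h1 : ∀ j : Fin (p + 1), μ {ω | 3 * τ * N ≤ ∑ i ∈ S, aug (O i ω).1 j ^ 2} ≤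
      ENNReal.ofReal (Real.exp (-N)) := fun j => by
    obtain ⟨hi, h3⟩ := hE.coord j
    have heq : ∀ o : Obs p, Real.exp (τ⁻¹ * aug o.1 j ^ 2) = Real.exp (aug o.1 j ^ 2 / τ) :=
      fun o => by rw [div_eq_inv_mul]
    refine (measure_le_sum_le_exp hlaw hind (g := fun _ o => aug o.1 j ^ 2)
      (fun _ => (measurable_aug_apply j).pow_const 2) S (inv_nonneg.2 hτ.le) (c := fun _ => 2)
      (fun _ _ => by simpa only [heq] using hi) (fun _ _ => ?_) (3 * τ * N)).trans ?_
    · simp only [heq]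
      have := Real.add_one_le_exp (2 : ℝ)
      linarith
    · refine ENNReal.ofReal_le_ofReal (Real.exp_le_exp.2 ?_)
      rw [Finset.sum_const, nsmul_eq_mul]
      have : -τ⁻¹ * (3 * τ * N) = -3 * N := by field_simp
      rw [this]
      linarith
  calc μ {ω | ∃ j, 3 * τ * N < ∑ i ∈ S, aug (O i ω).1 j ^ 2}
      ≤ μ (⋃ j, {ω | 3 * τ * N ≤ ∑ i ∈ S, aug (O i ω).1 j ^ 2}) :=
        measure_mono fun ω ⟨j, hj⟩ => Set.mem_iUnion.2 ⟨j, le_of_lt hj⟩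
    _ ≤ ∑ j : Fin (p + 1), μ {ω | 3 * τ * N ≤ ∑ i ∈ S, aug (O i ω).1 j ^ 2} :=
        measure_iUnion_fintype_le _ _
    _ ≤ ∑ _j : Fin (p + 1), ENNReal.ofReal (Real.exp (-N)) := Finset.sum_le_sum fun j _ => h1 j
    _ = ENNReal.ofReal ((p + 1 : ℕ) * Real.exp (-N)) := by
        rw [Finset.sum_const, Finset.card_univ, Fintype.card_fin, nsmul_eq_mul,
          ENNReal.ofReal_mul (Nat.cast_nonneg _), ENNReal.ofReal_natCast]

/-- Uniform lower bound for the empirical curvature on a Euclidean sphere within an `l₁` ball: a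
union bound over the averages of `k` vertices of the `l₁` ball. -/
lemma measure_curvature_lt_le (hK : KernelAssumption K)
    (hM : ModelAssumption P β Cf ν₀ c₁ c₂ M c C a₁ a₂) (hc : 0 < c) (hCf : 0 < Cf)
    (ha₁ : 0 < a₁) (hτ : 0 < τ)
    (hE : ExpSquareBound P τ) (hh : 0 < h) (hsmall : 392 * smoothConst Cf c τ * h ≤ a₁)
    (hr0 : 0 < r) (hr : 1572864 * τ ^ 2 * r ^ 2 ≤ a₁ * h ^ 3)
    (hlaw : ∀ i, HasLaw (O i) P μ) (hind : iIndepFun O μ) (S : Finset ι) {N R : ℝ} (hN : 0 < N)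
    (hcard : (S.card : ℝ) ≤ N) {k : ℕ} (hk : 0 < k)
    (hkR : 128 * R ^ 2 * (3 * τ / h + 112 * a₁) ≤ a₁ * r ^ 2 * k) :
    μ {ω | ∃ v, l2Norm v = r ∧ l1Norm v ≤ R ∧
      ∑ i ∈ S, curvTerm K h β v (O i ω) <
        (27 / 16 * S.card - N / 16) * (kappaLow K * a₁ * r ^ 2)} ≤
      ENNReal.ofReal ((p + 1 : ℕ) * Real.exp (-N) +
        (2 * (p + 1 : ℕ)) ^ k * Real.exp (-(N * a₁ ^ 2 * h ^ 2) / (196608 * τ ^ 2))) := by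
  have hκ := hK.low_pos
  set α := kappaLow K * a₁ with hα
  have hα0 : 0 < α := by positivity
  set V : ℝ := (kappaLow K / h) ^ 2 * (6 * τ ^ 2 * (16 * r ^ 4)) with hV
  have hV0 : 0 < V := by positivity
  set a : ℝ := N * (α * r ^ 2 / 32) with ha
  have hkk : (0 : ℝ) < k := by exact_mod_cast hk
  -- a lower tail bound at each point `z`, whose curvature has second moment at most `V`
  have hpt : ∀ z : Fin (p + 1) → ℝ, l2Norm z ≤ 2 * r →
      μ {ω | ∑ i ∈ S, curvTerm K h β z (O i ω) ≤
        S.card * (7 / 4 * α * l2Norm z ^ 2 - α * r ^ 2 / 32) - a} ≤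
      ENNReal.ofReal (Real.exp (-(N * a₁ ^ 2 * h ^ 2) / (196608 * τ ^ 2))) := fun z hz => by
    obtain ⟨hi2, hb2⟩ := integral_curvTerm_sq_le (β := β) hK hh hτ hE z
    have hz4 : l2Norm z ^ 4 ≤ 16 * r ^ 4 := by
      have := pow_le_pow_left₀ (l2Norm_nonneg z) hz 4
      nlinarith
    have h1 := measure_sum_le_sub_le hlaw hind (g := fun _ => curvTerm K h β z)
      (fun _ => measurable_curvTerm z) S hN hcard hV0 (a := a) (by positivity)
      (fun _ _ => curvTerm_nonneg hK hh z) (fun _ _ => integrable_curvTerm hK hh hτ hE z)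
      (fun _ _ => hi2) (fun _ _ => hb2.trans (by rw [hV]; gcongr))
    rw [Finset.sum_const, nsmul_eq_mul] at h1
    refine (measure_mono fun ω hω => ?_).trans (h1.trans_eq ?_)
    · rw [Set.mem_ofPred_eq] at hω ⊢
      refine hω.trans ?_
      have := mul_le_mul_of_nonneg_left (le_integral_curvTerm hK hM hc hCf hτ hE hh hsmall hr hz)
        (Nat.cast_nonneg (α := ℝ) S.card)
      linarith
    · congr 2
      rw [ha, hV, hα]
      field_simp
      ring
  set J := Fin (p + 1) × Bool
  set G : (Fin k → J) → Set Ω := fun f => {ω | l2Norm (vertexAverage R f) ≤ 2 * r ∧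
    ∑ i ∈ S, curvTerm K h β (vertexAverage R f) (O i ω) ≤
        S.card * (7 / 4 * α * l2Norm (vertexAverage R f) ^ 2 - α * r ^ 2 / 32) - a} with hG
  have hGm : μ (⋃ f, G f) ≤ ENNReal.ofReal ((2 * (p + 1 : ℕ)) ^ k *
      Real.exp (-(N * a₁ ^ 2 * h ^ 2) / (196608 * τ ^ 2))) := by
    refine (measure_iUnion_fintype_le _ _).trans ((Finset.sum_le_sum fun f _ =>
      (show μ (G f) ≤ ENNReal.ofReal (Real.exp (-(N * a₁ ^ 2 * h ^ 2) / (196608 * τ ^ 2))) from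
      ?_)).trans_eq ?_)
    · by_cases hf : l2Norm (vertexAverage R f) ≤ 2 * r
      · exact (measure_mono fun ω hω => hω.2).trans (hpt _ hf)
      · have : G f = ∅ := Set.eq_empty_of_forall_notMem fun ω hω => hf hω.1
        rw [this, measure_empty]; exact zero_le
    · rw [Finset.sum_const, Finset.card_univ, Fintype.card_fun, Fintype.card_fin,
        Fintype.card_prod, Fintype.card_bool, Fintype.card_fin, nsmul_eq_mul,
        ENNReal.ofReal_mul (by positivity), mul_comm (p + 1) 2]
      congr 1
      rw [← ENNReal.ofReal_natCast]
      push_cast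
      rfl
  rw [ENNReal.ofReal_add (by positivity) (by positivity)]
  refine (measure_mono ?_).trans ((measure_union_le _ _).trans
    (add_le_add (measure_sum_sq_gt_le hτ hE hlaw hind S hcard) hGm))
  rintro ω ⟨v, hv2, hv1, hlt⟩
  by_contra hω
  simp only [Set.mem_union, Set.mem_iUnion, hG, Set.mem_ofPred_eq, not_or, not_exists, not_and,
    not_lt, not_le] at hω
  obtain ⟨hω1, hω2⟩ := hω
  refine absurd hlt (not_lt.2 ?_)
  refine lower_of_vertexAverage (X := fun i => aug (O i ω).1)
    (w := fun i => curvWeight K h (margin β (O i ω))) (B := 3 * τ) (ω₀ := kappaLow K / h)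
    (div_nonneg hκ.le hh.le) (fun i => ⟨curvWeight_nonneg hK hh _, curvWeight_le hK hh _⟩)
    hα0 hr0 hcard hk ?_ hω1 (fun f hf => ?_) hv2 hv1
  · rw [div_le_iff₀ hkk]
    have := mul_le_mul_of_nonneg_left hkR hκ.le
    have h2 : 4 * R ^ 2 * (kappaLow K / h * (3 * τ) + 112 * α) =
        kappaLow K * (128 * R ^ 2 * (3 * τ / h + 112 * a₁)) / 32 := by
      rw [hα]; field_simp; ring
    rw [h2, hα]
    linarith
  · exact (hω2 f hf).le

end LowerProbability

/-! ### Uniform deviations of gradients and weighted Gram matrices -/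

section Deviations

variable {p : ℕ} {P : Measure (Obs p)} [IsProbabilityMeasure P]
  {β : Fin (p + 1) → ℝ} {K : ℝ → ℝ} {τ h a N : ℝ}
  {Ω ι : Type*} [MeasurableSpace Ω] {μ : Measure Ω} [IsProbabilityMeasure μ]
  {O : ι → Ω → Obs p}

/-- The derivative of the smoothed loss of one observation in the direction `v`. -/
def slopeTerm (K : ℝ → ℝ) (h : ℝ) (β v : Fin (p + 1) → ℝ) (o : Obs p) : ℝ :=
  smoothSlope K h (margin β o) * (o.2 * (aug o.1 ⬝ᵥ v))

lemma measurable_slopeTerm (hK : KernelAssumption K) (v : Fin (p + 1) → ℝ) :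
    Measurable (slopeTerm K h β v) :=
  ((measurable_smoothSlope hK).comp (measurable_margin β)).mul
    (measurable_snd.mul (measurable_aug_dot v))

omit [IsProbabilityMeasure P] in
lemma abs_slopeTerm_le (hK : KernelAssumption K) (hresp : ∀ᵐ o ∂P, o.2 = 1 ∨ o.2 = -1)
    (v : Fin (p + 1) → ℝ) : ∀ᵐ o ∂P, |slopeTerm K h β v o| ≤ |aug o.1 ⬝ᵥ v| := by
  filter_upwards [hresp] with o ho
  have h1 : |o.2| = 1 := by rcases ho with h | h <;> simp [h]
  rw [slopeTerm, abs_mul, abs_mul, h1, one_mul]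
  exact mul_le_of_le_one_left (abs_nonneg _) (abs_smoothSlope_le hK _)

lemma slopeTerm_eq_sum (v : Fin (p + 1) → ℝ) (o : Obs p) :
    slopeTerm K h β v o = ∑ j, v j * slopeTerm K h β (Pi.single j 1) o := by
  simp only [slopeTerm, dotProduct_single_one]
  rw [dotProduct, Finset.mul_sum, Finset.mul_sum]
  exact Finset.sum_congr rfl fun j _ => by ring

lemma integrable_slopeTerm (hK : KernelAssumption K) (hresp : ∀ᵐ o ∂P, o.2 = 1 ∨ o.2 = -1)
    (hτ : 0 < τ) (hE : ExpSquareBound P τ) (v : Fin (p + 1) → ℝ) :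
    Integrable (slopeTerm K h β v) P := by
  refine ((integrable_const (1 : ℝ)).add (hE.integral_sq hτ v).1).mono'
    (measurable_slopeTerm hK v).aestronglyMeasurable ?_
  filter_upwards [abs_slopeTerm_le hK hresp v] with o ho
  rw [Real.norm_eq_abs, Pi.add_apply, ← sq_abs (aug o.1 ⬝ᵥ v)]
  nlinarith [sq_nonneg (|aug o.1 ⬝ᵥ v| - 1), abs_nonneg (aug o.1 ⬝ᵥ v)]

/-- The empirical gradient deviates from its mean by at most `a` in every coordinate. -/
lemma measure_slope_deviation_le (hK : KernelAssumption K)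
    (hresp : ∀ᵐ o ∂P, o.2 = 1 ∨ o.2 = -1) (hτ : 0 < τ) (hE : ExpSquareBound P τ)
    (hlaw : ∀ i, HasLaw (O i) P μ) (hind : iIndepFun O μ) (S : Finset ι)
    (hN : 0 < N) (hcard : (S.card : ℝ) ≤ N) (ha : 0 ≤ a) :
    μ {ω | ∃ v, a * l1Norm v < |∑ i ∈ S, slopeTerm K h β v (O i ω) -
      S.card * ∫ o, slopeTerm K h β v o ∂P|} ≤
      ENNReal.ofReal ((p + 1 : ℕ) * (2 * Real.exp (-a ^ 2 / (40 * N * τ)))) := by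
  have hcoord : ∀ j, μ {ω | a ≤ |∑ i ∈ S, (slopeTerm K h β (Pi.single j 1) (O i ω) -
      ∫ o, slopeTerm K h β (Pi.single j 1) o ∂P)|} ≤
      ENNReal.ofReal (2 * Real.exp (-a ^ 2 / (40 * N * τ))) := fun j => by
    set g : Obs p → ℝ := slopeTerm K h β (Pi.single j 1) with hg
    have hgm : Measurable g := measurable_slopeTerm hK _
    obtain ⟨hi, h3⟩ := hE.coord j
    have hle : ∀ᵐ o ∂P, Real.exp (g o ^ 2 / τ) ≤ Real.exp (aug o.1 j ^ 2 / τ) := by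
      filter_upwards [abs_slopeTerm_le (h := h) (β := β) hK hresp (Pi.single j 1)] with o ho
      rw [dotProduct_single_one] at ho
      have := sq_le_sq.2 ho
      gcongr
    have hgi : Integrable (fun o => Real.exp (g o ^ 2 / τ)) P := by
      refine hi.mono' (by fun_prop) ?_
      filter_upwards [hle] with o ho
      rwa [Real.norm_of_nonneg (Real.exp_pos _).le]
    have hgb := (integral_mono_ae hgi hi hle).trans h3
    refine (measure_le_abs_sum_sub_le hlaw hind (g := fun _ => g) (fun _ => hgm) S hN hcard
      (V := 10 * τ) (θ₀ := a / (2 * N * (10 * τ))) (by positivity) ha le_rfl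
      fun _ _ θ _ => integral_exp_mul_le_of_exp_sq hgm hτ hgi hgb θ).trans_eq ?_
    congr 4
    ring
  calc _ ≤ μ (⋃ j, {ω | a ≤ |∑ i ∈ S, (slopeTerm K h β (Pi.single j 1) (O i ω) -
      ∫ o, slopeTerm K h β (Pi.single j 1) o ∂P)|}) := by
        refine measure_mono ?_
        rintro ω ⟨v, hv⟩
        by_contra hω
        simp only [Set.mem_iUnion, Set.mem_ofPred_eq, not_exists, not_le] at hω
        refine absurd hv (not_lt.2 ?_)
        have h1 : ∑ i ∈ S, slopeTerm K h β v (O i ω) -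
            S.card * ∫ o, slopeTerm K h β v o ∂P =
            ∑ j, v j * ∑ i ∈ S, (slopeTerm K h β (Pi.single j 1) (O i ω) -
              ∫ o, slopeTerm K h β (Pi.single j 1) o ∂P) := by
          have h2 : ∫ o, slopeTerm K h β v o ∂P =
              ∑ j, v j * ∫ o, slopeTerm K h β (Pi.single j 1) o ∂P := by
            simp only [slopeTerm_eq_sum v]
            rw [integral_finsetSum _ fun j _ =>
              (integrable_slopeTerm hK hresp hτ hE _).const_mul _]
            simp only [integral_const_mul]
          rw [h2]
          simp only [slopeTerm_eq_sum v, Finset.sum_sub_distrib, Finset.sum_const, nsmul_eq_mul,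
            mul_sub]
          rw [Finset.sum_comm, Finset.mul_sum]
          simp only [Finset.mul_sum]
          congr 1
          exact Finset.sum_congr rfl fun j _ => by ring
        rw [h1, l1Norm, Finset.mul_sum]
        refine (Finset.abs_sum_le_sum_abs _ _).trans (Finset.sum_le_sum fun j _ => ?_)
        rw [abs_mul, mul_comm]
        exact mul_le_mul_of_nonneg_right (hω j).le (abs_nonneg _)
    _ ≤ ∑ j : Fin (p + 1), ENNReal.ofReal (2 * Real.exp (-a ^ 2 / (40 * N * τ))) :=
        (measure_iUnion_fintype_le _ _).trans (Finset.sum_le_sum fun j _ => hcoord j)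
    _ = _ := by
        rw [Finset.sum_const, Finset.card_univ, Fintype.card_fin, nsmul_eq_mul,
          ENNReal.ofReal_mul (Nat.cast_nonneg _), ENNReal.ofReal_natCast]

lemma dotProduct_sq_eq_sum (x v : Fin (p + 1) → ℝ) :
    (x ⬝ᵥ v) ^ 2 = ∑ j, ∑ k, v j * v k * (x j * x k) := by
  rw [sq, dotProduct, Finset.sum_mul_sum]
  exact Finset.sum_congr rfl fun j _ => Finset.sum_congr rfl fun k _ => by ring

/-- Weighted Gram matrices deviate from their means by at most `a` in every entry. -/
lemma measure_gram_deviation_le (hτ : 0 < τ) (hE : ExpSquareBound P τ)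
    (hlaw : ∀ i, HasLaw (O i) P μ) (hind : iIndepFun O μ) (S : Finset ι)
    (hN : 0 < N) (hcard : (S.card : ℝ) ≤ N) {B : ℝ} (hB : 0 < B) {w : ι → Obs p → ℝ}
    (hwm : ∀ i, Measurable (w i)) (hw : ∀ i ∈ S, ∀ o, |w i o| ≤ B) (ha : 0 ≤ a)
    (haN : a ≤ 24 * (B * τ) * N) :
    μ {ω | ∃ v, a * l1Norm v ^ 2 < |∑ i ∈ S, w i (O i ω) * (aug (O i ω).1 ⬝ᵥ v) ^ 2 -
      ∑ i ∈ S, ∫ o, w i o * (aug o.1 ⬝ᵥ v) ^ 2 ∂P|} ≤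
      ENNReal.ofReal (((p + 1) * (p + 1) : ℕ) *
        (2 * Real.exp (-a ^ 2 / (96 * N * (B * τ) ^ 2)))) := by
  have hBτ : 0 < B * τ := by positivity
  set g : Fin (p + 1) → Fin (p + 1) → ι → Obs p → ℝ :=
    fun j k i o => w i o * (aug o.1 j * aug o.1 k) with hg
  have hgm : ∀ j k i, Measurable (g j k i) := fun j k i =>
    (hwm i).mul ((measurable_aug_apply j).mul (measurable_aug_apply k))
  have hmgf : ∀ j k, ∀ i ∈ S, Integrable (fun o => Real.exp (|g j k i o| / (B * τ))) P ∧
      ∫ o, Real.exp (|g j k i o| / (B * τ)) ∂P ≤ 3 := fun j k i hi => by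
    obtain ⟨hi', h3⟩ := hE.coord_mul hτ j k
    have hle : ∀ o, Real.exp (|g j k i o| / (B * τ)) ≤
        Real.exp (|aug o.1 j * aug o.1 k| / τ) := fun o => by
      refine Real.exp_le_exp.2 ?_
      rw [div_le_div_iff₀ hBτ hτ, hg]
      simp only [abs_mul (w i o)]
      have := mul_le_mul_of_nonneg_right (hw i hi o) (abs_nonneg (aug o.1 j * aug o.1 k))
      nlinarith
    have hgi : Integrable (fun o => Real.exp (|g j k i o| / (B * τ))) P := by
      refine hi'.mono' (((hgm j k i).abs.div_const _).exp.aestronglyMeasurable)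
        (ae_of_all _ fun o => ?_)
      rw [Real.norm_of_nonneg (Real.exp_pos _).le]
      exact hle o
    exact ⟨hgi, (integral_mono hgi hi' hle).trans h3⟩
  have hint : ∀ j k, ∀ i ∈ S, Integrable (g j k i) P := fun j k i hi => by
    refine ((hmgf j k i hi).1.const_mul (B * τ)).mono' (hgm j k i).aestronglyMeasurable
      (ae_of_all _ fun o => ?_)
    have h1 := Real.add_one_le_exp (|g j k i o| / (B * τ))
    have h2 := mul_le_mul_of_nonneg_left h1 hBτ.le
    have h3 : B * τ * (|g j k i o| / (B * τ)) = |g j k i o| := by field_simp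
    rw [Real.norm_eq_abs]
    linarith
  have hentry : ∀ q : Fin (p + 1) × Fin (p + 1),
      μ {ω | a ≤ |∑ i ∈ S, (g q.1 q.2 i (O i ω) - ∫ o, g q.1 q.2 i o ∂P)|} ≤
      ENNReal.ofReal (2 * Real.exp (-a ^ 2 / (96 * N * (B * τ) ^ 2))) := fun q => by
    refine (measure_le_abs_sum_sub_le hlaw hind (hgm q.1 q.2) S hN hcard
      (V := 24 * (B * τ) ^ 2) (θ₀ := 1 / (2 * (B * τ))) (by positivity) ha ?_
      fun i hi θ hθ => integral_exp_mul_le_of_exp_abs (hgm _ _ _) hBτ (hmgf _ _ i hi).1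
        (hmgf _ _ i hi).2 hθ).trans_eq ?_
    · rw [div_le_div_iff₀ (by positivity) (by positivity)]
      nlinarith
    · congr 4
      ring
  calc _ ≤ μ (⋃ q : Fin (p + 1) × Fin (p + 1),
        {ω | a ≤ |∑ i ∈ S, (g q.1 q.2 i (O i ω) - ∫ o, g q.1 q.2 i o ∂P)|}) := by
        refine measure_mono ?_
        rintro ω ⟨v, hv⟩
        by_contra hω
        simp only [Set.mem_iUnion, Set.mem_ofPred_eq, not_exists, not_le] at hω
        refine absurd hv (not_lt.2 ?_)
        have hexp : ∀ i o, w i o * (aug o.1 ⬝ᵥ v) ^ 2 = ∑ j, ∑ k, v j * v k * g j k i o :=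
          fun i o => by
            rw [dotProduct_sq_eq_sum, Finset.mul_sum]
            refine Finset.sum_congr rfl fun j _ => ?_
            rw [Finset.mul_sum]
            exact Finset.sum_congr rfl fun k _ => by rw [hg]; ring
        have hexpi : ∀ i ∈ S, ∫ o, w i o * (aug o.1 ⬝ᵥ v) ^ 2 ∂P =
            ∑ j, ∑ k, v j * v k * ∫ o, g j k i o ∂P := fun i hi => by
          simp only [hexp]
          rw [integral_finsetSum _ fun j _ => integrable_finsetSum _ fun k _ =>
            (hint j k i hi).const_mul _]
          refine Finset.sum_congr rfl fun j _ => ?_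
          rw [integral_finsetSum _ fun k _ => (hint j k i hi).const_mul _]
          simp only [integral_const_mul]
        have h1 : ∑ i ∈ S, w i (O i ω) * (aug (O i ω).1 ⬝ᵥ v) ^ 2 -
            ∑ i ∈ S, ∫ o, w i o * (aug o.1 ⬝ᵥ v) ^ 2 ∂P =
            ∑ j, ∑ k, v j * v k *
              ∑ i ∈ S, (g j k i (O i ω) - ∫ o, g j k i o ∂P) := by
          rw [Finset.sum_congr rfl hexpi, ← Finset.sum_sub_distrib]
          simp only [hexp, ← Finset.sum_sub_distrib, ← mul_sub]
          rw [Finset.sum_comm]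
          refine Finset.sum_congr rfl fun j _ => ?_
          rw [Finset.sum_comm]
          simp only [Finset.mul_sum]
        have h2 : a * l1Norm v ^ 2 = ∑ j, ∑ k, |v j * v k| * a := by
          rw [l1Norm, sq, Finset.sum_mul_sum, Finset.mul_sum]
          refine Finset.sum_congr rfl fun j _ => ?_
          rw [Finset.mul_sum]
          exact Finset.sum_congr rfl fun k _ => by rw [abs_mul]; ring
        rw [h1, h2]
        refine (Finset.abs_sum_le_sum_abs _ _).trans (Finset.sum_le_sum fun j _ => ?_)
        refine (Finset.abs_sum_le_sum_abs _ _).trans (Finset.sum_le_sum fun k _ => ?_)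
        rw [abs_mul]
        exact mul_le_mul_of_nonneg_left (hω (j, k)).le (abs_nonneg _)
    _ ≤ ∑ q : Fin (p + 1) × Fin (p + 1),
          ENNReal.ofReal (2 * Real.exp (-a ^ 2 / (96 * N * (B * τ) ^ 2))) :=
        (measure_iUnion_fintype_le _ _).trans (Finset.sum_le_sum fun q _ => hentry q)
    _ = _ := by
        rw [Finset.sum_const, Finset.card_univ, Fintype.card_prod, Fintype.card_fin, nsmul_eq_mul,
          ENNReal.ofReal_mul (Nat.cast_nonneg _), ENNReal.ofReal_natCast]

end Deviations

/-! ### The smooth part of the online objective -/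

section Objective

variable {p : ℕ} {K : ℝ → ℝ} {lam h : ℕ → ℝ} {n : ℕ → ℕ} {d : (t : ℕ) → Fin (n t) → Obs p}
  {β : ℕ → Fin (p + 1) → ℝ}

/-- The indices of all observations in the batches `1, …, t`. -/
def sampleIndex (n : ℕ → ℕ) (t : ℕ) : Finset ((t : ℕ) × Fin (n t)) :=
  (Finset.Icc 1 t).sigma fun _ => Finset.univ

lemma card_sampleIndex (n : ℕ → ℕ) (t : ℕ) : (sampleIndex n t).card = cumSize n t := by
  simp [sampleIndex, cumSize]

lemma one_le_of_mem_sampleIndex {t : ℕ} {q : (t : ℕ) × Fin (n t)} (hq : q ∈ sampleIndex n t) :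
    q.1 ∈ Finset.Icc 1 t := (Finset.mem_sigma.1 hq).1

lemma cumSize_succ (n : ℕ → ℕ) (t : ℕ) : cumSize n (t + 1) = cumSize n t + n (t + 1) := by
  rw [cumSize, Finset.sum_Icc_succ_top (by omega)]; rfl

lemma card_mul_batchLoss {m : ℕ} (h : ℝ) (x : Fin m → Obs p) (v : Fin (p + 1) → ℝ) :
    (m : ℝ) * batchLoss K h x v = ∑ i, smoothHinge K h (margin v (x i)) := by
  rcases Nat.eq_zero_or_pos m with rfl | hm
  · simp
  · rw [batchLoss, ← mul_assoc, mul_inv_cancel₀ (by positivity), one_mul]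

lemma dotProduct_batchHessian {m : ℕ} (h : ℝ) (x : Fin m → Obs p) (b v u : Fin (p + 1) → ℝ) :
    (m : ℝ) * (v ⬝ᵥ (batchHessian K h x b *ᵥ u)) =
      ∑ i, scaledKernel K h (1 - margin b (x i)) * ((aug (x i).1 ⬝ᵥ v) * (aug (x i).1 ⬝ᵥ u)) := by
  rcases Nat.eq_zero_or_pos m with rfl | hm
  · simp
  · rw [batchHessian, Matrix.smul_mulVec, dotProduct_smul, smul_eq_mul, ← mul_assoc,
      mul_inv_cancel₀ (by positivity), one_mul, Matrix.sum_mulVec, dotProduct_sum]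
    refine Finset.sum_congr rfl fun i _ => ?_
    rw [Matrix.smul_mulVec, dotProduct_smul, smul_eq_mul, Matrix.vecMulVec_mulVec, op_smul_eq_smul,
      dotProduct_smul, smul_eq_mul, dotProduct_comm v]
    ring

/-- The aggregated Hessian as a bilinear form. -/
lemma cumSize_mul_dotProduct_aggHessian (t : ℕ) (v u : Fin (p + 1) → ℝ) :
    (cumSize n t : ℝ) * (v ⬝ᵥ (aggHessian K h d β t *ᵥ u)) =
      ∑ q ∈ sampleIndex n t, scaledKernel K (h q.1) (1 - margin (β q.1) (d q.1 q.2)) *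
        ((aug (d q.1 q.2).1 ⬝ᵥ v) * (aug (d q.1 q.2).1 ⬝ᵥ u)) := by
  rw [sampleIndex, Finset.sum_sigma]
  simp only [← dotProduct_batchHessian]
  rcases Nat.eq_zero_or_pos (cumSize n t) with h0 | h0
  · rw [h0]
    have h1 : ∀ r ∈ Finset.Icc 1 t, n r = 0 := Finset.sum_eq_zero_iff.1 h0
    rw [Nat.cast_zero, zero_mul]
    exact (Finset.sum_eq_zero fun r hr => mul_eq_zero_of_left (by exact_mod_cast h1 r hr) _).symm
  · rw [aggHessian, Matrix.smul_mulVec, dotProduct_smul, smul_eq_mul, ← mul_assoc,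
      mul_inv_cancel₀ (by positivity), one_mul, Matrix.sum_mulVec, dotProduct_sum]
    refine Finset.sum_congr rfl fun r _ => ?_
    rw [Matrix.smul_mulVec, dotProduct_smul, smul_eq_mul]

lemma dotProduct_aggHessian_nonneg (hK : KernelAssumption K) {t : ℕ}
    (hh : ∀ r ∈ Finset.Icc 1 t, 0 < h r) (v : Fin (p + 1) → ℝ) :
    0 ≤ (cumSize n t : ℝ) * (v ⬝ᵥ (aggHessian K h d β t *ᵥ v)) := by
  rw [cumSize_mul_dotProduct_aggHessian]
  exact Finset.sum_nonneg fun q hq => mul_nonneg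
    (scaledKernel_nonneg hK (hh _ (one_le_of_mem_sampleIndex hq)) _) (mul_self_nonneg _)

/-- The smooth part of the online objective. -/
def onlineLoss (K : ℝ → ℝ) (h : ℕ → ℝ) {n : ℕ → ℕ} (d : (t : ℕ) → Fin (n t) → Obs p)
    (β : ℕ → Fin (p + 1) → ℝ) (t : ℕ) (v : Fin (p + 1) → ℝ) : ℝ :=
  (cumSize n t : ℝ)⁻¹ *
      ((cumSize n (t - 1) : ℝ) / 2 *
          ((v - β (t - 1)) ⬝ᵥ (aggHessian K h d β (t - 1) *ᵥ (v - β (t - 1)))) +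
        (n t : ℝ) * batchLoss K (h t) (d t) v)

lemma continuous_margin (o : Obs p) : Continuous fun v : Fin (p + 1) → ℝ => margin v o := by
  unfold margin dotProduct
  fun_prop

lemma continuous_onlineLoss (hK : KernelAssumption K) {t : ℕ} (ht : 0 < h t) :
    Continuous (onlineLoss K h d β t) := by
  unfold onlineLoss
  simp only [card_mul_batchLoss]
  have h1 : Continuous fun v : Fin (p + 1) → ℝ =>
      ∑ i, smoothHinge K (h t) (margin v (d t i)) :=
    continuous_finsetSum _ fun i _ => (continuous_smoothHinge hK ht).comp (continuous_margin _)
  have h2 : Continuous fun v : Fin (p + 1) → ℝ =>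
      (v - β (t - 1)) ⬝ᵥ (aggHessian K h d β (t - 1) *ᵥ (v - β (t - 1))) := by
    unfold dotProduct Matrix.mulVec dotProduct
    fun_prop
  fun_prop

lemma convexOn_onlineLoss (hK : KernelAssumption K) {t : ℕ}
    (hh : ∀ r ∈ Finset.Icc 1 t, 0 < h r) (ht : 0 < h t) :
    ConvexOn ℝ Set.univ (onlineLoss K h d β t) := by
  set A := aggHessian K h d β (t - 1) with hA
  have hquad : ConvexOn ℝ Set.univ fun v : Fin (p + 1) → ℝ =>
      (cumSize n (t - 1) : ℝ) / 2 * ((v - β (t - 1)) ⬝ᵥ (A *ᵥ (v - β (t - 1)))) := by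
    refine ⟨convex_univ, fun x _ y _ a b ha hb hab => ?_⟩
    have h1 : a • x + b • y - β (t - 1) = a • (x - β (t - 1)) + b • (y - β (t - 1)) := by
      obtain rfl : b = 1 - a := by linarith
      module
    have h2 := dotProduct_aggHessian_nonneg (n := n) (d := d) (β := β) hK (t := t - 1)
      (fun r hr => hh r (Finset.Icc_subset_Icc_right (Nat.sub_le _ _) hr))
      ((x - β (t - 1)) - (y - β (t - 1)))
    beta_reduce
    rw [h1]
    rw [← hA] at h2
    generalize x - β (t - 1) = x at h2 ⊢
    generalize y - β (t - 1) = y at h2 ⊢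
    simp only [Matrix.mulVec_add, Matrix.mulVec_sub, Matrix.mulVec_smul, dotProduct_add,
      dotProduct_sub, add_dotProduct, sub_dotProduct, dotProduct_smul, smul_dotProduct,
      smul_eq_mul] at h2 ⊢
    obtain rfl : b = 1 - a := by linarith
    nlinarith [mul_nonneg (mul_nonneg ha hb) h2]
  have hloss : ConvexOn ℝ Set.univ fun v : Fin (p + 1) → ℝ =>
      (n t : ℝ) * batchLoss K (h t) (d t) v := by
    simp only [card_mul_batchLoss]
    refine ⟨convex_univ, fun x _ y _ a b ha hb hab => ?_⟩
    simp only [smul_eq_mul]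
    rw [Finset.mul_sum, Finset.mul_sum, ← Finset.sum_add_distrib]
    refine Finset.sum_le_sum fun i _ => ?_
    have := (convexOn_smoothHinge hK ht).2 (Set.mem_univ (margin x (d t i)))
      (Set.mem_univ (margin y (d t i))) ha hb hab
    simp only [smul_eq_mul] at this
    refine le_trans (le_of_eq (congrArg _ ?_)) this
    simp only [margin, dotProduct_add, dotProduct_smul, smul_eq_mul]; ring
  have := (hquad.add hloss).smul (c := (cumSize n t : ℝ)⁻¹) (by positivity)
  exact this

lemma truncSq_mul_sign {y : ℝ} (hy : y = 1 ∨ y = -1) (T u : ℝ) :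
    truncSq T (y * u) = truncSq T u := by
  have : |y * u| = |u| := by rcases hy with rfl | rfl <;> simp
  rw [truncSq, truncSq, this]

/-- Increment of the smooth part at the target, in terms of the empirical gradient, the empirical
curvature and the aggregated Hessian. -/
lemma onlineLoss_sub_ge (hK : KernelAssumption K) {t : ℕ} (ht : 0 < h t)
    (hresp : ∀ i, (d t i).2 = 1 ∨ (d t i).2 = -1) (b v : Fin (p + 1) → ℝ) :
    (cumSize n t : ℝ)⁻¹ * (cumSize n (t - 1) / 2 *
        (v ⬝ᵥ (aggHessian K h d β (t - 1) *ᵥ v)) -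
      cumSize n (t - 1) * (v ⬝ᵥ (aggHessian K h d β (t - 1) *ᵥ (β (t - 1) - b))) +
      ∑ i, slopeTerm K (h t) b v (d t i) + 1 / 2 * ∑ i, curvTerm K (h t) b v (d t i)) ≤
    onlineLoss K h d β t (b + v) - onlineLoss K h d β t b := by
  rw [onlineLoss, onlineLoss, ← mul_sub]
  refine mul_le_mul_of_nonneg_left ?_ (by positivity)
  rw [card_mul_batchLoss, card_mul_batchLoss]
  have hsum : ∑ i, slopeTerm K (h t) b v (d t i) + 1 / 2 * ∑ i, curvTerm K (h t) b v (d t i) ≤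
      ∑ i, smoothHinge K (h t) (margin (b + v) (d t i)) -
        ∑ i, smoothHinge K (h t) (margin b (d t i)) := by
    rw [Finset.mul_sum, ← Finset.sum_add_distrib, ← Finset.sum_sub_distrib]
    refine Finset.sum_le_sum fun i _ => ?_
    have h1 := smoothHinge_curvature hK ht (margin b (d t i)) ((d t i).2 * (aug (d t i).1 ⬝ᵥ v))
    have h2 : margin b (d t i) + (d t i).2 * (aug (d t i).1 ⬝ᵥ v) = margin (b + v) (d t i) := by
      simp only [margin, dotProduct_add]; ring
    rw [h2, truncSq_mul_sign (hresp i)] at h1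
    rw [slopeTerm, curvTerm]
    linarith
  have hsymm : ∀ x y : Fin (p + 1) → ℝ,
      (cumSize n (t - 1) : ℝ) * (x ⬝ᵥ (aggHessian K h d β (t - 1) *ᵥ y)) =
        cumSize n (t - 1) * (y ⬝ᵥ (aggHessian K h d β (t - 1) *ᵥ x)) := fun x y => by
    rw [cumSize_mul_dotProduct_aggHessian, cumSize_mul_dotProduct_aggHessian]
    exact Finset.sum_congr rfl fun q _ => by ring
  have h3 : b + v - β (t - 1) = v - (β (t - 1) - b) := by abel
  have h4 : b - β (t - 1) = -(β (t - 1) - b) := by abel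
  rw [h3, h4]
  have h5 := hsymm (β (t - 1) - b) v
  set e := β (t - 1) - b
  simp only [Matrix.mulVec_sub, Matrix.mulVec_neg, dotProduct_sub, sub_dotProduct, dotProduct_neg,
    neg_dotProduct, neg_neg]
  nlinarith

end Objective

/-! ### Stability of the aggregated Hessian -/

section Stability

variable {p : ℕ} {K : ℝ → ℝ} {lam h : ℕ → ℝ} {n : ℕ → ℕ} {d : (t : ℕ) → Fin (n t) → Obs p}
  {β : ℕ → Fin (p + 1) → ℝ}

/-- The weight bounding the change of a Hessian summand when the coefficients move by at most `ρ`
in the `l₁` norm, beyond a small multiple of the summand itself. -/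
def remWeight (Cη κ₀ h ρ : ℝ) (o : Obs p) : ℝ :=
  min (Cη * ρ ^ 2 / h ^ 3 * ‖aug o.1‖ ^ 2) (κ₀ / h)

lemma measurable_remWeight (Cη κ₀ h ρ : ℝ) :
    Measurable (remWeight Cη κ₀ h ρ : Obs p → ℝ) :=
  ((measurable_norm_aug.pow_const 2).const_mul _).min measurable_const

lemma remWeight_nonneg {Cη κ₀ h ρ : ℝ} (hC : 0 ≤ Cη) (hκ : 0 ≤ κ₀) (hh : 0 < h) (o : Obs p) :
    0 ≤ remWeight Cη κ₀ h ρ o :=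
  le_min (by positivity) (by positivity)

lemma abs_scaledKernel_margin_sub_le (hK : KernelAssumption K) {η Cη κ₀ h ρ : ℝ} (hC : 0 ≤ Cη)
    (hη0 : 0 ≤ η) (hη : ∀ a b, |K (a + b) - K a| ≤ η * K a + Cη * b ^ 2) (hκ : ∀ t, K t ≤ κ₀)
    (hh : 0 < h) {o : Obs p} (ho : o.2 = 1 ∨ o.2 = -1) {b b' : Fin (p + 1) → ℝ}
    (hb : l1Norm (b' - b) ≤ ρ) :
    |scaledKernel K h (1 - margin b' o) - scaledKernel K h (1 - margin b o)| ≤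
      η * scaledKernel K h (1 - margin b o) + remWeight Cη κ₀ h ρ o := by
  set u := 1 - margin b o with hu
  set e := -(o.2 * (aug o.1 ⬝ᵥ (b' - b))) with he
  have h1 : 1 - margin b' o = u + e := by
    simp only [hu, he, margin, dotProduct_sub]; ring
  have he2 : e ^ 2 ≤ ρ ^ 2 * ‖aug o.1‖ ^ 2 := by
    have h2 : e ^ 2 = (aug o.1 ⬝ᵥ (b' - b)) ^ 2 := by
      rcases ho with h | h <;> rw [he, h] <;> ring
    rw [h2, ← sq_abs, ← mul_pow, mul_comm ρ]
    exact pow_le_pow_left₀ (abs_nonneg _) ((abs_dotProduct_le _ _).trans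
      (mul_le_mul_of_nonneg_left hb (norm_nonneg _))) 2
  have hk0 : ∀ x, 0 ≤ scaledKernel K h x := scaledKernel_nonneg hK hh
  have hk1 : ∀ x, scaledKernel K h x ≤ κ₀ / h := fun x => by
    rw [scaledKernel, div_eq_inv_mul κ₀]
    exact mul_le_mul_of_nonneg_left (hκ _) (inv_nonneg.2 hh.le)
  rw [h1, remWeight, ← min_add_add_left]
  refine le_min ?_ ?_
  · have h3 := hη (u / h) (e / h)
    have h4 : scaledKernel K h (u + e) - scaledKernel K h u =
        h⁻¹ * (K (u / h + e / h) - K (u / h)) := by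
      rw [scaledKernel, scaledKernel, ← add_div]; ring
    rw [h4, abs_mul, abs_of_pos (inv_pos.2 hh)]
    calc h⁻¹ * |K (u / h + e / h) - K (u / h)|
        ≤ h⁻¹ * (η * K (u / h) + Cη * (e / h) ^ 2) := by gcongr
      _ = η * scaledKernel K h u + Cη / h ^ 3 * e ^ 2 := by
        rw [scaledKernel]; field_simp
      _ ≤ η * scaledKernel K h u + Cη / h ^ 3 * (ρ ^ 2 * ‖aug o.1‖ ^ 2) := by gcongr
      _ = _ := by ring
  · have := mul_nonneg hη0 (hk0 u)
    rw [abs_le]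
    constructor <;> linarith [hk0 u, hk0 (u + e), hk1 u, hk1 (u + e)]

/-- Quadratic forms of the aggregated Hessian compared with those at the target `b`. -/
lemma abs_aggHessian_sub_le (hK : KernelAssumption K) {η Cη κ₀ : ℝ} (hC : 0 ≤ Cη) (hη0 : 0 ≤ η)
    (hη : ∀ a b, |K (a + b) - K a| ≤ η * K a + Cη * b ^ 2) (hκ : ∀ t, K t ≤ κ₀) {t : ℕ}
    (hh : ∀ r ∈ Finset.Icc 1 t, 0 < h r)
    (hresp : ∀ r ∈ Finset.Icc 1 t, ∀ i, (d r i).2 = 1 ∨ (d r i).2 = -1)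
    {b : Fin (p + 1) → ℝ} {ρ : ℕ → ℝ} (hρ : ∀ r ∈ Finset.Icc 1 t, l1Norm (β r - b) ≤ ρ r)
    (v : Fin (p + 1) → ℝ) :
    |(cumSize n t : ℝ) * (v ⬝ᵥ (aggHessian K h d β t *ᵥ v)) -
      ∑ q ∈ sampleIndex n t, scaledKernel K (h q.1) (1 - margin b (d q.1 q.2)) *
        (aug (d q.1 q.2).1 ⬝ᵥ v) ^ 2| ≤
      η * (∑ q ∈ sampleIndex n t, scaledKernel K (h q.1) (1 - margin b (d q.1 q.2)) *
        (aug (d q.1 q.2).1 ⬝ᵥ v) ^ 2) +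
      ∑ q ∈ sampleIndex n t, remWeight Cη κ₀ (h q.1) (ρ q.1) (d q.1 q.2) *
        (aug (d q.1 q.2).1 ⬝ᵥ v) ^ 2 := by
  rw [cumSize_mul_dotProduct_aggHessian, ← Finset.sum_sub_distrib, Finset.mul_sum,
    ← Finset.sum_add_distrib]
  refine (Finset.abs_sum_le_sum_abs _ _).trans (Finset.sum_le_sum fun q hq => ?_)
  have hq1 := one_le_of_mem_sampleIndex hq
  have h1 := mul_le_mul_of_nonneg_right (abs_scaledKernel_margin_sub_le hK hC hη0 hη hκ
    (hh _ hq1) (hresp _ hq1 q.2) (hρ _ hq1)) (sq_nonneg (aug (d q.1 q.2).1 ⬝ᵥ v))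
  rw [← sq, ← sub_mul, abs_mul, abs_of_nonneg (sq_nonneg (aug (d q.1 q.2).1 ⬝ᵥ v))]
  linarith

lemma sq_aggHessian_le (hK : KernelAssumption K) {t : ℕ}
    (hh : ∀ r ∈ Finset.Icc 1 t, 0 < h r) (v u : Fin (p + 1) → ℝ) :
    ((cumSize n t : ℝ) * (v ⬝ᵥ (aggHessian K h d β t *ᵥ u))) ^ 2 ≤
      ((cumSize n t : ℝ) * (v ⬝ᵥ (aggHessian K h d β t *ᵥ v))) *
        ((cumSize n t : ℝ) * (u ⬝ᵥ (aggHessian K h d β t *ᵥ u))) := by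
  simp only [cumSize_mul_dotProduct_aggHessian]
  have hw : ∀ q ∈ sampleIndex n t,
      0 ≤ scaledKernel K (h q.1) (1 - margin (β q.1) (d q.1 q.2)) := fun q hq =>
    scaledKernel_nonneg hK (hh _ (one_le_of_mem_sampleIndex hq)) _
  exact Finset.sum_sq_le_sum_mul_sum_of_sq_le_mul _
    (fun q hq => mul_nonneg (hw q hq) (mul_self_nonneg _))
    (fun q hq => mul_nonneg (hw q hq) (mul_self_nonneg _)) fun q _ => le_of_eq (by ring)

end Stability

/-! ### One step of the online estimator -/

section Step

variable {p : ℕ} {K : ℝ → ℝ} {lam h : ℕ → ℝ} {n : ℕ → ℕ} {d : (t : ℕ) → Fin (n t) → Obs p}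
  {β : ℕ → Fin (p + 1) → ℝ}

/-- The aggregated Hessian `A` is well conditioned up to the `l₁` norm, and `Δ` is the error of the
estimate it is centred at; `θ` is small compared with the `l₁` error. -/
structure PriorControl (A : Matrix (Fin (p + 1)) (Fin (p + 1)) ℝ) (Δ : Fin (p + 1) → ℝ)
    (a₁ a₂ θ C C₁ s lam : ℝ) : Prop where
  upper : ∀ v, v ⬝ᵥ (A *ᵥ v) ≤ 9 / 8 * a₂ * l2Norm v ^ 2 + θ * l1Norm v ^ 2
  lower : ∀ v, 9 / 10 * a₁ * l2Norm v ^ 2 - θ * l1Norm v ^ 2 ≤ v ⬝ᵥ (A *ᵥ v)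
  l2_le : l2Norm Δ ≤ C * √s * lam
  l1_le : l1Norm Δ ≤ C₁ * s * lam
  lam_nonneg : 0 ≤ lam
  theta_nonneg : 0 ≤ θ
  theta_error : θ * s * C₁ ^ 2 ≤ a₂ * C ^ 2 / 200
  theta_gain : a₂ * C ^ 2 * s * θ ≤ 1 / 80
  theta_cone : θ * (4 + 2 * (a₂ * C)) ^ 2 * s ≤ a₁ / 20

/-- The linear term that the quadratic prior contributes at the target. -/
lemma PriorControl.abs_linear_le (hK : KernelAssumption K) {t : ℕ}
    (hh : ∀ r ∈ Finset.Icc 1 t, 0 < h r) {a₁ a₂ θ C C₁ s l : ℝ} (ha₂ : 0 ≤ a₂) (hC : 0 ≤ C)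
    (hs : 0 ≤ s) {b : Fin (p + 1) → ℝ}
    (H : PriorControl (aggHessian K h d β t) (β t - b) a₁ a₂ θ C C₁ s l)
    (v : Fin (p + 1) → ℝ) :
    |(cumSize n t : ℝ) * (v ⬝ᵥ (aggHessian K h d β t *ᵥ (β t - b)))| ≤
      cumSize n t * l * (5 / 4 * (a₂ * C) * √s * l2Norm v + 1 / 8 * l1Norm v) := by
  set N : ℝ := (cumSize n t : ℝ) with hN
  have hN0 : 0 ≤ N := Nat.cast_nonneg _
  set A := aggHessian K h d β t with hA
  have hl := H.lam_nonneg
  have hθ := H.theta_nonneg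
  have hv2 := l2Norm_nonneg v
  have hv1 := l1Norm_nonneg v
  have hΔ2 : l2Norm (β t - b) ^ 2 ≤ C ^ 2 * s * l ^ 2 := by
    refine (pow_le_pow_left₀ (l2Norm_nonneg _) H.l2_le 2).trans_eq ?_
    rw [mul_pow, mul_pow, Real.sq_sqrt hs]
  have hΔ1 : l1Norm (β t - b) ^ 2 ≤ C₁ ^ 2 * s ^ 2 * l ^ 2 := by
    refine (pow_le_pow_left₀ (l1Norm_nonneg _) H.l1_le 2).trans_eq ?_
    ring
  have hu := H.upper (β t - b)
  have hu' : (β t - b) ⬝ᵥ (A *ᵥ (β t - b)) ≤ 113 / 100 * (a₂ * C ^ 2 * s * l ^ 2) := by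
    have h1 := mul_le_mul_of_nonneg_left hΔ2 (show 0 ≤ 9 / 8 * a₂ by positivity)
    have h2 := mul_le_mul_of_nonneg_left hΔ1 hθ
    have h3 := mul_le_mul_of_nonneg_right H.theta_error (show 0 ≤ s * l ^ 2 by positivity)
    linarith
  have hcs := sq_aggHessian_le (n := n) (d := d) (β := β) hK hh v (β t - b)
  have hvv := H.upper v
  have hnn := dotProduct_aggHessian_nonneg (n := n) (d := d) (β := β) hK hh v
  rw [← hN, ← hA] at hcs hnn
  refine abs_le_of_sq_le_sq (hcs.trans ?_) (by positivity)
  have hw : 0 ≤ 9 / 8 * a₂ * l2Norm v ^ 2 + θ * l1Norm v ^ 2 := by positivity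
  calc N * (v ⬝ᵥ (A *ᵥ v)) * (N * ((β t - b) ⬝ᵥ (A *ᵥ (β t - b))))
      ≤ N * (9 / 8 * a₂ * l2Norm v ^ 2 + θ * l1Norm v ^ 2) *
          (N * (113 / 100 * (a₂ * C ^ 2 * s * l ^ 2))) := by
        refine mul_le_mul (by gcongr) (by gcongr) ?_ (by positivity)
        exact dotProduct_aggHessian_nonneg hK hh _
    _ = (N * l) ^ 2 * (1017 / 800 * (a₂ * C) ^ 2 * s * l2Norm v ^ 2 +
          113 / 100 * (a₂ * C ^ 2 * s * θ) * l1Norm v ^ 2) := by ring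
    _ ≤ (N * l) ^ 2 * (25 / 16 * (a₂ * C) ^ 2 * s * l2Norm v ^ 2 + 1 / 64 * l1Norm v ^ 2) := by
        have h1 := mul_le_mul_of_nonneg_right H.theta_gain (sq_nonneg (l1Norm v))
        have h2 : 0 ≤ (a₂ * C) ^ 2 * s * l2Norm v ^ 2 := by positivity
        have h3 := sq_nonneg (l1Norm v)
        refine mul_le_mul_of_nonneg_left ?_ (sq_nonneg _)
        linarith
    _ ≤ (N * l * (5 / 4 * (a₂ * C) * √s * l2Norm v + 1 / 8 * l1Norm v)) ^ 2 := by
        rw [mul_pow (N * l)]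
        refine mul_le_mul_of_nonneg_left ?_ (sq_nonneg _)
        have h1 : 0 ≤ 2 * (5 / 4 * (a₂ * C) * √s * l2Norm v) * (1 / 8 * l1Norm v) := by positivity
        have h2 : (5 / 4 * (a₂ * C) * √s * l2Norm v) ^ 2 =
            25 / 16 * (a₂ * C) ^ 2 * s * l2Norm v ^ 2 := by
          rw [mul_pow, mul_pow, Real.sq_sqrt hs]; ring
        nlinarith

/-- If the gradient of the current batch is small at the target, its curvature is bounded below on
the relevant sphere, and the prior is controlled, then the online estimate exists and every choice
of it satisfies the error bounds. -/
lemma online_step (hK : KernelAssumption K) {t : ℕ} (ht : 1 ≤ t)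
    (hh : ∀ r ∈ Finset.Icc 1 t, 0 < h r) (hN : 0 < cumSize n t)
    (hresp : ∀ i, (d t i).2 = 1 ∨ (d t i).2 = -1) {b : Fin (p + 1) → ℝ} {s : ℕ}
    (hs : l0Norm b = s) (hs1 : 1 ≤ s) {a₁ a₂ C Cp : ℝ} (ha₁ : 0 < a₁) (ha₂ : 0 ≤ a₂)
    (hCp : 0 ≤ Cp) (hlam : 0 < lam t) (hC : 3 + 2 * (a₂ * Cp) ≤ kappaLow K * a₁ * C)
    (hnoise : ∀ v, |∑ i, slopeTerm K (h t) b v (d t i)| ≤ cumSize n t * lam t *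
      (1 / 8 * l1Norm v + (1 / 8 + 1 / 8 * (a₂ * Cp)) * √s * l2Norm v))
    (hlow : ∀ v, l2Norm v = C * √s * lam t →
      l1Norm v ≤ (4 + 2 * (a₂ * Cp)) * √s * l2Norm v →
      (27 / 16 * n t - (cumSize n t : ℝ) / 16) * (kappaLow K * a₁ * l2Norm v ^ 2) ≤
        ∑ i, curvTerm K (h t) b v (d t i))
    (hprior : cumSize n (t - 1) = 0 ∨
      (∃ θ C₁, PriorControl (aggHessian K h d β (t - 1)) (β (t - 1) - b) a₁ a₂ θ Cp C₁ s
        (lam (t - 1))) ∧ (cumSize n (t - 1) : ℝ) * lam (t - 1) ≤ cumSize n t * lam t) :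
    (∃ u, ∀ v, onlineObjective K lam h d β t u ≤ onlineObjective K lam h d β t v) ∧
    ∀ u, (∀ v, onlineObjective K lam h d β t u ≤ onlineObjective K lam h d β t v) →
      l2Norm (u - b) ≤ C * √s * lam t ∧
      l1Norm (u - b) ≤ (4 + 2 * (a₂ * Cp)) * √s * l2Norm (u - b) := by
  have htm : t ∈ Finset.Icc 1 t := Finset.mem_Icc.2 ⟨ht, le_rfl⟩
  have hht := hh t htm
  have hh' : ∀ r ∈ Finset.Icc 1 (t - 1), 0 < h r := fun r hr =>
    hh r (Finset.Icc_subset_Icc_right (Nat.sub_le _ _) hr)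
  have hNpos : (0 : ℝ) < cumSize n t := by exact_mod_cast hN
  set N : ℝ := (cumSize n t : ℝ) with hNdef
  set N' : ℝ := (cumSize n (t - 1) : ℝ) with hN'def
  have hNN : N = N' + n t := by
    rw [hNdef, hN'def]
    obtain ⟨r, rfl⟩ : ∃ r, t = r + 1 := ⟨t - 1, by omega⟩
    rw [Nat.add_sub_cancel, cumSize_succ]; push_cast; ring
  have hN'0 : 0 ≤ N' := Nat.cast_nonneg _
  set A := aggHessian K h d β (t - 1) with hA
  set D := a₂ * Cp with hDdef
  have hD : 0 ≤ D := by positivity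
  have hκ := hK.low_pos
  have hκ2 := hK.kappaLow_le_half
  have hs0 : (0 : ℝ) ≤ s := Nat.cast_nonneg _
  have hlinear : ∀ v, |N' * (v ⬝ᵥ (A *ᵥ (β (t - 1) - b)))| ≤
      N * lam t * (5 / 4 * D * √s * l2Norm v + 1 / 8 * l1Norm v) := fun v => by
    have hnn : 0 ≤ 5 / 4 * D * √s * l2Norm v + 1 / 8 * l1Norm v := by
      have := l2Norm_nonneg v; have := l1Norm_nonneg v; positivity
    rcases hprior with h0 | ⟨⟨θ, C₁, H⟩, hmono⟩
    · rw [hN'def, h0, Nat.cast_zero, zero_mul, abs_zero]; positivity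
    · exact (H.abs_linear_le hK hh' ha₂ hCp hs0 v).trans
        (mul_le_mul_of_nonneg_right hmono hnn)
  have hquad0 : ∀ v, 0 ≤ N' * (v ⬝ᵥ (A *ᵥ v)) := fun v => dotProduct_aggHessian_nonneg hK hh' v
  have hquad : ∀ v, l1Norm v ≤ (4 + 2 * D) * √s * l2Norm v →
      N' * (27 / 16 * (kappaLow K * a₁) * l2Norm v ^ 2) ≤ N' * (v ⬝ᵥ (A *ᵥ v)) := fun v hv => by
    rcases hprior with h0 | ⟨⟨θ, C₁, H⟩, -⟩
    · rw [hN'def, h0, Nat.cast_zero, zero_mul, zero_mul]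
    · refine mul_le_mul_of_nonneg_left (le_trans ?_ (H.lower v)) hN'0
      have h1 : l1Norm v ^ 2 ≤ (4 + 2 * D) ^ 2 * s * l2Norm v ^ 2 := by
        refine (pow_le_pow_left₀ (l1Norm_nonneg v) hv 2).trans_eq ?_
        rw [mul_pow, mul_pow, Real.sq_sqrt hs0]
      have h2 := mul_le_mul_of_nonneg_left h1 H.theta_nonneg
      have h3 := mul_le_mul_of_nonneg_right H.theta_cone (sq_nonneg (l2Norm v))
      rw [← hDdef] at h3
      have h4 := mul_le_mul_of_nonneg_right hκ2
        (show 0 ≤ a₁ * l2Norm v ^ 2 by positivity)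
      have h5 : 0 ≤ a₁ * l2Norm v ^ 2 := by positivity
      linarith
  have hinc := fun v => onlineLoss_sub_ge (d := d) (β := β) hK hht hresp b v
  have hcurv0 : ∀ v, 0 ≤ ∑ i, curvTerm K (h t) b v (d t i) := fun v =>
    Finset.sum_nonneg fun i _ => curvTerm_nonneg hK hht v _
  have hgen : ∀ v Q : _, N * Q ≤ N' / 2 * (v ⬝ᵥ (A *ᵥ v)) +
      1 / 2 * ∑ i, curvTerm K (h t) b v (d t i) →
      Q - (1 / 4 * lam t * l1Norm v + (1 / 8 + 11 / 8 * D) * √s * lam t * l2Norm v) ≤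
      onlineLoss K h d β t (b + v) - onlineLoss K h d β t b := fun v Q hQ => by
    refine le_trans ?_ (hinc v)
    rw [← hNdef, ← hN'def, ← hA, inv_mul_eq_div, le_div_iff₀ hNpos]
    have h1 := (abs_le.1 (hlinear v)).2
    have h2 := (abs_le.1 (hnoise v)).1
    linarith
  refine penalized_minimizer (convexOn_onlineLoss hK hh hht) (continuous_onlineLoss hK hht) hs hs1
    hlam hD (by positivity : 0 < kappaLow K * a₁) hC (fun v => ?_) fun v hv hcone => ?_
  · have := hgen v 0 (by linarith [hquad0 v, hcurv0 v])
    linarith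
  · refine hgen v _ ?_
    have h1 := hquad v hcone
    have h2 := hlow v hv hcone
    rw [hNN] at h2 ⊢
    linarith

end Step

/-! ### Induction over the batches -/

section Induction

variable {p : ℕ} {K : ℝ → ℝ} {lam h : ℕ → ℝ} {n : ℕ → ℕ} {d : (t : ℕ) → Fin (n t) → Obs p}

lemma onlineObjective_congr {β β' : ℕ → Fin (p + 1) → ℝ} {t : ℕ} (ht : 1 ≤ t)
    (hβ : ∀ r < t, β r = β' r) :
    onlineObjective K lam h d β t = onlineObjective K lam h d β' t := by
  have h1 : aggHessian K h d β (t - 1) = aggHessian K h d β' (t - 1) := by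
    unfold aggHessian
    congr 1
    refine Finset.sum_congr rfl fun r hr => ?_
    rw [hβ r (by have := Finset.mem_Icc.1 hr; omega)]
  funext v
  rw [onlineObjective, onlineObjective, h1, hβ (t - 1) (by omega)]

/-- If each step has minimizers, all with the property `Q`, as soon as the earlier estimates have
it, then online estimates exist and all of them have it. -/
lemma online_induction {Q : ℕ → (Fin (p + 1) → ℝ) → Prop} {b : ℕ}
    (hstep : ∀ t ∈ Finset.Icc 1 b, ∀ β : ℕ → Fin (p + 1) → ℝ,
      (∀ r ∈ Finset.Icc 1 (t - 1), Q r (β r)) →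
      (∃ u, ∀ v, onlineObjective K lam h d β t u ≤ onlineObjective K lam h d β t v) ∧
      ∀ u, (∀ v, onlineObjective K lam h d β t u ≤ onlineObjective K lam h d β t v) → Q t u) :
    (∃ β, IsOnlineLasso K lam h d b β) ∧
    ∀ β, IsOnlineLasso K lam h d b β → ∀ t ∈ Finset.Icc 1 b, Q t (β t) := by
  have hall : ∀ β, IsOnlineLasso K lam h d b β → ∀ t, t ∈ Finset.Icc 1 b → Q t (β t) := by
    intro β hβ t
    induction t using Nat.strong_induction_on with
    | _ t ih =>
      intro ht
      have ht' := Finset.mem_Icc.1 ht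
      refine (hstep t ht β fun r hr => ?_).2 _ (hβ.2 t ht)
      have hr' := Finset.mem_Icc.1 hr
      exact ih r (by omega) (Finset.mem_Icc.2 ⟨hr'.1, by omega⟩)
  refine ⟨?_, hall⟩
  suffices hex : ∀ t ≤ b, ∃ β, IsOnlineLasso K lam h d t β ∧
      ∀ r ∈ Finset.Icc 1 t, Q r (β r) by
    obtain ⟨β, hβ, -⟩ := hex b le_rfl
    exact ⟨β, hβ⟩
  intro t
  induction t with
  | zero => exact fun _ => ⟨fun _ => 0, ⟨rfl, by simp⟩, by simp⟩
  | succ t ih =>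
    intro htb
    obtain ⟨β, hβ, hQ⟩ := ih (by omega)
    obtain ⟨⟨u, hu⟩, hall'⟩ := hstep (t + 1) (Finset.mem_Icc.2 ⟨by omega, htb⟩) β
      (by rwa [Nat.add_sub_cancel])
    have hne : ∀ r < t + 1, Function.update β (t + 1) u r = β r := fun r hr =>
      Function.update_of_ne (by omega) _ _
    refine ⟨Function.update β (t + 1) u, ⟨by rw [hne 0 (by omega), hβ.1], fun r hr v => ?_⟩,
      fun r hr => ?_⟩
    · have hr' := Finset.mem_Icc.1 hr
      rw [onlineObjective_congr (β' := β) hr'.1 fun i hi => hne i (by omega)]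
      rcases Nat.lt_or_ge r (t + 1) with h | h
      · rw [hne r h]
        exact hβ.2 r (Finset.mem_Icc.2 ⟨hr'.1, by omega⟩) v
      · obtain rfl : r = t + 1 := by omega
        rw [Function.update_self]
        exact hu v
    · have hr' := Finset.mem_Icc.1 hr
      rcases Nat.lt_or_ge r (t + 1) with h | h
      · rw [hne r h]
        exact hQ r (Finset.mem_Icc.2 ⟨hr'.1, by omega⟩)
      · obtain rfl : r = t + 1 := by omega
        rw [Function.update_self]
        exact hall' u hu

end Induction

/-! ### Growth of the constants -/

section Growth

variable {r G a₂ : ℝ}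

lemma constTwo_succ (t : ℕ) :
    constTwo r G a₂ (t + 1) = (3 + r + 2 * (a₂ * constTwo r G a₂ t)) * G := by
  rw [constTwo]; ring

lemma constOne_succ (t : ℕ) : constOne r G a₂ (t + 1) =
    (4 + r + 2 * (a₂ * constTwo r G a₂ t)) * constTwo r G a₂ (t + 1) := by
  rw [constOne]; ring

/-- The constants grow at least geometrically; in particular they dominate the batch number. -/
lemma natCast_le_mul_constTwo (hr : 0 ≤ r) (hG : 2 ≤ a₂ * G) (t : ℕ) :
    (t : ℝ) ≤ a₂ * constTwo r G a₂ t := by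
  induction t with
  | zero => simp [constTwo]
  | succ t ih =>
    have ht : (0 : ℝ) ≤ t := Nat.cast_nonneg t
    rw [constTwo_succ]
    push_cast
    have h1 : a₂ * ((3 + r + 2 * (a₂ * constTwo r G a₂ t)) * G) =
        (a₂ * G) * (3 + r + 2 * (a₂ * constTwo r G a₂ t)) := by ring
    rw [h1]
    nlinarith

lemma four_mul_add_six_le (hr : 0 ≤ r) (hG : 2 ≤ a₂ * G) (t : ℕ) :
    6 + 4 * (t : ℝ) ≤ a₂ * constTwo r G a₂ (t + 1) := by
  have h := natCast_le_mul_constTwo hr hG t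
  have ht : (0 : ℝ) ≤ t := Nat.cast_nonneg t
  rw [constTwo_succ]
  have h1 : a₂ * ((3 + r + 2 * (a₂ * constTwo r G a₂ t)) * G) =
      (a₂ * G) * (3 + r + 2 * (a₂ * constTwo r G a₂ t)) := by ring
  rw [h1]
  nlinarith

lemma constTwo_succ_pos (ha₂ : 0 < a₂) (hr : 0 ≤ r) (hG : 2 ≤ a₂ * G) (t : ℕ) :
    0 < constTwo r G a₂ (t + 1) := by
  have h := four_mul_add_six_le hr hG t
  have ht : (0 : ℝ) ≤ t := Nat.cast_nonneg t
  exact pos_of_mul_pos_right (by linarith) ha₂.le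

lemma constTwo_nonneg (ha₂ : 0 < a₂) (hr : 0 ≤ r) (hG : 2 ≤ a₂ * G) (t : ℕ) :
    0 ≤ constTwo r G a₂ t := by
  cases t with
  | zero => exact le_rfl
  | succ t => exact (constTwo_succ_pos ha₂ hr hG t).le

lemma four_mul_constTwo_le (ha₂ : 0 < a₂) (hr : 0 ≤ r) (hG : 2 ≤ a₂ * G) (t : ℕ) :
    4 * constTwo r G a₂ (t + 1) ≤ constOne r G a₂ (t + 1) := by
  have h1 := mul_nonneg ha₂.le (constTwo_nonneg ha₂ hr hG t)
  have h2 := constTwo_succ_pos ha₂ hr hG t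
  rw [constOne_succ]
  exact mul_le_mul_of_nonneg_right (by linarith) h2.le

lemma constOne_mul_eq (t : ℕ) : constOne r G a₂ (t + 1) * G =
    constTwo r G a₂ (t + 1) ^ 2 + G * constTwo r G a₂ (t + 1) := by
  have h : (3 + r + 2 * (a₂ * constTwo r G a₂ t)) * G = constTwo r G a₂ (t + 1) :=
    (constTwo_succ t).symm
  rw [constOne_succ]
  linear_combination constTwo r G a₂ (t + 1) * h

lemma constOne_le (ha₂ : 0 < a₂) (hr : 0 ≤ r) (hG : 2 ≤ a₂ * G) (t : ℕ) :
    constOne r G a₂ (t + 1) ≤ 2 / 3 * (a₂ * constTwo r G a₂ (t + 1) ^ 2) := by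
  have hG0 : 0 < G := pos_of_mul_pos_right (by linarith) ha₂.le
  have hc := constTwo_succ_pos ha₂ hr hG t
  have h3 : 3 * G ≤ constTwo r G a₂ (t + 1) := by
    rw [constTwo_succ]
    have := mul_nonneg ha₂.le (constTwo_nonneg ha₂ hr hG t)
    nlinarith
  have h1 := constOne_mul_eq (r := r) (G := G) (a₂ := a₂) t
  refine le_of_mul_le_mul_right ?_ hG0
  rw [h1]
  have h4 := mul_le_mul_of_nonneg_right h3 hc.le
  have h5 := mul_le_mul_of_nonneg_right hG (sq_nonneg (constTwo r G a₂ (t + 1)))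
  nlinarith

lemma sq_constTwo_le (ha₂ : 0 < a₂) (hr : 0 ≤ r) (hG : 2 ≤ a₂ * G) {Gb : ℝ} (hGb : G ≤ Gb)
    (t : ℕ) : constTwo r G a₂ (t + 1) ^ 2 ≤ Gb * constOne r G a₂ (t + 1) := by
  have hG0 : 0 < G := pos_of_mul_pos_right (by linarith) ha₂.le
  have hc := constTwo_succ_pos ha₂ hr hG t
  have h4 := four_mul_constTwo_le ha₂ hr hG t
  have h1 := constOne_mul_eq (r := r) (G := G) (a₂ := a₂) t
  have h2 := mul_le_mul_of_nonneg_right hGb (show 0 ≤ constOne r G a₂ (t + 1) by linarith)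
  have := mul_pos hG0 hc
  linarith

lemma one_add_le_constOne (ha₂ : 0 < a₂) (hr : 0 ≤ r) (hG : 2 ≤ a₂ * G) (t : ℕ) :
    1 + a₂ * constTwo r G a₂ (t + 1) ≤ a₂ * constOne r G a₂ (t + 1) := by
  have h1 := four_mul_add_six_le hr hG t
  have ht : (0 : ℝ) ≤ t := Nat.cast_nonneg t
  have h2 := mul_le_mul_of_nonneg_left (four_mul_constTwo_le ha₂ hr hG t) ha₂.le
  linarith

end Growth

/-! ### Events of small probability -/

section Events

/-- The probability allotted to each exceptional event of batch `t`; it is summable in `t`. -/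
def tailBound (p t : ℕ) : ℝ := 1 / ((p : ℝ) * t) ^ 2

lemma exp_neg_le_tailBound {p t : ℕ} (hp : 1 ≤ p) (ht : 1 ≤ t) {x : ℝ}
    (hx : 2 * Real.log p + 2 * Real.log t ≤ x) : Real.exp (-x) ≤ tailBound p t := by
  have hp' : (0 : ℝ) < p := by exact_mod_cast hp
  have ht' : (0 : ℝ) < t := by exact_mod_cast ht
  refine (Real.exp_le_exp.2 (neg_le_neg hx)).trans_eq ?_
  rw [tailBound, Real.exp_neg, one_div, mul_pow, Real.exp_add, mul_comm 2 (Real.log p),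
    mul_comm 2 (Real.log t), Real.exp_mul, Real.exp_mul, Real.exp_log hp', Real.exp_log ht',
    Real.rpow_two, Real.rpow_two]

lemma sum_tailBound_le (p b : ℕ) :
    ∑ t ∈ Finset.Icc 1 b, tailBound p t ≤ 2 / (p : ℝ) ^ 2 := by
  have h : ∀ b : ℕ, ∑ t ∈ Finset.Icc 1 (b + 1), 1 / (t : ℝ) ^ 2 ≤ 2 - 1 / ((b : ℝ) + 1) :=
    fun b => by
    induction b with
    | zero => norm_num
    | succ b ih =>
      rw [Finset.sum_Icc_succ_top (by omega)]
      push_cast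
      have hb : (0 : ℝ) ≤ b := Nat.cast_nonneg b
      have h1 : 1 / ((b : ℝ) + 1 + 1) ^ 2 ≤ 1 / ((b : ℝ) + 1) - 1 / ((b : ℝ) + 1 + 1) := by
        rw [div_sub_div _ _ (by positivity) (by positivity),
          div_le_div_iff₀ (by positivity) (by positivity)]
        nlinarith
      linarith
  have h2 : ∑ t ∈ Finset.Icc 1 b, 1 / (t : ℝ) ^ 2 ≤ 2 := by
    cases b with
    | zero => simp
    | succ b => exact (h b).trans (sub_le_self _ (by positivity))
  have h3 : ∀ t : ℕ, tailBound p t = 1 / (p : ℝ) ^ 2 * (1 / (t : ℝ) ^ 2) := fun t => by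
    rw [tailBound, mul_pow, one_div_mul_one_div]
  simp only [h3]
  rw [← Finset.mul_sum]
  calc 1 / (p : ℝ) ^ 2 * ∑ t ∈ Finset.Icc 1 b, 1 / (t : ℝ) ^ 2 ≤ 1 / (p : ℝ) ^ 2 * 2 := by gcongr
    _ = 2 / (p : ℝ) ^ 2 := by ring

lemma log_natCast_le (t : ℕ) : Real.log t ≤ t := by
  have := Real.log_le_self (Nat.cast_nonneg (α := ℝ) t)
  exact this

lemma sq_natCast_eq_exp {p : ℕ} (hp : 1 ≤ p) : (p : ℝ) ^ 2 = Real.exp (2 * Real.log p) := by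
  have hp' : (0 : ℝ) < p := by exact_mod_cast hp
  rw [mul_comm, Real.exp_mul, Real.exp_log hp', Real.rpow_two]

lemma one_le_log {p : ℕ} (hp : 4 ≤ p) : 1 ≤ Real.log p := by
  rw [Real.le_log_iff_exp_le (by exact_mod_cast (by omega : 0 < p))]
  have h1 : (4 : ℝ) ≤ p := by exact_mod_cast hp
  have := Real.exp_one_lt_d9
  linarith

variable {p : ℕ} {P : Measure (Obs p)} [IsProbabilityMeasure P]
  {β : Fin (p + 1) → ℝ} {K : ℝ → ℝ} {τ h : ℝ}
  {Ω ι : Type*} [MeasurableSpace Ω] {μ : Measure Ω} [IsProbabilityMeasure μ]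
  {O : ι → Ω → Obs p}

/-- The factor by which the gradient bound of batch `t` may exceed that of the first batches. From
the batch `p` on it grows, to make the exceptional probabilities summable in `t`. -/
def noiseFactor (p t : ℕ) : ℝ := if t ≤ p then 1 else √t

lemma noiseFactor_pos {p t : ℕ} (ht : 1 ≤ t) : 0 < noiseFactor p t := by
  unfold noiseFactor
  split_ifs
  · exact one_pos
  · exact Real.sqrt_pos.2 (by exact_mod_cast ht)

lemma measure_slope_event_le (hK : KernelAssumption K)
    (hresp : ∀ᵐ o ∂P, o.2 = 1 ∨ o.2 = -1) (hτ : 0 < τ) (hE : ExpSquareBound P τ)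
    (hlaw : ∀ i, HasLaw (O i) P μ) (hind : iIndepFun O μ) (S : Finset ι) {N lam : ℝ} {t : ℕ}
    (hN : 0 < N) (hcard : (S.card : ℝ) ≤ N) (hp : 4 ≤ p) (ht : 1 ≤ t)
    (hlam : 0 ≤ lam) (hNlam : 15360 * τ * Real.log p ≤ N * lam ^ 2) :
    μ {ω | ∃ v, N * lam * noiseFactor p t / 8 * l1Norm v <
      |∑ i ∈ S, slopeTerm K h β v (O i ω) - S.card * ∫ o, slopeTerm K h β v o ∂P|} ≤
      ENNReal.ofReal (tailBound p t) := by
  have hT := noiseFactor_pos (p := p) ht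
  set T := noiseFactor p t with hTdef
  have hL := one_le_log hp
  set L := Real.log p with hLdef
  have hp4 : (4 : ℝ) ≤ p := by exact_mod_cast hp
  refine (measure_slope_deviation_le hK hresp hτ hE hlaw hind S hN hcard
    (by positivity)).trans (ENNReal.ofReal_le_ofReal ?_)
  have h1 : 6 * L * T ^ 2 ≤ (N * lam * T / 8) ^ 2 / (40 * N * τ) := by
    rw [le_div_iff₀ (by positivity)]
    have := mul_le_mul_of_nonneg_right hNlam (show 0 ≤ N * T ^ 2 / 64 by positivity)
    linarith
  have h2 : 4 * L + 2 * Real.log t ≤ 6 * L * T ^ 2 := by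
    have ht1 : (1 : ℝ) ≤ t := by exact_mod_cast ht
    rw [hTdef]; unfold noiseFactor
    split_ifs with htp
    · have : Real.log t ≤ L := Real.log_le_log (by linarith) (by exact_mod_cast htp)
      linarith
    · rw [Real.sq_sqrt (by linarith)]
      have := log_natCast_le t
      nlinarith
  calc ((p + 1 : ℕ) : ℝ) * (2 * Real.exp (-(N * lam * T / 8) ^ 2 / (40 * N * τ)))
      ≤ (p : ℝ) ^ 2 * Real.exp (-(4 * L + 2 * Real.log t)) := by
        rw [← mul_assoc, neg_div]
        refine mul_le_mul (by push_cast; nlinarith)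
          (Real.exp_le_exp.2 (neg_le_neg (h2.trans h1))) (Real.exp_pos _).le (by positivity)
    _ = Real.exp (-(2 * L + 2 * Real.log t)) := by
        rw [sq_natCast_eq_exp (by omega), ← Real.exp_add]; congr 1; ring
    _ ≤ tailBound p t := exp_neg_le_tailBound (by omega) ht le_rfl

lemma measure_gram_event_le (hτ : 0 < τ) (hE : ExpSquareBound P τ)
    (hlaw : ∀ i, HasLaw (O i) P μ) (hind : iIndepFun O μ) (S : Finset ι) {N θ B : ℝ} {t : ℕ}
    (hN : 0 < N) (hcard : (S.card : ℝ) ≤ N) (hp : 4 ≤ p) (ht : 1 ≤ t)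
    (hB : 0 < B) {w : ι → Obs p → ℝ}
    (hwm : ∀ i, Measurable (w i)) (hw : ∀ i ∈ S, ∀ o, |w i o| ≤ B) (hθ : 0 ≤ θ)
    (hθB : θ ≤ 24 * (B * τ)) (hexp : 768 * (B * τ) ^ 2 * (Real.log p * t) ≤ N * θ ^ 2) :
    μ {ω | ∃ v, N * θ * l1Norm v ^ 2 < |∑ i ∈ S, w i (O i ω) * (aug (O i ω).1 ⬝ᵥ v) ^ 2 -
      ∑ i ∈ S, ∫ o, w i o * (aug o.1 ⬝ᵥ v) ^ 2 ∂P|} ≤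
      ENNReal.ofReal (tailBound p t) := by
  have hL := one_le_log hp
  set L := Real.log p with hLdef
  have hp4 : (4 : ℝ) ≤ p := by exact_mod_cast hp
  have ht1 : (1 : ℝ) ≤ t := by exact_mod_cast ht
  refine (measure_gram_deviation_le hτ hE hlaw hind S hN hcard hB hwm hw
    (a := N * θ) (by positivity) (by nlinarith)).trans (ENNReal.ofReal_le_ofReal ?_)
  have h1 : 8 * (L * t) ≤ (N * θ) ^ 2 / (96 * N * (B * τ) ^ 2) := by
    rw [le_div_iff₀ (by positivity)]
    have := mul_le_mul_of_nonneg_right hexp hN.le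
    linarith
  have h2 : 6 * L + 2 * Real.log t ≤ 8 * (L * t) := by
    have := log_natCast_le t
    nlinarith
  calc (((p + 1) * (p + 1) : ℕ) : ℝ) * (2 * Real.exp (-(N * θ) ^ 2 / (96 * N * (B * τ) ^ 2)))
      ≤ ((p : ℝ) ^ 2 * (p : ℝ) ^ 2) * Real.exp (-(6 * L + 2 * Real.log t)) := by
        rw [← mul_assoc, neg_div]
        refine mul_le_mul ?_
          (Real.exp_le_exp.2 (neg_le_neg (h2.trans h1))) (Real.exp_pos _).le (by positivity)
        push_cast
        have h3 : ((p : ℝ) + 1) * (p + 1) ≤ 2 * (p : ℝ) ^ 2 := by nlinarith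
        have h4 : (16 : ℝ) ≤ (p : ℝ) ^ 2 := by nlinarith
        nlinarith
    _ = Real.exp (-(2 * L + 2 * Real.log t)) := by
        rw [sq_natCast_eq_exp (by omega), ← Real.exp_add, ← Real.exp_add]; congr 1; ring
    _ ≤ tailBound p t := exp_neg_le_tailBound (by omega) ht le_rfl

lemma two_mul_exp_le_tailBound {p t : ℕ} (hp : 1 ≤ p) (ht : 1 ≤ t) {x : ℝ}
    (hpx : Real.log p ≤ x) (htx : (t : ℝ) ≤ x) (hx : 1 ≤ x) :
    Real.exp (-(5 * x)) + Real.exp (-(5 * x)) ≤ tailBound p t := by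
  have h1 : Real.exp (-(5 * x)) + Real.exp (-(5 * x)) ≤ Real.exp 1 * Real.exp (-(5 * x)) := by
    have := mul_le_mul_of_nonneg_right (Real.add_one_le_exp (1 : ℝ)) (Real.exp_pos (-(5 * x))).le
    linarith
  refine h1.trans ?_
  rw [← Real.exp_add, ← neg_neg (1 + -(5 * x))]
  refine exp_neg_le_tailBound hp ht ?_
  have h4 := log_natCast_le t
  linarith

/-- The number of vertices averaged, up to the factor `s (1 + D)² / h`. -/
def vertexConst (τ a₁ : ℝ) : ℝ := 2048 * (3 * τ + 112 * a₁) / a₁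

variable [NeZero p] {Cf ν₀ c₁ c₂ M c C a₁ a₂ r : ℝ}

/-- The uniform curvature bound on the cone, with a number `k` of vertices for which both the error
of Maurey's argument and the size `(2 (p + 1))ᵏ` of the union bound are acceptable. -/
lemma measure_curvature_event_le (hK : KernelAssumption K)
    (hM : ModelAssumption P β Cf ν₀ c₁ c₂ M c C a₁ a₂) (hc : 0 < c) (hCf : 0 < Cf)
    (ha₁ : 0 < a₁) (hτ : 0 < τ)
    (hE : ExpSquareBound P τ) (hh : 0 < h) (hh1 : h ≤ 1)
    (hsmall : 392 * smoothConst Cf c τ * h ≤ a₁)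
    (hr0 : 0 < r) (hr : 1572864 * τ ^ 2 * r ^ 2 ≤ a₁ * h ^ 3)
    (hlaw : ∀ i, HasLaw (O i) P μ) (hind : iIndepFun O μ) (S : Finset ι) {N D Q : ℝ} {s t : ℕ}
    (hN : 0 < N) (hcard : (S.card : ℝ) ≤ N) (hp : 4 ≤ p) (ht : 1 ≤ t) (hs : 1 ≤ s)
    (hD : 0 ≤ D) (htD : (t : ℝ) ≤ 1 + D) (hQ7 : 7 ≤ Q)
    (hQ : 196608 * τ ^ 2 / a₁ ^ 2 * (2 * vertexConst τ a₁ + 7) ≤ Q)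
    (hNh : Q * ((1 + D) ^ 2 * s * Real.log p) ≤ N * h ^ 3) :
    μ {ω | ∃ v, l2Norm v = r ∧ l1Norm v ≤ (4 + 2 * D) * √s * r ∧
      ∑ i ∈ S, curvTerm K h β v (O i ω) <
        (27 / 16 * S.card - N / 16) * (kappaLow K * a₁ * r ^ 2)} ≤
      ENNReal.ofReal (tailBound p t) := by
  have hL := one_le_log hp
  set L := Real.log p with hLdef
  have hp4 : (4 : ℝ) ≤ p := by exact_mod_cast hp
  have ht1 : (1 : ℝ) ≤ t := by exact_mod_cast ht
  have hs1 : (1 : ℝ) ≤ s := by exact_mod_cast hs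
  set c' := vertexConst τ a₁ with hc'
  have hc'0 : 0 < c' := by rw [hc']; unfold vertexConst; positivity
  set y : ℝ := (1 + D) ^ 2 * s / h with hy
  have hy0 : 0 < y := by positivity
  have hyt : (t : ℝ) ≤ y := by
    rw [hy, le_div_iff₀ hh]
    have h1 : (t : ℝ) ≤ (1 + D) ^ 2 := by nlinarith
    have h2 : (t : ℝ) * h ≤ t := mul_le_of_le_one_right (by linarith) hh1
    have h3 : (1 + D) ^ 2 ≤ (1 + D) ^ 2 * s := le_mul_of_one_le_right (sq_nonneg _) hs1
    linarith
  set k := ⌈c' * y⌉₊ with hk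
  have hk0 : 0 < k := Nat.ceil_pos.2 (by positivity)
  have hk1 : c' * y ≤ k := Nat.le_ceil _
  have hk2 : (k : ℝ) ≤ c' * y + 1 := (Nat.ceil_lt_add_one (by positivity)).le
  have hkR : 128 * ((4 + 2 * D) * √s * r) ^ 2 * (3 * τ / h + 112 * a₁) ≤ a₁ * r ^ 2 * k := by
    have h1 : ((4 + 2 * D) * √(s : ℝ) * r) ^ 2 = (4 + 2 * D) ^ 2 * s * r ^ 2 := by
      rw [mul_pow, mul_pow, Real.sq_sqrt (Nat.cast_nonneg _)]
    have h2 : (4 + 2 * D) ^ 2 ≤ 16 * (1 + D) ^ 2 := by nlinarith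
    have h3 : 3 * τ / h + 112 * a₁ ≤ (3 * τ + 112 * a₁) / h := by
      rw [add_div]
      have : 112 * a₁ ≤ 112 * a₁ / h := by
        rw [le_div_iff₀ hh]; exact mul_le_of_le_one_right (by positivity) hh1
      linarith
    rw [h1]
    calc 128 * ((4 + 2 * D) ^ 2 * s * r ^ 2) * (3 * τ / h + 112 * a₁)
        ≤ 128 * (16 * (1 + D) ^ 2 * s * r ^ 2) * ((3 * τ + 112 * a₁) / h) := by gcongr
      _ = a₁ * r ^ 2 * (c' * y) := by
        rw [hc', hy]; unfold vertexConst; field_simp; ring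
      _ ≤ a₁ * r ^ 2 * k := by gcongr
  refine (measure_curvature_lt_le hK hM hc hCf ha₁ hτ hE hh hsmall hr0 hr hlaw hind S hN hcard hk0
    hkR).trans (ENNReal.ofReal_le_ofReal ?_)
  have hNh2 : Q * (y * L) ≤ N * h ^ 2 := by
    have h1 : Q * ((1 + D) ^ 2 * s * L) = Q * (y * L) * h := by rw [hy]; field_simp
    rw [h1] at hNh
    refine le_of_mul_le_mul_right (hNh.trans_eq ?_) hh
    ring
  have hQ0 : 0 < Q := by linarith
  have hyL : 1 ≤ y * L := (ht1.trans hyt).trans (le_mul_of_one_le_right hy0.le hL)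
  have hNQ : 7 * (y * L) ≤ N := by
    have h1 : h ^ 2 ≤ 1 := pow_le_one₀ hh.le hh1
    have h2 : N * h ^ 2 ≤ N := mul_le_of_le_one_right hN.le h1
    have h3 : 7 * (y * L) ≤ Q * (y * L) := by gcongr
    linarith
  have hexp2 : (2 * c' + 7) * (y * L) ≤ N * a₁ ^ 2 * h ^ 2 / (196608 * τ ^ 2) := by
    rw [le_div_iff₀ (by positivity)]
    have h1 := mul_le_mul_of_nonneg_right hQ
      (show 0 ≤ a₁ ^ 2 * (y * L) by positivity)
    have h2 := mul_le_mul_of_nonneg_left hNh2 (sq_nonneg a₁)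
    have h3 : 196608 * τ ^ 2 / a₁ ^ 2 * (2 * c' + 7) * (a₁ ^ 2 * (y * L)) =
        (2 * c' + 7) * (y * L) * (196608 * τ ^ 2) := by field_simp
    linarith
  have hp2 : 2 * ((p + 1 : ℕ) : ℝ) ≤ Real.exp (2 * L) := by
    rw [← sq_natCast_eq_exp (p := p) (by omega)]
    push_cast
    nlinarith
  have hfirst : ((p + 1 : ℕ) : ℝ) * Real.exp (-N) ≤ Real.exp (-(5 * (y * L))) := by
    have h1 : ((p + 1 : ℕ) : ℝ) ≤ Real.exp (2 * L) :=
      (le_mul_of_one_le_left (Nat.cast_nonneg _) one_le_two).trans hp2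
    refine (mul_le_mul_of_nonneg_right h1 (Real.exp_pos _).le).trans ?_
    rw [← Real.exp_add]
    refine Real.exp_le_exp.2 ?_
    have : L ≤ y * L := le_mul_of_one_le_left (by linarith) (by linarith)
    linarith
  have hsecond : (2 * ((p + 1 : ℕ) : ℝ)) ^ k *
      Real.exp (-(N * a₁ ^ 2 * h ^ 2) / (196608 * τ ^ 2)) ≤ Real.exp (-(5 * (y * L))) := by
    have h2 : (2 * ((p + 1 : ℕ) : ℝ)) ^ k ≤ Real.exp (k * (2 * L)) := by
      rw [Real.exp_nat_mul]
      exact pow_le_pow_left₀ (by positivity) hp2 k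
    refine (mul_le_mul_of_nonneg_right h2 (Real.exp_pos _).le).trans ?_
    rw [← Real.exp_add, neg_div]
    refine Real.exp_le_exp.2 ?_
    have h3 : L ≤ y * L := le_mul_of_one_le_left (by linarith) (by linarith)
    have h4 : (k : ℝ) * (2 * L) ≤ (c' * y + 1) * (2 * L) := by gcongr
    linarith
  refine (add_le_add hfirst hsecond).trans
    (two_mul_exp_le_tailBound (by omega) ht ?_ (hyt.trans (le_mul_of_one_le_right hy0.le hL)) hyL)
  exact le_mul_of_one_le_left (by linarith) (ht1.trans hyt)

end Events

/-! ### Control of the aggregated Hessian -/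

section Population

variable {p : ℕ} [NeZero p] {P : Measure (Obs p)} [IsProbabilityMeasure P]
  {b : Fin (p + 1) → ℝ} {K : ℝ → ℝ} {Cf ν₀ c₁ c₂ M c C a₁ a₂ τ h : ℝ}

omit [IsProbabilityMeasure P] in
lemma ModelAssumption.eig_le (hM : ModelAssumption P b Cf ν₀ c₁ c₂ M c C a₁ a₂) : a₁ ≤ a₂ := by
  obtain ⟨D, hD, h1, h2⟩ := hM.hessian
  exact h1.trans ((minEig_le_maxEig hD.isHermitian).trans h2)

/-- The expected smoothed Hessian is close to the Dirac Hessian. -/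
lemma integral_scaledKernel_bounds (hK : KernelAssumption K)
    (hM : ModelAssumption P b Cf ν₀ c₁ c₂ M c C a₁ a₂) (hc : 0 < c) (hCf : 0 < Cf)
    (hτ : 0 < τ) (hE : ExpSquareBound P τ) (hh : 0 < h)
    (hsmall : 64 * (smoothConst Cf c τ * kappa K 1) * h ≤ a₁) (v : Fin (p + 1) → ℝ) :
    63 / 64 * a₁ * l2Norm v ^ 2 ≤
        ∫ o, scaledKernel K h (1 - margin b o) * (aug o.1 ⬝ᵥ v) ^ 2 ∂P ∧
      ∫ o, scaledKernel K h (1 - margin b o) * (aug o.1 ⬝ᵥ v) ^ 2 ∂P ≤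
        65 / 64 * a₂ * l2Norm v ^ 2 := by
  obtain ⟨D, hD, hD1, hD2⟩ := hM.hessian
  obtain ⟨κ₀, -, hκ₀⟩ := hK.exists_bound
  have habs : ∀ u, |scaledKernel K h u| = scaledKernel K h u := fun u =>
    abs_of_nonneg (scaledKernel_nonneg hK hh u)
  have hb : ∀ u, |scaledKernel K h u| ≤ h⁻¹ * κ₀ := fun u => by
    rw [habs]; exact mul_le_mul_of_nonneg_left (hκ₀ _) (inv_nonneg.2 hh.le)
  have h1 := abs_integral_kernel_sub_hessian_le hM hc hCf hτ hE hD (measurable_scaledKernel hK h)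
    hb (integrable_scaledKernel hK hh) (integral_scaledKernel hK hh)
    (by simpa only [habs] using integrable_abs_mul_scaledKernel hK hh) v
  simp only [habs] at h1
  rw [integral_abs_mul_scaledKernel hh] at h1
  have h2 := minEig_mul_le_dotProduct_mulVec hD.isHermitian v
  have h3 := dotProduct_mulVec_le_maxEig hD.isHermitian v
  have hv := sq_nonneg (l2Norm v)
  have h4 := mul_le_mul_of_nonneg_right hD1 hv
  have h5 := mul_le_mul_of_nonneg_right hD2 hv
  have h6 := mul_le_mul_of_nonneg_right hsmall hv
  have h7 := mul_le_mul_of_nonneg_right hM.eig_le hv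
  obtain ⟨h8, h9⟩ := abs_le.1 h1
  constructor <;> linarith

omit [NeZero p] [IsProbabilityMeasure P] in
lemma integral_remWeight_le (hτ : 0 < τ) (hE : ExpSquareBound P τ) (hp : 1 ≤ Real.log p)
    (hh : 0 < h) {Cη κ₀ ρ : ℝ} (hC : 0 ≤ Cη) (hκ : 0 ≤ κ₀)
    (hsmall : 64 * (Cη * (6 * τ ^ 2 + 2 * τ * (3 + 6 * τ ^ 2))) * (ρ ^ 2 * Real.log p) ≤
      a₁ * h ^ 3) (v : Fin (p + 1) → ℝ) :
    ∫ o : Obs p, remWeight Cη κ₀ h ρ o * (aug o.1 ⬝ᵥ v) ^ 2 ∂P ≤ 1 / 64 * a₁ * l2Norm v ^ 2 := by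
  obtain ⟨hi, hb⟩ := hE.integral_norm_sq_mul_sq hτ hp v
  have hle : ∀ o : Obs p, remWeight Cη κ₀ h ρ o * (aug o.1 ⬝ᵥ v) ^ 2 ≤
      Cη * ρ ^ 2 / h ^ 3 * (‖aug o.1‖ ^ 2 * (aug o.1 ⬝ᵥ v) ^ 2) := fun o => by
    rw [← mul_assoc]
    exact mul_le_mul_of_nonneg_right (min_le_left _ _) (sq_nonneg _)
  have hi' := hi.const_mul (Cη * ρ ^ 2 / h ^ 3)
  refine (integral_mono_of_nonneg (ae_of_all _ fun o => mul_nonneg (remWeight_nonneg hC hκ hh o)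
    (sq_nonneg _)) hi' (ae_of_all _ hle)).trans ?_
  rw [integral_const_mul]
  refine (mul_le_mul_of_nonneg_left hb (by positivity)).trans ?_
  have h1 := mul_le_mul_of_nonneg_right hsmall
    (show 0 ≤ l2Norm v ^ 2 / (64 * h ^ 3) by positivity)
  have h2 : a₁ * h ^ 3 * (l2Norm v ^ 2 / (64 * h ^ 3)) = 1 / 64 * a₁ * l2Norm v ^ 2 := by
    field_simp
  rw [h2] at h1
  refine le_trans (le_of_eq ?_) h1
  field_simp

end Population

section Control

variable {p : ℕ} {P : Measure (Obs p)} {K : ℝ → ℝ} {h : ℕ → ℝ} {n : ℕ → ℕ}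
  {d : (t : ℕ) → Fin (n t) → Obs p} {β : ℕ → Fin (p + 1) → ℝ} {b : Fin (p + 1) → ℝ}

/-- Deviation bounds at the target turn into bounds for the aggregated Hessian at the estimates. -/
lemma aggHessian_bounds (hK : KernelAssumption K) {Cη κ₀ a₁ a₂ θ : ℝ} (hC : 0 ≤ Cη)
    (hη : ∀ a b, |K (a + b) - K a| ≤ 1 / 32 * K a + Cη * b ^ 2) (hκ : ∀ t, K t ≤ κ₀)
    (ha₁ : 0 < a₁) (ha : a₁ ≤ a₂) {t : ℕ} (hN : 0 < cumSize n t) (hθ : 0 ≤ θ)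
    (hh : ∀ r ∈ Finset.Icc 1 t, 0 < h r)
    (hresp : ∀ r ∈ Finset.Icc 1 t, ∀ i, (d r i).2 = 1 ∨ (d r i).2 = -1)
    {ρ : ℕ → ℝ} (hρ : ∀ r ∈ Finset.Icc 1 t, l1Norm (β r - b) ≤ ρ r)
    (hEH : ∀ r ∈ Finset.Icc 1 t, ∀ v,
      63 / 64 * a₁ * l2Norm v ^ 2 ≤
        ∫ o, scaledKernel K (h r) (1 - margin b o) * (aug o.1 ⬝ᵥ v) ^ 2 ∂P ∧
      ∫ o, scaledKernel K (h r) (1 - margin b o) * (aug o.1 ⬝ᵥ v) ^ 2 ∂P ≤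
        65 / 64 * a₂ * l2Norm v ^ 2)
    (hER : ∀ r ∈ Finset.Icc 1 t, ∀ v,
      ∫ o : Obs p, remWeight Cη κ₀ (h r) (ρ r) o * (aug o.1 ⬝ᵥ v) ^ 2 ∂P ≤
        1 / 64 * a₁ * l2Norm v ^ 2)
    (hH : ∀ v, |∑ q ∈ sampleIndex n t, scaledKernel K (h q.1) (1 - margin b (d q.1 q.2)) *
        (aug (d q.1 q.2).1 ⬝ᵥ v) ^ 2 - ∑ q ∈ sampleIndex n t,
        ∫ o, scaledKernel K (h q.1) (1 - margin b o) * (aug o.1 ⬝ᵥ v) ^ 2 ∂P| ≤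
      cumSize n t * θ * l1Norm v ^ 2)
    (hR : ∀ v, |∑ q ∈ sampleIndex n t, remWeight Cη κ₀ (h q.1) (ρ q.1) (d q.1 q.2) *
        (aug (d q.1 q.2).1 ⬝ᵥ v) ^ 2 - ∑ q ∈ sampleIndex n t,
        ∫ o : Obs p, remWeight Cη κ₀ (h q.1) (ρ q.1) o * (aug o.1 ⬝ᵥ v) ^ 2 ∂P| ≤
      cumSize n t * θ * l1Norm v ^ 2) (v : Fin (p + 1) → ℝ) :
    v ⬝ᵥ (aggHessian K h d β t *ᵥ v) ≤
        9 / 8 * a₂ * l2Norm v ^ 2 + 3 * θ * l1Norm v ^ 2 ∧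
      9 / 10 * a₁ * l2Norm v ^ 2 - 3 * θ * l1Norm v ^ 2 ≤
        v ⬝ᵥ (aggHessian K h d β t *ᵥ v) := by
  have hNpos : (0 : ℝ) < cumSize n t := by exact_mod_cast hN
  have hmain := abs_le.1 (abs_aggHessian_sub_le (n := n) (d := d) (β := β) hK hC (by norm_num) hη
    hκ hh hresp hρ v)
  have hH' := abs_le.1 (hH v)
  have hR' := abs_le.1 (hR v)
  have hsumc : ∀ x : ℝ, ∑ _q ∈ sampleIndex n t, x = cumSize n t * x := fun x => by
    rw [Finset.sum_const, card_sampleIndex, nsmul_eq_mul]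
  have e1 := Finset.sum_le_sum fun q (hq : q ∈ sampleIndex n t) =>
    (hEH q.1 (one_le_of_mem_sampleIndex hq) v).1
  have e2 := Finset.sum_le_sum fun q (hq : q ∈ sampleIndex n t) =>
    (hEH q.1 (one_le_of_mem_sampleIndex hq) v).2
  have e3 := Finset.sum_le_sum fun q (hq : q ∈ sampleIndex n t) =>
    hER q.1 (one_le_of_mem_sampleIndex hq) v
  rw [hsumc] at e1 e2 e3
  set N : ℝ := (cumSize n t : ℝ)
  have hq : 0 ≤ N * l2Norm v ^ 2 := by positivity
  have hl : 0 ≤ N * (θ * l1Norm v ^ 2) := by positivity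
  have h1 := mul_nonneg ha₁.le hq
  have h2 := mul_le_mul_of_nonneg_right ha hq
  constructor
  · refine le_of_mul_le_mul_left ?_ hNpos
    linarith [hmain.2, hH'.2, hR'.2]
  · refine le_of_mul_le_mul_left ?_ hNpos
    linarith [hmain.1, hH'.1, hR'.2, hH'.2]

end Control

section PriorConstants

variable {r G a₁ a₂ : ℝ}

/-- An entrywise accuracy `θ` of the Hessian that is a small multiple of `1 / (s C₁)` satisfies the
requirements of `PriorControl`. -/
lemma theta_bounds (ha₁ : 0 < a₁) (ha₂ : 0 < a₂) (hr : 0 ≤ r) (hG : 2 ≤ a₂ * G) {Gb η₁ s : ℝ}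
    (hGb : G ≤ Gb) (hs : 0 < s) (hη0 : 0 ≤ η₁) (hη1 : 400 * η₁ ≤ 1)
    (hη2 : 240 * (a₂ * Gb) * η₁ ≤ 1) (hη3 : 430 * (a₂ ^ 2 * Gb) * η₁ ≤ a₁) (t : ℕ) :
    let C := constTwo r G a₂ (t + 1)
    let C₁ := constOne r G a₂ (t + 1)
    let θ := 3 * (η₁ / (s * C₁))
    θ * s * C₁ ^ 2 ≤ a₂ * C ^ 2 / 200 ∧ a₂ * C ^ 2 * s * θ ≤ 1 / 80 ∧
      θ * (4 + 2 * (a₂ * C)) ^ 2 * s ≤ a₁ / 20 := by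
  intro C C₁ θ
  have hC : 0 < C := constTwo_succ_pos ha₂ hr hG t
  have h4 : 4 * C ≤ C₁ := four_mul_constTwo_le ha₂ hr hG t
  have hC₁ : 0 < C₁ := by linarith
  have h1 : C₁ ≤ 2 / 3 * (a₂ * C ^ 2) := constOne_le ha₂ hr hG t
  have h2 : C ^ 2 ≤ Gb * C₁ := sq_constTwo_le ha₂ hr hG hGb t
  have h6 : 6 ≤ a₂ * C := by
    have := four_mul_add_six_le hr hG t
    have ht : (0 : ℝ) ≤ t := Nat.cast_nonneg t
    linarith
  have hx : ∀ x, x * s * θ = 3 * η₁ * x / C₁ := fun x => by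
    simp only [θ]; field_simp
  refine ⟨?_, ?_, ?_⟩
  · rw [mul_comm θ s, mul_comm (s * θ), ← mul_assoc, hx, sq C₁]
    have h7 : 3 * η₁ * (C₁ * C₁) / C₁ = 3 * η₁ * C₁ := by field_simp
    rw [h7]
    have h8 := mul_le_mul_of_nonneg_left h1 hη0
    have h9 := mul_le_mul_of_nonneg_right hη1 (show 0 ≤ a₂ * C ^ 2 by positivity)
    linarith
  · rw [hx, div_le_iff₀ hC₁]
    have h8 := mul_le_mul_of_nonneg_left h2 (show 0 ≤ 3 * η₁ * a₂ by positivity)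
    have h9 := mul_le_mul_of_nonneg_right hη2 hC₁.le
    linarith
  · rw [mul_comm θ, mul_right_comm, hx, div_le_iff₀ hC₁]
    have h7 : (4 + 2 * (a₂ * C)) ^ 2 ≤ 64 / 9 * (a₂ * C) ^ 2 := by nlinarith
    have h8 := mul_le_mul_of_nonneg_left h2 (show 0 ≤ 64 / 3 * η₁ * a₂ ^ 2 by positivity)
    have h9 := mul_le_mul_of_nonneg_right hη3 hC₁.le
    have h10 := mul_le_mul_of_nonneg_left h7 hη0
    have h11 := mul_nonneg ha₁.le hC₁.le
    have h12 : 0 ≤ η₁ * (a₂ ^ 2 * (Gb * C₁)) := by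
      have := (sq_nonneg C).trans h2
      positivity
    linarith

end PriorConstants

/-! ### The error bounds outside the exceptional events -/

/-- The numerical conditions under which every batch `t ≤ b` can be processed. The sequences `E₁`
and `E₂` are the constants of the `l₁` and `l₂` bounds; `Bw / h t` bounds all kernel weights of the
batches up to `t`, and `η₁ / (s E₁ t)` is the entrywise accuracy required of the Hessian. -/
structure Regime (K : ℝ → ℝ) (p s : ℕ) (n : ℕ → ℕ) (b : ℕ) (lam h E₁ E₂ : ℕ → ℝ)
    (Cf c τ a₁ a₂ κ₀ Cη η₁ Bw : ℝ) : Prop where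
  lam_pos : ∀ t ∈ Finset.Icc 1 b, 0 < lam t
  lam_mono : ∀ t ∈ Finset.Ico 1 b, cumSize n t * lam t ≤ cumSize n (t + 1) * lam (t + 1)
  lam_large : ∀ t ∈ Finset.Icc 1 b, 15360 * τ * Real.log p ≤ cumSize n t * lam t ^ 2
  bias : ∀ t ∈ Finset.Icc 1 b,
    4 * smoothConst Cf c τ * kappa K 2 * h t ^ 2 ≤ 1 / 8 * √s * lam t
  h_pos : ∀ t ∈ Finset.Icc 1 b, 0 < h t
  h_le_one : ∀ t ∈ Finset.Icc 1 b, h t ≤ 1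
  h_window : ∀ t ∈ Finset.Icc 1 b, 392 * smoothConst Cf c τ * h t ≤ a₁
  h_hessian : ∀ t ∈ Finset.Icc 1 b, 64 * (smoothConst Cf c τ * kappa K 1) * h t ≤ a₁
  radius : ∀ t ∈ Finset.Icc 1 b,
    1572864 * τ ^ 2 * (E₂ t * √s * lam t) ^ 2 ≤ a₁ * h t ^ 3
  curvature : ∀ t ∈ Finset.Icc 1 b,
    (7 + 196608 * τ ^ 2 / a₁ ^ 2 * (2 * vertexConst τ a₁ + 7)) *
      ((1 + a₂ * E₂ (t - 1)) ^ 2 * s * Real.log p) ≤ cumSize n t * h t ^ 3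
  remainder : ∀ t ∈ Finset.Ico 1 b, 64 * (Cη * (6 * τ ^ 2 + 2 * τ * (3 + 6 * τ ^ 2))) *
    ((E₁ t * s * lam t) ^ 2 * Real.log p) ≤ a₁ * h t ^ 3
  weight : ∀ t ∈ Finset.Ico 1 b, ∀ r ∈ Finset.Icc 1 t, κ₀ / h r ≤ Bw / h t
  gram : ∀ t ∈ Finset.Ico 1 b, 768 * (Bw / h t * τ) ^ 2 * (Real.log p * t) ≤
    cumSize n t * (η₁ / (s * E₁ t)) ^ 2
  gram_small : ∀ t ∈ Finset.Ico 1 b, η₁ / (s * E₁ t) ≤ 24 * (Bw / h t * τ)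

/-- Gradient bound at the target. After the first `p` batches the `l₁` norm is bounded by
`√(p + 1)` times the Euclidean norm, and the growth of the constants absorbs the larger
deviation. -/
lemma noise_le {p s t : ℕ} {N m lam D bias : ℝ} {f F : (Fin (p + 1) → ℝ) → ℝ} (hm : 0 ≤ m)
    (hmN : m ≤ N) (hlam : 0 ≤ lam) (hs : 1 ≤ s) (hD : 0 ≤ D) (htD : p < t → (t : ℝ) ≤ D)
    (hdev : ∀ v, |f v - m * F v| ≤ N * lam * noiseFactor p t / 8 * l1Norm v)
    (hF : ∀ v, |F v| ≤ bias * l2Norm v) (hbias : bias ≤ 1 / 8 * √s * lam)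
    (v : Fin (p + 1) → ℝ) :
    |f v| ≤ N * lam * (1 / 8 * l1Norm v + (1 / 8 + 1 / 8 * D) * √s * l2Norm v) := by
  have hv2 := l2Norm_nonneg v
  have hv1 := l1Norm_nonneg v
  have hN : 0 ≤ N := hm.trans hmN
  have hNl : 0 ≤ N * lam := mul_nonneg hN hlam
  have h1 : |f v| ≤ |f v - m * F v| + m * |F v| := by
    have := abs_add_le (f v - m * F v) (m * F v)
    rwa [sub_add_cancel, abs_mul, abs_of_nonneg hm] at this
  have h2 : m * |F v| ≤ N * (1 / 8 * √s * lam * l2Norm v) :=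
    mul_le_mul hmN ((hF v).trans (mul_le_mul_of_nonneg_right hbias hv2)) (abs_nonneg _) hN
  have hsq1 : 1 ≤ √(s : ℝ) := Real.one_le_sqrt.2 (by exact_mod_cast hs)
  have h3 : noiseFactor p t * l1Norm v ≤ l1Norm v + D * √s * l2Norm v := by
    unfold noiseFactor
    split_ifs with htp
    · rw [one_mul]
      have : 0 ≤ D * √s * l2Norm v := by positivity
      linarith
    · have h4 : l1Norm v ≤ √t * l2Norm v := by
        refine (l1Norm_le_sqrt_mul_l2Norm v).trans (mul_le_mul_of_nonneg_right
          (Real.sqrt_le_sqrt ?_) hv2)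
        exact_mod_cast (by omega : p + 1 ≤ t)
      calc √(t : ℝ) * l1Norm v ≤ √t * (√t * l2Norm v) := by gcongr
        _ = t * l2Norm v := by rw [← mul_assoc, Real.mul_self_sqrt (Nat.cast_nonneg _)]
        _ ≤ D * √s * l2Norm v := by
          refine mul_le_mul_of_nonneg_right ((htD (not_le.1 htp)).trans ?_) hv2
          exact le_mul_of_one_le_right hD hsq1
        _ ≤ _ := le_add_of_nonneg_left hv1
  have h5 := mul_le_mul_of_nonneg_left h3 hNl
  have h6 := hdev v
  linarith

section Good

variable {p : ℕ} [NeZero p] {P : Measure (Obs p)} [IsProbabilityMeasure P]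
  {βs : Fin (p + 1) → ℝ} {K : ℝ → ℝ} {Cf ν₀ c₁ c₂ M c C a₁ a₂ τ κ₀ Cη η₁ Bw r G Gb : ℝ}
  {s b : ℕ} {n : ℕ → ℕ} {lam h : ℕ → ℝ} {d : (t : ℕ) → Fin (n t) → Obs p}

/-- The sample `d` avoids all exceptional events. -/
structure GoodSample (P : Measure (Obs p)) (βs : Fin (p + 1) → ℝ) (K : ℝ → ℝ) (s b : ℕ)
    (lam h E₁ E₂ : ℕ → ℝ) (a₁ a₂ κ₀ Cη η₁ : ℝ) (d : (t : ℕ) → Fin (n t) → Obs p) : Prop where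
  resp : ∀ t i, (d t i).2 = 1 ∨ (d t i).2 = -1
  slope : ∀ t ∈ Finset.Icc 1 b, ∀ v, |∑ i, slopeTerm K (h t) βs v (d t i) -
      n t * ∫ o, slopeTerm K (h t) βs v o ∂P| ≤
    cumSize n t * lam t * noiseFactor p t / 8 * l1Norm v
  curv : ∀ t ∈ Finset.Icc 1 b, ∀ v, l2Norm v = E₂ t * √s * lam t →
    l1Norm v ≤ (4 + 2 * (a₂ * E₂ (t - 1))) * √s * (E₂ t * √s * lam t) →
    (27 / 16 * n t - (cumSize n t : ℝ) / 16) * (kappaLow K * a₁ * (E₂ t * √s * lam t) ^ 2) ≤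
      ∑ i, curvTerm K (h t) βs v (d t i)
  hess : ∀ t ∈ Finset.Ico 1 b, ∀ v,
    |∑ q ∈ sampleIndex n t, scaledKernel K (h q.1) (1 - margin βs (d q.1 q.2)) *
        (aug (d q.1 q.2).1 ⬝ᵥ v) ^ 2 - ∑ q ∈ sampleIndex n t,
        ∫ o, scaledKernel K (h q.1) (1 - margin βs o) * (aug o.1 ⬝ᵥ v) ^ 2 ∂P| ≤
      cumSize n t * (η₁ / (s * E₁ t)) * l1Norm v ^ 2
  rem : ∀ t ∈ Finset.Ico 1 b, ∀ v,
    |∑ q ∈ sampleIndex n t, remWeight Cη κ₀ (h q.1) (E₁ q.1 * s * lam q.1) (d q.1 q.2) *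
        (aug (d q.1 q.2).1 ⬝ᵥ v) ^ 2 - ∑ q ∈ sampleIndex n t,
        ∫ o : Obs p, remWeight Cη κ₀ (h q.1) (E₁ q.1 * s * lam q.1) o *
          (aug o.1 ⬝ᵥ v) ^ 2 ∂P| ≤
      cumSize n t * (η₁ / (s * E₁ t)) * l1Norm v ^ 2

/-- The deterministic conclusion: on a good sample the online estimates exist and satisfy the error
bounds at every batch. -/
lemma GoodSample.bounds (hK : KernelAssumption K)
    (hM : ModelAssumption P βs Cf ν₀ c₁ c₂ M c C a₁ a₂) (hc : 0 < c) (hCf : 0 < Cf)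
    (ha₁ : 0 < a₁) (ha₂ : 0 < a₂) (hτ : 0 < τ) (hE : ExpSquareBound P τ) (hp : 4 ≤ p)
    (hs : l0Norm βs = s) (hs1 : 1 ≤ s) (hn : ∀ t ∈ Finset.Icc 1 b, 1 ≤ n t)
    (hC : 0 ≤ Cη) (hη : ∀ a b, |K (a + b) - K a| ≤ 1 / 32 * K a + Cη * b ^ 2)
    (hκ : ∀ t, K t ≤ κ₀) (hr : 0 ≤ r) (hG : 2 ≤ a₂ * G) (hG1 : 1 ≤ kappaLow K * a₁ * G)
    (hGb : G ≤ Gb) (hη0 : 0 ≤ η₁) (hη1 : 400 * η₁ ≤ 1)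
    (hη2 : 240 * (a₂ * Gb) * η₁ ≤ 1) (hη3 : 430 * (a₂ ^ 2 * Gb) * η₁ ≤ a₁)
    (R : Regime K p s n b lam h (constOne r G a₂) (constTwo r G a₂) Cf c τ a₁ a₂ κ₀ Cη η₁ Bw)
    (H : GoodSample P βs K s b lam h (constOne r G a₂) (constTwo r G a₂) a₁ a₂ κ₀ Cη η₁ d) :
    (∃ β, IsOnlineLasso K lam h d b β) ∧
    ∀ β, IsOnlineLasso K lam h d b β → ∀ t ∈ Finset.Icc 1 b,
      l2Norm (β t - βs) ≤ constTwo r G a₂ t * √s * lam t ∧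
      l1Norm (β t - βs) ≤ constOne r G a₂ t * s * lam t := by
  have hs0 : (0 : ℝ) < s := by exact_mod_cast hs1
  have hL := one_le_log hp
  have hκ₀ : 0 ≤ κ₀ := (hK.nonneg 0).trans (hκ 0)
  have hSC : 0 ≤ smoothConst Cf c τ := by unfold smoothConst; positivity
  refine online_induction (Q := fun t u => l2Norm (u - βs) ≤ constTwo r G a₂ t * √s * lam t ∧
    l1Norm (u - βs) ≤ constOne r G a₂ t * s * lam t) fun t ht β hβ => ?_
  have ht' := Finset.mem_Icc.1 ht
  have hsub : ∀ q ∈ Finset.Icc 1 t, q ∈ Finset.Icc 1 b := fun q hq =>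
    Finset.Icc_subset_Icc_right ht'.2 hq
  have hNt : ∀ q ∈ Finset.Icc 1 b, 0 < cumSize n q := fun q hq => by
    have hq' := Finset.mem_Icc.1 hq
    exact lt_of_lt_of_le (hn q hq) (Finset.single_le_sum (f := n) (fun _ _ => Nat.zero_le _)
      (Finset.mem_Icc.2 ⟨hq'.1, le_rfl⟩))
  have hCt := constTwo_nonneg ha₂ hr hG (t - 1)
  set D := a₂ * constTwo r G a₂ (t - 1) with hD
  have hD0 : 0 ≤ D := by positivity
  obtain ⟨u, rfl⟩ : ∃ u, t = u + 1 := ⟨t - 1, by omega⟩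
  have hlam := R.lam_pos _ ht
  have hnN : (n (u + 1) : ℝ) ≤ cumSize n (u + 1) := by
    rw [cumSize_succ]; push_cast; exact le_add_of_nonneg_left (Nat.cast_nonneg _)
  have hstep := online_step (lam := lam) (d := d) (β := β) (b := βs) hK ht'.1
    (fun q hq => R.h_pos q (hsub q hq)) (hNt _ ht) (H.resp _) hs hs1 ha₁ ha₂.le hCt hlam
    (C := constTwo r G a₂ (u + 1))
    (by
      have h1 : kappaLow K * a₁ * constTwo r G a₂ (u + 1) =
          kappaLow K * a₁ * G * (3 + r + 2 * (a₂ * constTwo r G a₂ u)) := by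
        rw [constTwo_succ]; ring
      rw [Nat.add_sub_cancel] at hD ⊢
      rw [h1, ← hD]
      nlinarith)
    (fun v => noise_le (bias := 4 * smoothConst Cf c τ * kappa K 2 * h (u + 1) ^ 2)
      (f := fun v => ∑ i, slopeTerm K (h (u + 1)) βs v (d (u + 1) i)) (Nat.cast_nonneg _)
      hnN hlam.le hs1 hD0
      (fun hpt => by
        obtain ⟨w, rfl⟩ : ∃ w, u = w + 1 := ⟨u - 1, by omega⟩
        have h1 := four_mul_add_six_le hr hG w
        have hw : (0 : ℝ) ≤ w := Nat.cast_nonneg w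
        rw [hD, Nat.add_sub_cancel]
        push_cast
        linarith)
      (H.slope _ ht)
      (fun v => abs_integral_slope_le hK hM hc hCf hτ hE (R.h_pos _ ht) v)
      (R.bias _ ht) v)
    (fun v hv hv1 => by
      rw [hv] at hv1 ⊢
      exact H.curv _ ht v hv hv1)
    (by
      rw [Nat.add_sub_cancel] at *
      cases u with
      | zero => exact Or.inl rfl
      | succ u =>
        have hu : u + 1 ∈ Finset.Ico 1 b := Finset.mem_Ico.2 ⟨by omega, by omega⟩
        have hu' : u + 1 ∈ Finset.Icc 1 b := Finset.Ico_subset_Icc_self hu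
        have hsub' : ∀ q ∈ Finset.Icc 1 (u + 1), q ∈ Finset.Ico 1 b := fun q hq => by
          have := Finset.mem_Icc.1 hq
          exact Finset.mem_Ico.2 ⟨this.1, by omega⟩
        have hE₁ : 0 < constOne r G a₂ (u + 1) := by
          have := four_mul_constTwo_le ha₂ hr hG u
          have := constTwo_succ_pos ha₂ hr hG u
          linarith
        have hθ : 0 ≤ η₁ / (s * constOne r G a₂ (u + 1)) := by positivity
        have hb := aggHessian_bounds (P := P) (d := d) (β := β) hK hC hη hκ ha₁ hM.eig_le
          (hNt _ hu') hθ (fun q hq => R.h_pos q (Finset.Ico_subset_Icc_self (hsub' q hq)))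
          (fun q _ => H.resp q) (fun q hq => (hβ q hq).2)
          (fun q hq => integral_scaledKernel_bounds hK hM hc hCf hτ hE
            (R.h_pos q (Finset.Ico_subset_Icc_self (hsub' q hq)))
            (R.h_hessian q (Finset.Ico_subset_Icc_self (hsub' q hq))))
          (fun q hq => integral_remWeight_le hτ hE hL
            (R.h_pos q (Finset.Ico_subset_Icc_self (hsub' q hq))) hC hκ₀
            (R.remainder q (hsub' q hq)))
          (H.hess _ hu) (H.rem _ hu)
        obtain ⟨h1, h2, h3⟩ := theta_bounds ha₁ ha₂ hr hG hGb hs0 hη0 hη1 hη2 hη3 u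
        have hlast := hβ (u + 1) (Finset.mem_Icc.2 ⟨by omega, le_rfl⟩)
        exact Or.inr ⟨⟨_, _, fun v => (hb v).1, fun v => (hb v).2, hlast.1, hlast.2,
          (R.lam_pos _ hu').le, by positivity, h1, h2, h3⟩, R.lam_mono _ hu⟩)
  refine ⟨hstep.1, fun v hv => ?_⟩
  obtain ⟨h1, h2⟩ := hstep.2 v hv
  refine ⟨h1, h2.trans ?_⟩
  rw [Nat.add_sub_cancel] at *
  have hc2 := constTwo_nonneg ha₂ hr hG (u + 1)
  calc (4 + 2 * D) * √(s : ℝ) * l2Norm (v - βs)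
      ≤ (4 + r + 2 * D) * √s * (constTwo r G a₂ (u + 1) * √s * lam (u + 1)) := by
        have := l2Norm_nonneg (v - βs)
        gcongr
        linarith
    _ = constOne r G a₂ (u + 1) * (√s * √s) * lam (u + 1) := by rw [constOne_succ, hD]; ring
    _ = _ := by rw [Real.mul_self_sqrt hs0.le]

omit [NeZero p] [IsProbabilityMeasure P] in
lemma hasLaw_ae_response {Ω : Type*} [MeasurableSpace Ω] {μ : Measure Ω} {O : Ω → Obs p}
    (hO : HasLaw O P μ) (hresp : ∀ᵐ o ∂P, o.2 = 1 ∨ o.2 = -1) :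
    ∀ᵐ ω ∂μ, (O ω).2 = 1 ∨ (O ω).2 = -1 := by
  rw [← hO.map_eq] at hresp
  exact ae_of_ae_map hO.aemeasurable hresp

lemma measure_not_goodSample_le (hK : KernelAssumption K)
    (hM : ModelAssumption P βs Cf ν₀ c₁ c₂ M c C a₁ a₂) (hc : 0 < c) (hCf : 0 < Cf)
    (ha₁ : 0 < a₁) (ha₂ : 0 < a₂) (hτ : 0 < τ) (hE : ExpSquareBound P τ) (hp : 4 ≤ p)
    (hs1 : 1 ≤ s) (hn : ∀ t ∈ Finset.Icc 1 b, 1 ≤ n t)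
    (hC : 0 ≤ Cη) (hκ : ∀ t, K t ≤ κ₀) (hκ₀ : 0 < κ₀) (hBw : 0 < Bw)
    (hr : 0 ≤ r) (hG : 2 ≤ a₂ * G) (hη0 : 0 ≤ η₁)
    (R : Regime K p s n b lam h (constOne r G a₂) (constTwo r G a₂) Cf c τ a₁ a₂ κ₀ Cη η₁ Bw)
    {Ω : Type*} [MeasurableSpace Ω] {μ : Measure Ω} [IsProbabilityMeasure μ]
    {W : (t : ℕ) → Fin (n t) → Ω → Obs p} (hlaw : ∀ t i, HasLaw (W t i) P μ)
    (hind : iIndepFun (fun q : (t : ℕ) × Fin (n t) => W q.1 q.2) μ) :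
    μ {ω | ¬ GoodSample P βs K s b lam h (constOne r G a₂) (constTwo r G a₂) a₁ a₂ κ₀ Cη η₁
      (fun t i => W t i ω)} ≤ ENNReal.ofReal (8 / (p : ℝ) ^ 2) := by
  have hs0 : (0 : ℝ) < s := by exact_mod_cast hs1
  have hL := one_le_log hp
  set E₁ := constOne r G a₂
  set E₂ := constTwo r G a₂
  have hNt : ∀ t ∈ Finset.Icc 1 b, (0 : ℝ) < cumSize n t := fun t ht => by
    have ht' := Finset.mem_Icc.1 ht
    exact_mod_cast lt_of_lt_of_le (hn t ht) (Finset.single_le_sum (f := n)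
      (fun _ _ => Nat.zero_le _) (Finset.mem_Icc.2 ⟨ht'.1, le_rfl⟩))
  have hnN : ∀ t ∈ Finset.Icc 1 b, (n t : ℝ) ≤ cumSize n t := fun t ht => by
    have ht' := Finset.mem_Icc.1 ht
    exact_mod_cast Finset.single_le_sum (f := n)
      (fun _ _ => Nat.zero_le _) (Finset.mem_Icc.2 ⟨ht'.1, le_rfl⟩)
  set A₁ : ℕ → Set Ω := fun t => {ω | ∃ v, cumSize n t * lam t * noiseFactor p t / 8 * l1Norm v <
    |∑ i ∈ (Finset.univ : Finset (Fin (n t))), slopeTerm K (h t) βs v (W t i ω) -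
      (Finset.univ : Finset (Fin (n t))).card * ∫ o, slopeTerm K (h t) βs v o ∂P|} with hA₁
  set A₂ : ℕ → Set Ω := fun t => {ω | ∃ v, l2Norm v = E₂ t * √s * lam t ∧
    l1Norm v ≤ (4 + 2 * (a₂ * E₂ (t - 1))) * √s * (E₂ t * √s * lam t) ∧
    ∑ i ∈ (Finset.univ : Finset (Fin (n t))), curvTerm K (h t) βs v (W t i ω) <
      (27 / 16 * (Finset.univ : Finset (Fin (n t))).card - (cumSize n t : ℝ) / 16) *
        (kappaLow K * a₁ * (E₂ t * √s * lam t) ^ 2)} with hA₂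
  set A₃ : ℕ → Set Ω := fun t => {ω | ∃ v, cumSize n t * (η₁ / (s * E₁ t)) * l1Norm v ^ 2 <
    |∑ q ∈ sampleIndex n t, scaledKernel K (h q.1) (1 - margin βs (W q.1 q.2 ω)) *
        (aug (W q.1 q.2 ω).1 ⬝ᵥ v) ^ 2 - ∑ q ∈ sampleIndex n t,
        ∫ o, scaledKernel K (h q.1) (1 - margin βs o) * (aug o.1 ⬝ᵥ v) ^ 2 ∂P|} with hA₃
  set A₄ : ℕ → Set Ω := fun t => {ω | ∃ v, cumSize n t * (η₁ / (s * E₁ t)) * l1Norm v ^ 2 <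
    |∑ q ∈ sampleIndex n t, remWeight Cη κ₀ (h q.1) (E₁ q.1 * s * lam q.1) (W q.1 q.2 ω) *
        (aug (W q.1 q.2 ω).1 ⬝ᵥ v) ^ 2 - ∑ q ∈ sampleIndex n t,
        ∫ o : Obs p, remWeight Cη κ₀ (h q.1) (E₁ q.1 * s * lam q.1) o *
          (aug o.1 ⬝ᵥ v) ^ 2 ∂P|} with hA₄
  set A₀ : Set Ω := {ω | ¬ ∀ t i, (W t i ω).2 = 1 ∨ (W t i ω).2 = -1} with hA₀
  have hsub : {ω | ¬ GoodSample P βs K s b lam h E₁ E₂ a₁ a₂ κ₀ Cη η₁ (fun t i => W t i ω)} ⊆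
      A₀ ∪ ((⋃ t ∈ Finset.Icc 1 b, (A₁ t ∪ A₂ t)) ∪ ⋃ t ∈ Finset.Ico 1 b, (A₃ t ∪ A₄ t)) := by
    intro ω hω
    by_contra hcon
    simp only [Set.mem_union, Set.mem_iUnion, not_or, not_exists] at hcon
    obtain ⟨h0, h12, h34⟩ := hcon
    refine hω ⟨not_not.1 h0, fun t ht v => ?_, fun t ht v hv hv1 => ?_, fun t ht v => ?_,
      fun t ht v => ?_⟩
    · by_contra hlt
      refine (h12 t ht).1 ⟨v, ?_⟩
      rw [Finset.card_univ, Fintype.card_fin]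
      exact not_le.1 hlt
    · by_contra hlt
      refine (h12 t ht).2 ⟨v, hv, hv1, ?_⟩
      rw [Finset.card_univ, Fintype.card_fin]
      exact not_le.1 hlt
    · by_contra hlt
      exact (h34 t ht).1 ⟨v, not_le.1 hlt⟩
    · by_contra hlt
      exact (h34 t ht).2 ⟨v, not_le.1 hlt⟩
  have hm0 : μ A₀ = 0 := by
    refine ae_iff.1 ?_
    rw [ae_all_iff]
    intro t
    rw [ae_all_iff]
    exact fun i => hasLaw_ae_response (hlaw t i) hM.response
  have hindt : ∀ t, iIndepFun (W t) μ := fun t =>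
    hind.precomp (g := fun i : Fin (n t) => (⟨t, i⟩ : (t : ℕ) × Fin (n t)))
      (fun i j hij => by simpa using hij)
  have hT0 : ∀ t, 0 ≤ tailBound p t := fun t => by unfold tailBound; positivity
  have hm1 : ∀ t ∈ Finset.Icc 1 b, μ (A₁ t) ≤ ENNReal.ofReal (tailBound p t) := fun t ht => by
    have ht1 := (Finset.mem_Icc.1 ht).1
    exact measure_slope_event_le hK hM.response hτ hE (hlaw t) (hindt t) Finset.univ (hNt t ht)
      (by simpa using hnN t ht) hp ht1 (R.lam_pos t ht).le (R.lam_large t ht)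
  have hm2 : ∀ t ∈ Finset.Icc 1 b, μ (A₂ t) ≤ ENNReal.ofReal (tailBound p t) := fun t ht => by
    have ht1 := (Finset.mem_Icc.1 ht).1
    obtain ⟨u, rfl⟩ : ∃ u, t = u + 1 := ⟨t - 1, by omega⟩
    have hD : 0 ≤ a₂ * E₂ u := mul_nonneg ha₂.le (constTwo_nonneg ha₂ hr hG u)
    have hlam := R.lam_pos _ ht
    have hE2 : 0 < E₂ (u + 1) := constTwo_succ_pos ha₂ hr hG u
    have hvc : 0 < vertexConst τ a₁ := by unfold vertexConst; positivity
    exact measure_curvature_event_le hK hM hc hCf ha₁ hτ hE (R.h_pos _ ht) (R.h_le_one _ ht)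
      (R.h_window _ ht) (by positivity) (R.radius _ ht) (hlaw _) (hindt _) Finset.univ (hNt _ ht)
      (by simpa using hnN _ ht) hp ht1 hs1 hD
      (by
        have := natCast_le_mul_constTwo hr hG u
        push_cast
        linarith)
      (le_add_of_nonneg_right (by positivity)) (le_add_of_nonneg_left (by norm_num))
      (R.curvature _ ht)
  have hgram : ∀ t ∈ Finset.Ico 1 b, ∀ w : (t : ℕ) × Fin (n t) → Obs p → ℝ,
      (∀ q, Measurable (w q)) → (∀ q ∈ sampleIndex n t, ∀ o, 0 ≤ w q o ∧ w q o ≤ κ₀ / h q.1) →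
      μ {ω | ∃ v, cumSize n t * (η₁ / (s * E₁ t)) * l1Norm v ^ 2 <
        |∑ q ∈ sampleIndex n t, w q (W q.1 q.2 ω) *
        (aug (W q.1 q.2 ω).1 ⬝ᵥ v) ^ 2 - ∑ q ∈ sampleIndex n t,
        ∫ o, w q o * (aug o.1 ⬝ᵥ v) ^ 2 ∂P|} ≤ ENNReal.ofReal (tailBound p t) := by
    intro t ht w hwm hw
    have ht' : t ∈ Finset.Icc 1 b := Finset.Ico_subset_Icc_self ht
    have ht1 := (Finset.mem_Icc.1 ht').1
    have hE1 : 0 ≤ E₁ t := by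
      obtain ⟨u, rfl⟩ : ∃ u, t = u + 1 := ⟨t - 1, by omega⟩
      have := four_mul_constTwo_le ha₂ hr hG u
      have := constTwo_succ_pos ha₂ hr hG u
      linarith
    have hht := R.h_pos t ht'
    refine measure_gram_event_le hτ hE (fun q : (t : ℕ) × Fin (n t) => hlaw q.1 q.2) hind
      (sampleIndex n t) (hNt t ht') (by rw [card_sampleIndex]) hp ht1
      (B := Bw / h t) (by positivity) hwm (fun q hq o => ?_) (by positivity)
      (R.gram_small t ht) (R.gram t ht)
    rw [abs_of_nonneg (hw q hq o).1]
    exact (hw q hq o).2.trans (R.weight t ht q.1 (one_le_of_mem_sampleIndex hq))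
  have hhq : ∀ t ∈ Finset.Ico 1 b, ∀ q ∈ sampleIndex n t, 0 < h q.1 := fun t ht q hq => by
    have h1 := Finset.mem_Ico.1 ht
    have h2 := Finset.mem_Icc.1 (one_le_of_mem_sampleIndex hq)
    exact R.h_pos _ (Finset.mem_Icc.2 ⟨h2.1, by omega⟩)
  have hm3 : ∀ t ∈ Finset.Ico 1 b, μ (A₃ t) ≤ ENNReal.ofReal (tailBound p t) := fun t ht =>
    hgram t ht (fun q o => scaledKernel K (h q.1) (1 - margin βs o))
      (fun q => (measurable_scaledKernel hK _).comp ((measurable_margin βs).const_sub 1))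
      fun q hq o => ⟨scaledKernel_nonneg hK (hhq t ht q hq) _, by
        rw [scaledKernel, div_eq_inv_mul κ₀]
        exact mul_le_mul_of_nonneg_left (hκ _) (inv_nonneg.2 (hhq t ht q hq).le)⟩
  have hm4 : ∀ t ∈ Finset.Ico 1 b, μ (A₄ t) ≤ ENNReal.ofReal (tailBound p t) := fun t ht =>
    hgram t ht (fun q o => remWeight Cη κ₀ (h q.1) (E₁ q.1 * s * lam q.1) o)
      (fun q => measurable_remWeight _ _ _ _)
      fun q hq o => ⟨remWeight_nonneg hC hκ₀.le (hhq t ht q hq) _, min_le_right _ _⟩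
  have hpair : ∀ {S : Finset ℕ} {X Y : ℕ → Set Ω}, S ⊆ Finset.Icc 1 b →
      (∀ t ∈ S, μ (X t) ≤ ENNReal.ofReal (tailBound p t)) →
      (∀ t ∈ S, μ (Y t) ≤ ENNReal.ofReal (tailBound p t)) →
      μ (⋃ t ∈ S, (X t ∪ Y t)) ≤ ENNReal.ofReal (4 / (p : ℝ) ^ 2) := by
    intro S X Y hS hX hY
    calc μ (⋃ t ∈ S, (X t ∪ Y t)) ≤ ∑ t ∈ S, μ (X t ∪ Y t) := measure_biUnion_finset_le _ _
      _ ≤ ∑ t ∈ S, ENNReal.ofReal (2 * tailBound p t) := Finset.sum_le_sum fun t ht => by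
          rw [two_mul, ENNReal.ofReal_add (hT0 t) (hT0 t)]
          exact (measure_union_le _ _).trans (add_le_add (hX t ht) (hY t ht))
      _ ≤ ∑ t ∈ Finset.Icc 1 b, ENNReal.ofReal (2 * tailBound p t) :=
          Finset.sum_le_sum_of_subset hS
      _ = ENNReal.ofReal (2 * ∑ t ∈ Finset.Icc 1 b, tailBound p t) := by
          rw [Finset.mul_sum, ENNReal.ofReal_sum_of_nonneg fun t _ =>
            mul_nonneg zero_le_two (hT0 t)]
      _ ≤ ENNReal.ofReal (4 / (p : ℝ) ^ 2) := by
          refine ENNReal.ofReal_le_ofReal ?_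
          have := sum_tailBound_le p b
          calc 2 * ∑ t ∈ Finset.Icc 1 b, tailBound p t ≤ 2 * (2 / (p : ℝ) ^ 2) := by gcongr
            _ = 4 / (p : ℝ) ^ 2 := by ring
  calc _ ≤ μ A₀ + (μ (⋃ t ∈ Finset.Icc 1 b, (A₁ t ∪ A₂ t)) +
        μ (⋃ t ∈ Finset.Ico 1 b, (A₃ t ∪ A₄ t))) :=
        (measure_mono hsub).trans ((measure_union_le _ _).trans
          (add_le_add le_rfl (measure_union_le _ _)))
    _ ≤ 0 + (ENNReal.ofReal (4 / (p : ℝ) ^ 2) + ENNReal.ofReal (4 / (p : ℝ) ^ 2)) := by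
        rw [hm0]
        gcongr
        · exact hpair subset_rfl hm1 hm2
        · exact hpair Finset.Ico_subset_Icc_self hm3 hm4
    _ = ENNReal.ofReal (8 / (p : ℝ) ^ 2) := by
        rw [zero_add, ← ENNReal.ofReal_add (by positivity) (by positivity)]
        congr 1; ring

end Good

/-! ### Consequences of the tuning and scaling conditions -/

section Tuning

variable {K : ℝ → ℝ} {p s b : ℕ} {n : ℕ → ℕ} {lam h : ℕ → ℝ}
  {A₀ A₁ B₀ B₁ A B ρ ε Q Q₂ : ℝ}

lemma cumSize_mono (n : ℕ → ℕ) {r t : ℕ} (hrt : r ≤ t) : cumSize n r ≤ cumSize n t :=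
  Finset.sum_le_sum_of_subset (Finset.Icc_subset_Icc_right hrt)

lemma le_cumSize {t : ℕ} (ht : 1 ≤ t) : n t ≤ cumSize n t :=
  Finset.single_le_sum (f := n) (fun _ _ => Nat.zero_le _) (Finset.mem_Icc.2 ⟨ht, le_rfl⟩)

lemma cumSize_one_le {t : ℕ} (ht : 1 ≤ t) : n 1 ≤ cumSize n t :=
  (le_cumSize le_rfl).trans (cumSize_mono n ht)

lemma Tuning.lam_bounds (T : Tuning p s n b lam h A₀ A₁ B₀ B₁ ρ) (hA₀ : 0 < A₀) (hA : A₁ ≤ A)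
    (hL : 1 ≤ Real.log p) {t : ℕ} (ht : t ∈ Finset.Icc 1 b) (hN : 0 < cumSize n t) :
    0 < lam t ∧ A₀ ^ 2 * Real.log p ≤ cumSize n t * lam t ^ 2 ∧
      cumSize n t * lam t ^ 2 ≤ A ^ 2 * Real.log p := by
  have hN' : (0 : ℝ) < cumSize n t := by exact_mod_cast hN
  have hq : 0 < Real.log p / cumSize n t := by positivity
  have h0 := Real.sqrt_pos.2 hq
  have h1 := T.lam_low t ht
  have h2 := (T.lam_high t ht).trans (mul_le_mul_of_nonneg_right hA h0.le)
  have hlam : 0 < lam t := lt_of_lt_of_le (by positivity) h1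
  have hsq : ∀ x : ℝ, cumSize n t * (x * √(Real.log p / cumSize n t)) ^ 2 =
      x ^ 2 * Real.log p := fun x => by
    rw [mul_pow, Real.sq_sqrt hq.le]; field_simp
  refine ⟨hlam, ?_, ?_⟩
  · rw [← hsq]; gcongr
  · rw [← hsq]; gcongr

lemma Tuning.h_bounds (T : Tuning p s n b lam h A₀ A₁ B₀ B₁ ρ) (hB₀ : 0 < B₀) (hB : B₁ ≤ B)
    (hx : 0 < s * Real.log p) {t : ℕ} (ht : t ∈ Finset.Icc 1 b) (hN : 0 < cumSize n t) :
    0 < h t ∧ B₀ ^ 4 * (s * Real.log p) ≤ cumSize n t * h t ^ 4 ∧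
      cumSize n t * h t ^ 4 ≤ B ^ 4 * (s * Real.log p) := by
  have hN' : (0 : ℝ) < cumSize n t := by exact_mod_cast hN
  have hq : 0 < s * Real.log p / cumSize n t := by positivity
  set y := (s * Real.log p / cumSize n t) ^ (1 / 4 : ℝ) with hy
  have hy0 : 0 < y := Real.rpow_pos_of_pos hq _
  have hy4 : y ^ 4 = s * Real.log p / cumSize n t := by
    rw [hy, ← Real.rpow_natCast, ← Real.rpow_mul hq.le]
    norm_num
  have h1 := T.h_low t ht
  have h2 := (T.h_high t ht).trans (mul_le_mul_of_nonneg_right hB hy0.le)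
  rw [← hy] at h1 h2
  have hh : 0 < h t := lt_of_lt_of_le (by positivity) h1
  have hpow : ∀ z : ℝ, cumSize n t * (z * y) ^ 4 = z ^ 4 * (s * Real.log p) := fun z => by
    rw [mul_pow, hy4]; field_simp
  refine ⟨hh, ?_, ?_⟩
  · rw [← hpow]; gcongr
  · rw [← hpow]; gcongr

/-- The bandwidths are small. -/
lemma h_le_inv {t : ℕ} (ht : 1 ≤ t) (hN : 0 < cumSize n t) (hQ₂ : 0 < Q₂)
    (hε : 0 ≤ ε) (hh : 0 < h t) (hx : s * Real.log p ≤ ε * n 1)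
    (hh4 : cumSize n t * h t ^ 4 ≤ B ^ 4 * (s * Real.log p)) (hεQ : ε * (B * Q₂) ^ 4 ≤ 1) :
    Q₂ * h t ≤ 1 := by
  have hN' : (0 : ℝ) < cumSize n t := by exact_mod_cast hN
  have h1 : (n 1 : ℝ) ≤ cumSize n t := by exact_mod_cast cumSize_one_le ht
  have h2 : cumSize n t * h t ^ 4 ≤ cumSize n t * (B ^ 4 * ε) := by
    calc cumSize n t * h t ^ 4 ≤ B ^ 4 * (s * Real.log p) := hh4
      _ ≤ B ^ 4 * (ε * n 1) := by gcongr
      _ ≤ B ^ 4 * (ε * cumSize n t) := by gcongr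
      _ = _ := by ring
  have h3 := le_of_mul_le_mul_left h2 hN'
  have h4 : (Q₂ * h t) ^ 4 ≤ 1 := by
    calc (Q₂ * h t) ^ 4 = Q₂ ^ 4 * h t ^ 4 := mul_pow _ _ _
      _ ≤ Q₂ ^ 4 * (B ^ 4 * ε) := by gcongr
      _ = ε * (B * Q₂) ^ 4 := by ring
      _ ≤ 1 := hεQ
  exact (pow_le_one_iff_of_nonneg (by positivity) (by norm_num)).1 h4

/-- Later bandwidths exceed earlier ones at most by a constant factor. -/
lemma mul_h_le {r t : ℕ} (hrt : r ≤ t) (hB : 0 ≤ B) (hN : 0 < cumSize n t)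
    (hr0 : 0 < h r) {x : ℝ} (hr : B₀ ^ 4 * x ≤ cumSize n r * h r ^ 4)
    (ht : cumSize n t * h t ^ 4 ≤ B ^ 4 * x) : B₀ * h t ≤ B * h r := by
  have hN' : (0 : ℝ) < cumSize n t := by exact_mod_cast hN
  have h1 : (cumSize n r : ℝ) ≤ cumSize n t := by exact_mod_cast cumSize_mono n hrt
  refine le_of_pow_le_pow_left₀ (n := 4) (by norm_num) (by positivity) ?_
  refine le_of_mul_le_mul_left ?_ hN'
  calc cumSize n t * (B₀ * h t) ^ 4 = B₀ ^ 4 * (cumSize n t * h t ^ 4) := by ring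
    _ ≤ B₀ ^ 4 * (B ^ 4 * x) := by gcongr
    _ = B ^ 4 * (B₀ ^ 4 * x) := by ring
    _ ≤ B ^ 4 * (cumSize n r * h r ^ 4) := by gcongr
    _ ≤ B ^ 4 * (cumSize n t * h r ^ 4) := by gcongr
    _ = _ := by ring

lemma ScalingAt.le {C : ℝ} {t : ℕ} (H : ScalingAt p s n h C ε t) (ht : 1 ≤ t) (hn : 1 ≤ n 1) :
    C ^ 2 * (s : ℝ) ^ 2 * Real.log p ^ 3 ≤ ε * (cumSize n t * h t ^ 3) := by
  refine le_trans (le_mul_of_one_le_right (by positivity) ?_) H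
  have h1 : (1 : ℝ) ≤ cumSize n t / n 1 := by
    rw [one_le_div (by exact_mod_cast hn)]
    exact_mod_cast cumSize_one_le ht
  linarith [Real.log_nonneg h1]

variable {r Gb a₁ a₂ Cf c τ κ₀ Cη η₁ : ℝ} {E₁ E₂ : ℕ → ℝ}

/-- A sequence growing at most like the constants of the error bounds, weighted with the bandwidth,
stays bounded. -/
lemma index_mul_le {N g Q E S x u : ℝ} (hQ : 0 < Q) (hB : B ^ 4 * a₂ ^ 2 ≤ Q) (hx : 0 < x)
    (hxS : x ≤ S) (hg : 0 ≤ g) (hu : u ≤ (a₂ * E) ^ 2) (hN : Q * (E ^ 2 * S) ≤ N * g ^ 3)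
    (hN' : N * g ^ 4 ≤ B ^ 4 * x) : u * g ≤ 1 := by
  have h1 := mul_le_mul_of_nonneg_right hN hg
  have h2 := mul_le_mul_of_nonneg_left hxS (show 0 ≤ Q * E ^ 2 * g by positivity)
  have h3 : Q * E ^ 2 * g * x ≤ B ^ 4 * x := by linarith
  have h4 := mul_le_mul_of_nonneg_left (le_of_mul_le_mul_right h3 hx) (sq_nonneg a₂)
  have h5 := mul_le_mul_of_nonneg_left (mul_le_mul_of_nonneg_right hu hg) hQ.le
  refine le_of_mul_le_mul_left ?_ hQ
  linarith

/-- The quantity `N h³` of one batch is controlled by that of a later batch. -/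
lemma pow_mul_cube_le {N M k g x : ℝ} (hB₀ : 0 ≤ B₀) (hB : 0 ≤ B) (hx : 0 < x) (hN : 0 ≤ N)
    (hM : 0 ≤ M) (hk : 0 ≤ k) (hg : 0 ≤ g) (hNk : B₀ ^ 4 * x ≤ N * k ^ 4)
    (hMg : M * g ^ 4 ≤ B ^ 4 * x) (hkg : B₀ * k ≤ B * g) :
    B₀ ^ 5 * (M * g ^ 3) ≤ B ^ 5 * (N * k ^ 3) := by
  have h1 := mul_le_mul_of_nonneg_left hNk (show 0 ≤ B₀ * (M * g ^ 3) by positivity)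
  have h2 := mul_le_mul_of_nonneg_left hkg (show 0 ≤ M * g ^ 3 * (N * k ^ 3) by positivity)
  have h3 := mul_le_mul_of_nonneg_left hMg (show 0 ≤ B * (N * k ^ 3) by positivity)
  refine le_of_mul_le_mul_right ?_ hx
  linarith

/-- The curvature condition at a batch, from the scaling condition at the preceding one. -/
lemma curvature_of_scaling {Q E F S x Z X : ℝ} (hB : 0 < B) (hQ : 0 ≤ Q) (hx : 0 ≤ x) (hxS : x ≤ S)
    (hF : 0 ≤ F) (hFE : F ≤ a₂ * E) (hZ : E ^ 2 * S ≤ ε * Z) (hZ0 : 0 ≤ Z)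
    (hXZ : B₀ ^ 5 * Z ≤ B ^ 5 * X) (hεB : ε * (Q * a₂ ^ 2 * B ^ 5) ≤ B₀ ^ 5) :
    Q * (F ^ 2 * x) ≤ X := by
  refine le_of_mul_le_mul_left ?_ (pow_pos hB 5)
  calc B ^ 5 * (Q * (F ^ 2 * x)) ≤ B ^ 5 * (Q * ((a₂ * E) ^ 2 * S)) := by gcongr
    _ = Q * a₂ ^ 2 * B ^ 5 * (E ^ 2 * S) := by ring
    _ ≤ Q * a₂ ^ 2 * B ^ 5 * (ε * Z) := by gcongr
    _ = ε * (Q * a₂ ^ 2 * B ^ 5) * Z := by ring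
    _ ≤ B₀ ^ 5 * Z := by gcongr
    _ ≤ B ^ 5 * X := hXZ

lemma radius_of_curvature {N l g e D w L S : ℝ} (hN : 0 < N) (ha₁ : 0 ≤ a₁) (hS : 0 ≤ S)
    (hL : 0 ≤ L) (he : 0 ≤ e) (hew : e ≤ w * (1 + D)) (hl : N * l ^ 2 ≤ A ^ 2 * L)
    (hQ : 1572864 * τ ^ 2 * w ^ 2 * A ^ 2 ≤ a₁ * Q)
    (hc : Q * ((1 + D) ^ 2 * S * L) ≤ N * g ^ 3) :
    1572864 * τ ^ 2 * (e * √S * l) ^ 2 ≤ a₁ * g ^ 3 := by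
  refine le_of_mul_le_mul_left ?_ hN
  calc N * (1572864 * τ ^ 2 * (e * √S * l) ^ 2)
      = 1572864 * τ ^ 2 * (e ^ 2 * S) * (N * l ^ 2) := by
        rw [mul_pow, mul_pow, Real.sq_sqrt hS]; ring
    _ ≤ 1572864 * τ ^ 2 * ((w * (1 + D)) ^ 2 * S) * (A ^ 2 * L) := by gcongr
    _ = 1572864 * τ ^ 2 * w ^ 2 * A ^ 2 * ((1 + D) ^ 2 * S * L) := by ring
    _ ≤ a₁ * Q * ((1 + D) ^ 2 * S * L) := by gcongr
    _ = a₁ * (Q * ((1 + D) ^ 2 * S * L)) := by ring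
    _ ≤ a₁ * (N * g ^ 3) := by gcongr
    _ = N * (a₁ * g ^ 3) := by ring

lemma remainder_of_scaling {N l g e Y L S : ℝ} (hN : 0 < N) (ha₁ : 0 ≤ a₁) (hY : 0 ≤ Y)
    (hL : 1 ≤ L) (hl : N * l ^ 2 ≤ A ^ 2 * L) (hQ : Y * A ^ 2 ≤ a₁ * Q)
    (hc : Q * (e ^ 2 * S ^ 2 * L ^ 3) ≤ N * g ^ 3) :
    Y * ((e * S * l) ^ 2 * L) ≤ a₁ * g ^ 3 := by
  have hL0 : 0 ≤ L := by linarith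
  have hLL : L ^ 2 ≤ L ^ 3 := pow_le_pow_right₀ hL (by norm_num)
  refine le_of_mul_le_mul_left ?_ hN
  calc N * (Y * ((e * S * l) ^ 2 * L))
      = Y * (e ^ 2 * S ^ 2) * (N * l ^ 2) * L := by ring
    _ ≤ Y * (e ^ 2 * S ^ 2) * (A ^ 2 * L) * L := by gcongr
    _ = Y * A ^ 2 * (e ^ 2 * S ^ 2 * L ^ 2) := by ring
    _ ≤ Y * A ^ 2 * (e ^ 2 * S ^ 2 * L ^ 3) := by gcongr
    _ ≤ a₁ * Q * (e ^ 2 * S ^ 2 * L ^ 3) := by gcongr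
    _ = a₁ * (Q * (e ^ 2 * S ^ 2 * L ^ 3)) := by ring
    _ ≤ a₁ * (N * g ^ 3) := by gcongr
    _ = N * (a₁ * g ^ 3) := by ring

lemma gram_of_scaling {N g e w L S u : ℝ} (hg : 0 < g) (he : 0 < e) (hS : 0 < S) (hL : 1 ≤ L)
    (hu : u * g ≤ 1) (hu0 : 0 ≤ u) (hQ : 768 * w ^ 2 ≤ Q * η₁ ^ 2)
    (hc : Q * (e ^ 2 * S ^ 2 * L ^ 3) ≤ N * g ^ 3) :
    768 * (w / g) ^ 2 * (L * u) ≤ N * (η₁ / (S * e)) ^ 2 := by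
  have hSe : 0 < S * e := by positivity
  have hL0 : 0 ≤ L := by linarith
  have hL3 : L ≤ L ^ 3 := le_self_pow₀ hL (by norm_num)
  rw [div_pow, div_pow, ← mul_div_assoc, div_mul_eq_mul_div, ← mul_div_assoc,
    div_le_div_iff₀ (by positivity) (by positivity)]
  refine le_of_mul_le_mul_right ?_ hg
  have h0 : 0 ≤ u * g := by positivity
  calc 768 * w ^ 2 * (L * u) * (S * e) ^ 2 * g
      = 768 * w ^ 2 * (e ^ 2 * S ^ 2 * L) * (u * g) := by ring
    _ ≤ 768 * w ^ 2 * (e ^ 2 * S ^ 2 * L) * 1 := by gcongr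
    _ ≤ 768 * w ^ 2 * (e ^ 2 * S ^ 2 * L ^ 3) * 1 := by gcongr
    _ ≤ Q * η₁ ^ 2 * (e ^ 2 * S ^ 2 * L ^ 3) * 1 := by gcongr
    _ = η₁ ^ 2 * (Q * (e ^ 2 * S ^ 2 * L ^ 3)) := by ring
    _ ≤ η₁ ^ 2 * (N * g ^ 3) := by gcongr
    _ = N * η₁ ^ 2 * g ^ 2 * g := by ring

/-- The tuning and scaling conditions imply all numerical conditions, when `Q` is large and `ε` is
small in terms of `Q`. The recursion over batches enters through the comparison of `N_t h_t³` with
its value at the preceding batch, where the scaling condition is available. -/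
lemma Tuning.regime (T : Tuning p s n b lam h A₀ A₁ B₀ B₁ ρ) (hK : KernelAssumption K)
    (hp : 4 ≤ p) (hs : 1 ≤ s) (hn : ∀ t ∈ Finset.Icc 1 b, 1 ≤ n t)
    (hx : s * Real.log p ≤ ε * n 1)
    (hscal : ∀ t ∈ Finset.Ico 1 b, ScalingAt p s n h (E₁ t) ε t)
    (ha₁ : 0 < a₁) (ha₂ : 0 < a₂) (hτ : 0 < τ) (hSC : 0 ≤ smoothConst Cf c τ)
    (hE₂zero : E₂ 0 = 0) (hE₂ : ∀ t, t ≤ a₂ * E₂ t)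
    (hE₂succ : ∀ t, E₂ (t + 1) ≤ (3 + r) * Gb * (1 + a₂ * E₂ t))
    (hE₁₂ : ∀ t, 1 + a₂ * E₂ (t + 1) ≤ a₂ * E₁ (t + 1)) (hκ₀ : 1 ≤ κ₀) (hCη : 0 ≤ Cη)
    (hη₁ : 0 < η₁)
    (hη₁τ : η₁ * a₂ ≤ τ)
    (hA₀ : 0 < A₀) (hA₀τ : 15360 * τ ≤ A₀ ^ 2) (hA : A₁ ≤ A)
    (hρ : 4 * smoothConst Cf c τ * kappa K 2 * ρ ≤ 1 / 8)
    (hB₀ : 0 < B₀) (hB : B₁ ≤ B) (hB₀B : B₀ ≤ B)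
    (hQ1 : 1 ≤ Q) (hQ₂ : Q ≤ Q₂) (hQ₂B : Q ≤ Q₂ * B₀ ^ 4)
    (hQwin : 392 * smoothConst Cf c τ ≤ a₁ * Q)
    (hQhess : 64 * (smoothConst Cf c τ * kappa K 1) ≤ a₁ * Q)
    (hQrad : 1572864 * τ ^ 2 * ((3 + r) * Gb) ^ 2 * A ^ 2 ≤ a₁ * Q)
    (hQcurv : 7 + 196608 * τ ^ 2 / a₁ ^ 2 * (2 * vertexConst τ a₁ + 7) ≤ Q)
    (hQrem : 64 * (Cη * (6 * τ ^ 2 + 2 * τ * (3 + 6 * τ ^ 2))) * A ^ 2 ≤ a₁ * Q)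
    (hQB : B ^ 4 * a₂ ^ 2 ≤ Q) (hQgram : 768 * (κ₀ * (B / B₀) * τ) ^ 2 ≤ Q * η₁ ^ 2)
    (hε0 : 0 < ε) (hεQ : ε * Q ≤ 1) (hεQ₂ : ε * (B * Q₂) ^ 4 ≤ 1)
    (hεB : ε * (Q * a₂ ^ 2 * B ^ 5) ≤ B₀ ^ 5) :
    Regime K p s n b lam h E₁ E₂ Cf c τ a₁ a₂ κ₀ Cη η₁
      (κ₀ * (B / B₀)) := by
  have hL := one_le_log hp
  set L := Real.log p with hLdef
  have hs' : (1 : ℝ) ≤ s := by exact_mod_cast hs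
  have hL0 : 0 < L := by linarith
  have hs0 : (0 : ℝ) < s := by linarith
  set x : ℝ := s * L with hxdef
  have hx0 : 0 < x := by positivity
  have hB0 : 0 < B := hB₀.trans_le hB₀B
  have hQ0 : 0 < Q := by linarith
  have hNt : ∀ t ∈ Finset.Icc 1 b, 0 < cumSize n t := fun t ht =>
    lt_of_lt_of_le (hn t ht) (le_cumSize (Finset.mem_Icc.1 ht).1)
  have hIco : ∀ t ∈ Finset.Ico 1 b, t ∈ Finset.Icc 1 b := fun t ht =>
    Finset.Ico_subset_Icc_self ht
  have hlam := fun t (ht : t ∈ Finset.Icc 1 b) => T.lam_bounds hA₀ hA hL ht (hNt t ht)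
  have hh := fun t (ht : t ∈ Finset.Icc 1 b) => T.h_bounds hB₀ hB hx0 ht (hNt t ht)
  have hQ₂h : ∀ t ∈ Finset.Icc 1 b, Q₂ * h t ≤ 1 := fun t ht =>
    h_le_inv (p := p) (s := s) (Finset.mem_Icc.1 ht).1 (hNt t ht) (hQ0.trans_le hQ₂) hε0.le
      (hh t ht).1 hx (hh t ht).2.2 hεQ₂
  have hQh : ∀ t ∈ Finset.Icc 1 b, Q * h t ≤ 1 := fun t ht =>
    (mul_le_mul_of_nonneg_right hQ₂ (hh t ht).1.le).trans (hQ₂h t ht)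
  have hh1 : ∀ t ∈ Finset.Icc 1 b, h t ≤ 1 := fun t ht =>
    (le_mul_of_one_le_left (hh t ht).1.le hQ1).trans (hQh t ht)
  have hn1 : ∀ t ∈ Finset.Ico 1 b, 1 ≤ n 1 := fun t ht => by
    have := Finset.mem_Ico.1 ht
    exact hn 1 (Finset.mem_Icc.2 ⟨le_rfl, by omega⟩)
  have hE₂0 : ∀ t, 0 ≤ E₂ t := fun t =>
    nonneg_of_mul_nonneg_right ((Nat.cast_nonneg t).trans (hE₂ t)) ha₂
  have hE₁ : ∀ t ∈ Finset.Ico 1 b, (t : ℝ) + 1 ≤ a₂ * E₁ t := fun t ht => by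
    obtain ⟨u, rfl⟩ : ∃ u, t = u + 1 := ⟨t - 1, by have := Finset.mem_Ico.1 ht; omega⟩
    linarith [hE₁₂ u, hE₂ (u + 1)]
  have hE₁0 : ∀ t ∈ Finset.Ico 1 b, 0 < E₁ t := fun t ht => by
    have h1 := hE₁ t ht
    have ht0 : (0 : ℝ) ≤ t := Nat.cast_nonneg t
    exact pos_of_mul_pos_right (by linarith) ha₂.le
  -- the scaling condition with the large constant
  have hbig : ∀ t ∈ Finset.Ico 1 b,
      Q * (E₁ t ^ 2 * (s : ℝ) ^ 2 * L ^ 3) ≤ cumSize n t * h t ^ 3 := fun t ht => by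
    have h1 := (hscal t ht).le (Finset.mem_Ico.1 ht).1 (hn1 t ht)
    have h0 : 0 ≤ (cumSize n t : ℝ) * h t ^ 3 :=
      mul_nonneg (Nat.cast_nonneg _) (pow_nonneg (hh t (hIco t ht)).1.le 3)
    have h2 := mul_le_mul_of_nonneg_left h1 hQ0.le
    have h3 := mul_le_mul_of_nonneg_right hεQ h0
    linarith
  have hsL : s * L ≤ (s : ℝ) ^ 2 * L ^ 3 := by
    have h1 : (s : ℝ) ≤ s ^ 2 := le_self_pow₀ hs' (by norm_num)
    have h2 : L ≤ L ^ 3 := le_self_pow₀ hL (by norm_num)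
    exact mul_le_mul h1 h2 hL0.le (by positivity)
  have hth : ∀ t ∈ Finset.Ico 1 b, (t : ℝ) * h t ≤ 1 := fun t ht => by
    obtain ⟨h0, -, h4⟩ := hh t (hIco t ht)
    have ht1 : (1 : ℝ) ≤ t := by exact_mod_cast (Finset.mem_Ico.1 ht).1
    have h2 : (t : ℝ) ≤ (a₂ * E₁ t) ^ 2 := by nlinarith [hE₁ t ht]
    refine index_mul_le hQ0 hQB hx0 hsL h0.le h2 ?_ h4
    rw [← mul_assoc (E₁ t ^ 2)]
    exact hbig t ht
  have hcurv : ∀ t ∈ Finset.Icc 1 b,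
      Q * ((1 + a₂ * E₂ (t - 1)) ^ 2 * s * L) ≤ cumSize n t * h t ^ 3 :=
    fun t ht => by
    obtain ⟨h0, h4, -⟩ := hh t ht
    obtain ⟨u, rfl⟩ : ∃ u, t = u + 1 := ⟨t - 1, by have := Finset.mem_Icc.1 ht; omega⟩
    rw [Nat.add_sub_cancel]
    cases u with
    | zero =>
      rw [hE₂zero, mul_zero, add_zero, one_pow, one_mul, ← hxdef]
      have hnn : 0 ≤ (cumSize n (0 + 1) : ℝ) * h (0 + 1) ^ 3 :=
        mul_nonneg (Nat.cast_nonneg _) (pow_nonneg h0.le 3)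
      calc Q * x ≤ Q₂ * B₀ ^ 4 * x := by gcongr
        _ = Q₂ * (B₀ ^ 4 * x) := by ring
        _ ≤ Q₂ * (cumSize n (0 + 1) * h (0 + 1) ^ 4) :=
            mul_le_mul_of_nonneg_left h4 (hQ0.trans_le hQ₂).le
        _ = cumSize n (0 + 1) * h (0 + 1) ^ 3 * (Q₂ * h (0 + 1)) := by ring
        _ ≤ _ := mul_le_of_le_one_right hnn (hQ₂h _ ht)
    | succ u =>
      have hu : u + 1 ∈ Finset.Ico 1 b := by
        have := Finset.mem_Icc.1 ht
        exact Finset.mem_Ico.2 ⟨by omega, by omega⟩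
      obtain ⟨g0, g4, g4'⟩ := hh (u + 1) (hIco _ hu)
      have hratio := mul_h_le (n := n) (Nat.le_succ (u + 1)) hB0.le (hNt _ ht) g0 g4
        (hh _ ht).2.2
      have hscal' := (hscal _ hu).le (Finset.mem_Ico.1 hu).1 (hn1 _ hu)
      have h1 := hE₁₂ u
      have h2 := mul_nonneg ha₂.le (hE₂0 (u + 1))
      have hXZ := pow_mul_cube_le hB₀.le hB0.le hx0 (Nat.cast_nonneg (cumSize n (u + 1 + 1)))
        (Nat.cast_nonneg (cumSize n (u + 1))) h0.le g0.le h4 g4' hratio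
      rw [mul_assoc ((1 + a₂ * E₂ (u + 1)) ^ 2)]
      refine curvature_of_scaling hB0 hQ0.le hx0.le hsL (by linarith) h1 ?_
        (mul_nonneg (Nat.cast_nonneg _) (pow_nonneg g0.le 3)) hXZ hεB
      rw [← mul_assoc]
      exact hscal'
  refine ⟨fun t ht => (hlam t ht).1, T.lam_mono, fun t ht => ?_, fun t ht => ?_,
    fun t ht => (hh t ht).1, hh1, fun t ht => ?_, fun t ht => ?_, fun t ht => ?_, fun t ht => ?_,
    fun t ht => ?_, fun t ht q hq => ?_, fun t ht => ?_, fun t ht => ?_⟩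
  · exact (mul_le_mul_of_nonneg_right hA₀τ hL0.le).trans (hlam t ht).2.1
  · have h1 := T.h_sq t ht
    have hk := hK.kappa_nonneg 2
    have h2 := mul_le_mul_of_nonneg_left h1
      (show 0 ≤ 4 * smoothConst Cf c τ * kappa K 2 by positivity)
    have h3 := mul_le_mul_of_nonneg_right hρ
      (show 0 ≤ √(s : ℝ) * lam t from mul_nonneg (Real.sqrt_nonneg _) (hlam t ht).1.le)
    linarith
  · have h1 := mul_le_mul_of_nonneg_right hQwin (hh t ht).1.le
    have h2 := mul_le_mul_of_nonneg_left (hQh t ht) ha₁.le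
    linarith
  · have h1 := mul_le_mul_of_nonneg_right hQhess (hh t ht).1.le
    have h2 := mul_le_mul_of_nonneg_left (hQh t ht) ha₁.le
    linarith
  · have hN : (0 : ℝ) < cumSize n t := by exact_mod_cast hNt t ht
    obtain ⟨u, rfl⟩ : ∃ u, t = u + 1 := ⟨t - 1, by have := Finset.mem_Icc.1 ht; omega⟩
    have hc := hcurv _ ht
    rw [Nat.add_sub_cancel] at hc
    exact radius_of_curvature hN ha₁.le hs0.le hL0.le (hE₂0 _) (hE₂succ u) (hlam _ ht).2.2 hQrad hc
  · refine le_trans (mul_le_mul_of_nonneg_right hQcurv (by positivity)) (hcurv t ht)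
  · have ht' := hIco t ht
    have hN : (0 : ℝ) < cumSize n t := by exact_mod_cast hNt t ht'
    exact remainder_of_scaling hN ha₁.le (by positivity) hL (hlam t ht').2.2 hQrem (hbig t ht)
  · have ht' := hIco t ht
    have hq' : q ∈ Finset.Icc 1 b := Finset.Icc_subset_Icc_right (Finset.mem_Icc.1 ht').2 hq
    have hratio := mul_h_le (n := n) (Finset.mem_Icc.1 hq).2 hB0.le (hNt t ht')
      (hh q hq').1 (hh q hq').2.1 (hh t ht').2.2
    rw [div_le_div_iff₀ (hh q hq').1 (hh t ht').1, mul_assoc]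
    refine mul_le_mul_of_nonneg_left ?_ (by linarith)
    rw [div_mul_eq_mul_div, le_div_iff₀ hB₀]
    linarith
  · have ht' := hIco t ht
    have h0 := (hh t ht').1
    have hE := hE₁0 t ht
    rw [div_mul_eq_mul_div]
    exact gram_of_scaling h0 hE hs0 hL (hth t ht) (Nat.cast_nonneg t) hQgram (hbig t ht)
  · have ht' := hIco t ht
    have h0 := (hh t ht').1
    have hE := hE₁0 t ht
    have ht0 : (0 : ℝ) ≤ t := Nat.cast_nonneg t
    have h1 : η₁ / (s * E₁ t) ≤ τ := by
      rw [div_le_iff₀ (by positivity)]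
      have h2 : 1 ≤ s * (a₂ * E₁ t) :=
        one_le_mul_of_one_le_of_one_le hs' (by linarith [hE₁ t ht])
      have h3 := mul_le_mul_of_nonneg_left h2 hη₁.le
      have h4 := mul_le_mul_of_nonneg_right hη₁τ (show 0 ≤ s * E₁ t by positivity)
      linarith
    have h5 : 1 ≤ κ₀ * (B / B₀) / h t := by
      rw [one_le_div h0]
      exact (hh1 t ht').trans (one_le_mul_of_one_le_of_one_le hκ₀ ((one_le_div hB₀).2 hB₀B))
    have h6 := mul_le_mul_of_nonneg_right h5 hτ.le
    linarith

end Tuning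

/-! ### Choice of the constants -/

lemma eventually_mul_le_of_pos {a : ℝ} (ha : 0 < a) (b : ℝ) : ∀ᶠ x in 𝓝[>] (0 : ℝ), b * x ≤ a := by
  have h : Tendsto (fun x : ℝ => b * x) (𝓝[>] 0) (𝓝 0) := by
    have := (continuous_const_mul b).tendsto (0 : ℝ)
    rw [mul_zero] at this
    exact this.mono_left nhdsWithin_le_nhds
  exact (h.eventually_lt_const ha).mono fun _ => le_of_lt

lemma eventually_le_mul_of_pos {a : ℝ} (ha : 0 < a) (b : ℝ) : ∀ᶠ x in atTop, b ≤ a * x :=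
  (tendsto_id.const_mul_atTop ha).eventually_ge_atTop b

section Gain

variable {p : ℕ} [NeZero p] {P : Measure (Obs p)} [IsProbabilityMeasure P]
  {βs : Fin (p + 1) → ℝ} {K : ℝ → ℝ} {Cf ν₀ c₁ c₂ M c C a₁ a₂ : ℝ}

omit [NeZero p] [IsProbabilityMeasure P] in
/-- `G` is bounded by a constant depending on the eigenvalue bounds only, and it is bounded below
because `γ₁ ≥ γ_{p+1}`, `κ_l ≤ 1 / 2` and `a₁ ≤ a₂`. -/
lemma gainFactor_bounds (hK : KernelAssumption K) (h : DesignAssumption P ν₀ c₁ c₂ M)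
    (hc₁ : 0 < c₁) (ha₁ : 0 < a₁) (ha : a₁ ≤ a₂) :
    gainFactor K P a₁ a₂ ≤ c₂ * c₁⁻¹ * a₂ / (kappaLow K * a₁ ^ 2) ∧
      2 ≤ a₂ * gainFactor K P a₁ a₂ ∧ 1 ≤ kappaLow K * a₁ * gainFactor K P a₁ a₂ := by
  have hk := hK.low_pos
  have hk2 := hK.kappaLow_le_half
  have ha₂ : 0 < a₂ := ha₁.trans_le ha
  have h1 := h.eig_low
  have h2 := h.eig_high
  have h3 := minEig_le_maxEig (secondMoment_isHermitian P)
  unfold gainFactor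
  set l := minEig (secondMoment P)
  set g := maxEig (secondMoment P)
  have hl : 0 < l := hc₁.trans_le h1
  have hg : 0 < g := hl.trans_le h3
  have hq : 1 ≤ g * l⁻¹ := by rwa [← div_eq_mul_inv, one_le_div hl]
  have hc₂ : 0 ≤ c₂ := hg.le.trans h2
  refine ⟨?_, ?_, ?_⟩
  · have : l⁻¹ ≤ c₁⁻¹ := inv_anti₀ hc₁ h1
    gcongr
  · rw [← mul_div_assoc, le_div_iff₀ (by positivity)]
    have h4 : a₁ ^ 2 ≤ a₂ ^ 2 := by gcongr
    have h5 : a₂ ^ 2 ≤ g * l⁻¹ * a₂ ^ 2 := le_mul_of_one_le_left (by positivity) hq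
    have h6 : kappaLow K * a₁ ^ 2 ≤ 1 / 2 * a₁ ^ 2 := by gcongr
    linarith
  · rw [← mul_div_assoc, le_div_iff₀ (by positivity)]
    have h5 : a₁ ≤ g * l⁻¹ * a₂ := ha.trans (le_mul_of_one_le_left ha₂.le hq)
    have h6 := mul_le_mul_of_nonneg_left h5 (show 0 ≤ kappaLow K * a₁ by positivity)
    linarith

omit [IsProbabilityMeasure P] in
lemma ModelAssumption.one_le_l0Norm (h : ModelAssumption P βs Cf ν₀ c₁ c₂ M c C a₁ a₂)
    (hc : 0 < c) : 1 ≤ l0Norm βs := by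
  rw [l0Norm, Nat.one_le_iff_ne_zero, ne_eq, Set.ncard_eq_zero (Set.toFinite _)]
  intro h0
  have h1 : βs (Fin.succ 0) = 0 := by
    have := Set.eq_empty_iff_forall_notMem.1 h0 (Fin.succ 0)
    simpa using this
  have h2 := h.first_coef
  rw [h1, abs_zero] at h2
  linarith

/-- The bound for fixed constants, from the deterministic conclusion and the probability of the
exceptional events. -/
lemma Regime.measure_lt {τ κ₀ Cη η₁ Bw r G Gb : ℝ} {s b : ℕ} {n : ℕ → ℕ} {lam h : ℕ → ℝ}
    (R : Regime K p s n b lam h (constOne r G a₂) (constTwo r G a₂) Cf c τ a₁ a₂ κ₀ Cη η₁ Bw)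
    (hK : KernelAssumption K) (hM : ModelAssumption P βs Cf ν₀ c₁ c₂ M c C a₁ a₂) (hc : 0 < c)
    (hCf : 0 < Cf) (ha₁ : 0 < a₁) (ha₂ : 0 < a₂) (hτ : 0 < τ) (hE : ExpSquareBound P τ)
    (hp : 4 ≤ p) (hs : l0Norm βs = s) (hs1 : 1 ≤ s) (hb : 1 ≤ b)
    (hn : ∀ t ∈ Finset.Icc 1 b, 1 ≤ n t)
    (hCη : 0 ≤ Cη) (hη : ∀ a b, |K (a + b) - K a| ≤ 1 / 32 * K a + Cη * b ^ 2)
    (hκ : ∀ t, K t ≤ κ₀) (hκ₀ : 0 < κ₀) (hBw : 0 < Bw) (hr : 0 ≤ r) (hG : 2 ≤ a₂ * G)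
    (hG1 : 1 ≤ kappaLow K * a₁ * G) (hGb : G ≤ Gb) (hη0 : 0 ≤ η₁) (hη1 : 400 * η₁ ≤ 1)
    (hη2 : 240 * (a₂ * Gb) * η₁ ≤ 1) (hη3 : 430 * (a₂ ^ 2 * Gb) * η₁ ≤ a₁)
    {Ω : Type*} [MeasurableSpace Ω] {μ : Measure Ω} [IsProbabilityMeasure μ]
    {W : (t : ℕ) → Fin (n t) → Ω → Obs p} (hlaw : ∀ t i, HasLaw (W t i) P μ)
    (hind : iIndepFun (fun q : (t : ℕ) × Fin (n t) => W q.1 q.2) μ) :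
    μ {ω | ¬ ((∃ β, IsOnlineLasso K lam h (fun t i => W t i ω) b β) ∧
        ∀ β, IsOnlineLasso K lam h (fun t i => W t i ω) b β →
          l2Norm (β b - βs) ≤ constTwo r G a₂ b * √s * lam b ∧
          l1Norm (β b - βs) ≤ constOne r G a₂ b * s * lam b)} < ENNReal.ofReal (4 / p) := by
  have hp' : (4 : ℝ) ≤ p := by exact_mod_cast hp
  have hp0 : (0 : ℝ) < p := by linarith
  have hbad := measure_not_goodSample_le hK hM hc hCf ha₁ ha₂ hτ hE hp hs1 hn hCη hκ hκ₀ hBw hr hG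
    hη0 R hlaw hind
  refine (measure_mono fun ω hω => ?_).trans_lt (hbad.trans_lt ?_)
  · refine fun H => hω ?_
    have hbd := GoodSample.bounds hK hM hc hCf ha₁ ha₂ hτ hE hp hs hs1 hn hCη hη hκ hr hG hG1
      hGb hη0 hη1 hη2 hη3 R H
    exact ⟨hbd.1, fun β hβ => hbd.2 β hβ b (Finset.mem_Icc.2 ⟨hb, le_rfl⟩)⟩
  · rw [ENNReal.ofReal_lt_ofReal_iff (by positivity), div_lt_div_iff₀ (by positivity) hp0]
    nlinarith

end Gain

end SmoothedSVM

end

open SmoothedSVM in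
theorem theorem4
    (K : ℝ → ℝ) (hK : KernelAssumption K)
    (Cf ν₀ c₁ c₂ M c C a₁ a₂ : ℝ)
    (hCf : 0 < Cf) (hν₀ : 0 < ν₀) (hc₁ : 0 < c₁) (hc : 0 < c) (hC : 0 < C) (ha₁ : 0 < a₁) :
    ∃ A₀ > 0, ∃ ρ > 0, ∀ A₁ B₀ B₁ : ℝ, 0 < B₀ → ∃ ε > 0,
      ∀ (p : ℕ) [NeZero p] (P : Measure (Obs p)) [IsProbabilityMeasure P]
        (βstar : Fin (p + 1) → ℝ) (s : ℕ)
        (Ω : Type*) [MeasurableSpace Ω] (μ : Measure Ω) [IsProbabilityMeasure μ]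
        (b : ℕ) (n : ℕ → ℕ) (W : (t : ℕ) → Fin (n t) → Ω → Obs p) (lam h : ℕ → ℝ),
        ModelAssumption P βstar Cf ν₀ c₁ c₂ M c C a₁ a₂ →
        l0Norm βstar = s →
        1 ≤ b → (∀ t ∈ Finset.Icc 1 b, 1 ≤ n t) →
        (∀ t i, HasLaw (W t i) P μ) →
        iIndepFun (fun q : (t : ℕ) × Fin (n t) => W q.1 q.2) μ →
        Tuning p s n b lam h A₀ A₁ B₀ B₁ ρ →
        s * Real.log p ≤ ε * n 1 →
        (∀ t ∈ Finset.Ico 1 b, ScalingAt p s n h (C1 K P Cf c a₁ a₂ t) ε t) →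
        μ {ω | ¬ ((∃ β, IsOnlineLasso K lam h (fun t i => W t i ω) b β) ∧
            ∀ β, IsOnlineLasso K lam h (fun t i => W t i ω) b β →
              l2Norm (β b - βstar) ≤ C2 K P Cf c a₁ a₂ b * √s * lam b ∧
              l1Norm (β b - βstar) ≤ C1 K P Cf c a₁ a₂ b * s * lam b)} <
          ENNReal.ofReal (4 / p) := by
  -- the constants do not depend on `P`, but a model with these parameters needs `a₁ ≤ a₂`, `0 < c₂`
  by_cases hpos : a₁ ≤ a₂ ∧ 0 < c₂
  swap
  · refine ⟨1, one_pos, 1, one_pos, fun A₁ B₀ B₁ hB₀ => ⟨1, one_pos, ?_⟩⟩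
    intro p _ P _ βs s Ω _ μ _ b n W lam h hM
    exact absurd ⟨hM.eig_le, (hM.design.expSquareBound hν₀ hc₁).1⟩ hpos
  obtain ⟨ha, hc₂⟩ := hpos
  have ha₂ : 0 < a₂ := ha₁.trans_le ha
  have hk := hK.low_pos
  set τ := 4 * (ν₀ ^ 2 * c₂) with hτdef
  have hτ : 0 < τ := by positivity
  set SC := smoothConst Cf c τ with hSCdef
  have hSC : 0 ≤ SC := by rw [hSCdef, smoothConst]; positivity
  set r := biasRatio K Cf c with hrdef
  have hr : 0 ≤ r := by
    have := hK.kappa_nonneg 2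
    rw [hrdef, biasRatio]; positivity
  set Gb := c₂ * c₁⁻¹ * a₂ / (kappaLow K * a₁ ^ 2) with hGbdef
  have hGb : 0 < Gb := by positivity
  obtain ⟨Cη, hCη, hη⟩ := hK.abs_sub_le (η := 1 / 32) (by norm_num)
  obtain ⟨κ₀, hκ₀, hκ⟩ := hK.exists_bound
  -- `η₁ / (s C_{t,1})` is the entrywise accuracy required of the aggregated Hessian
  obtain ⟨η₁, ⟨⟨⟨⟨hη400, hη240⟩, hη430⟩, hηa⟩, hη₁⟩⟩ :=
    (((((eventually_mul_le_of_pos one_pos 400).and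
      (eventually_mul_le_of_pos one_pos (240 * (a₂ * Gb)))).and
      (eventually_mul_le_of_pos ha₁ (430 * (a₂ ^ 2 * Gb)))).and
      (eventually_mul_le_of_pos hτ a₂)).and self_mem_nhdsWithin).exists
  obtain ⟨ρ, hρ, hρ0⟩ :=
    ((eventually_mul_le_of_pos (a := 1 / 8) (by norm_num) (4 * SC * kappa K 2)).and
      self_mem_nhdsWithin).exists
  refine ⟨√(15360 * τ), by positivity, ρ, hρ0, fun A₁ B₀ B₁ hB₀ => ?_⟩
  set A := max A₁ 1
  set B := max B₁ B₀
  have hB : 0 < B := hB₀.trans_le (le_max_right _ _)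
  -- all quantities of higher order have to be smaller by a factor `Q` than what they compete with
  obtain ⟨Q, ⟨⟨⟨⟨⟨⟨hQ1, hQwin⟩, hQhess⟩, hQrad⟩, hQcurv⟩, hQrem⟩, hQB⟩, hQgram⟩ :=
    ((((((((eventually_ge_atTop (1 : ℝ)).and (eventually_le_mul_of_pos ha₁ (392 * SC))).and
      (eventually_le_mul_of_pos ha₁ (64 * (SC * kappa K 1)))).and
      (eventually_le_mul_of_pos ha₁ (1572864 * τ ^ 2 * ((3 + r) * Gb) ^ 2 * A ^ 2))).and
      (eventually_ge_atTop (7 + 196608 * τ ^ 2 / a₁ ^ 2 * (2 * vertexConst τ a₁ + 7)))).and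
      (eventually_le_mul_of_pos ha₁
        (64 * (Cη * (6 * τ ^ 2 + 2 * τ * (3 + 6 * τ ^ 2))) * A ^ 2))).and
      (eventually_ge_atTop (B ^ 4 * a₂ ^ 2))).and
      (eventually_le_mul_of_pos (pow_pos hη₁ 2) (768 * (κ₀ * (B / B₀) * τ) ^ 2))).exists
  obtain ⟨Q₂, hQ₂, hQ₂B⟩ := ((eventually_ge_atTop Q).and
    (eventually_le_mul_of_pos (pow_pos hB₀ 4) Q)).exists
  obtain ⟨ε, ⟨⟨hεQ, hεQ₂⟩, hεB⟩, hε⟩ := ((((eventually_mul_le_of_pos one_pos Q).and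
    (eventually_mul_le_of_pos one_pos ((B * Q₂) ^ 4))).and
    (eventually_mul_le_of_pos (pow_pos hB₀ 5) (Q * a₂ ^ 2 * B ^ 5))).and
    self_mem_nhdsWithin).exists
  refine ⟨ε, hε, ?_⟩
  intro p _ P _ βs s Ω _ μ _ b n W lam h hM hs hb hn hlaw hind T hx hscal
  have hp0 : 0 < p := Nat.pos_of_ne_zero (NeZero.ne p)
  have hp0' : (0 : ℝ) < p := by exact_mod_cast hp0
  -- for `p < 4` the asserted probability bound exceeds one
  rcases lt_or_ge p 4 with hp | hp
  · refine prob_le_one.trans_lt ?_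
    rw [ENNReal.one_lt_ofReal, one_lt_div hp0']
    exact_mod_cast hp
  have hs1 : 1 ≤ s := hs ▸ hM.one_le_l0Norm hc
  have hE := (hM.design.expSquareBound hν₀ hc₁).2
  obtain ⟨hGle, hG2, hG1⟩ := gainFactor_bounds hK hM.design hc₁ ha₁ ha
  unfold C1 C2 at *
  set G := gainFactor K P a₁ a₂
  have R := T.regime (E₁ := constOne r G a₂) (E₂ := constTwo r G a₂) (Cf := Cf) (c := c)
    (τ := τ) (a₁ := a₁) (κ₀ := κ₀) (Cη := Cη) (η₁ := η₁) (r := r) (Gb := Gb) (A := A) (B := B)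
    hK hp hs1 hn hx hscal ha₁ ha₂ hτ hSC rfl (natCast_le_mul_constTwo hr hG2)
    (fun t => by
      have hD := mul_nonneg ha₂.le (constTwo_nonneg ha₂ hr hG2 t)
      rw [constTwo_succ, mul_right_comm]
      exact mul_le_mul (by nlinarith) hGle (pos_of_mul_pos_right (by linarith) ha₂.le).le
        (by positivity))
    (one_add_le_constOne ha₂ hr hG2) hκ₀ hCη.le hη₁ (by linarith) (by positivity)
    (Real.sq_sqrt (by positivity)).ge (le_max_left _ _) hρ hB₀ (le_max_left _ _)
    (le_max_right _ _) hQ1 hQ₂ (by linarith) hQwin hQhess hQrad hQcurv hQrem hQB (by linarith)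
    hε (by linarith) (by linarith) (by linarith)
  exact R.measure_lt hK hM hc hCf ha₁ ha₂ hτ hE hp hs hs1 hb hn hCη.le hη hκ
    (one_pos.trans_le hκ₀) (by positivity) hr hG2 hG1 hGle hη₁.le hη400 hη240 hη430 hlaw hind
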